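/- Let $G=(V,E)$ be a fully dynamic simple undirected graph on a fixed set of $n$ vertices. It starts without edges and undergoes an arbitrary (online) sequence of edge insertions, edge deletions and queries. Let $m$ denote the current number of edges. For a pattern $\mathcal P$, let $\mathbf c(G,\mathcal P)$ be the number of (not necessarily induced) subgraphs of $G$ isomorphic to $\mathcal P$, and for $e\in E$ let $\mathbf c(G,\mathcal P,e)$ be the number of those that contain the edge $e$. The computational model is a deterministic unit-cost RAM with $O(\log n)$-bit words and a constant number of registers and hash tables. Keys are triples of words. A table access takes one step, and the space is the maximum number of stored (non-zero) table entries at any time, also during an operation. For each of the four patterns below there is one deterministic algorithm (a single program for all $n$) that maintains $\mathbf c(G,\mathcal P)$, so that $\mathbf c(G,\mathcal P)$ can be queried at any time in worst-case constant time, and that moreover answers queries for $\mathbf c(G,\mathcal P,e)$, for an arbitrary edge $e\in E$ given with the query, with the following bounds. 1. If $\mathcal P$ is the path of length $3$: amortized update time $O(\sqrt m)$, space $O(\min(m^{3/2},n^2))$, and worst-case time $O(\sqrt m)$ for a query of $\mathbf c(G,\mathcal P,e)$. 2. If $\mathcal P$ is the paw (a triangle with one further edge attached to one of its vertices) or the $4$-cycle: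 amortized update time $O(m^{2/3})$, space $O(n^2)$, and worst-case time $O(m^{2/3})$ for a query of $\mathbf c(G,\mathcal P,e)$. 3. If $\mathcal P$ is the diamond (a $4$-cycle with one chord): amortized update time $O(m^{2/3})$, space $O(\min(nm,m^{5/3}))$, and worst-case time $O(m^{2/3})$ for a query of $\mathbf c(G,\mathcal P,e)$. Here a bound $O(f(n,m))$ means at most $C\,(f(n,m)+1)$ with an absolute constant $C$. Amortized update time $O(f)$ means that, in every sequence of operations, the total time of the updates among the first $N$ operations is, for every $N$, at most $C\sum (f(n,m_i)+1)$, where the sum is over these updates and $m_i$ is the number of edges after the $i$-th update. -/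

import Mathlib

namespace DynCount

/-! ### The machine

A deterministic unit-cost word machine with finitely many registers (the local variables of a
program) and finitely many hash tables. A table maps keys (triples of words) to words; only
entries with non-zero value are stored. A program is a fixed finite piece of syntax, the same one
for graphs of all sizes. -/

/-- Expressions over registers and tables. -/
inductive Expr where
  | const (k : ℕ)
  | reg (x : ℕ)
  /-- The entry of table number `t` under the key `(a, b, c)`. -/
  | look (t : ℕ) (a b c : Expr)
  | plus (a b : Expr)
  | minus (a b : Expr)
  | times (a b : Expr)
  | quot (a b : Expr)
  | less (a b : Expr)
  | eq (a b : Expr)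

/-- Programs. -/
inductive Cmd where
  | skip
  /-- Put the value of `e` into register `x`. -/
  | assign (x : ℕ) (e : Expr)
  /-- Set the entry of table number `t` under the key `(a, b, c)` to the value of `e`. -/
  | store (t : ℕ) (a b c e : Expr)
  | seq (p q : Cmd)
  | cond (e : Expr) (p q : Cmd)
  | loop (e : Expr) (p : Cmd)

/-- The contents of all tables: the value of the entry of table `t` under the key `(a, b, c)` is
the value at `(t, a, b, c)`. All but finitely many entries are zero, that is, not stored. -/
abbrev Tables := (ℕ × ℕ × ℕ × ℕ) →₀ ℕ

/-- The space used by the tables: the number of stored (non-zero) entries. -/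
def space (μ : Tables) : ℕ := μ.support.card

structure State where
  reg : ℕ → ℕ
  tab : Tables

/-- The value of an expression on a machine whose words are the numbers below `W`: sums and
products are reduced modulo `W`, subtraction is truncated at zero, division rounds down, and
tests return `0` or `1`. -/
def Expr.eval (W : ℕ) (s : State) : Expr → ℕ
  | .const k => k % W
  | .reg x => s.reg x
  | .look t a b c => s.tab (t, a.eval W s, b.eval W s, c.eval W s)
  | .plus a b => (a.eval W s + b.eval W s) % W
  | .minus a b => a.eval W s - b.eval W s
  | .times a b => (a.eval W s * b.eval W s) % W
  | .quot a b => a.eval W s / b.eval W s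
  | .less a b => if a.eval W s < b.eval W s then 1 else 0
  | .eq a b => if a.eval W s = b.eval W s then 1 else 0

/-- The number of elementary steps of the evaluation of an expression. -/
def Expr.cost : Expr → ℕ
  | .const _ => 1
  | .reg _ => 1
  | .look _ a b c => a.cost + b.cost + c.cost + 1
  | .plus a b => a.cost + b.cost + 1
  | .minus a b => a.cost + b.cost + 1
  | .times a b => a.cost + b.cost + 1
  | .quot a b => a.cost + b.cost + 1
  | .less a b => a.cost + b.cost + 1
  | .eq a b => a.cost + b.cost + 1

/-- `Exec W p s s' time peak`: with words below `W`, the program `p` started in the state `s`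
halts in the state `s'` after `time` elementary steps, and `peak` is the largest space used by
the tables during this run. -/
inductive Exec (W : ℕ) : Cmd → State → State → ℕ → ℕ → Prop where
  | skip (s : State) : Exec W .skip s s 1 (space s.tab)
  | assign (s : State) (x : ℕ) (e : Expr) :
      Exec W (.assign x e) s ⟨Function.update s.reg x (e.eval W s), s.tab⟩
        (e.cost + 1) (space s.tab)
  | store (s : State) (t : ℕ) (a b c e : Expr) (μ : Tables)
      (hμ : μ = s.tab.update (t, a.eval W s, b.eval W s, c.eval W s) (e.eval W s)) :
      Exec W (.store t a b c e) s ⟨s.reg, μ⟩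
        (a.cost + b.cost + c.cost + e.cost + 1) (max (space s.tab) (space μ))
  | seq {p q : Cmd} {s s' s'' : State} {t₁ t₂ k₁ k₂ : ℕ}
      (h₁ : Exec W p s s' t₁ k₁) (h₂ : Exec W q s' s'' t₂ k₂) :
      Exec W (.seq p q) s s'' (t₁ + t₂) (max k₁ k₂)
  | condTrue {e : Expr} {p q : Cmd} {s s' : State} {t k : ℕ}
      (he : e.eval W s ≠ 0) (h : Exec W p s s' t k) :
      Exec W (.cond e p q) s s' (e.cost + 1 + t) k
  | condFalse {e : Expr} {p q : Cmd} {s s' : State} {t k : ℕ}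
      (he : e.eval W s = 0) (h : Exec W q s s' t k) :
      Exec W (.cond e p q) s s' (e.cost + 1 + t) k
  | loopTrue {e : Expr} {p : Cmd} {s s' s'' : State} {t₁ t₂ k₁ k₂ : ℕ}
      (he : e.eval W s ≠ 0) (h₁ : Exec W p s s' t₁ k₁) (h₂ : Exec W (.loop e p) s' s'' t₂ k₂) :
      Exec W (.loop e p) s s'' (e.cost + 1 + t₁ + t₂) (max k₁ k₂)
  | loopFalse {e : Expr} {p : Cmd} {s : State} (he : e.eval W s = 0) :
      Exec W (.loop e p) s s (e.cost + 1) (space s.tab)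

/-! ### Dynamic graphs -/

/-- The operations on a dynamic graph with vertex set `Fin n`: the insertion and the deletion of
an edge, the query for the number of copies of the pattern in the current graph, and the query
for the number of those copies that contain a given edge of the current graph. -/
inductive Op (n : ℕ) where
  | insert (u v : Fin n)
  | delete (u v : Fin n)
  | count
  | countEdge (u v : Fin n)

variable {n : ℕ}

/-- Only non-edges between distinct vertices are inserted; only edges are deleted or queried. -/
def Op.Valid (G : SimpleGraph (Fin n)) : Op n → Prop
  | .insert u v => u ≠ v ∧ ¬ G.Adj u v
  | .delete u v => G.Adj u v
  | .count => True
  | .countEdge u v => G.Adj u v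

/-- The graph after an operation. -/
def Op.apply (G : SimpleGraph (Fin n)) : Op n → SimpleGraph (Fin n)
  | .insert u v => G ⊔ SimpleGraph.edge u v
  | .delete u v => G.deleteEdges {s(u, v)}
  | .count => G
  | .countEdge _ _ => G

def Op.isUpdate : Op n → Bool
  | .insert _ _ => true
  | .delete _ _ => true
  | .count => false
  | .countEdge _ _ => false

/-- The graph before the `i`-th operation; initially, the graph has no edges. -/
def graphAt (ops : ℕ → Op n) : ℕ → SimpleGraph (Fin n)
  | 0 => ⊥
  | i + 1 => (ops i).apply (graphAt ops i)

/-- The number of edges before the `i`-th operation. -/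
noncomputable def edgesAt (ops : ℕ → Op n) (i : ℕ) : ℕ := (graphAt ops i).edgeSet.ncard

/-- The number of (not necessarily induced) subgraphs of `G` that are isomorphic to `P` and
contain the edge `e`. -/
noncomputable def copyCountEdge {V U : Type*} (G : SimpleGraph V) (P : SimpleGraph U)
    (e : Sym2 V) : ℕ :=
  {H : G.Subgraph | e ∈ H.edgeSet ∧ Nonempty (P ≃g H.coe)}.ncard

/-- The output `r` is the right answer to an operation on the current graph `G` for the
pattern `P`. Updates have no output. -/
def Op.Correct {U : Type*} (P : SimpleGraph U) (G : SimpleGraph (Fin n)) (r : ℕ) : Op n → Prop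
  | .insert _ _ => True
  | .delete _ _ => True
  | .count => r = G.copyCount P
  | .countEdge u v => r = copyCountEdge G P s(u, v)

/-! ### Dynamic algorithms -/

/-- A dynamic algorithm: one program for each kind of operation. -/
structure Algorithm where
  insert : Cmd
  delete : Cmd
  count : Cmd
  countEdge : Cmd

def Algorithm.code (A : Algorithm) : Op n → Cmd
  | .insert _ _ => A.insert
  | .delete _ _ => A.delete
  | .count => A.count
  | .countEdge _ _ => A.countEdge

/-- At the start of an operation, register `0` holds the number of vertices, registers `1` and
`2` hold the endpoints of the given edge, and the other registers are zero. -/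
def Op.input : Op n → ℕ → ℕ
  | _, 0 => n
  | .insert u _, 1 => u
  | .insert _ v, 2 => v
  | .delete u _, 1 => u
  | .delete _ v, 2 => v
  | .countEdge u _, 1 => u
  | .countEdge _ v, 2 => v
  | _, _ => 0

/-- For graphs with `n` vertices, words have `b` times (the number of binary digits of `n`, plus
one) bits; this is the number of words. -/
def wordBound (b n : ℕ) : ℕ := 2 ^ (b * (n.size + 1))

/-- One operation of the algorithm: it turns the tables `μ` into the tables `μ'`, takes
`time` elementary steps, uses at most the space `peak` at any time, and outputs the final content
`r` of register `0`. Only the tables survive from one operation to the next. -/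
def Algorithm.Performs (A : Algorithm) (b : ℕ) (op : Op n) (μ μ' : Tables)
    (time peak r : ℕ) : Prop :=
  ∃ ρ : ℕ → ℕ, Exec (wordBound b n) (A.code op) ⟨op.input, μ⟩ ⟨ρ, μ'⟩ time peak ∧ r = ρ 0

/-- There is a deterministic dynamic algorithm that maintains the number of copies of `P` in a
dynamic graph, where `n` is the number of vertices and `m` is the current number of edges, with
amortized update time `O(upd n m)`, space `O(spc n m)`, worst-case constant time for a query of
this number, and worst-case time `O(qry n m)` for a query of the number of copies of `P` that
contain a given edge. The word length is `O(log n)`.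

The sequence of operations is arbitrary; finite sequences are covered as initial parts of infinite
ones. The bounds hold with one constant `C` for all `n` and all sequences; the summand `1` takes
care of graphs with few edges. -/
def Maintains {U : Type*} (P : SimpleGraph U) (upd qry spc : ℕ → ℕ → ℝ) : Prop :=
  ∃ (A : Algorithm) (b C : ℕ), 1 ≤ b ∧
    ∀ (n : ℕ) (ops : ℕ → Op n), (∀ i, (ops i).Valid (graphAt ops i)) →
      ∃ (μ : ℕ → Tables) (time peak out : ℕ → ℕ), μ 0 = 0 ∧
        (∀ i, A.Performs b (ops i) (μ i) (μ (i + 1)) (time i) (peak i) (out i)) ∧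
        (∀ i, (ops i).Correct P (graphAt ops i) (out i)) ∧
        -- total time of the updates among the first `N` operations
        (∀ N, ((∑ i ∈ Finset.range N with (ops i).isUpdate, time i : ℕ) : ℝ) ≤
          C * ∑ i ∈ Finset.range N with (ops i).isUpdate,
            (upd n (edgesAt ops (i + 1)) + 1)) ∧
        (∀ i, (peak i : ℝ) ≤ C * (spc n (edgesAt ops (i + 1)) + 1)) ∧
        (∀ i, ops i = .count → time i ≤ C) ∧
        (∀ i u v, ops i = .countEdge u v → (time i : ℝ) ≤ C * (qry n (edgesAt ops i) + 1))

/-! ### The patterns -/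

/-- The path of length three. -/
def path3 : SimpleGraph (Fin 4) := SimpleGraph.pathGraph 4

/-- The paw: a triangle with one additional edge attached to one of its vertices. -/
def paw : SimpleGraph (Fin 4) := SimpleGraph.fromEdgeSet {s(0, 1), s(1, 2), s(2, 0), s(2, 3)}

def fourCycle : SimpleGraph (Fin 4) := SimpleGraph.cycleGraph 4

/-- The diamond: a 4-cycle with one chord. -/
def diamond : SimpleGraph (Fin 4) :=
  SimpleGraph.fromEdgeSet {s(0, 1), s(1, 2), s(2, 3), s(3, 0), s(0, 2)}

end DynCount

/-!
If `uv` is the edge that is inserted or deleted, the number of copies changes by the number of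
copies that contain `uv`. So it suffices to maintain auxiliary tables from which `c(G, P, uv)` can
be computed fast.

*Thresholds.* Time is divided into phases. A phase that starts with `m` edges lasts for about
`m / 2` updates. Its parameters are `τ`, which is `k` for the path and `k ^ 2` otherwise, and the
least `k` with `m < k * τ`. So `τ` is of the order of `√m` or of `m ^ (2/3)`. A vertex is put into
the class `B` of big vertices when its degree exceeds `k`, and into the class `H` of huge vertices
when it exceeds `τ`; it stays there until the phase ends. Hence `|B| = O(τ)` and `|H| = O(k)`
(`Cheap`). To promote a vertex, its edges are removed, which makes its class irrelevant to all
tables, and put back after the change; at the end of a phase all edges are removed and added again.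
Both are paid for by the potential `Scheme.pot`: a promotion costs `O(τ)` for each edge at the
vertex, and the additions of the phase, `I` in number, pay for it, since
`k * |B| + ∑ x ∉ B, deg x ≤ 2 * I`, and likewise for `H` and `τ`; each update contributes `O(τ)` to
the next rebuilding.

*Closed formulas.* `card_aut_mul_copyCountEdge` turns the number of copies through an edge into a
sum over the images of the four vertices of the pattern, and the `two_mul_copyCountEdge` lemmas
evaluate it by degrees, walks of length two and three, and pairs of a walk and a triangle. The
auxiliary tables hold those parts of these sums in which the inner vertices are not big, or not
huge: such sums change by few terms when an edge is added. In the remaining parts one vertex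
ranges over `B` or over `H`, so that they can be computed when they are needed. For example, the
walks of length two from `u` to `v` with a huge middle vertex are found by a loop over `H`, and the
others are an entry of a table, which changes only at pairs of an endpoint of the new edge and a
neighbour of its other endpoint, provided that the latter is not huge. The `addE` lemmas are these
derivative identities; read backwards they treat the removal of an edge.

*Programs.* An update or a query is a nested sum over neighbourhoods, over `B` and over `H`. It is
written as a `Prog`, whose meaning `Prog.delta` is an element of a commutative ring. A register `σ`
that holds `1` or `-1` modulo `(n + 2) ^ 6` lets one program serve for additions and removals. All
tables are kept modulo this number, which exceeds all true values, so that identities in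
`ZMod` suffice. The running time is the product of the loop bounds, `k + 1`, `τ + 1`, `4 * k` or
`4 * τ`, and `Prog.cost_le_tau` reads off its exponent from the syntax. `Scheme.ofTables` combines
tables and query into a `Scheme`, and `Scheme.maintains` is the analysis common to all patterns.
-/

namespace DynCount

open Finset (range sum_congr mem_range card_le_card mul_sum sum_add_distrib sum_le_sum card_image_le
  sum_sub_distrib sum_mul sum_comm sum_eq_zero mem_insert mem_image mem_erase card_insert_of_notMem)
open Nat (mod_eq_of_lt)
open Function (update update_of_ne update_self)

variable {P : SimpleGraph (Fin 4)}

/-- The number of a table together with a key of that table. -/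
abbrev Key := ℕ × ℕ × ℕ × ℕ

/-! ### Running programs -/

/-- Programs without loops. -/
def Cmd.plain : Cmd → Bool
  | .skip => true
  | .assign _ _ => true
  | .store _ _ _ _ _ => true
  | .seq p q => p.plain && q.plain
  | .cond _ p q => p.plain && q.plain
  | .loop _ _ => false

/-- The final state of a program without loops. -/
noncomputable def Cmd.run (W : ℕ) : Cmd → State → State
  | .skip, s => s
  | .assign x e, s => ⟨update s.reg x (e.eval W s), s.tab⟩
  | .store t a b c e, s =>
      ⟨s.reg, s.tab.update (t, a.eval W s, b.eval W s, c.eval W s) (e.eval W s)⟩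
  | .seq p q, s => q.run W (p.run W s)
  | .cond e p q, s => if e.eval W s ≠ 0 then p.run W s else q.run W s
  | .loop _ _, s => s

/-- A bound for the number of steps of a program without loops. -/
def Cmd.steps : Cmd → ℕ
  | .skip => 1
  | .assign _ e => e.cost + 1
  | .store _ a b c e => a.cost + b.cost + c.cost + e.cost + 1
  | .seq p q => p.steps + q.steps
  | .cond e p q => e.cost + 1 + max p.steps q.steps
  | .loop _ _ => 0

theorem space_update_le (μ : Tables) (k : Key) (v : ℕ) :
    space (μ.update k v) ≤ space μ + 1 := by
  classical
  unfold space
  refine (card_le_card (Finsupp.support_update_subset (f := μ) (a := k) (b := v))).trans ?_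
  exact Finset.card_insert_le _ _

/-- A run of `t` steps stores at most `t` new entries. -/
theorem Exec.space_le {W : ℕ} {p : Cmd} {s s' : State} {t k : ℕ} (h : Exec W p s s' t k) :
    space s'.tab ≤ space s.tab + t ∧ k ≤ space s.tab + t := by
  induction h with
  | skip s => constructor <;> omega
  | assign s x e => constructor <;> simp
  | store s t a b c e μ hμ =>
    have := space_update_le s.tab (t, a.eval W s, b.eval W s, c.eval W s) (e.eval W s)
    rw [← hμ] at this
    constructor
    · change space μ ≤ _
      omega
    · apply max_le <;> omega
  | seq h₁ h₂ ih₁ ih₂ => constructor <;> [skip; apply max_le] <;> omega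
  | condTrue he h ih => constructor <;> omega
  | condFalse he h ih => constructor <;> omega
  | loopTrue he h₁ h₂ ih₁ ih₂ => constructor <;> [skip; apply max_le] <;> omega
  | loopFalse he => constructor <;> omega

theorem Cmd.exec_run (W : ℕ) (p : Cmd) (hp : p.plain = true) (s : State) :
    ∃ t k, Exec W p s (p.run W s) t k ∧ t ≤ p.steps := by
  induction p generalizing s with
  | skip => exact ⟨_, _, .skip s, le_rfl⟩
  | assign x e => exact ⟨_, _, .assign s x e, le_rfl⟩
  | store t a b c e => exact ⟨_, _, .store s t a b c e _ rfl, le_rfl⟩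
  | seq p q ihp ihq =>
    simp only [Cmd.plain, Bool.and_eq_true] at hp
    obtain ⟨t₁, k₁, h₁, l₁⟩ := ihp hp.1 s
    obtain ⟨t₂, k₂, h₂, l₂⟩ := ihq hp.2 (p.run W s)
    exact ⟨_, _, .seq h₁ h₂, by simp only [Cmd.steps]; omega⟩
  | cond e p q ihp ihq =>
    simp only [Cmd.plain, Bool.and_eq_true] at hp
    by_cases he : e.eval W s = 0
    · obtain ⟨t₁, k₁, h₁, l₁⟩ := ihq hp.2 s
      refine ⟨_, _, by simpa [Cmd.run, he] using Exec.condFalse he h₁, ?_⟩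
      simp only [Cmd.steps]; omega
    · obtain ⟨t₁, k₁, h₁, l₁⟩ := ihp hp.1 s
      refine ⟨_, _, by simpa [Cmd.run, he] using Exec.condTrue he h₁, ?_⟩
      simp only [Cmd.steps]; omega
  | loop e p => simp [Cmd.plain] at hp

/-- Total correctness with resource bounds: started in `s`, the program `p` halts after some time
`t` in a state `s'` with `Q t s'`, and its tables never use more than the space `P`. -/
def Tr (W : ℕ) (p : Cmd) (s : State) (P : ℕ) (Q : ℕ → State → Prop) : Prop :=
  ∃ s' t k, Exec W p s s' t k ∧ k ≤ P ∧ Q t s'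

theorem Tr.mono {W : ℕ} {p : Cmd} {s : State} {P P' : ℕ} {Q Q' : ℕ → State → Prop}
    (h : Tr W p s P Q) (hP : P ≤ P') (hQ : ∀ t s', Q t s' → Q' t s') : Tr W p s P' Q' := by
  obtain ⟨s', t, k, h₁, h₂, h₃⟩ := h
  exact ⟨s', t, k, h₁, h₂.trans hP, hQ _ _ h₃⟩

theorem Tr.imp {W : ℕ} {p : Cmd} {s : State} {P : ℕ} {Q Q' : ℕ → State → Prop}
    (h : Tr W p s P Q) (hQ : ∀ t s', Q t s' → Q' t s') : Tr W p s P Q' :=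
  h.mono le_rfl hQ

theorem Tr.seq {W : ℕ} {p q : Cmd} {s : State} {P : ℕ} {Q₁ Q : ℕ → State → Prop}
    (h : Tr W p s P Q₁)
    (h' : ∀ t₁ s₁, Q₁ t₁ s₁ → Tr W q s₁ P (fun t₂ s₂ => Q (t₁ + t₂) s₂)) :
    Tr W (.seq p q) s P Q := by
  obtain ⟨s₁, t₁, k₁, e₁, l₁, q₁⟩ := h
  obtain ⟨s₂, t₂, k₂, e₂, l₂, q₂⟩ := h' _ _ q₁
  exact ⟨s₂, _, _, .seq e₁ e₂, max_le l₁ l₂, q₂⟩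

theorem Tr.cond {W : ℕ} {e : Expr} {p q : Cmd} {s : State} {P : ℕ} {Q : ℕ → State → Prop}
    (h₁ : e.eval W s ≠ 0 → Tr W p s P (fun t s' => Q (e.cost + 1 + t) s'))
    (h₂ : e.eval W s = 0 → Tr W q s P (fun t s' => Q (e.cost + 1 + t) s')) :
    Tr W (.cond e p q) s P Q := by
  by_cases he : e.eval W s = 0
  · obtain ⟨s₁, t₁, k₁, e₁, l₁, q₁⟩ := h₂ he
    exact ⟨s₁, _, _, .condFalse he e₁, l₁, q₁⟩
  · obtain ⟨s₁, t₁, k₁, e₁, l₁, q₁⟩ := h₁ he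
    exact ⟨s₁, _, _, .condTrue he e₁, l₁, q₁⟩

/-- A loop with a variant: `Inv i t s` says that `i` rounds remain and that `t` steps have been
made so far. -/
theorem Tr.loop {W : ℕ} {e : Expr} {p : Cmd} {P : ℕ} (Inv : ℕ → ℕ → State → Prop)
    (step : ∀ i t s, Inv (i + 1) t s → e.eval W s ≠ 0 ∧
      Tr W p s P (fun t' s' => Inv i (t + (e.cost + 1 + t')) s'))
    (done : ∀ t s, Inv 0 t s → e.eval W s = 0 ∧ space s.tab ≤ P)
    (N : ℕ) (t₀ : ℕ) (s : State) (h : Inv N t₀ s) :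
    Tr W (.loop e p) s P (fun t s' => ∃ t₁, t₀ + t = t₁ + (e.cost + 1) ∧ Inv 0 t₁ s') := by
  induction N generalizing t₀ s with
  | zero =>
    obtain ⟨h₁, h₂⟩ := done _ _ h
    exact ⟨s, _, _, .loopFalse h₁, h₂, t₀, rfl, h⟩
  | succ N ih =>
    obtain ⟨h₁, s₁, t₁, k₁, e₁, l₁, q₁⟩ := step _ _ _ h
    obtain ⟨s₂, t₂, k₂, e₂, l₂, t₃, q₂, q₃⟩ := ih _ _ q₁
    exact ⟨s₂, _, _, .loopTrue h₁ e₁ e₂, max_le l₁ l₂, t₃, by omega, q₃⟩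

theorem Tr.of_exec {W : ℕ} {p : Cmd} {s s' : State} {t k T P : ℕ} {Q : ℕ → State → Prop}
    (h : Exec W p s s' t k) (ht : t ≤ T) (hP : space s.tab + T ≤ P) (hQ : Q t s') :
    Tr W p s P Q :=
  ⟨s', t, k, h, by have := h.space_le.2; omega, hQ⟩

/-! ### Finite sets in the tables

The tables `4`, `5` and `6` hold a family of finite sets of words, indexed by words: their
cardinalities, their elements in an arbitrary order, and for each element its position in this
order, plus one. -/

/-- The tables `μ` hold the sets `S s`. -/
structure SetsRep (μ : Key → ℕ) (S : ℕ → Finset ℕ) : Prop where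
  size : ∀ s, μ (4, s, 0, 0) = (S s).card
  elt : ∀ s i, i < (S s).card → μ (5, s, i, 0) ∈ S s ∧ μ (6, s, μ (5, s, i, 0), 0) = i + 1
  pos : ∀ s x, x ∈ S s → 1 ≤ μ (6, s, x, 0) ∧ μ (6, s, x, 0) ≤ (S s).card ∧
    μ (5, s, μ (6, s, x, 0) - 1, 0) = x
  pos_zero : ∀ s x, x ∉ S s → μ (6, s, x, 0) = 0
  elt_zero : ∀ s i, (S s).card ≤ i → μ (5, s, i, 0) = 0
  size_junk : ∀ s b c, b ≠ 0 ∨ c ≠ 0 → μ (4, s, b, c) = 0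
  elt_junk : ∀ s b c, c ≠ 0 → μ (5, s, b, c) = 0
  pos_junk : ∀ s b c, c ≠ 0 → μ (6, s, b, c) = 0

theorem SetsRep.pos_ne_zero {μ : Key → ℕ} {S : ℕ → Finset ℕ} (h : SetsRep μ S)
    (s x : ℕ) : μ (6, s, x, 0) ≠ 0 ↔ x ∈ S s := by
  by_cases hx : x ∈ S s
  · have := (h.pos s x hx).1
    simp only [hx, iff_true]; omega
  · simp [hx, h.pos_zero s x hx]

theorem SetsRep.congr {μ ν : Key → ℕ} {S : ℕ → Finset ℕ} (h : SetsRep μ S)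
    (e : ∀ key : Key, key.1 = 4 ∨ key.1 = 5 ∨ key.1 = 6 → ν key = μ key) :
    SetsRep ν S := by
  have e4 : ∀ a b c, ν (4, a, b, c) = μ (4, a, b, c) := fun a b c => e _ (by simp)
  have e5 : ∀ a b c, ν (5, a, b, c) = μ (5, a, b, c) := fun a b c => e _ (by simp)
  have e6 : ∀ a b c, ν (6, a, b, c) = μ (6, a, b, c) := fun a b c => e _ (by simp)
  constructor <;> simp only [e4, e5, e6]
  exacts [h.size, h.elt, h.pos, h.pos_zero, h.elt_zero, h.size_junk, h.elt_junk, h.pos_junk]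

/-- Inserts the content of register `x` into the set indexed by the content of register `s`. -/
def setIns (s x : ℕ) : Cmd :=
  .seq (.store 5 (.reg s) (.look 4 (.reg s) (.const 0) (.const 0)) (.const 0) (.reg x))
  (.seq (.store 4 (.reg s) (.const 0) (.const 0)
      (.plus (.look 4 (.reg s) (.const 0) (.const 0)) (.const 1)))
    (.store 6 (.reg s) (.reg x) (.const 0) (.look 4 (.reg s) (.const 0) (.const 0))))

/-- Removes the content of register `x` from the set indexed by the content of register `s`; the
last element takes its place. Uses the registers `22`, `23` and `24`. -/
def setRem (s x : ℕ) : Cmd :=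
  .seq (.assign 22 (.look 6 (.reg s) (.reg x) (.const 0)))
  (.seq (.assign 23 (.minus (.look 4 (.reg s) (.const 0) (.const 0)) (.const 1)))
  (.seq (.assign 24 (.look 5 (.reg s) (.reg 23) (.const 0)))
  (.seq (.store 5 (.reg s) (.minus (.reg 22) (.const 1)) (.const 0) (.reg 24))
  (.seq (.store 6 (.reg s) (.reg 24) (.const 0) (.reg 22))
  (.seq (.store 5 (.reg s) (.reg 23) (.const 0) (.const 0))
  (.seq (.store 6 (.reg s) (.reg x) (.const 0) (.const 0))
    (.store 4 (.reg s) (.const 0) (.const 0) (.reg 23))))))))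

theorem setIns_spec {W : ℕ} (hW : 2 ≤ W) (sr xr : ℕ) (s : State) {S : ℕ → Finset ℕ}
    (h : SetsRep s.tab S) (hx : s.reg xr ∉ S (s.reg sr))
    (hc : (S (s.reg sr)).card + 1 < W) :
    ((setIns sr xr).run W s).reg = s.reg ∧
    SetsRep ((setIns sr xr).run W s).tab
      (update S (s.reg sr) (insert (s.reg xr) (S (s.reg sr)))) ∧
    (∀ key : Key, key.1 ≠ 4 → key.1 ≠ 5 → key.1 ≠ 6 →
      ((setIns sr xr).run W s).tab key = s.tab key) ∧
    ∀ key : Key, key.2.1 ≠ s.reg sr →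
      ((setIns sr xr).run W s).tab key = s.tab key := by
  have h1 : 1 % W = 1 := mod_eq_of_lt (by omega)
  have h2 : ((S (s.reg sr)).card + 1) % W = (S (s.reg sr)).card + 1 := mod_eq_of_lt hc
  set σ := s.reg sr with hσ
  set x := s.reg xr with hxx
  have htab : ∀ key, ((setIns sr xr).run W s).tab key =
      if key = (6, σ, x, 0) then (S σ).card + 1
      else if key = (4, σ, 0, 0) then (S σ).card + 1
      else if key = (5, σ, (S σ).card, 0) then x else s.tab key := by
    intro key
    simp [setIns, Cmd.run, Expr.eval, Finsupp.coe_update, Function.update_apply, h1, h2, h.size,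
      ← hσ, ← hxx]
  refine ⟨by simp [setIns, Cmd.run], ?_, ?_, ?_⟩
  · have hcard : (insert x (S σ)).card = (S σ).card + 1 := card_insert_of_notMem hx
    have hS : ∀ s', (update S σ (insert x (S σ))) s' =
      if s' = σ then insert x (S σ) else S s' := by
      intro s'; simp [Function.update_apply]
    constructor
    · intro s'
      rw [htab, hS]
      by_cases e : s' = σ <;> simp [e, hcard, h.size]
    · intro s' i
      rw [hS]
      by_cases e : s' = σ
      · subst e
        simp only [if_true, hcard]
        intro hi
        by_cases e2 : i = (S σ).card
        · subst e2
          simp [htab]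
        · have := h.elt σ i (by omega)
          have h3 : s.tab (5, σ, i, 0) ≠ x := fun h' => hx (h' ▸ this.1)
          simp [htab, e2, h3, this]
      · intro hi
        simp only [if_neg e] at hi
        have := h.elt s' i hi
        simp [htab, e, this]
    · intro s' y
      rw [hS]
      by_cases e : s' = σ
      · subst e
        simp only [if_true, hcard]
        intro hy
        by_cases e2 : y = x
        · subst e2; simp [htab]
        · have hy' : y ∈ S σ := by simpa [e2] using hy
          have := h.pos σ y hy'
          have h3 : s.tab (6, σ, y, 0) - 1 ≠ (S σ).card := by omega
          simp [htab, e2, h3, this]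
          omega
      · intro hi
        simp only [if_neg e] at hi
        have := h.pos s' y hi
        simp [htab, e, this]
    · intro s' y
      rw [hS, htab]
      by_cases e : s' = σ
      · subst e
        simp only [if_true]
        intro hy
        simp only [mem_insert, not_or] at hy
        simp [hy.1, h.pos_zero σ y hy.2]
      · intro hi
        simp only [if_neg e] at hi
        simp [e, h.pos_zero s' y hi]
    · intro s' i
      rw [hS, htab]
      by_cases e : s' = σ
      · subst e
        simp only [if_true, hcard]
        intro hi
        have : i ≠ (S σ).card := by omega
        simp [this, h.elt_zero σ i (by omega)]
      · intro hi
        simp only [if_neg e] at hi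
        simp [e, h.elt_zero s' i hi]
    · intro s' b c hbc
      have hj := h.size_junk s' b c hbc
      rw [htab]
      rcases hbc with hb | hb <;> simp [hb, hj]
    · intro s' b c hc
      rw [htab]
      simp [hc, h.elt_junk s' b c hc]
    · intro s' b c hc
      rw [htab]
      simp [hc, h.pos_junk s' b c hc]
  · intro key k4 k5 k6
    rw [htab]
    have e6 : key ≠ (6, σ, x, 0) := fun h => k6 (by rw [h])
    have e4 : key ≠ (4, σ, 0, 0) := fun h => k4 (by rw [h])
    have e5 : key ≠ (5, σ, (S σ).card, 0) := fun h => k5 (by rw [h])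
    simp [e4, e5, e6]
  · intro key hk
    rw [htab]
    have e : ∀ t k, key ≠ (t, σ, k) := by
      rintro t k rfl
      exact hk rfl
    simp [e]

theorem setRem_spec {W : ℕ} (hW : 2 ≤ W) (sr xr : ℕ) (hs : sr < 22) (hxr : xr < 22 ∨ 25 ≤ xr)
    (s : State) {S : ℕ → Finset ℕ}
    (h : SetsRep s.tab S) (hx : s.reg xr ∈ S (s.reg sr)) :
    (∀ r, r < 22 ∨ 25 ≤ r → ((setRem sr xr).run W s).reg r = s.reg r) ∧
    SetsRep ((setRem sr xr).run W s).tab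
      (update S (s.reg sr) ((S (s.reg sr)).erase (s.reg xr))) ∧
    (∀ key : Key, key.1 ≠ 4 → key.1 ≠ 5 → key.1 ≠ 6 →
      ((setRem sr xr).run W s).tab key = s.tab key) ∧
    ∀ key : Key, key.2.1 ≠ s.reg sr →
      ((setRem sr xr).run W s).tab key = s.tab key := by
  have h1 : 1 % W = 1 := mod_eq_of_lt (by omega)
  have r1 : sr ≠ 22 := by omega
  have r2 : sr ≠ 23 := by omega
  have r3 : sr ≠ 24 := by omega
  have r4 : xr ≠ 22 := by omega
  have r5 : xr ≠ 23 := by omega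
  have r6 : xr ≠ 24 := by omega
  set σ := s.reg sr with hσ
  set x := s.reg xr with hxx
  obtain ⟨p1, p2, p3⟩ := h.pos σ x hx
  set p := s.tab (6, σ, x, 0) with hp
  set y := s.tab (5, σ, (S σ).card - 1, 0) with hy
  obtain ⟨y1, y2⟩ := h.elt σ ((S σ).card - 1) (by omega)
  rw [← hy] at y1 y2
  have htab : ∀ key, ((setRem sr xr).run W s).tab key =
      if key = (4, σ, 0, 0) then (S σ).card - 1
      else if key = (6, σ, x, 0) then 0
      else if key = (5, σ, (S σ).card - 1, 0) then 0
      else if key = (6, σ, y, 0) then p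
      else if key = (5, σ, p - 1, 0) then y else s.tab key := by
    intro key
    simp [setRem, Cmd.run, Expr.eval, Finsupp.coe_update, Function.update_apply, h1, h.size,
      ← hσ, ← hxx, r1, r2, r3, r4, r5, r6, ← hp, ← hy]
  refine ⟨?_, ?_, ?_, ?_⟩
  · intro r hr
    have q1 : r ≠ 22 := by omega
    have q2 : r ≠ 23 := by omega
    have q3 : r ≠ 24 := by omega
    simp [setRem, Cmd.run, Function.update_apply, q1, q2, q3]
  · have hcard : ((S σ).erase x).card = (S σ).card - 1 := Finset.card_erase_of_mem hx
    have hS : ∀ s', (update S σ ((S σ).erase x)) s' =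
      if s' = σ then (S σ).erase x else S s' := by
      intro s'; simp [Function.update_apply]
    constructor
    · intro s'
      rw [htab, hS]
      by_cases e : s' = σ <;> simp [e, hcard, h.size]
    · intro s' i
      rw [hS]
      by_cases e : s' = σ
      · subst e
        simp only [if_true, hcard]
        intro hi
        have hi1 : i ≠ (S σ).card - 1 := by omega
        obtain ⟨i1, i2⟩ := h.elt σ i (by omega)
        by_cases e2 : i = p - 1
        · have hyx : y ≠ x := by
            intro hyx; rw [hyx] at y2; omega
          rw [htab, htab]
          simp only [Prod.mk.injEq, reduceCtorEq, e2]
          have e3 : p - 1 ≠ (S σ).card - 1 := by omega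
          simp [e3, hyx, y1]
          omega
        · have n1 : s.tab (5, σ, i, 0) ≠ x := by
            intro hh; rw [hh] at i2; omega
          have n2 : s.tab (5, σ, i, 0) ≠ y := by
            intro hh; rw [hh] at i2; omega
          simp [htab, hi1, e2, n1, n2, i1, i2]
      · intro hi
        simp only [if_neg e] at hi
        have := h.elt s' i hi
        simp [htab, e, this]
    · intro s' z
      rw [hS]
      by_cases e : s' = σ
      · subst e
        simp only [if_true, hcard]
        intro hz
        obtain ⟨z1, z2⟩ := Finset.mem_erase.1 hz
        obtain ⟨q1, q2, q3⟩ := h.pos σ z z2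
        by_cases e2 : z = y
        · have hpne : p ≠ (S σ).card := by
            intro hh
            apply z1; rw [e2, hy, ← hh, p3]
          have e3 : p - 1 ≠ (S σ).card - 1 := by omega
          rw [e2] at z1
          simp [htab, e2, z1, e3]
          omega
        · have q4 : s.tab (6, σ, z, 0) ≠ (S σ).card := by
            intro hh; rw [hh] at q3; exact e2 q3.symm
          have q5 : s.tab (6, σ, z, 0) - 1 ≠ (S σ).card - 1 := by omega
          have q6 : s.tab (6, σ, z, 0) - 1 ≠ p - 1 := by
            intro hh; rw [hh, p3] at q3; exact z1 q3.symm
          simp [htab, e2, z1, q5, q6, q3]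
          omega
      · intro hi
        simp only [if_neg e] at hi
        have := h.pos s' z hi
        simp [htab, e, this]
    · intro s' z
      rw [hS, htab]
      by_cases e : s' = σ
      · subst e
        simp only [if_true]
        intro hz
        by_cases e2 : z = x
        · simp [e2]
        · have z2 : z ∉ S σ := fun hh => hz (Finset.mem_erase.2 ⟨e2, hh⟩)
          have z3 : z ≠ y := fun hh => z2 (hh ▸ y1)
          simp [e2, z3, h.pos_zero σ z z2]
      · intro hi
        simp only [if_neg e] at hi
        simp [e, h.pos_zero s' z hi]
    · intro s' i
      rw [hS, htab]
      by_cases e : s' = σ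
      · subst e
        simp only [if_true, hcard]
        intro hi
        by_cases e2 : i = (S σ).card - 1
        · simp [e2]
        · have : i ≠ p - 1 := by omega
          simp [this, e2, h.elt_zero σ i (by omega)]
      · intro hi
        simp only [if_neg e] at hi
        simp [e, h.elt_zero s' i hi]
    · intro s' b c hbc
      have hj := h.size_junk s' b c hbc
      rw [htab]
      rcases hbc with hb | hb <;> simp [hb, hj]
    · intro s' b c hc
      rw [htab]
      simp [hc, h.elt_junk s' b c hc]
    · intro s' b c hc
      rw [htab]
      simp [hc, h.pos_junk s' b c hc]
  · intro key k4 k5 k6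
    rw [htab]
    have e6 : ∀ k, key ≠ (6, k) := fun k h => k6 (by rw [h])
    have e4 : ∀ k, key ≠ (4, k) := fun k h => k4 (by rw [h])
    have e5 : ∀ k, key ≠ (5, k) := fun k h => k5 (by rw [h])
    simp [e4, e5, e6]
  · intro key hk
    rw [htab]
    have e : ∀ t k, key ≠ (t, σ, k) := by
      rintro t k rfl
      exact hk rfl
    simp [e]

/-! ### Summation programs

The updates of the auxiliary tables and the queries are nested sums over the sets kept in the
tables. They are written in a small language whose meaning is a sum in a commutative ring. -/

/-- An entry of table `t` under a key held in three registers. -/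
structure Atom where
  t : ℕ
  x : ℕ
  y : ℕ
  z : ℕ

/-- The table lookup that an atom stands for. -/
def Atom.expr (a : Atom) : Expr := .look a.t (.reg a.x) (.reg a.y) (.reg a.z)

/-- The value of an atom, for the registers `ρ` and the table contents `μ`. -/
def Atom.val (a : Atom) (ρ : ℕ → ℕ) (μ : Key → ℕ) : ℕ := μ (a.t, ρ a.x, ρ a.y, ρ a.z)

/-- Summation programs. Register `3` holds a modulus `K`, and register `4` a number `σ`, which
plays the role of a sign; tables are changed modulo `K`. -/
inductive Prog where
  | skip
  /-- Add the product of the entries `vs`, times `σ`, times `-1` if `neg`, to the entry of table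
  `t` under the key held in the registers `x`, `y`, `z`. -/
  | emit (t x y z : ℕ) (neg : Bool) (vs : List Atom)
  /-- Run `p` once for each element of the set whose index is held in register `s`. At nesting
  depth `N`, the element is put into register `N`. -/
  | iter (s : ℕ) (p : Prog)
  | ifnz (a : Atom) (p : Prog)
  | ifz (a : Atom) (p : Prog)
  | seq (p q : Prog)

/-- The command `r := r mod K`. -/
def modCmd (r : ℕ) : Cmd :=
  .assign r (.minus (.reg r) (.times (.quot (.reg r) (.reg 3)) (.reg 3)))

/-- Multiply register `N` by the given entries, reducing modulo `K` after each factor. -/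
def mulCmd (N : ℕ) : List Atom → Cmd
  | [] => .skip
  | a :: l => .seq (.seq (.assign N (.times (.reg N) a.expr)) (modCmd N)) (mulCmd N l)

/-- The command for a summation program at nesting depth `N`. The loop at depth `N` keeps its
index in register `100 + N`. -/
def Prog.compile : Prog → ℕ → Cmd
  | .skip, _ => .skip
  | .emit t x y z neg vs, N =>
      .seq (.assign N (if neg then .minus (.reg 3) (.reg 4) else .reg 4))
      (.seq (mulCmd N vs)
      (.seq (.assign N (.plus (.look t (.reg x) (.reg y) (.reg z)) (.reg N)))
        (.store t (.reg x) (.reg y) (.reg z)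
          (.minus (.reg N) (.times (.quot (.reg N) (.reg 3)) (.reg 3))))))
  | .iter s p, N =>
      .seq (.assign (100 + N) (.const 0))
      (.loop (.less (.reg (100 + N)) (.look 4 (.reg s) (.const 0) (.const 0)))
        (.seq (.assign N (.look 5 (.reg s) (.reg (100 + N)) (.const 0)))
        (.seq (p.compile (N + 1))
          (.assign (100 + N) (.plus (.reg (100 + N)) (.const 1))))))
  | .ifnz a p, N => .cond a.expr (p.compile N) .skip
  | .ifz a p, N => .cond a.expr .skip (p.compile N)
  | .seq p q, N => .seq (p.compile N) (q.compile N)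

/-- What a summation program adds to the entry under `key`, up to the sign `σ`, if its expressions
are evaluated with the registers `ρ` and the tables `μ`. -/
def Prog.delta (R : Type*) [CommRing R] : Prog → ℕ → (ℕ → ℕ) → (Key → ℕ) →
    Key → R
  | .skip, _, _, _, _ => 0
  | .emit t x y z neg vs, _, ρ, μ, key =>
      if key = (t, ρ x, ρ y, ρ z) then
        (if neg then -1 else 1) * (vs.map fun a => (a.val ρ μ : R)).prod else 0
  | .iter s p, N, ρ, μ, key =>
      ∑ i ∈ range (μ (4, ρ s, 0, 0)),
        p.delta R (N + 1) (update ρ N (μ (5, ρ s, i, 0))) μ key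
  | .ifnz a p, N, ρ, μ, key => if a.val ρ μ = 0 then 0 else p.delta R N ρ μ key
  | .ifz a p, N, ρ, μ, key => if a.val ρ μ = 0 then p.delta R N ρ μ key else 0
  | .seq p q, N, ρ, μ, key => p.delta R N ρ μ key + q.delta R N ρ μ key

/-- A bound for the number of steps of a summation program. -/
def Prog.cost : Prog → ℕ → (ℕ → ℕ) → (Key → ℕ) → ℕ
  | .skip, _, _, _ => 1
  | .emit _ _ _ _ _ vs, _, _, _ => 25 + 15 * vs.length
  | .iter s p, N, ρ, μ =>
      10 + ∑ i ∈ range (μ (4, ρ s, 0, 0)),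
        (p.cost (N + 1) (update ρ N (μ (5, ρ s, i, 0))) μ + 20)
  | .ifnz a p, N, ρ, μ => 6 + if a.val ρ μ = 0 then 0 else p.cost N ρ μ
  | .ifz a p, N, ρ, μ => 6 + if a.val ρ μ = 0 then p.cost N ρ μ else 0
  | .seq p q, N, ρ, μ => p.cost N ρ μ + q.cost N ρ μ

/-- The entry is not in a table of `wr`, and its key is held in registers below `N`. -/
def Atom.ok (wr : List ℕ) (N : ℕ) (a : Atom) : Bool :=
  decide (a.t ∉ wr ∧ a.x < N ∧ a.y < N ∧ a.z < N)

/-- At depth `N`, the program reads no table of `wr`, writes only to tables of `wr`, and reads only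
registers that are set. -/
def Prog.ok (wr : List ℕ) : Prog → ℕ → Bool
  | .skip, _ => true
  | .emit t x y z _ vs, N =>
      decide (t ∈ wr ∧ x < N ∧ y < N ∧ z < N ∧ N < 100) && vs.all (Atom.ok wr N)
  | .iter s p, N => decide (s < N ∧ N < 100) && p.ok wr (N + 1)
  | .ifnz a p, N => a.ok wr N && p.ok wr N
  | .ifz a p, N => a.ok wr N && p.ok wr N
  | .seq p q, N => p.ok wr N && q.ok wr N

theorem Atom.val_congr {wr : List ℕ} {N : ℕ} {a : Atom} (h : a.ok wr N = true)
    {ρ ρ' : ℕ → ℕ} {μ μ' : Key → ℕ} (hρ : ∀ x < N, ρ' x = ρ x)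
    (hμ : ∀ key : Key, key.1 ∉ wr → μ' key = μ key) :
    a.val ρ' μ' = a.val ρ μ := by
  simp only [Atom.ok, decide_eq_true_eq] at h
  unfold Atom.val
  rw [hρ _ h.2.1, hρ _ h.2.2.1, hρ _ h.2.2.2, hμ _ h.1]

theorem update_congr {N y : ℕ} {ρ ρ' : ℕ → ℕ} (hρ : ∀ x < N, ρ' x = ρ x) :
    ∀ x < N + 1, update ρ' N y x = update ρ N y x := by
  intro x hx
  by_cases e : x = N
  · simp [e]
  · simp [update_of_ne e, hρ x (by omega)]

theorem Prog.delta_congr (R : Type*) [CommRing R] {wr : List ℕ} (h4 : 4 ∉ wr) (h5 : 5 ∉ wr)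
    {p : Prog} {N : ℕ} (h : p.ok wr N = true)
    {ρ ρ' : ℕ → ℕ} {μ μ' : Key → ℕ} (hρ : ∀ x < N, ρ' x = ρ x)
    (hμ : ∀ key : Key, key.1 ∉ wr → μ' key = μ key) (key : Key) :
    p.delta R N ρ' μ' key = p.delta R N ρ μ key := by
  induction p generalizing N ρ ρ' with
  | skip => rfl
  | emit t x y z neg vs =>
    simp only [Prog.ok, Bool.and_eq_true, decide_eq_true_eq, List.all_eq_true] at h
    have : (vs.map fun a => (a.val ρ' μ' : R)) = vs.map fun a => (a.val ρ μ : R) :=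
      List.map_congr_left fun a ha => by rw [Atom.val_congr (h.2 a ha) hρ hμ]
    simp only [Prog.delta, this]
    rw [hρ _ h.1.2.1, hρ _ h.1.2.2.1, hρ _ h.1.2.2.2.1]
  | iter s p ih =>
    simp only [Prog.ok, Bool.and_eq_true, decide_eq_true_eq] at h
    simp only [Prog.delta]
    rw [hρ _ h.1.1, hμ (4, _) h4]
    refine sum_congr rfl fun i _ => ?_
    rw [hμ (5, _) h5]
    exact ih h.2 (update_congr hρ)
  | ifnz a p ih =>
    simp only [Prog.ok, Bool.and_eq_true] at h
    simp only [Prog.delta]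
    rw [Atom.val_congr h.1 hρ hμ, ih h.2 hρ]
  | ifz a p ih =>
    simp only [Prog.ok, Bool.and_eq_true] at h
    simp only [Prog.delta]
    rw [Atom.val_congr h.1 hρ hμ, ih h.2 hρ]
  | seq p q ihp ihq =>
    simp only [Prog.ok, Bool.and_eq_true] at h
    simp only [Prog.delta]
    rw [ihp h.1 hρ, ihq h.2 hρ]

theorem Prog.cost_congr {wr : List ℕ} (h4 : 4 ∉ wr) (h5 : 5 ∉ wr)
    {p : Prog} {N : ℕ} (h : p.ok wr N = true)
    {ρ ρ' : ℕ → ℕ} {μ μ' : Key → ℕ} (hρ : ∀ x < N, ρ' x = ρ x)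
    (hμ : ∀ key : Key, key.1 ∉ wr → μ' key = μ key) :
    p.cost N ρ' μ' = p.cost N ρ μ := by
  induction p generalizing N ρ ρ' with
  | skip => rfl
  | emit t x y z neg vs => rfl
  | iter s p ih =>
    simp only [Prog.ok, Bool.and_eq_true, decide_eq_true_eq] at h
    simp only [Prog.cost]
    rw [hρ _ h.1.1, hμ (4, _) h4]
    congr 1
    refine sum_congr rfl fun i _ => ?_
    rw [hμ (5, _) h5, ih h.2 (update_congr hρ)]
  | ifnz a p ih =>
    simp only [Prog.ok, Bool.and_eq_true] at h
    simp only [Prog.cost]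
    rw [Atom.val_congr h.1 hρ hμ, ih h.2 hρ]
  | ifz a p ih =>
    simp only [Prog.ok, Bool.and_eq_true] at h
    simp only [Prog.cost]
    rw [Atom.val_congr h.1 hρ hμ, ih h.2 hρ]
  | seq p q ihp ihq =>
    simp only [Prog.ok, Bool.and_eq_true] at h
    simp only [Prog.cost]
    rw [ihp h.1 hρ, ihq h.2 hρ]

theorem sub_div_mul_self (a K : ℕ) : a - a / K * K = a % K := by
  have := Nat.mod_add_div a K
  rw [mul_comm] at this; omega

theorem Atom.eval_expr (W : ℕ) (s : State) (a : Atom) : a.expr.eval W s = a.val s.reg s.tab := rfl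

theorem mulCmd_exec {W K : ℕ} (hK : 2 ≤ K) (hW : K * K + K ≤ W) {N : ℕ} (hN : 5 ≤ N)
    {wr : List ℕ} (vs : List Atom) (hvs : ∀ a ∈ vs, a.ok wr N = true) (s : State)
    (h3 : s.reg 3 = K) (hlt : ∀ key, s.tab key < K) (hv : s.reg N < K) :
    ∃ v t k, Exec W (mulCmd N vs) s ⟨update s.reg N v, s.tab⟩ t k ∧
      t ≤ 1 + 15 * vs.length ∧ v < K ∧
      (v : ZMod K) = s.reg N * (vs.map fun a => (a.val s.reg s.tab : ZMod K)).prod := by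
  induction vs generalizing s with
  | nil =>
    refine ⟨s.reg N, 1, space s.tab, ?_, by simp, hv, by simp⟩
    rw [Function.update_eq_self]
    exact .skip s
  | cons a l ih =>
    have ha : a.val s.reg s.tab < K := hlt _
    have e1 : s.reg N * a.val s.reg s.tab < W := by nlinarith
    have e2 : s.reg N * a.val s.reg s.tab / K * K % W =
        s.reg N * a.val s.reg s.tab / K * K :=
      mod_eq_of_lt (lt_of_le_of_lt (Nat.div_mul_le_self _ _) e1)
    have n3 : (3 : ℕ) ≠ N := by omega
    obtain ⟨t₁, k₁, h₁, l₁⟩ := Cmd.exec_run W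
      (.seq (.assign N (.times (.reg N) a.expr)) (modCmd N)) (by simp [Cmd.plain, modCmd]) s
    have hrun : Cmd.run W (.seq (.assign N (.times (.reg N) a.expr)) (modCmd N)) s =
        ⟨update s.reg N ((s.reg N * a.val s.reg s.tab) % K), s.tab⟩ := by
      simp only [Cmd.run, modCmd, Expr.eval, Atom.eval_expr, mod_eq_of_lt e1,
        update_self, update_of_ne n3, h3, e2, sub_div_mul_self,
        Function.update_idem]
    rw [hrun] at h₁
    obtain ⟨v, t₂, k₂, h₂, l₂, hv, hv'⟩ := ih (fun b hb => hvs b (by simp [hb]))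
      ⟨update s.reg N ((s.reg N * a.val s.reg s.tab) % K), s.tab⟩
      (by simp [update_of_ne n3, h3]) hlt
      (by simpa using Nat.mod_lt _ (by omega))
    refine ⟨v, _, _, by simpa [mulCmd] using Exec.seq h₁ h₂, ?_, hv, ?_⟩
    · simp [Cmd.steps, modCmd, Expr.cost, Atom.expr] at l₁ ⊢
      omega
    · rw [hv']
      have : (l.map fun b => (b.val (update s.reg N ((s.reg N * a.val s.reg s.tab) % K))
          s.tab : ZMod K)) = l.map fun b => (b.val s.reg s.tab : ZMod K) := by
        refine List.map_congr_left fun b hb => ?_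
        rw [Atom.val_congr (wr := wr) (hvs b (by simp [hb])) (ρ := s.reg) (μ := s.tab) ?_ ?_]
        · intro x hx; rw [update_of_ne (by omega)]
        · intros; rfl
      simp only at this ⊢
      rw [this]
      simp [mul_assoc]

/-- A summation program adds its sum, times `σ`, to the tables it writes. -/
theorem Prog.exec {W K σ : ℕ} (hK : 2 ≤ K) (hW : K * K + K ≤ W) (hσ : 1 ≤ σ) (hσK : σ < K)
    {wr : List ℕ} (h4 : 4 ∉ wr) (h5 : 5 ∉ wr) {p : Prog} {N : ℕ} (hN : 5 ≤ N)
    (hp : p.ok wr N = true) (s : State) (r3 : s.reg 3 = K) (r4 : s.reg 4 = σ)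
    (hlt : ∀ key, s.tab key < K) :
    ∃ s' t k, Exec W (p.compile N) s s' t k ∧ t ≤ p.cost N s.reg s.tab ∧
      (∀ x, x < N ∨ (100 ≤ x ∧ x < 100 + N) → s'.reg x = s.reg x) ∧
      (∀ key, s'.tab key < K) ∧
      (∀ key, (s'.tab key : ZMod K) = s.tab key + σ * p.delta (ZMod K) N s.reg s.tab key) ∧
      ∀ key : Key, key.1 ∉ wr → s'.tab key = s.tab key := by
  induction p generalizing N s with
  | skip =>
    exact ⟨s, _, _, .skip s, by simp [Prog.cost], fun _ _ => rfl, hlt,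
      fun key => by simp [Prog.delta], fun _ _ => rfl⟩
  | emit t x y z neg vs =>
    simp only [Prog.ok, Bool.and_eq_true, decide_eq_true_eq, List.all_eq_true] at hp
    obtain ⟨⟨ht, hx, hy, hz, hN'⟩, hvs⟩ := hp
    have n3 : (3 : ℕ) ≠ N := by omega
    have hxN : x ≠ N := by omega
    have hyN : y ≠ N := by omega
    have hzN : z ≠ N := by omega
    set v₀ := if neg then K - σ else σ with hv₀
    have hv₀K : v₀ < K := by rw [hv₀]; split_ifs <;> omega
    have hv₀c : (v₀ : ZMod K) = σ * (if neg then -1 else 1) := by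
      rw [hv₀]; split_ifs
      · rw [Nat.cast_sub hσK.le]; simp
      · simp
    have e₁ := Exec.assign (W := W) s N (if neg then .minus (.reg 3) (.reg 4) else .reg 4)
    have hev : (if neg then Expr.minus (.reg 3) (.reg 4) else .reg 4).eval W s = v₀ := by
      rw [hv₀]; split_ifs <;> simp [Expr.eval, r3, r4]
    rw [hev] at e₁
    obtain ⟨v, t₂, k₂, e₂, l₂, hvK, hv⟩ := mulCmd_exec hK hW hN vs hvs
      ⟨update s.reg N v₀, s.tab⟩ (by simp [update_of_ne n3, r3]) hlt
      (by simpa using hv₀K)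
    simp only [Function.update_idem, update_self] at e₂ hv
    have hmap : (vs.map fun a => (a.val (update s.reg N v₀) s.tab : ZMod K)) =
        vs.map fun a => (a.val s.reg s.tab : ZMod K) := by
      refine List.map_congr_left fun b hb => ?_
      rw [Atom.val_congr (wr := wr) (hvs b hb) (ρ := s.reg) (μ := s.tab) ?_ ?_]
      · intro x hx; rw [update_of_ne (by omega)]
      · intros; rfl
    rw [hmap, hv₀c] at hv
    set T := s.tab (t, s.reg x, s.reg y, s.reg z) with hT
    have hTK : T < K := hlt _
    have m1 : (T + v) % W = T + v := mod_eq_of_lt (by nlinarith)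
    have m2 : (T + v) / K * K % W = (T + v) / K * K :=
      mod_eq_of_lt (lt_of_le_of_lt (Nat.div_mul_le_self _ _) (by nlinarith))
    obtain ⟨t₃, k₃, e₃, l₃⟩ := Cmd.exec_run W
      (.seq (.assign N (.plus (.look t (.reg x) (.reg y) (.reg z)) (.reg N)))
        (.store t (.reg x) (.reg y) (.reg z)
          (.minus (.reg N) (.times (.quot (.reg N) (.reg 3)) (.reg 3)))))
      (by simp [Cmd.plain]) ⟨update s.reg N v, s.tab⟩
    have hrun : Cmd.run W (.seq (.assign N (.plus (.look t (.reg x) (.reg y) (.reg z)) (.reg N)))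
        (.store t (.reg x) (.reg y) (.reg z)
          (.minus (.reg N) (.times (.quot (.reg N) (.reg 3)) (.reg 3)))))
        ⟨update s.reg N v, s.tab⟩ = ⟨update s.reg N (T + v),
          s.tab.update (t, s.reg x, s.reg y, s.reg z) ((T + v) % K)⟩ := by
      simp [Cmd.run, Expr.eval, update_of_ne hxN, update_of_ne hyN,
        update_of_ne hzN, update_of_ne n3, ← hT, m1, r3, m2,
        sub_div_mul_self]
    rw [hrun] at e₃
    refine ⟨_, _, _, .seq e₁ (.seq e₂ e₃), ?_, ?_, ?_, ?_, ?_⟩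
    · simp only [Cmd.steps, Expr.cost] at l₃
      have : (if neg then Expr.minus (.reg 3) (.reg 4) else .reg 4).cost ≤ 3 := by
        split_ifs <;> simp [Expr.cost]
      simp only [Prog.cost]
      omega
    · intro r hr
      have : r ≠ N := by omega
      simp [update_of_ne this]
    · intro key
      simp only [Finsupp.coe_update, Function.update_apply]
      split_ifs
      · exact Nat.mod_lt _ (by omega)
      · exact hlt _
    · intro key
      simp only [Finsupp.coe_update, Function.update_apply, Prog.delta]
      split_ifs with h1 h2
      · rw [h1, ZMod.natCast_mod]; push_cast; rw [hv]; simp [h2, hT]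
      · rw [h1, ZMod.natCast_mod]; push_cast; rw [hv]; simp [h2, hT]
      · simp
    · intro key hkey
      simp only [Finsupp.coe_update, Function.update_apply]
      rw [if_neg]
      rintro rfl
      exact hkey ht
  | iter sr p ih =>
    simp only [Prog.ok, Bool.and_eq_true, decide_eq_true_eq] at hp
    obtain ⟨⟨hs, hN'⟩, hp⟩ := hp
    have W0 : 0 % W = 0 := Nat.zero_mod _
    have W1 : 1 % W = 1 := mod_eq_of_lt (by nlinarith)
    set size := s.tab (4, s.reg sr, 0, 0) with hsize
    have hszK : size < K := hlt _
    -- the rounds from the one with index `c` on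
    have key_loop : ∀ (r c : ℕ) (s₁ : State), c + r = size → s₁.reg (100 + N) = c →
        (∀ x, x < N ∨ (100 ≤ x ∧ x < 100 + N) → s₁.reg x = s.reg x) →
        (∀ key, s₁.tab key < K) →
        (∀ key : Key, key.1 ∉ wr → s₁.tab key = s.tab key) →
        ∃ s' t k, Exec W (.loop (.less (.reg (100 + N)) (.look 4 (.reg sr) (.const 0) (.const 0)))
          (.seq (.assign N (.look 5 (.reg sr) (.reg (100 + N)) (.const 0)))
          (.seq (p.compile (N + 1))
            (.assign (100 + N) (.plus (.reg (100 + N)) (.const 1)))))) s₁ s' t k ∧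
          t ≤ 7 + ∑ i ∈ range r,
            (p.cost (N + 1) (update s.reg N (s.tab (5, s.reg sr, c + i, 0))) s.tab + 20) ∧
          (∀ x, x < N ∨ (100 ≤ x ∧ x < 100 + N) → s'.reg x = s.reg x) ∧
          (∀ key, s'.tab key < K) ∧
          (∀ key, (s'.tab key : ZMod K) = s₁.tab key + σ * ∑ i ∈ range r,
            p.delta (ZMod K) (N + 1) (update s.reg N (s.tab (5, s.reg sr, c + i, 0)))
              s.tab key) ∧
          ∀ key : Key, key.1 ∉ wr → s'.tab key = s.tab key := by
      intro r
      induction r with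
      | zero =>
        intro c s₁ hc hi hr hl hw
        have hcond : Expr.eval W s₁ (.less (.reg (100 + N))
            (.look 4 (.reg sr) (.const 0) (.const 0))) = 0 := by
          simp only [Expr.eval, hi, hr sr (Or.inl hs), W0, hw (4, _) h4, ← hsize]
          rw [if_neg (by omega)]
        refine ⟨s₁, _, _, .loopFalse hcond, by simp [Expr.cost], hr, hl, by simp, hw⟩
      | succ r ihr =>
        intro c s₁ hc hi hr hl hw
        have hcond : Expr.eval W s₁ (.less (.reg (100 + N))
            (.look 4 (.reg sr) (.const 0) (.const 0))) ≠ 0 := by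
          simp only [Expr.eval, hi, hr sr (Or.inl hs), W0, hw (4, _) h4, ← hsize]
          rw [if_pos (by omega)]; simp
        set y := s.tab (5, s.reg sr, c, 0) with hy
        have e₁ := Exec.assign (W := W) s₁ N (.look 5 (.reg sr) (.reg (100 + N)) (.const 0))
        have hev : Expr.eval W s₁ (.look 5 (.reg sr) (.reg (100 + N)) (.const 0)) = y := by
          simp only [Expr.eval, hi, hr sr (Or.inl hs), W0, hw (5, _) h5, hy]
        rw [hev] at e₁
        have agree : ∀ x < N + 1, update s₁.reg N y x = update s.reg N y x :=
          update_congr fun x hx => hr x (Or.inl hx)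
        obtain ⟨s₂, t₂, k₂, e₂, l₂, r₂, lt₂, d₂, w₂⟩ := ih (N := N + 1) (by omega) hp
          ⟨update s₁.reg N y, s₁.tab⟩
          (by simp only; rw [agree 3 (by omega), update_of_ne (by omega), r3])
          (by simp only; rw [agree 4 (by omega), update_of_ne (by omega), r4]) hl
        simp only at l₂ r₂ d₂ w₂
        rw [Prog.cost_congr h4 h5 hp agree hw] at l₂
        simp only [Prog.delta_congr (ZMod K) h4 h5 hp agree hw] at d₂
        have hi₂ : s₂.reg (100 + N) = c := by
          rw [r₂ _ (by omega), update_of_ne (by omega), hi]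
        have e₃ := Exec.assign (W := W) s₂ (100 + N) (.plus (.reg (100 + N)) (.const 1))
        have hev₃ : Expr.eval W s₂ (.plus (.reg (100 + N)) (.const 1)) = c + 1 := by
          simp only [Expr.eval, hi₂, W1]
          exact mod_eq_of_lt (by nlinarith)
        rw [hev₃] at e₃
        obtain ⟨s₄, t₄, k₄, e₄, l₄, r₄, lt₄, d₄, w₄⟩ := ihr (c + 1)
          ⟨update s₂.reg (100 + N) (c + 1), s₂.tab⟩ (by omega) (by simp)
          (by
            intro x hx
            have hx' : x ≠ 100 + N := by omega
            simp only [update_of_ne hx']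
            rw [r₂ x (by omega), update_of_ne (by omega), hr x hx])
          lt₂ (by intro key hkey; simp only; rw [w₂ key hkey, hw key hkey])
        refine ⟨s₄, _, _, .loopTrue hcond (.seq e₁ (.seq e₂ e₃)) e₄, ?_, r₄, lt₄, ?_, w₄⟩
        · rw [Finset.sum_range_succ']
          simp only [Expr.cost, add_zero] at l₄ ⊢
          rw [← hy]
          have hsum : ∀ f : ℕ → ℕ, ∑ i ∈ range r, f (c + (i + 1)) =
              ∑ i ∈ range r, f (c + 1 + i) := fun f =>
            sum_congr rfl fun i _ => by congr 1; omega
          rw [hsum fun j => p.cost (N + 1)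
            (update s.reg N (s.tab (5, s.reg sr, j, 0))) s.tab + 20]
          omega
        · intro key
          rw [d₄ key, Finset.sum_range_succ']
          simp only [add_zero]
          rw [d₂ key, ← hy]
          have hsum : ∀ f : ℕ → ZMod K, ∑ i ∈ range r, f (c + (i + 1)) =
              ∑ i ∈ range r, f (c + 1 + i) := fun f =>
            sum_congr rfl fun i _ => by congr 1; omega
          rw [hsum fun j => p.delta (ZMod K) (N + 1)
            (update s.reg N (s.tab (5, s.reg sr, j, 0))) s.tab key]
          ring
    have e₁ := Exec.assign (W := W) s (100 + N) (.const 0)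
    simp only [Expr.eval, W0] at e₁
    obtain ⟨s', t, k, e₂, l₂, r₂, lt₂, d₂, w₂⟩ := key_loop size 0
      ⟨update s.reg (100 + N) 0, s.tab⟩ (by omega) (by simp)
      (by
        intro x hx
        have hx' : x ≠ 100 + N := by omega
        simp [update_of_ne hx']) hlt (fun _ _ => rfl)
    refine ⟨s', _, _, .seq e₁ e₂, ?_, r₂, lt₂, ?_, w₂⟩
    · simp only [zero_add] at l₂
      simp only [Prog.cost, Expr.cost, ← hsize]
      omega
    · intro key
      rw [d₂ key]
      simp only [zero_add, Prog.delta, ← hsize]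
  | ifnz a p ih =>
    simp only [Prog.ok, Bool.and_eq_true] at hp
    by_cases ha : a.val s.reg s.tab = 0
    · refine ⟨s, _, _, .condFalse ha (.skip s), ?_, fun _ _ => rfl, hlt, ?_, fun _ _ => rfl⟩
      · simp [Prog.cost, ha, Expr.cost, Atom.expr]
      · intro key; simp [Prog.delta, ha]
    · obtain ⟨s', t, k, e, l, r, lt, d, w⟩ := ih hN hp.2 s r3 r4 hlt
      refine ⟨s', _, _, .condTrue ha e, ?_, r, lt, ?_, w⟩
      · simp only [Prog.cost, Expr.cost, Atom.expr, if_neg ha]; omega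
      · intro key; simp only [Prog.delta, if_neg ha, d key]
  | ifz a p ih =>
    simp only [Prog.ok, Bool.and_eq_true] at hp
    by_cases ha : a.val s.reg s.tab = 0
    · obtain ⟨s', t, k, e, l, r, lt, d, w⟩ := ih hN hp.2 s r3 r4 hlt
      refine ⟨s', _, _, .condFalse ha e, ?_, r, lt, ?_, w⟩
      · simp only [Prog.cost, Expr.cost, Atom.expr, if_pos ha]; omega
      · intro key; simp only [Prog.delta, if_pos ha, d key]
    · refine ⟨s, _, _, .condTrue ha (.skip s), ?_, fun _ _ => rfl, hlt, ?_, fun _ _ => rfl⟩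
      · simp [Prog.cost, ha, Expr.cost, Atom.expr]
      · intro key; simp [Prog.delta, ha]
  | seq p q ihp ihq =>
    simp only [Prog.ok, Bool.and_eq_true] at hp
    obtain ⟨s₁, t₁, k₁, e₁, l₁, r₁, lt₁, d₁, w₁⟩ := ihp hN hp.1 s r3 r4 hlt
    obtain ⟨s₂, t₂, k₂, e₂, l₂, r₂, lt₂, d₂, w₂⟩ := ihq hN hp.2 s₁
      (by rw [r₁ 3 (by omega), r3]) (by rw [r₁ 4 (by omega), r4]) lt₁
    refine ⟨s₂, _, _, .seq e₁ e₂, ?_, ?_, lt₂, ?_, ?_⟩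
    · rw [Prog.cost_congr h4 h5 hp.2 (fun x hx => r₁ x (Or.inl hx)) w₁] at l₂
      simp only [Prog.cost]; omega
    · intro x hx; rw [r₂ x hx, r₁ x hx]
    · intro key
      rw [d₂ key, d₁ key, Prog.delta_congr (ZMod K) h4 h5 hp.2 (fun x hx => r₁ x (Or.inl hx)) w₁]
      simp only [Prog.delta]; ring
    · intro key hkey; rw [w₂ key hkey, w₁ key hkey]

theorem Prog.delta_eq_zero (R : Type*) [CommRing R] {wr : List ℕ} {p : Prog} {N : ℕ}
    (h : p.ok wr N = true) (ρ : ℕ → ℕ) (μ : Key → ℕ) (key : Key)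
    (hkey : key.1 ∉ wr) : p.delta R N ρ μ key = 0 := by
  induction p generalizing N ρ with
  | skip => rfl
  | emit t x y z neg vs =>
    simp only [Prog.ok, Bool.and_eq_true, decide_eq_true_eq, List.all_eq_true] at h
    rw [Prog.delta, if_neg]
    rintro rfl
    exact hkey h.1.1
  | iter s p ih =>
    simp only [Prog.ok, Bool.and_eq_true, decide_eq_true_eq] at h
    exact sum_eq_zero fun i _ => ih h.2 _
  | ifnz a p ih =>
    simp only [Prog.ok, Bool.and_eq_true] at h
    simp [Prog.delta, ih h.2]
  | ifz a p ih =>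
    simp only [Prog.ok, Bool.and_eq_true] at h
    simp [Prog.delta, ih h.2]
  | seq p q ihp ihq =>
    simp only [Prog.ok, Bool.and_eq_true] at h
    simp [Prog.delta, ihp h.1, ihq h.2]

/-- All output of the program goes to the entry of table `t` under the key in register `6`. -/
def Prog.scalar (t : ℕ) : Prog → Bool
  | .skip => true
  | .emit t' x y z _ _ => decide (t' = t ∧ x = 6 ∧ y = 6 ∧ z = 6)
  | .iter _ p => p.scalar t
  | .ifnz _ p => p.scalar t
  | .ifz _ p => p.scalar t
  | .seq p q => p.scalar t && q.scalar t

theorem Prog.delta_scalar (R : Type*) [CommRing R] {t : ℕ} {p : Prog} {N : ℕ} (hN : 7 ≤ N)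
    (h : p.scalar t = true) (ρ : ℕ → ℕ) (h6 : ρ 6 = 0) (μ : Key → ℕ)
    (key : Key) (hkey : key ≠ (t, 0, 0, 0)) : p.delta R N ρ μ key = 0 := by
  induction p generalizing N ρ with
  | skip => rfl
  | emit t x y z neg vs =>
    simp only [Prog.scalar, decide_eq_true_eq] at h
    obtain ⟨rfl, rfl, rfl, rfl⟩ := h
    rw [Prog.delta, if_neg]
    rw [h6]; exact hkey
  | iter s p ih =>
    refine sum_eq_zero fun i _ => ih (by omega) h _ ?_
    rw [update_of_ne (by omega), h6]
  | ifnz a p ih => simp [Prog.delta, ih hN h ρ h6]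
  | ifz a p ih => simp [Prog.delta, ih hN h ρ h6]
  | seq p q ihp ihq =>
    simp only [Prog.scalar, Bool.and_eq_true] at h
    simp [Prog.delta, ihp hN h.1 ρ h6, ihq hN h.2 ρ h6]

/-- Total correctness with a time bound. -/
def Timed (W : ℕ) (p : Cmd) (s : State) (T : ℕ) (Q : State → Prop) : Prop :=
  ∃ s' t k, Exec W p s s' t k ∧ t ≤ T ∧ Q s'

theorem Timed.seq {W : ℕ} {p q : Cmd} {s : State} {T₁ T₂ : ℕ} {Q₁ Q : State → Prop}
    (h : Timed W p s T₁ Q₁) (h' : ∀ s₁, Q₁ s₁ → Timed W q s₁ T₂ Q) :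
    Timed W (.seq p q) s (T₁ + T₂) Q := by
  obtain ⟨s₁, t₁, k₁, e₁, l₁, q₁⟩ := h
  obtain ⟨s₂, t₂, k₂, e₂, l₂, q₂⟩ := h' _ q₁
  exact ⟨s₂, _, _, .seq e₁ e₂, by omega, q₂⟩

theorem Timed.plain {W : ℕ} {p : Cmd} {s : State} {Q : State → Prop}
    (hp : p.plain = true) (hQ : Q (p.run W s)) : Timed W p s p.steps Q := by
  obtain ⟨t, k, h, l⟩ := p.exec_run W hp s
  exact ⟨_, t, k, h, l, hQ⟩

theorem Timed.mono {W : ℕ} {p : Cmd} {s : State} {T T' : ℕ} {Q Q' : State → Prop}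
    (h : Timed W p s T Q) (hT : T ≤ T') (hQ : ∀ s, Q s → Q' s) : Timed W p s T' Q' := by
  obtain ⟨s', t, k, h₁, h₂, h₃⟩ := h
  exact ⟨s', t, k, h₁, h₂.trans hT, hQ _ h₃⟩

theorem Timed.tr {W : ℕ} {p : Cmd} {s : State} {T P : ℕ} {Q : State → Prop}
    (h : Timed W p s T Q) (hP : space s.tab + T ≤ P) : Tr W p s P (fun t s' => t ≤ T ∧ Q s') := by
  obtain ⟨s', t, k, h₁, h₂, h₃⟩ := h
  exact .of_exec h₁ h₂ hP ⟨h₂, h₃⟩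

/-! ### Configurations of the data structure -/

/-- What the tables hold, apart from the auxiliary tables: the neighbourhoods `nb`, the classes
`B` of big and `H` of huge vertices, the set `E` of edge codes, a temporary set `T` of vertices,
the parameters `k` and `τ` of the current phase, the number `r` of updates that remain in this
phase, and the current number `c` of copies of the pattern. -/
structure Cfg where
  nb : ℕ → Finset ℕ
  B : Finset ℕ
  H : Finset ℕ
  E : Finset ℕ
  T : Finset ℕ
  k : ℕ
  τ : ℕ
  r : ℕ
  c : ℕ

/-- The family of sets held by the tables `4`, `5` and `6`. -/
def Cfg.sets (c : Cfg) (n : ℕ) (s : ℕ) : Finset ℕ :=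
  if s < n then c.nb s else if s = n then c.B else if s = n + 1 then c.H
  else if s = n + 2 then c.E else if s = n + 3 then c.T else ∅

/-- The number held by table `t < 4`. -/
def Cfg.scal (c : Cfg) : ℕ → ℕ
  | 0 => c.k
  | 1 => c.τ
  | 2 => c.r
  | _ => c.c

/-- The tables `μ` hold the configuration `c` and the auxiliary tables `A`. -/
structure Rep (n : ℕ) (c : Cfg) (A μ : Key → ℕ) : Prop where
  sets : SetsRep μ (c.sets n)
  aux : ∀ key : Key, 7 ≤ key.1 → μ key = A key
  scal : ∀ t < 4, ∀ a, μ (t, a) = if a = (0, 0, 0) then c.scal t else 0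

/-- The neighbourhoods `nb` form a simple graph with vertices below `n`. -/
structure Gr (n : ℕ) (nb : ℕ → Finset ℕ) : Prop where
  symm : ∀ x y, y ∈ nb x → x ∈ nb y
  irrefl : ∀ x, x ∉ nb x
  lt : ∀ x y, y ∈ nb x → x < n

theorem Gr.lt' {n : ℕ} {nb : ℕ → Finset ℕ} (h : Gr n nb) {x y : ℕ} (hy : y ∈ nb x) : y < n :=
  h.lt y x (h.symm x y hy)

theorem Gr.subset {n : ℕ} {nb : ℕ → Finset ℕ} (h : Gr n nb) (x : ℕ) :
    nb x ⊆ range n := fun _ hy => mem_range.2 (h.lt' hy)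

theorem Gr.card_le {n : ℕ} {nb : ℕ → Finset ℕ} (h : Gr n nb) (x : ℕ) : (nb x).card ≤ n := by
  simpa using card_le_card (h.subset x)

/-- The graph with the additional edge `ab`. -/
def addE (nb : ℕ → Finset ℕ) (a b x : ℕ) : Finset ℕ :=
  if x = a then insert b (nb x) else if x = b then insert a (nb x) else nb x

/-- The graph without the edge `ab`. -/
def delE (nb : ℕ → Finset ℕ) (a b x : ℕ) : Finset ℕ :=
  if x = a then (nb x).erase b else if x = b then (nb x).erase a else nb x

theorem mem_addE {nb : ℕ → Finset ℕ} {a b x y : ℕ} (hab : a ≠ b) :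
    y ∈ addE nb a b x ↔ y ∈ nb x ∨ (x = a ∧ y = b) ∨ (x = b ∧ y = a) := by
  unfold addE
  split_ifs with h1 h2
  · subst h1; simp [hab]; tauto
  · subst h2; simp [h1]; tauto
  · simp [h1, h2]

theorem mem_delE {nb : ℕ → Finset ℕ} {a b x y : ℕ} (hab : a ≠ b) :
    y ∈ delE nb a b x ↔ y ∈ nb x ∧ ¬ (x = a ∧ y = b) ∧ ¬ (x = b ∧ y = a) := by
  unfold delE
  split_ifs with h1 h2
  · subst h1; simp [hab]; tauto
  · subst h2; simp [h1]; tauto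
  · simp [h1, h2]

protected theorem Gr.addE {n : ℕ} {nb : ℕ → Finset ℕ} (h : Gr n nb) {a b : ℕ} (hab : a ≠ b) (ha : a < n)
    (hb : b < n) : Gr n (addE nb a b) where
  symm x y hxy := by
    rw [mem_addE hab] at hxy ⊢
    rcases hxy with h1 | h1 | h1
    · exact Or.inl (h.symm _ _ h1)
    · tauto
    · tauto
  irrefl x hx := by
    rw [mem_addE hab] at hx
    rcases hx with h1 | h1 | h1
    · exact h.irrefl x h1
    · omega
    · omega
  lt x y hxy := by
    rw [mem_addE hab] at hxy
    rcases hxy with h1 | h1 | h1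
    · exact h.lt x y h1
    · omega
    · omega

theorem Gr.mono {n : ℕ} {nb nb' : ℕ → Finset ℕ} (h : Gr n nb) (hs : ∀ x, nb' x ⊆ nb x)
    (hsymm : ∀ x y, y ∈ nb' x → x ∈ nb' y) : Gr n nb' where
  symm := hsymm
  irrefl x hx := h.irrefl x (hs x hx)
  lt x y hxy := h.lt x y (hs x hxy)

theorem delE_subset (nb : ℕ → Finset ℕ) {a b : ℕ} (hab : a ≠ b) (x : ℕ) :
    delE nb a b x ⊆ nb x := fun y hy => ((mem_delE hab).1 hy).1

theorem Gr.delE {n : ℕ} {nb : ℕ → Finset ℕ} (h : Gr n nb) {a b : ℕ} (hab : a ≠ b) :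
    Gr n (delE nb a b) := by
  refine h.mono (delE_subset nb hab) fun x y hxy => ?_
  rw [mem_delE hab] at hxy ⊢
  exact ⟨h.symm _ _ hxy.1, by tauto, by tauto⟩

theorem addE_delE {n : ℕ} {nb : ℕ → Finset ℕ} (h : Gr n nb) {a b : ℕ} (hab : a ≠ b)
    (hb : b ∈ nb a) : addE (delE nb a b) a b = nb := by
  funext x
  ext y
  rw [mem_addE hab, mem_delE hab]
  constructor
  · rintro (h1 | ⟨rfl, rfl⟩ | ⟨rfl, rfl⟩)
    · exact h1.1
    · exact hb
    · exact h.symm _ _ hb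
  · intro hy; tauto

/-- The threshold for huge vertices as a function of the threshold `k` for big vertices. -/
def tau (sq : Bool) (k : ℕ) : ℕ := if sq then k * k else k

/-- The degree and size bounds on which the running times rest. -/
structure Cheap (sq : Bool) (nb : ℕ → Finset ℕ) (B H : Finset ℕ) (k : ℕ) : Prop where
  big : ∀ x, x ∉ B → (nb x).card ≤ k + 1
  huge : ∀ x, x ∉ H → (nb x).card ≤ tau sq k + 1
  B_card : B.card ≤ 4 * tau sq k
  H_card : H.card ≤ 4 * k

/-- The modulus of the arithmetic in the tables. -/
def modulus (n : ℕ) : ℕ := (n + 2) ^ 6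

/-- The registers with fixed content. -/
structure Base (n : ℕ) (ρ : ℕ → ℕ) : Prop where
  r0 : ρ 0 = n
  r3 : ρ 3 = modulus n
  r5 : ρ 5 = n + 1
  r6 : ρ 6 = 0
  r9 : ρ 9 = n + 2
  r10 : ρ 10 = n + 3

/-- The neighbourhoods of a graph. -/
noncomputable def nbOf {n : ℕ} (G : SimpleGraph (Fin n)) (x : ℕ) : Finset ℕ := by
  classical
  exact (range n).filter fun y => ∃ (hx : x < n) (hy : y < n), G.Adj ⟨x, hx⟩ ⟨y, hy⟩

/-- The part of a dynamic algorithm that depends on the pattern: the definition of the auxiliary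
tables, summation programs that update them when an edge is added or removed and that answer a
query for an edge, and bounds for the number of entries and the running times. -/
structure Scheme (P : SimpleGraph (Fin 4)) where
  /-- Whether the threshold for huge vertices is `k ^ 2` rather than `k`. -/
  sq : Bool
  /-- The auxiliary tables, as a function of the graph and the classes `B` and `H`. -/
  F : ℕ → (ℕ → Finset ℕ) → Finset ℕ → Finset ℕ → Key → ℕ
  /-- The first part of the update; it may read the tables that are written by the second. -/
  pre : Prog
  post : Prog
  /-- The first part of a query writes to table `14`, the second reads it and writes to `15`. -/
  q₁ : Prog
  q₂ : Prog
  wrPre : List ℕ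
  wr : List ℕ
  /-- A bound for the number of entries of the auxiliary tables. -/
  entries : ℕ → ℕ → ℕ → ℕ
  C : ℕ
  wrPre_sub : ∀ t ∈ wrPre, t ∈ wr
  wr_ge : ∀ t ∈ wr, 7 ≤ t
  pre_ok : pre.ok wrPre 30 = true
  post_ok : post.ok wr 30 = true
  post_wrPre : ∀ (R : Type) [CommRing R] (ρ : ℕ → ℕ) (μ key), key.1 ∈ wrPre →
    post.delta R 30 ρ μ key = 0
  q₁_ok : q₁.ok [14] 30 = true
  q₂_ok : q₂.ok [15] 30 = true
  q₁_scalar : q₁.scalar 14 = true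
  q₂_scalar : q₂.scalar 15 = true
  F_lt : ∀ n nb B H key, Gr n nb → F n nb B H key < modulus n
  F_empty : ∀ n B H key, F n (fun _ => ∅) B H key = 0
  F_scratch : ∀ n nb B H key, 14 ≤ key.1 → F n nb B H key = 0
  F_insert_B : ∀ n nb B H x key, Gr n nb → nb x = ∅ → F n nb (insert x B) H key = F n nb B H key
  F_insert_H : ∀ n nb B H x key, Gr n nb → nb x = ∅ → F n nb B (insert x H) key = F n nb B H key
  F_addE : ∀ (R : Type) [CommRing R] (n : ℕ) (c : Cfg) (μ : Key → ℕ) (ρ : ℕ → ℕ)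
    (a b : ℕ) (key : Key),
    Rep n c (F n c.nb c.B c.H) μ → Gr n c.nb → c.B ⊆ range n → c.H ⊆ range n →
    Base n ρ → ρ 1 = a → ρ 2 = b → a < n → b < n → a ≠ b → b ∉ c.nb a → 7 ≤ key.1 →
    (F n (addE c.nb a b) c.B c.H key : R) =
      F n c.nb c.B c.H key + pre.delta R 30 ρ μ key + post.delta R 30 ρ μ key
  query : ∀ (R : Type) [CommRing R] (n : ℕ) (G : SimpleGraph (Fin n)) (u v : Fin n) (c : Cfg)
    (μ μ' : Key → ℕ) (ρ : ℕ → ℕ),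
    G.Adj u v → c.nb = nbOf G → Gr n c.nb → c.B ⊆ range n → c.H ⊆ range n →
    Rep n c (F n c.nb c.B c.H) μ → (∀ key : Key, key.1 ≠ 14 → μ' key = μ key) →
    (μ' (14, 0, 0, 0) : R) = q₁.delta R 30 ρ μ (14, 0, 0, 0) →
    Base n ρ → ρ 1 = u → ρ 2 = v →
    q₂.delta R 30 ρ μ' (15, 0, 0, 0) = 2 * (copyCountEdge G P s(u, v) : R)
  upd_cost : ∀ (n : ℕ) (c : Cfg) (A μ : Key → ℕ) (ρ : ℕ → ℕ) (a b : ℕ),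
    Rep n c A μ → Gr n c.nb → c.B ⊆ range n → c.H ⊆ range n →
    Cheap sq c.nb c.B c.H c.k → Base n ρ → ρ 1 = a → ρ 2 = b → a < n → b < n →
    pre.cost 30 ρ μ + post.cost 30 ρ μ ≤ C * (tau sq c.k + 1)
  query_cost : ∀ (n : ℕ) (c : Cfg) (μ μ' : Key → ℕ) (ρ : ℕ → ℕ) (a b : ℕ),
    SetsRep μ (c.sets n) → SetsRep μ' (c.sets n) → Gr n c.nb → c.B ⊆ range n →
    c.H ⊆ range n → Cheap sq c.nb c.B c.H c.k → Base n ρ → ρ 1 = a → ρ 2 = b →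
    a < n → b < n → q₁.cost 30 ρ μ + q₂.cost 30 ρ μ' ≤ C * (tau sq c.k + 1)
  entries_mono : ∀ n M M' k k', M ≤ M' → k ≤ k' → entries n M k ≤ entries n M' k'
  F_entries : ∀ n nb B H M k, Gr n nb → B ⊆ range n → H ⊆ range n →
    Cheap sq nb B H k → ∑ x ∈ range n, (nb x).card ≤ 2 * M →
    ∃ S : Finset Key, S.card ≤ entries n M k ∧
      ∀ key, F n nb B H key ≠ 0 → key ∈ S

/-- A configuration as it occurs for graphs with at most `M` edges. -/
structure Cfg.Ok (sq : Bool) (n M : ℕ) (c : Cfg) : Prop where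
  gr : Gr n c.nb
  B_sub : c.B ⊆ range n
  H_sub : c.H ⊆ range n
  T_sub : c.T ⊆ range n
  E_sub : c.E ⊆ range (n * n)
  scal_lt : ∀ t, c.scal t < modulus n
  tau_eq : c.τ = tau sq c.k
  sum_le : ∑ x ∈ range n, (c.nb x).card ≤ 2 * M
  E_card : c.E.card ≤ M
  T_card : c.T.card ≤ 2 * M
  cheap : Cheap sq c.nb c.B c.H c.k

theorem modulus_ge (n : ℕ) : n * n + n + 4 ≤ modulus n := by
  have h : modulus n = (n + 2) ^ 2 * (n + 2) ^ 4 := by unfold modulus; ring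
  have h4 : 1 ≤ (n + 2) ^ 4 := Nat.one_le_pow _ _ (by omega)
  rw [h]; nlinarith

theorem wordBound_ge (n : ℕ) : (n + 2) ^ 16 ≤ wordBound 16 n := by
  unfold wordBound
  rw [mul_comm, pow_mul]
  refine Nat.pow_le_pow_left ?_ _
  have := Nat.lt_size_self n
  rw [pow_succ]; omega

theorem modulus_sq_le (n : ℕ) : modulus n * modulus n + modulus n ≤ wordBound 16 n := by
  refine le_trans ?_ (wordBound_ge n)
  have h : (n + 2) ^ 16 = modulus n * modulus n * (n + 2) ^ 4 := by unfold modulus; ring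
  have h1 : 1 ≤ modulus n := Nat.one_le_pow _ _ (by omega)
  have h4 : 2 ≤ (n + 2) ^ 4 := by
    calc 2 ≤ n + 2 := by omega
      _ = (n + 2) ^ 1 := (pow_one _).symm
      _ ≤ (n + 2) ^ 4 := Nat.pow_le_pow_right (by omega) (by omega)
  rw [h]; nlinarith

theorem Cfg.sets_cases (c : Cfg) (n s : ℕ) : (s < n ∧ c.sets n s = c.nb s) ∨
    (s = n ∧ c.sets n s = c.B) ∨ (s = n + 1 ∧ c.sets n s = c.H) ∨
    (s = n + 2 ∧ c.sets n s = c.E) ∨ (s = n + 3 ∧ c.sets n s = c.T) ∨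
    (n + 4 ≤ s ∧ c.sets n s = ∅) := by
  unfold Cfg.sets
  split_ifs with h1 h2 h3 h4 h5
  · exact Or.inl ⟨h1, rfl⟩
  · exact Or.inr (Or.inl ⟨h2, rfl⟩)
  · exact Or.inr (Or.inr (Or.inl ⟨h3, rfl⟩))
  · exact Or.inr (Or.inr (Or.inr (Or.inl ⟨h4, rfl⟩)))
  · exact Or.inr (Or.inr (Or.inr (Or.inr (Or.inl ⟨h5, rfl⟩))))
  · exact Or.inr (Or.inr (Or.inr (Or.inr (Or.inr ⟨by omega, rfl⟩))))

theorem Cfg.sets_nb (c : Cfg) {n x : ℕ} (h : x < n) : c.sets n x = c.nb x := by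
  simp [Cfg.sets, h]

theorem Cfg.sets_B (c : Cfg) (n : ℕ) : c.sets n n = c.B := by simp [Cfg.sets]

theorem Cfg.sets_H (c : Cfg) (n : ℕ) : c.sets n (n + 1) = c.H := by simp [Cfg.sets]

theorem Cfg.sets_E (c : Cfg) (n : ℕ) : c.sets n (n + 2) = c.E := by simp [Cfg.sets]

theorem Cfg.sets_T (c : Cfg) (n : ℕ) : c.sets n (n + 3) = c.T := by simp [Cfg.sets]

theorem Rep.lt {n : ℕ} {c : Cfg} {A μ : Key → ℕ} (h : Rep n c A μ)
    (hgr : Gr n c.nb) (hB : c.B ⊆ range n) (hH : c.H ⊆ range n)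
    (hT : c.T ⊆ range n) (hE : c.E ⊆ range (n * n))
    (hs : ∀ t, c.scal t < modulus n) (hA : ∀ key : Key, 7 ≤ key.1 → A key < modulus n)
    (key : Key) : μ key < modulus n := by
  have hm := modulus_ge n
  have hset : ∀ s, c.sets n s ⊆ range (n * n + n) := by
    intro s
    have h1 : range n ⊆ range (n * n + n) := by
      intro x; simp only [mem_range]; omega
    have h2 : range (n * n) ⊆ range (n * n + n) := by
      intro x; simp only [mem_range]; omega
    rcases c.sets_cases n s with h | h | h | h | h | h <;> rw [h.2]
    · exact (hgr.subset s).trans h1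
    · exact hB.trans h1
    · exact hH.trans h1
    · exact hE.trans h2
    · exact hT.trans h1
    · simp
  have hcard : ∀ s, (c.sets n s).card ≤ n * n + n := fun s => by
    simpa using card_le_card (hset s)
  obtain ⟨t, a, b, d⟩ := key
  have ht : t < 4 ∨ t = 4 ∨ t = 5 ∨ t = 6 ∨ 7 ≤ t := by omega
  rcases ht with ht | rfl | rfl | rfl | ht
  · rw [h.scal t ht]
    split_ifs
    · exact hs t
    · omega
  · by_cases e : b ≠ 0 ∨ d ≠ 0
    · rw [h.sets.size_junk a b d e]; omega
    · simp only [ne_eq, not_or, not_not] at e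
      rw [e.1, e.2, h.sets.size]
      have := hcard a; omega
  · by_cases e : d = 0
    · rw [e]
      by_cases hb : b < (c.sets n a).card
      · have := mem_range.1 (hset a (h.sets.elt a b hb).1)
        omega
      · rw [h.sets.elt_zero a b (by omega)]; omega
    · rw [h.sets.elt_junk a b d e]; omega
  · by_cases e : d = 0
    · rw [e]
      by_cases hb : b ∈ c.sets n a
      · have := h.sets.pos a b hb
        have := hcard a; omega
      · rw [h.sets.pos_zero a b hb]; omega
    · rw [h.sets.pos_junk a b d e]; omega
  · rw [h.aux _ ht]; exact hA _ ht

/-! ### Adding and removing an edge -/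

/-- Adds the edge between the contents of the registers `1` and `2`. -/
def Scheme.link (D : Scheme P) : Cmd :=
  .seq (.assign 4 (.const 1))
  (.seq (D.pre.compile 30)
  (.seq (D.post.compile 30)
  (.seq (setIns 1 2) (setIns 2 1))))

/-- Removes the edge between the contents of the registers `1` and `2`. The two parts of the update
of the auxiliary tables are undone in reverse order. -/
def Scheme.unlink (D : Scheme P) : Cmd :=
  .seq (.seq (setRem 1 2) (setRem 2 1))
  (.seq (.assign 4 (.minus (.reg 3) (.const 1)))
  (.seq (D.post.compile 30) (D.pre.compile 30)))

/-- The registers of the calling routines, and the order of the sets other than neighbourhoods,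
are unchanged. -/
structure Keep (n : ℕ) (s s' : State) : Prop where
  reg : ∀ x < 22, x ≠ 4 → s'.reg x = s.reg x
  elt : ∀ σ, n ≤ σ → ∀ i, s'.tab (5, σ, i, 0) = s.tab (5, σ, i, 0)

theorem Base.congr {n : ℕ} {ρ ρ' : ℕ → ℕ} (h : Base n ρ)
    (e : ∀ x < 11, x ≠ 1 → x ≠ 2 → x ≠ 4 → ρ' x = ρ x) :
    Base n ρ' := by
  constructor
  · rw [e 0 (by omega) (by omega) (by omega) (by omega), h.r0]
  · rw [e 3 (by omega) (by omega) (by omega) (by omega), h.r3]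
  · rw [e 5 (by omega) (by omega) (by omega) (by omega), h.r5]
  · rw [e 6 (by omega) (by omega) (by omega) (by omega), h.r6]
  · rw [e 9 (by omega) (by omega) (by omega) (by omega), h.r9]
  · rw [e 10 (by omega) (by omega) (by omega) (by omega), h.r10]

theorem cast_inj_of_lt {K a b : ℕ} (ha : a < K) (hb : b < K) (h : (a : ZMod K) = b) : a = b := by
  rw [ZMod.natCast_eq_natCast_iff] at h
  exact Nat.ModEq.eq_of_lt_of_lt h ha hb

theorem Prog.timed {n σ : ℕ} (hσ : 1 ≤ σ) (hσK : σ < modulus n)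
    {wr : List ℕ} (hwr : ∀ t ∈ wr, 7 ≤ t) {p : Prog} (hp : p.ok wr 30 = true) (s : State)
    (r3 : s.reg 3 = modulus n) (r4 : s.reg 4 = σ) (hlt : ∀ key, s.tab key < modulus n) :
    Timed (wordBound 16 n) (p.compile 30) s (p.cost 30 s.reg s.tab) (fun s' =>
      (∀ x < 30, s'.reg x = s.reg x) ∧ (∀ key, s'.tab key < modulus n) ∧
      (∀ key, (s'.tab key : ZMod (modulus n)) =
        s.tab key + σ * p.delta (ZMod (modulus n)) 30 s.reg s.tab key) ∧
      ∀ key : Key, key.1 ∉ wr → s'.tab key = s.tab key) := by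
  obtain ⟨s', t, k, e, l, r, lt, d, w⟩ := Prog.exec (W := wordBound 16 n) (K := modulus n)
    (by have := modulus_ge n; omega) (modulus_sq_le n) hσ hσK
    (fun h => by have := hwr _ h; omega) (fun h => by have := hwr _ h; omega)
    (by omega) hp s r3 r4 hlt
  exact ⟨s', t, k, e, l, fun x hx => r x (Or.inl hx), lt, d, w⟩

theorem wordBound_two_le (n : ℕ) : 2 ≤ wordBound 16 n := by
  have := modulus_sq_le n
  have := modulus_ge n
  nlinarith

theorem sets_update_nb (c : Cfg) {n a : ℕ} (ha : a < n) (S : Finset ℕ) :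
    update (c.sets n) a S = Cfg.sets { c with nb := update c.nb a S } n := by
  funext s
  unfold Cfg.sets
  by_cases h : s = a
  · subst h; simp [ha]
  · simp [update_of_ne h]

theorem addE_eq {nb : ℕ → Finset ℕ} {a b : ℕ} (hab : a ≠ b) :
    update (update nb a (insert b (nb a))) b (insert a (nb b)) =
      addE nb a b := by
  funext x
  unfold addE
  by_cases h1 : x = b
  · subst h1; simp [hab.symm]
  · by_cases h2 : x = a
    · subst h2; simp [hab]
    · simp [h1, h2]

theorem delE_eq {nb : ℕ → Finset ℕ} {a b : ℕ} (hab : a ≠ b) :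
    update (update nb a ((nb a).erase b)) b ((nb b).erase a) =
      delE nb a b := by
  funext x
  unfold delE
  by_cases h1 : x = b
  · subst h1; simp [hab.symm]
  · by_cases h2 : x = a
    · subst h2; simp [hab]
    · simp [h1, h2]

set_option maxHeartbeats 400000 in
theorem Scheme.link_timed (D : Scheme P) {n M : ℕ} {c : Cfg} (hc : c.Ok D.sq n M) {s : State}
    (hb : Base n s.reg) (hr : Rep n c (D.F n c.nb c.B c.H) s.tab) {a b : ℕ}
    (r1 : s.reg 1 = a) (r2 : s.reg 2 = b) (ha : a < n) (hb' : b < n) (hab : a ≠ b)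
    (hnb : b ∉ c.nb a) :
    Timed (wordBound 16 n) D.link s (D.C * (tau D.sq c.k + 1) + 100) (fun s' =>
      Rep n { c with nb := addE c.nb a b } (D.F n (addE c.nb a b) c.B c.H) s'.tab ∧
        Keep n s s') := by
  set W := wordBound 16 n with hW
  have hW2 : 2 ≤ W := wordBound_two_le n
  have hm := modulus_ge n
  have hmW : modulus n < W := by have := modulus_sq_le n; nlinarith
  have hcost := D.upd_cost n c _ s.tab (update s.reg 4 1) a b hr hc.gr hc.B_sub hc.H_sub
    hc.cheap (hb.congr fun x _ _ _ hx => update_of_ne hx _ _)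
    (by simpa using r1) (by simpa using r2) ha hb'
  have hlt := hr.lt hc.gr hc.B_sub hc.H_sub hc.T_sub hc.E_sub hc.scal_lt
    (fun key _ => D.F_lt n c.nb c.B c.H key hc.gr)
  have hadd := D.F_addE (ZMod (modulus n)) n c s.tab (update s.reg 4 1) a b
  have hb0 : Base n (update s.reg 4 1) :=
    hb.congr fun x _ _ _ hx => update_of_ne hx _ _
  have h4wr : ∀ t ∈ D.wr, t ≠ 4 ∧ t ≠ 5 ∧ t ≠ 6 := fun t ht => by
    have := D.wr_ge t ht; omega
  have h4pre : ∀ t ∈ D.wrPre, t ≠ 4 ∧ t ≠ 5 ∧ t ≠ 6 := fun t ht => h4wr t (D.wrPre_sub t ht)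
  refine Timed.mono (T := 2 + (D.pre.cost 30 (update s.reg 4 1) s.tab +
    (D.post.cost 30 (update s.reg 4 1) s.tab + (26 + 26)))) ?_ (by omega) (fun _ h => h)
  refine Timed.seq (Timed.plain (p := .assign 4 (.const 1)) rfl
    (Q := fun s₁ => s₁ = ⟨update s.reg 4 1, s.tab⟩) ?_) ?_
  · simp [Cmd.run, Expr.eval, mod_eq_of_lt (show 1 < W by omega)]
  rintro s₁ rfl
  refine Timed.seq (Prog.timed (σ := 1) le_rfl (by omega)
    (fun t ht => D.wr_ge t (D.wrPre_sub t ht)) D.pre_ok _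
    (by simpa using hb.r3) (by simp) hlt) ?_
  rintro s₂ ⟨g₂, lt₂, d₂, w₂⟩
  have hcost₂ : D.post.cost 30 s₂.reg s₂.tab =
      D.post.cost 30 (update s.reg 4 1) s.tab :=
    Prog.cost_congr (fun h => (h4wr _ h).1 rfl) (fun h => (h4wr _ h).2.1 rfl) D.post_ok g₂
      fun key hkey => w₂ key fun h => hkey (D.wrPre_sub _ h)
  rw [← hcost₂]
  refine Timed.seq (Prog.timed (σ := 1) le_rfl (by omega) D.wr_ge D.post_ok s₂
    (by rw [g₂ 3 (by omega)]; simpa using hb.r3) (by rw [g₂ 4 (by omega)]; simp) lt₂) ?_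
  rintro s₃ ⟨g₃, lt₃, d₃, w₃⟩
  have hreg₃ : ∀ x < 30, s₃.reg x = update s.reg 4 1 x := fun x hx => by
    rw [g₃ x hx, g₂ x hx]
  have haux : ∀ key : Key, 7 ≤ key.1 →
      s₃.tab key = D.F n (addE c.nb a b) c.B c.H key := by
    intro key hkey
    refine cast_inj_of_lt (lt₃ key) (D.F_lt _ _ _ _ _ (hc.gr.addE hab ha hb')) ?_
    rw [hadd key hr hc.gr hc.B_sub hc.H_sub hb0 (by simpa using r1) (by simpa using r2) ha hb' hab
      hnb hkey, d₃ key, d₂ key, Prog.delta_congr (ZMod (modulus n))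
      (fun h => (h4wr _ h).1 rfl) (fun h => (h4wr _ h).2.1 rfl) D.post_ok g₂
      (fun key hkey => w₂ key fun h => hkey (D.wrPre_sub _ h)) key]
    simp only [hr.aux key hkey]
    push_cast; ring
  have hlow : ∀ key : Key, key.1 < 7 → s₃.tab key = s.tab key := by
    intro key hkey
    rw [w₃ key (fun h => by have := D.wr_ge _ h; omega),
      w₂ key (fun h => by have := D.wr_ge _ (D.wrPre_sub _ h); omega)]
  have hsets₃ : SetsRep s₃.tab (c.sets n) := hr.sets.congr fun key hkey => hlow key (by omega)
  have q1 : s₃.reg 1 = a := by rw [hreg₃ 1 (by omega)]; simpa using r1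
  have q2 : s₃.reg 2 = b := by rw [hreg₃ 2 (by omega)]; simpa using r2
  obtain ⟨i1, i2, i3, i4⟩ := setIns_spec hW2 1 2 s₃ hsets₃
    (by rw [q1, q2, c.sets_nb ha]; exact hnb)
    (by rw [q1, c.sets_nb ha]; have := hc.gr.card_le a; nlinarith)
  rw [q1, q2, c.sets_nb ha, sets_update_nb c ha] at i2
  set s₄ := (setIns 1 2).run W s₃ with hs₄
  refine Timed.seq (Timed.plain (p := setIns 1 2) rfl (Q := fun s' => s' = s₄) rfl) ?_
  rintro _ rfl
  have q1' : s₄.reg 1 = a := by rw [i1, q1]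
  have q2' : s₄.reg 2 = b := by rw [i1, q2]
  have hanb : a ∉ c.nb b := fun h => hnb (hc.gr.symm _ _ h)
  obtain ⟨j1, j2, j3, j4⟩ := setIns_spec hW2 2 1 s₄ i2
    (by rw [q1', q2', Cfg.sets_nb _ hb']; simpa [update_of_ne hab.symm] using hanb)
    (by rw [q2', Cfg.sets_nb _ hb']; have := hc.gr.card_le b
        simp only [update_of_ne hab.symm]; nlinarith)
  rw [q1', q2', Cfg.sets_nb _ hb', sets_update_nb _ hb'] at j2
  simp only [update_of_ne hab.symm] at j2
  rw [addE_eq hab] at j2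
  refine Timed.plain (p := setIns 2 1) rfl ⟨⟨j2, ?_, ?_⟩, ?_, ?_⟩
  · intro key hkey
    rw [j3 key (by omega) (by omega) (by omega), i3 key (by omega) (by omega) (by omega)]
    exact haux key hkey
  · intro t ht x
    rw [j3 _ (by simp; omega) (by simp; omega) (by simp; omega),
      i3 _ (by simp; omega) (by simp; omega) (by simp; omega),
      hlow _ (by simp; omega), hr.scal t ht]
    rfl
  · intro x hx hx4
    rw [j1, i1, hreg₃ x (by omega), update_of_ne hx4]
  · intro σ hσ i
    rw [j4 _ (by simp only [q2']; omega), i4 _ (by simp only [q1]; omega), hlow _ (by simp)]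

set_option maxHeartbeats 400000 in
theorem Scheme.unlink_timed (D : Scheme P) {n M : ℕ} {c : Cfg} (hc : c.Ok D.sq n M) {s : State}
    (hb : Base n s.reg) (hr : Rep n c (D.F n c.nb c.B c.H) s.tab) {a b : ℕ}
    (r1 : s.reg 1 = a) (r2 : s.reg 2 = b) (ha : a < n) (hb' : b < n) (hab : a ≠ b)
    (hnb : b ∈ c.nb a) :
    Timed (wordBound 16 n) D.unlink s (D.C * (tau D.sq c.k + 1) + 200) (fun s' =>
      Rep n { c with nb := delE c.nb a b } (D.F n (delE c.nb a b) c.B c.H) s'.tab ∧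
        Keep n s s') := by
  set W := wordBound 16 n with hW
  have hW2 : 2 ≤ W := wordBound_two_le n
  have hm := modulus_ge n
  have hmW : modulus n < W := by have := modulus_sq_le n; nlinarith
  have hlt := hr.lt hc.gr hc.B_sub hc.H_sub hc.T_sub hc.E_sub hc.scal_lt
    (fun key _ => D.F_lt n c.nb c.B c.H key hc.gr)
  have h4wr : ∀ t ∈ D.wr, t ≠ 4 ∧ t ≠ 5 ∧ t ≠ 6 := fun t ht => by
    have := D.wr_ge t ht; omega
  set c' : Cfg := { c with nb := delE c.nb a b } with hc'
  have hgr' : Gr n c'.nb := hc.gr.delE hab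
  have hnb' : b ∉ c'.nb a := by simp [hc', mem_delE hab]
  have hadd' : addE c'.nb a b = c.nb := addE_delE hc.gr hab hnb
  have hcheap' : Cheap D.sq c'.nb c'.B c'.H c'.k :=
    { hc.cheap with
      big := fun x hx => (card_le_card (delE_subset _ hab x)).trans (hc.cheap.big x hx)
      huge := fun x hx => (card_le_card (delE_subset _ hab x)).trans (hc.cheap.huge x hx) }
  have hanb : a ∈ c.nb b := hc.gr.symm _ _ hnb
  obtain ⟨i1, i2, i3, i4⟩ := setRem_spec hW2 1 2 (by omega) (by omega) s hr.sets
    (by rw [r1, r2, c.sets_nb ha]; exact hnb)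
  rw [r1, r2, c.sets_nb ha, sets_update_nb c ha] at i2
  set s₁ := (setRem 1 2).run W s with hs₁
  have q1 : s₁.reg 1 = a := by rw [i1 1 (by omega), r1]
  have q2 : s₁.reg 2 = b := by rw [i1 2 (by omega), r2]
  obtain ⟨j1, j2, j3, j4⟩ := setRem_spec hW2 2 1 (by omega) (by omega) s₁ i2
    (by rw [q1, q2, Cfg.sets_nb _ hb']; simpa [update_of_ne hab.symm] using hanb)
  rw [q1, q2, Cfg.sets_nb _ hb', sets_update_nb _ hb'] at j2
  simp only [update_of_ne hab.symm] at j2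
  rw [delE_eq hab] at j2
  set s₂ := (setRem 2 1).run W s₁ with hs₂
  set σ := modulus n - 1 with hσ
  set s₃ : State := ⟨update s₂.reg 4 σ, s₂.tab⟩ with hs₃
  have hreg₃ : ∀ x < 22, x ≠ 4 → s₃.reg x = s.reg x := by
    intro x hx hx4
    simp only [hs₃, update_of_ne hx4]
    rw [j1 x (by omega), i1 x (by omega)]
  have hb₃ : Base n s₃.reg := hb.congr fun x hx _ _ hx4 => hreg₃ x (by omega) hx4
  have hhigh₃ : ∀ key : Key, key.1 < 4 ∨ 7 ≤ key.1 → s₃.tab key = s.tab key := by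
    intro key hkey
    simp only [hs₃]
    rw [j3 key (by omega) (by omega) (by omega), i3 key (by omega) (by omega) (by omega)]
  have hrep₃ : Rep n c' (D.F n c.nb c.B c.H) s₃.tab := by
    refine ⟨j2, ?_, ?_⟩
    · intro key hkey
      rw [hhigh₃ key (Or.inr hkey), hr.aux key hkey]
    · intro t ht x
      rw [hhigh₃ _ (Or.inl ht), hr.scal t ht]
      rfl
  have hlt₃ := hrep₃.lt hgr' hc.B_sub hc.H_sub hc.T_sub hc.E_sub hc.scal_lt
    (fun key _ => D.F_lt n c.nb c.B c.H key hc.gr)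
  -- the tables for the graph without the edge
  set ν : Key → ℕ := fun key =>
    if 7 ≤ key.1 then D.F n c'.nb c'.B c'.H key else s₃.tab key with hν
  have hνlow : ∀ key : Key, key.1 < 7 → ν key = s₃.tab key := fun key hkey => by
    simp only [hν]; rw [if_neg (by omega)]
  have hνhigh : ∀ key : Key, 7 ≤ key.1 → ν key = D.F n c'.nb c'.B c'.H key :=
    fun key hkey => by simp only [hν]; rw [if_pos hkey]
  have hrepν : Rep n c' (D.F n c'.nb c'.B c'.H) ν := by
    refine ⟨hrep₃.sets.congr fun key hkey => hνlow key (by omega), hνhigh, ?_⟩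
    intro t ht x
    rw [hνlow _ (by simp; omega)]
    exact hrep₃.scal t ht x
  have hadd := fun key hkey => D.F_addE (ZMod (modulus n)) n c' ν s₃.reg a b key hrepν hgr'
    hc.B_sub hc.H_sub hb₃ (by rw [hreg₃ 1 (by omega) (by omega), r1])
    (by rw [hreg₃ 2 (by omega) (by omega), r2]) ha hb' hab hnb' hkey
  simp only [hadd'] at hadd
  have hFlt : ∀ key, D.F n c.nb c.B c.H key < modulus n := fun key => D.F_lt _ _ _ _ _ hc.gr
  have hFlt' : ∀ key, D.F n c'.nb c.B c.H key < modulus n := fun key => D.F_lt _ _ _ _ _ hgr'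
  have hoff : ∀ key : Key, key.1 ∉ D.wr → ν key = s₃.tab key := by
    intro key hkey
    by_cases h7 : 7 ≤ key.1
    · rw [hνhigh key h7, hrep₃.aux key h7]
      have := hadd key h7
      rw [Prog.delta_eq_zero _ D.post_ok _ _ _ hkey,
        Prog.delta_eq_zero _ D.pre_ok _ _ _ (fun h => hkey (D.wrPre_sub _ h)), add_zero,
        add_zero] at this
      exact (cast_inj_of_lt (hFlt key) (hFlt' key) this).symm
    · exact hνlow key (by omega)
  have hcost := D.upd_cost n c' _ ν s₃.reg a b hrepν hgr' hc.B_sub hc.H_sub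
    hcheap' hb₃ (by rw [hreg₃ 1 (by omega) (by omega), r1])
    (by rw [hreg₃ 2 (by omega) (by omega), r2]) ha hb'
  have n4 : 4 ∉ D.wr := fun h => (h4wr _ h).1 rfl
  have n5 : 5 ∉ D.wr := fun h => (h4wr _ h).2.1 rfl
  have n4' : 4 ∉ D.wrPre := fun h => n4 (D.wrPre_sub _ h)
  have n5' : 5 ∉ D.wrPre := fun h => n5 (D.wrPre_sub _ h)
  have hσc : (σ : ZMod (modulus n)) = -1 := by
    rw [hσ, Nat.cast_sub (by omega)]; simp
  refine Timed.mono (T := (setRem 1 2).steps + (setRem 2 1).steps + (4 +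
    (D.post.cost 30 s₃.reg ν + D.pre.cost 30 s₃.reg ν))) ?_
    (by
      have : (setRem 1 2).steps + (setRem 2 1).steps ≤ 150 := by decide
      have hk : c'.k = c.k := rfl
      rw [hk] at hcost
      omega) (fun _ h => h)
  refine Timed.seq (Timed.plain (p := .seq (setRem 1 2) (setRem 2 1)) rfl
    (Q := fun s' => s' = s₂) rfl) ?_
  rintro _ rfl
  refine Timed.seq (Timed.plain (p := .assign 4 (.minus (.reg 3) (.const 1))) rfl
    (Q := fun s' => s' = s₃) ?_) ?_
  · have : s₂.reg 3 = modulus n := by rw [j1 3 (by omega), i1 3 (by omega), hb.r3]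
    simp only [Cmd.run, Expr.eval, mod_eq_of_lt (show 1 < W by omega), this, ← hσ, hs₃]
  rintro _ rfl
  have hcost₃ : D.post.cost 30 s₃.reg ν = D.post.cost 30 s₃.reg s₃.tab :=
    Prog.cost_congr n4 n5 D.post_ok (fun _ _ => rfl) hoff
  rw [hcost₃]
  refine Timed.seq (Prog.timed (σ := σ) (by omega) (by omega) D.wr_ge D.post_ok s₃
    hb₃.r3 (by simp [hs₃]) hlt₃) ?_
  rintro s₄ ⟨g₄, lt₄, d₄, w₄⟩
  have hoff₄ : ∀ key : Key, key.1 ∉ D.wrPre → s₄.tab key = ν key := by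
    intro key hkey
    by_cases h7 : 7 ≤ key.1
    · rw [hνhigh key h7]
      refine cast_inj_of_lt (lt₄ key) (hFlt' key) ?_
      have := hadd key h7
      rw [Prog.delta_eq_zero _ D.pre_ok _ _ _ hkey, add_zero] at this
      rw [d₄ key, ← Prog.delta_congr _ n4 n5 D.post_ok (fun _ _ => rfl) hoff, hrep₃.aux key h7,
        this, hσc]
      ring
    · rw [hνlow key (by omega), w₄ key fun h => h7 (D.wr_ge _ h)]
  have hcost₄ : D.pre.cost 30 s₃.reg ν = D.pre.cost 30 s₄.reg s₄.tab :=
    (Prog.cost_congr n4' n5' D.pre_ok g₄ hoff₄).symm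
  rw [hcost₄]
  refine Timed.mono (Prog.timed (σ := σ) (by omega) (by omega)
    (fun t ht => D.wr_ge t (D.wrPre_sub t ht)) D.pre_ok s₄
    (by rw [g₄ 3 (by omega)]; exact hb₃.r3) (by rw [g₄ 4 (by omega)]; simp [hs₃]) lt₄) le_rfl ?_
  rintro s₅ ⟨g₅, lt₅, d₅, w₅⟩
  have hlow₅ : ∀ key : Key, key.1 < 7 → s₅.tab key = s₃.tab key := by
    intro key hkey
    rw [w₅ key (fun h => by have := D.wr_ge _ (D.wrPre_sub _ h); omega),
      w₄ key (fun h => by have := D.wr_ge _ h; omega)]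
  refine ⟨⟨hrep₃.sets.congr fun key hkey => hlow₅ key (by omega), ?_, ?_⟩, ?_, ?_⟩
  · intro key h7
    refine cast_inj_of_lt (lt₅ key) (hFlt' key) ?_
    by_cases hkey : key.1 ∈ D.wrPre
    · have h1 := hadd key h7
      have h2 : D.post.delta (ZMod (modulus n)) 30 s₃.reg ν key = 0 := by
        exact D.post_wrPre _ _ _ _ hkey
      have h3 : D.post.delta (ZMod (modulus n)) 30 s₃.reg s₃.tab key = 0 := by
        exact D.post_wrPre _ _ _ _ hkey
      rw [d₅ key, d₄ key, h3, Prog.delta_congr _ n4' n5' D.pre_ok g₄ hoff₄, hrep₃.aux key h7, h1,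
        h2, hσc]
      ring
    · rw [w₅ key hkey, hoff₄ key hkey, hνhigh key h7]
  · intro t ht x
    rw [hlow₅ _ (by simp; omega)]
    exact hrep₃.scal t ht x
  · intro x hx hx4
    rw [g₅ x (by omega), g₄ x (by omega), hreg₃ x hx hx4]
  · intro τ hτ i
    rw [hlow₅ _ (by simp)]
    simp only [hs₃]
    rw [j4 _ (by simp only [q2]; omega), i4 _ (by simp only [r1]; omega)]

/-! ### Space -/

theorem tau_mono (sq : Bool) {k k' : ℕ} (h : k ≤ k') : tau sq k ≤ tau sq k' := by
  unfold tau; split_ifs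
  · exact Nat.mul_le_mul h h
  · exact h

theorem le_tau (sq : Bool) (k : ℕ) : k ≤ tau sq k := by
  unfold tau; split_ifs
  · nlinarith [Nat.zero_le k, Nat.le_mul_self k]
  · exact le_rfl

/-- A bound for the space between the changes of single edges. -/
def Scheme.base (D : Scheme P) (n M k : ℕ) : ℕ := D.entries n M k + 15 * M + 24 * tau D.sq k + 4

/-- A bound for the space at any time. -/
def Scheme.peak (D : Scheme P) (n M k : ℕ) : ℕ :=
  D.base n M k + D.C * (tau D.sq k + 1) + 200 * M + 800 * tau D.sq k + 2000

theorem Scheme.base_mono (D : Scheme P) {n M M' k k' : ℕ} (hM : M ≤ M') (hk : k ≤ k') :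
    D.base n M k ≤ D.base n M' k' := by
  have h1 := D.entries_mono n M M' k k' hM hk
  have h2 := tau_mono D.sq hk
  unfold Scheme.base
  omega

theorem Scheme.peak_mono (D : Scheme P) {n M M' k k' : ℕ} (hM : M ≤ M') (hk : k ≤ k') :
    D.peak n M k ≤ D.peak n M' k' := by
  have h1 := D.base_mono (n := n) hM hk
  have h2 := tau_mono D.sq hk
  have h3 : D.C * (tau D.sq k + 1) ≤ D.C * (tau D.sq k' + 1) := Nat.mul_le_mul_left _ (by omega)
  unfold Scheme.peak
  omega

theorem Cfg.sum_card_sets (c : Cfg) (n : ℕ) : ∑ s ∈ range (n + 4), (c.sets n s).card =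
    ∑ x ∈ range n, (c.nb x).card + c.B.card + c.H.card + c.E.card + c.T.card := by
  rw [Finset.sum_range_succ, Finset.sum_range_succ, Finset.sum_range_succ, Finset.sum_range_succ,
    c.sets_B, c.sets_H, c.sets_E, c.sets_T]
  congr 4
  exact sum_congr rfl fun x hx => by rw [c.sets_nb (mem_range.1 hx)]

theorem Rep.space_le (D : Scheme P) {n M : ℕ} {c : Cfg} {μ : Tables} (hc : c.Ok D.sq n M)
    (hr : Rep n c (D.F n c.nb c.B c.H) μ) : space μ ≤ D.base n M c.k := by
  classical
  obtain ⟨S, hS, hS'⟩ := D.F_entries n c.nb c.B c.H M c.k hc.gr hc.B_sub hc.H_sub hc.cheap hc.sum_le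
  let X : Finset Key := (range 4).image fun t => (t, 0, 0, 0)
  let Y : Finset Key := (range (n + 4)).biUnion fun s =>
    if c.sets n s = ∅ then ∅ else
      insert (4, s, 0, 0) (((range (c.sets n s).card).image fun i => (5, s, i, 0)) ∪
        (c.sets n s).image fun x => (6, s, x, 0))
  have hlt : ∀ s, (c.sets n s).Nonempty → s < n + 4 := by
    intro s hs
    rcases c.sets_cases n s with h | h | h | h | h | h
    all_goals try omega
    rw [h.2] at hs; simp at hs
  have hsub : μ.support ⊆ X ∪ Y ∪ S := by
    intro key hkey
    have hne : μ key ≠ 0 := by simpa using hkey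
    obtain ⟨t, a, b, d⟩ := key
    simp only [Finset.mem_union]
    have ht : t < 4 ∨ t = 4 ∨ t = 5 ∨ t = 6 ∨ 7 ≤ t := by omega
    have hY : ∀ key, (c.sets n a).Nonempty → key ∈ insert (4, a, 0, 0)
        (((range (c.sets n a).card).image fun i => (5, a, i, 0)) ∪
        (c.sets n a).image fun x => (6, a, x, 0)) → key ∈ Y := by
      intro key h1 h2
      refine Finset.mem_biUnion.2 ⟨a, mem_range.2 (hlt a h1), ?_⟩
      rw [if_neg h1.ne_empty]; exact h2
    rcases ht with ht | rfl | rfl | rfl | ht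
    · left; left
      rw [hr.scal t ht] at hne
      split_ifs at hne with h
      · simp only [X, mem_image, mem_range]
        exact ⟨t, ht, by rw [h]⟩
      · exact absurd rfl hne
    · left; right
      by_cases e : b ≠ 0 ∨ d ≠ 0
      · exact absurd (hr.sets.size_junk a b d e) hne
      · simp only [ne_eq, not_or, not_not] at e
        rw [e.1, e.2, hr.sets.size] at hne
        rw [e.1, e.2]
        exact hY _ (Finset.card_pos.1 (by omega)) (by simp)
    · left; right
      by_cases e : d = 0
      · subst e
        by_cases hb : b < (c.sets n a).card
        · exact hY _ (Finset.card_pos.1 (by omega)) (by simp [hb])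
        · exact absurd (hr.sets.elt_zero a b (by omega)) hne
      · exact absurd (hr.sets.elt_junk a b d e) hne
    · left; right
      by_cases e : d = 0
      · subst e
        by_cases hb : b ∈ c.sets n a
        · exact hY _ ⟨b, hb⟩ (by simp [hb])
        · exact absurd (hr.sets.pos_zero a b hb) hne
      · exact absurd (hr.sets.pos_junk a b d e) hne
    · right
      rw [hr.aux _ ht] at hne
      exact hS' _ hne
  have hXc : X.card ≤ 4 := by
    simpa using card_image_le (s := range 4)
      (f := fun t => ((t, 0, 0, 0) : Key))
  have hYc : Y.card ≤ 3 * ∑ s ∈ range (n + 4), (c.sets n s).card := by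
    refine Finset.card_biUnion_le.trans ?_
    rw [mul_sum]
    refine sum_le_sum fun s _ => ?_
    split_ifs with h
    · simp
    · have h0 : 0 < (c.sets n s).card := Finset.card_pos.2 (Finset.nonempty_iff_ne_empty.2 h)
      refine (Finset.card_insert_le _ _).trans ?_
      have h1 := Finset.card_union_le ((range (c.sets n s).card).image fun i =>
        ((5, s, i, 0) : Key)) ((c.sets n s).image fun x => (6, s, x, 0))
      have h2 := card_image_le (s := range (c.sets n s).card)
        (f := fun i => ((5, s, i, 0) : Key))
      have h3 := card_image_le (s := c.sets n s)
        (f := fun x => ((6, s, x, 0) : Key))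
      rw [Finset.card_range] at h2
      omega
  have h1 := card_le_card hsub
  have h2 := Finset.card_union_le (X ∪ Y) S
  have h3 := Finset.card_union_le X Y
  rw [c.sum_card_sets] at hYc
  have := hc.sum_le
  have := hc.E_card
  have := hc.T_card
  have := hc.cheap.B_card
  have := hc.cheap.H_card
  have := le_tau D.sq c.k
  unfold space Scheme.base
  omega

theorem Rep.space_peak (D : Scheme P) {n M Pk : ℕ} {c : Cfg} {μ : Tables} (hc : c.Ok D.sq n M)
    (hr : Rep n c (D.F n c.nb c.B c.H) μ) (hP : D.peak n M c.k ≤ Pk) :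
    space μ + (D.C * (tau D.sq c.k + 1) + 200 * M + 800 * tau D.sq c.k + 2000) ≤ Pk := by
  refine le_trans (le_of_le_of_eq (Nat.add_le_add_right (Rep.space_le D hc hr) _) ?_) hP
  simp only [Scheme.peak]
  ring

/-! ### Loops over sets -/

/-- Runs `body` for each element of the set whose index is held in register `s`, with the element
in register `y` and its position in register `i`. -/
def forSet (s i y : ℕ) (body : Cmd) : Cmd :=
  .seq (.assign i (.const 0))
    (.loop (.less (.reg i) (.look 4 (.reg s) (.const 0) (.const 0)))
      (.seq (.assign y (.look 5 (.reg s) (.reg i) (.const 0)))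
      (.seq body (.assign i (.plus (.reg i) (.const 1))))))

theorem forSet_tr {W : ℕ} {s i y N : ℕ} {b : Cmd} (e : ℕ → ℕ) {Pk : ℕ}
    (Inv : ℕ → ℕ → State → Prop) (hN : N + 1 < W)
    (hstab : ∀ j t st st', Inv j t st → st'.tab = st.tab →
      (∀ x, x ≠ i → x ≠ y → st'.reg x = st.reg x) → Inv j t st')
    (hrd : ∀ j t st, Inv j t st → st.tab (4, st.reg s, 0, 0) = N ∧
      (∀ l < N, st.tab (5, st.reg s, l, 0) = e l) ∧ space st.tab + 10 ≤ Pk)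
    (hiy : i ≠ y)
    (body : ∀ j < N, ∀ t st, Inv j t st → st.reg y = e j →
      Tr W b st Pk (fun t' st' => st'.reg i = st.reg i ∧ Inv (j + 1) (t + t' + 16) st'))
    (s₀ : State) (h₀ : Inv 0 0 s₀) :
    Tr W (forSet s i y b) s₀ Pk (fun t s' => ∃ t', t = t' + 9 ∧ Inv N t' s') := by
  have W0 : 0 % W = 0 := Nat.zero_mod _
  have W1 : 1 % W = 1 := mod_eq_of_lt (by omega)
  refine Tr.seq (Q₁ := fun t s' => t = 2 ∧ s'.reg i = 0 ∧ Inv 0 0 s') ?_ ?_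
  · refine .of_exec (T := 2) (.assign s₀ i (.const 0)) (by simp [Expr.cost]) ?_ ?_
    · have := (hrd 0 0 s₀ h₀).2.2; omega
    · refine ⟨by simp [Expr.cost], by simp [Expr.eval], hstab 0 0 s₀ _ h₀ rfl ?_⟩
      intro x hx _
      simp [update_of_ne hx]
  · rintro t₁ s₁ ⟨rfl, hi, h₁⟩
    refine Tr.imp (Tr.loop (Inv := fun rr t st => ∃ j t', j + rr = N ∧ st.reg i = j ∧
      t = 2 + t' ∧ Inv j t' st) ?_ ?_ N 2 s₁ ⟨0, 0, by omega, hi, rfl, h₁⟩) ?_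
    · rintro rr t st ⟨j, t', hj, hij, rfl, hInv⟩
      obtain ⟨g1, g2, g3⟩ := hrd j t' st hInv
      refine ⟨?_, ?_⟩
      · simp only [Expr.eval, W0, hij, g1]
        rw [if_pos (by omega)]; simp
      · refine Tr.seq (Q₁ := fun t s' => t = 5 ∧ s'.reg y = e j ∧ s'.reg i = j ∧
          Inv j t' s') ?_ ?_
        · refine .of_exec (T := 5) (.assign st y (.look 5 (.reg s) (.reg i) (.const 0)))
            (by simp [Expr.cost]) (by omega) ?_
          refine ⟨by simp [Expr.cost], ?_, ?_, hstab j t' st _ hInv rfl ?_⟩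
          · simp [Expr.eval, hij, g2 j (by omega)]
          · simp [update_of_ne hiy, hij]
          · intro x _ hx
            simp [update_of_ne hx]
        · rintro _ s₂ ⟨rfl, hy₂, hi₂, h₂⟩
          refine Tr.seq (body j (by omega) t' s₂ h₂ hy₂) ?_
          rintro t₃ s₃ ⟨hi₃, h₃⟩
          refine .of_exec (T := 4) (.assign s₃ i (.plus (.reg i) (.const 1)))
            (by simp [Expr.cost]) ?_ ?_
          · have := (hrd _ _ _ h₃).2.2; omega
          · refine ⟨j + 1, t' + t₃ + 16, by omega, ?_, ?_, hstab _ _ s₃ _ h₃ rfl ?_⟩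
            · simp only [Expr.eval, W1, hi₃, hi₂, update_self]
              exact mod_eq_of_lt (by omega)
            · simp only [Expr.cost]; omega
            · intro x hx _
              simp [update_of_ne hx]
    · rintro t st ⟨j, t', hj, hij, rfl, hInv⟩
      obtain ⟨g1, g2, g3⟩ := hrd j t' st hInv
      refine ⟨?_, by omega⟩
      simp only [Expr.eval, W0, hij, g1]
      rw [if_neg (by omega)]
    · rintro t s' ⟨t₁, ht, j, t', hj, hij, ht', hInv⟩
      obtain rfl : j = N := by omega
      refine ⟨t', ?_, hInv⟩
      simp only [Expr.cost] at ht
      omega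

/-- The first `j` elements of a set, in the order in which the tables list them. -/
theorem SetsRep.enum {μ : Key → ℕ} {S : ℕ → Finset ℕ} (h : SetsRep μ S) (s : ℕ)
    {e : ℕ → ℕ} (he : ∀ i, e i = μ (5, s, i, 0)) :
    (range (S s).card).image e = S s ∧
    (∀ j < (S s).card, e j ∈ S s) ∧
    (∀ j < (S s).card, e j ∉ (range j).image e) ∧
    ∀ j ≤ (S s).card, (range j).image e ⊆ S s := by
  obtain rfl : e = fun i => μ (5, s, i, 0) := funext he
  have h1 : ∀ j ≤ (S s).card, (range j).image (fun i => μ (5, s, i, 0)) ⊆ S s := by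
    intro j hj x hx
    obtain ⟨i, hi, rfl⟩ := Finset.mem_image.1 hx
    exact (h.elt s i (by have := mem_range.1 hi; omega)).1
  refine ⟨Finset.Subset.antisymm (h1 _ le_rfl) ?_, fun j hj => (h.elt s j hj).1, ?_, h1⟩
  · intro x hx
    obtain ⟨p1, p2, p3⟩ := h.pos s x hx
    exact Finset.mem_image.2 ⟨_, mem_range.2 (by omega), p3⟩
  · intro j hj hx
    obtain ⟨i, hi, hij⟩ := Finset.mem_image.1 hx
    have hi' := mem_range.1 hi
    have e1 := (h.elt s i (by omega)).2
    have e2 := (h.elt s j hj).2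
    simp only at hij
    rw [hij] at e1; omega

theorem image_range_succ (e : ℕ → ℕ) (j : ℕ) :
    (range (j + 1)).image e = insert (e j) ((range j).image e) := by
  rw [Finset.range_add_one, Finset.image_insert]

/-- Empties the set whose index is held in register `s`. -/
def clear (s : ℕ) : Cmd :=
  .loop (.look 4 (.reg s) (.const 0) (.const 0))
    (.seq (.assign 25 (.look 5 (.reg s) (.const 0) (.const 0))) (setRem s 25))

theorem clear_timed {W : ℕ} (hW : 2 ≤ W) {sr : ℕ} (hs : sr < 22) (m : ℕ) (s : State)
    {S : ℕ → Finset ℕ} (h : SetsRep s.tab S) (hm : (S (s.reg sr)).card = m) :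
    Timed W (clear sr) s (100 * m + 5) (fun s' =>
      (∀ r < 22, s'.reg r = s.reg r) ∧ SetsRep s'.tab (update S (s.reg sr) ∅) ∧
      (∀ key : Key, key.1 ≠ 4 → key.1 ≠ 5 → key.1 ≠ 6 → s'.tab key = s.tab key) ∧
      ∀ key : Key, key.2.1 ≠ s.reg sr → s'.tab key = s.tab key) := by
  have W0 : 0 % W = 0 := Nat.zero_mod _
  induction m generalizing s S with
  | zero =>
    refine ⟨s, _, _, .loopFalse ?_, by simp [Expr.cost], fun _ _ => rfl, ?_,
      fun _ _ _ _ => rfl, fun _ _ => rfl⟩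
    · simp [Expr.eval, h.size, hm]
    · rw [← Finset.card_eq_zero.1 hm, Function.update_eq_self]; exact h
  | succ m ih =>
    set x := s.tab (5, s.reg sr, 0, 0) with hx
    set s₁ : State := ⟨update s.reg 25 x, s.tab⟩ with hs₁
    have e₁ := Exec.assign (W := W) s 25 (.look 5 (.reg sr) (.const 0) (.const 0))
    simp only [Expr.eval, W0, ← hx] at e₁
    have q1 : s₁.reg sr = s.reg sr := by simp [hs₁, update_of_ne (show sr ≠ 25 by omega)]
    have q2 : s₁.reg 25 = x := by simp [hs₁]
    have hmem : x ∈ S (s.reg sr) := (h.elt _ 0 (by omega)).1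
    obtain ⟨i1, i2, i3, i4⟩ := setRem_spec hW sr 25 (by omega) (by omega) s₁ h
      (by rw [q1, q2]; exact hmem)
    rw [q1, q2] at i2
    rw [q1] at i4
    obtain ⟨t₂, k₂, e₂, l₂⟩ := Cmd.exec_run W (setRem sr 25) rfl s₁
    set s₂ := (setRem sr 25).run W s₁ with hs₂
    have q3 : s₂.reg sr = s.reg sr := by rw [i1 sr (by omega), q1]
    obtain ⟨s₃, t₃, k₃, e₃, l₃, j1, j2, j3, j4⟩ := ih s₂ i2 (by
      rw [q3, update_self, Finset.card_erase_of_mem hmem]; omega)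
    rw [q3, Function.update_idem] at j2
    rw [q3] at j4
    refine ⟨s₃, _, _, .loopTrue ?_ (.seq e₁ e₂) e₃, ?_, ?_, j2, ?_, ?_⟩
    · simp [Expr.eval, h.size, hm]
    · have : (setRem sr 25).steps ≤ 75 := by simp [setRem, Cmd.steps, Expr.cost]
      simp only [Expr.cost]
      omega
    · intro r hr
      rw [j1 r hr, i1 r (by omega), hs₁]
      simp [update_of_ne (show r ≠ 25 by omega)]
    · intro key h4 h5 h6
      rw [j3 key h4 h5 h6, i3 key h4 h5 h6]
    · intro key hkey
      rw [j4 key hkey, i4 key hkey]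

/-! ### Promotion of vertices -/

/-- The graph without the edges between `x` and the set `S` of neighbours of `x`. -/
def cut (nb : ℕ → Finset ℕ) (x : ℕ) (S : Finset ℕ) (z : ℕ) : Finset ℕ :=
  if z = x then nb x \ S else if z ∈ S then (nb z).erase x else nb z

theorem cut_empty (nb : ℕ → Finset ℕ) (x : ℕ) : cut nb x ∅ = nb := by
  funext z; unfold cut; split_ifs with h
  · subst h; simp
  · simp at *
  · rfl

theorem cut_subset (nb : ℕ → Finset ℕ) (x : ℕ) (S : Finset ℕ) (z : ℕ) : cut nb x S z ⊆ nb z := by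
  unfold cut; split_ifs with h
  · subst h; exact Finset.sdiff_subset
  · exact Finset.erase_subset _ _
  · exact subset_rfl

theorem mem_cut {nb : ℕ → Finset ℕ} {x : ℕ} {S : Finset ℕ} {z y : ℕ} :
    y ∈ cut nb x S z ↔ y ∈ nb z ∧ ¬ (z = x ∧ y ∈ S) ∧ ¬ (z ≠ x ∧ z ∈ S ∧ y = x) := by
  unfold cut; split_ifs with h1 h2
  · subst h1; simp
  · simp [h1, h2]; tauto
  · simp [h1, h2]

theorem Gr.cut {n : ℕ} {nb : ℕ → Finset ℕ} (h : Gr n nb) (x : ℕ) (S : Finset ℕ) :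
    Gr n (cut nb x S) := by
  refine h.mono (cut_subset nb x S) fun z y hy => ?_
  rw [mem_cut] at hy ⊢
  have hne : z ≠ y := fun e => h.irrefl z (by rw [e] at hy ⊢; exact hy.1)
  refine ⟨h.symm _ _ hy.1, ?_, ?_⟩
  · rintro ⟨rfl, h2⟩; exact hy.2.2 ⟨hne, h2, rfl⟩
  · rintro ⟨h1, h2, rfl⟩; exact hy.2.1 ⟨rfl, h2⟩

theorem delE_cut {n : ℕ} {nb : ℕ → Finset ℕ} (h : Gr n nb) {x y : ℕ} {S : Finset ℕ}
    (hx : x ∉ S) (hyx : x ≠ y) : delE (cut nb x S) x y = cut nb x (insert y S) := by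
  funext z; ext w
  rw [mem_delE hyx, mem_cut, mem_cut]
  simp only [mem_insert]
  constructor
  · rintro ⟨⟨h1, h2, h3⟩, h4, h5⟩
    exact ⟨h1, by tauto, by tauto⟩
  · rintro ⟨h1, h2, h3⟩
    refine ⟨⟨h1, by tauto, by tauto⟩, by tauto, ?_⟩
    rintro ⟨rfl, rfl⟩
    exact h3 ⟨hyx.symm, Or.inl rfl, rfl⟩

theorem mem_cut_self {nb : ℕ → Finset ℕ} {x y : ℕ} {S : Finset ℕ} (hy : y ∈ nb x) (hyS : y ∉ S) :
    y ∈ cut nb x S x := by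
  rw [mem_cut]; tauto

theorem addE_cut {n : ℕ} {nb : ℕ → Finset ℕ} (h : Gr n nb) {x y : ℕ} {S : Finset ℕ}
    (hx : x ∉ S) (hyx : x ≠ y) (hy : y ∈ nb x) (hyS : y ∉ S) :
    addE (cut nb x (insert y S)) x y = cut nb x S := by
  rw [← delE_cut h hx hyx]
  exact addE_delE (h.cut x S) hyx (mem_cut_self hy hyS)

/-- The registers `14` to `21` and the order of the set of all edges are unchanged. -/
structure Far (n : ℕ) (s s' : State) : Prop where
  reg : ∀ x, 14 ≤ x → x < 22 → s'.reg x = s.reg x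
  elt : ∀ i, s'.tab (5, n + 2, i, 0) = s.tab (5, n + 2, i, 0)

theorem Far.trans {n : ℕ} {s s' s'' : State} (h : Far n s s') (h' : Far n s' s'') : Far n s s'' :=
  ⟨fun x h1 h2 => (h'.reg x h1 h2).trans (h.reg x h1 h2), fun i => (h'.elt i).trans (h.elt i)⟩

theorem Far.rfl' {n : ℕ} {s : State} : Far n s s := ⟨fun _ _ _ => rfl, fun _ => rfl⟩

theorem Cfg.Ok.shrink {sq : Bool} {n M : ℕ} {c : Cfg} (hc : c.Ok sq n M) {nb : ℕ → Finset ℕ}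
    {T : Finset ℕ} (hgr : Gr n nb) (hs : ∀ x, nb x ⊆ c.nb x) (hT : T ⊆ range n)
    (hTc : T.card ≤ 2 * M) : Cfg.Ok sq n M { c with nb := nb, T := T } :=
  { gr := hgr
    B_sub := hc.B_sub
    H_sub := hc.H_sub
    T_sub := hT
    E_sub := hc.E_sub
    scal_lt := hc.scal_lt
    tau_eq := hc.tau_eq
    sum_le := (sum_le_sum fun x _ => card_le_card (hs x)).trans hc.sum_le
    E_card := hc.E_card
    T_card := hTc
    cheap :=
      { big := fun x hx => (card_le_card (hs x)).trans (hc.cheap.big x hx)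
        huge := fun x hx => (card_le_card (hs x)).trans (hc.cheap.huge x hx)
        B_card := hc.cheap.B_card
        H_card := hc.cheap.H_card } }

/-- Puts the vertex held in register `11` into the class whose index is held in register `12`:
its edges are removed, and added again after the change of the class. -/
def Scheme.reclass (D : Scheme P) : Cmd :=
  .seq (forSet 11 13 2 (setIns 10 2))
  (.seq (forSet 10 13 2 (.seq (.assign 1 (.reg 11)) D.unlink))
  (.seq (setIns 12 11)
  (.seq (forSet 10 13 2 (.seq (.assign 1 (.reg 11)) D.link))
    (clear 10))))

theorem sets_update_T (c : Cfg) (n : ℕ) (S : Finset ℕ) :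
    update (c.sets n) (n + 3) S = Cfg.sets { c with T := S } n := by
  funext s
  unfold Cfg.sets
  grind

theorem sets_update_E (c : Cfg) (n : ℕ) (S : Finset ℕ) :
    update (c.sets n) (n + 2) S = Cfg.sets { c with E := S } n := by
  funext s
  unfold Cfg.sets
  grind

theorem sets_update_B (c : Cfg) (n : ℕ) (S : Finset ℕ) :
    update (c.sets n) n S = Cfg.sets { c with B := S } n := by
  funext s
  unfold Cfg.sets
  grind

theorem sets_update_H (c : Cfg) (n : ℕ) (S : Finset ℕ) :
    update (c.sets n) (n + 1) S = Cfg.sets { c with H := S } n := by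
  funext s
  unfold Cfg.sets
  grind

theorem Rep.of_sets {n : ℕ} {c c' : Cfg} {A μ μ' : Key → ℕ} (hr : Rep n c A μ)
    (h : SetsRep μ' (c'.sets n))
    (hμ : ∀ key : Key, key.1 ≠ 4 → key.1 ≠ 5 → key.1 ≠ 6 → μ' key = μ key)
    (hsc : c'.scal = c.scal) : Rep n c' A μ' := by
  refine ⟨h, fun key hkey => ?_, fun t ht a => ?_⟩
  · rw [hμ key (by omega) (by omega) (by omega)]; exact hr.aux key hkey
  · rw [hμ _ (by simp; omega) (by simp; omega) (by simp; omega), hr.scal t ht, hsc]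

theorem Rep.setIns {n : ℕ} {c c' : Cfg} {A : Key → ℕ} {s : State}
    (hr : Rep n c A s.tab) (sr xr : ℕ) (hx : s.reg xr ∉ c.sets n (s.reg sr))
    (hc : (c.sets n (s.reg sr)).card < modulus n)
    (hs : update (c.sets n) (s.reg sr) (insert (s.reg xr) (c.sets n (s.reg sr))) =
      c'.sets n) (hsc : c'.scal = c.scal) :
    Timed (wordBound 16 n) (DynCount.setIns sr xr) s 26 (fun s' => s'.reg = s.reg ∧
      Rep n c' A s'.tab ∧ ∀ σ, σ ≠ s.reg sr → ∀ i, s'.tab (5, σ, i, 0) = s.tab (5, σ, i, 0)) := by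
  have hm := modulus_ge n
  have hmW := modulus_sq_le n
  obtain ⟨i1, i2, i3, i4⟩ := setIns_spec (wordBound_two_le n) sr xr s hr.sets hx (by nlinarith)
  rw [hs] at i2
  exact Timed.plain rfl ⟨i1, hr.of_sets i2 i3 hsc, fun σ hσ i => i4 _ hσ⟩

theorem Rep.setRem {n : ℕ} {c c' : Cfg} {A : Key → ℕ} {s : State}
    (hr : Rep n c A s.tab) (sr xr : ℕ) (hsr : sr < 22) (hxr : xr < 22)
    (hx : s.reg xr ∈ c.sets n (s.reg sr))
    (hs : update (c.sets n) (s.reg sr) ((c.sets n (s.reg sr)).erase (s.reg xr)) =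
      c'.sets n) (hsc : c'.scal = c.scal) :
    Timed (wordBound 16 n) (DynCount.setRem sr xr) s 75 (fun s' =>
      (∀ r < 22, s'.reg r = s.reg r) ∧ Rep n c' A s'.tab) := by
  obtain ⟨i1, i2, i3, i4⟩ := setRem_spec (wordBound_two_le n) sr xr hsr (Or.inl hxr) s hr.sets hx
  rw [hs] at i2
  exact Timed.mono (Timed.plain (p := DynCount.setRem sr xr) rfl
    (Q := fun s' => (∀ r < 22, s'.reg r = s.reg r) ∧ Rep n c' A s'.tab)
    ⟨fun r hr => i1 r (Or.inl hr), hr.of_sets i2 i3 hsc⟩)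
    (by simp [DynCount.setRem, Cmd.steps, Expr.cost]) (fun _ h => h)

theorem Rep.clear {n : ℕ} {c c' : Cfg} {A : Key → ℕ} {s : State}
    (hr : Rep n c A s.tab) (sr : ℕ) (hsr : sr < 22)
    (hs : update (c.sets n) (s.reg sr) ∅ = c'.sets n) (hsc : c'.scal = c.scal) :
    Timed (wordBound 16 n) (DynCount.clear sr) s (100 * (c.sets n (s.reg sr)).card + 5)
      (fun s' => (∀ r < 22, s'.reg r = s.reg r) ∧ Rep n c' A s'.tab ∧
        ∀ σ, σ ≠ s.reg sr → ∀ i, s'.tab (5, σ, i, 0) = s.tab (5, σ, i, 0)) := by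
  refine (clear_timed (wordBound_two_le n) hsr _ s hr.sets rfl).mono le_rfl ?_
  rintro s' ⟨i1, i2, i3, i4⟩
  rw [hs] at i2
  exact ⟨i1, hr.of_sets i2 i3 hsc, fun σ hσ i => i4 _ hσ⟩

theorem insert_sdiff_insert' {N S : Finset ℕ} {y : ℕ} (hy : y ∈ N) (hyS : y ∉ S) :
    insert y (N \ insert y S) = N \ S := by
  ext z; simp only [mem_insert, Finset.mem_sdiff]
  by_cases h : z = y
  · subst h; tauto
  · tauto

set_option maxHeartbeats 4000000 in
theorem Scheme.reclass_tr (D : Scheme P) {n M Pk cl x : ℕ} {c c' : Cfg} (hc : c.Ok D.sq n M)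
    (hc' : c'.Ok D.sq n M) (hT : c.T = ∅) (hnb : c'.nb = c.nb) (hT' : c'.T = c.T)
    (hsc : c'.scal = c.scal) (hcl : cl = n ∨ cl = n + 1)
    (hxcl : ∀ nb T, x ∉ Cfg.sets { c with nb := nb, T := T } n cl)
    (hset : ∀ nb T, update (Cfg.sets { c with nb := nb, T := T } n) cl
      (insert x (Cfg.sets { c with nb := nb, T := T } n cl)) =
        Cfg.sets { c' with nb := nb, T := T } n)
    (hF : ∀ nb, Gr n nb → nb x = ∅ → ∀ key, D.F n nb c'.B c'.H key = D.F n nb c.B c.H key)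
    (hP : D.peak n M c.k ≤ Pk) (hx : x < n) {s : State} (hb : Base n s.reg)
    (h11 : s.reg 11 = x) (h12 : s.reg 12 = cl) (hr : Rep n c (D.F n c.nb c.B c.H) s.tab) :
    Tr (wordBound 16 n) D.reclass s Pk (fun t s' =>
      t ≤ ((c.nb x).card + 1) * (2 * (D.C * (tau D.sq c.k + 1) + 200) + 300) ∧
      Rep n c' (D.F n c'.nb c'.B c'.H) s'.tab ∧ Base n s'.reg ∧ Far n s s' ∧
      s'.reg 11 = x) := by
  set W := wordBound 16 n with hW
  set A₀ := D.C * (tau D.sq c.k + 1) + 200 with hA₀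
  set N := c.nb x with hN
  have hmod := modulus_ge n
  have hmW : modulus n * modulus n + modulus n ≤ W := modulus_sq_le n
  have hk' : c'.k = c.k := congrFun hsc 0
  have hNn : N.card ≤ n := hc.gr.card_le x
  have hNM : N.card ≤ 2 * M := le_trans (Finset.single_le_sum (f := fun z => (c.nb z).card)
    (fun _ _ => Nat.zero_le _) (mem_range.2 hx)) hc.sum_le
  have hNsub : N ⊆ range n := hc.gr.subset x
  have hxN : x ∉ N := hc.gr.irrefl x
  -- a small command does not exceed the space bound
  have hsp : ∀ (d : Cfg) (μ : Tables), d.Ok D.sq n M → d.k = c.k →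
      Rep n d (D.F n d.nb d.B d.H) μ → space μ + (A₀ + 200 * M + 1500) ≤ Pk := by
    intro d μ hd hdk hrd
    have := hrd.space_peak D hd (Pk := Pk) (by rw [hdk]; exact hP)
    rw [hdk] at this
    refine le_trans (Nat.add_le_add_left ?_ _) this
    rw [hA₀]
    generalize D.C * (tau D.sq c.k + 1) = X
    generalize tau D.sq c.k = Y
    linarith
  have hokT : ∀ T ⊆ N, Cfg.Ok D.sq n M { c with nb := c.nb, T := T } := fun T hTN =>
    hc.shrink hc.gr (fun _ => subset_rfl) (hTN.trans hNsub)
      ((card_le_card hTN).trans hNM)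
  have hokC : ∀ S, Cfg.Ok D.sq n M { c with nb := cut c.nb x S, T := N } := fun S =>
    hc.shrink (hc.gr.cut x S) (cut_subset _ _ _) hNsub hNM
  have hokC' : ∀ S, Cfg.Ok D.sq n M { c' with nb := cut c.nb x S, T := N } := fun S =>
    hc'.shrink (hc.gr.cut x S) (by rw [hnb]; exact cut_subset _ _ _) hNsub hNM
  -- the neighbours are copied
  set e : ℕ → ℕ := fun i => s.tab (5, x, i, 0) with he
  obtain ⟨en1, en2, en3, en4⟩ := hr.sets.enum x (e := e) (fun _ => rfl)
  rw [c.sets_nb hx, ← hN] at en1 en2 en3 en4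
  have stage1 : Tr W (forSet 11 13 2 (DynCount.setIns 10 2)) s Pk (fun t s' =>
      t ≤ N.card * 42 + 9 ∧ Base n s'.reg ∧ s'.reg 11 = x ∧ s'.reg 12 = cl ∧ Far n s s' ∧
      Rep n { c with nb := c.nb, T := N } (D.F n c.nb c.B c.H) s'.tab) := by
    refine Tr.imp (forSet_tr (N := N.card) e (Inv := fun j t st => t ≤ j * 42 ∧ Base n st.reg ∧
      st.reg 11 = x ∧ st.reg 12 = cl ∧ Far n s st ∧ j ≤ N.card ∧
      Rep n { c with nb := c.nb, T := (range j).image e } (D.F n c.nb c.B c.H) st.tab ∧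
      ∀ l, st.tab (5, x, l, 0) = e l) (by nlinarith) ?_ ?_ (by omega) ?_ s ?_) ?_
    · rintro j t st st' ⟨g1, g2, g3, g4, g5, g6, g7, g8⟩ ht hreg
      refine ⟨g1, g2.congr fun y hy _ h2 _ => hreg y (by omega) (by omega),
        by rw [hreg 11 (by omega) (by omega), g3], by rw [hreg 12 (by omega) (by omega), g4],
        ⟨fun y h1 h2 => by rw [hreg y (by omega) (by omega), g5.reg y h1 h2],
          fun i => by rw [ht, g5.elt]⟩, g6, by rw [ht]; exact g7, by rw [ht]; exact g8⟩
    · rintro j t st ⟨g1, g2, g3, g4, g5, g6, g7, g8⟩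
      refine ⟨?_, ?_, ?_⟩
      · rw [g3, g7.sets.size, Cfg.sets_nb _ hx]
      · intro l _; rw [g3, g8]
      · have := hsp _ _ (hokT _ (en4 j g6)) rfl g7; omega
    · rintro j hj t st ⟨g1, g2, g3, g4, g5, g6, g7, g8⟩ hy
      refine Tr.imp (Timed.tr (g7.setIns (c' := { c with nb := c.nb, T := (range (j + 1)).image e })
        10 2 ?_ ?_ ?_ rfl) ?_) ?_
      · rw [g2.r10, Cfg.sets_T, hy]; exact en3 j hj
      · rw [g2.r10, Cfg.sets_T]
        have := card_le_card (en4 j g6)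
        simp only
        nlinarith
      · rw [g2.r10, Cfg.sets_T, hy, sets_update_T, image_range_succ]
      · have := hsp _ _ (hokT _ (en4 j g6)) rfl g7; omega
      · rintro t' s' ⟨ht', i1, i2, i3⟩
        refine ⟨by rw [i1], by nlinarith, by rw [i1]; exact g2, by rw [i1]; exact g3,
          by rw [i1]; exact g4, g5.trans ⟨fun y _ _ => by rw [i1], fun i => i3 _ ?_ i⟩, hj, i2, ?_⟩
        · rw [g2.r10]; omega
        · intro l; rw [i3 _ (by rw [g2.r10]; omega), g8]
    · refine ⟨by simp, hb, h11, h12, Far.rfl', by omega, ?_, fun _ => rfl⟩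
      simp only [Finset.range_zero, Finset.image_empty]
      rw [← hT]; exact hr
    · rintro t s' ⟨t', rfl, g1, g2, g3, g4, g5, g6, g7, g8⟩
      rw [en1] at g7
      exact ⟨by omega, g2, g3, g4, g5, g7⟩
  refine Tr.seq stage1 ?_
  rintro t₁ s₁ ⟨ht₁, b₁, x₁, cl₁, f₁, rep₁⟩
  -- the edges of `x` are removed
  set e' : ℕ → ℕ := fun i => s₁.tab (5, n + 3, i, 0) with he'
  obtain ⟨fn1, fn2, fn3, fn4⟩ := rep₁.sets.enum (n + 3) (e := e') (fun _ => rfl)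
  rw [Cfg.sets_T] at fn1 fn2 fn3 fn4
  simp only at fn1 fn2 fn3 fn4
  have hxe : ∀ j ≤ N.card, x ∉ (range j).image e' := fun j hj h => hxN (fn4 j hj h)
  have stage2 : Tr W (forSet 10 13 2 (.seq (.assign 1 (.reg 11)) D.unlink)) s₁ Pk (fun t s' =>
      t ≤ N.card * (A₀ + 20) + 9 ∧ Base n s'.reg ∧ s'.reg 11 = x ∧ s'.reg 12 = cl ∧ Far n s s' ∧
      Rep n { c with nb := cut c.nb x N, T := N } (D.F n (cut c.nb x N) c.B c.H) s'.tab ∧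
      ∀ l, s'.tab (5, n + 3, l, 0) = e' l) := by
    refine Tr.imp (forSet_tr (N := N.card) e' (Inv := fun j t st => t ≤ j * (A₀ + 20) ∧
      Base n st.reg ∧ st.reg 11 = x ∧ st.reg 12 = cl ∧ Far n s st ∧ j ≤ N.card ∧
      Rep n { c with nb := cut c.nb x ((range j).image e'), T := N }
        (D.F n (cut c.nb x ((range j).image e')) c.B c.H) st.tab ∧
      ∀ l, st.tab (5, n + 3, l, 0) = e' l) (by nlinarith) ?_ ?_ (by omega) ?_ s₁ ?_) ?_
    · rintro j t st st' ⟨g1, g2, g3, g4, g5, g6, g7, g8⟩ ht hreg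
      refine ⟨g1, g2.congr fun y hy _ h2 _ => hreg y (by omega) (by omega),
        by rw [hreg 11 (by omega) (by omega), g3], by rw [hreg 12 (by omega) (by omega), g4],
        ⟨fun y h1 h2 => by rw [hreg y (by omega) (by omega), g5.reg y h1 h2],
          fun i => by rw [ht, g5.elt]⟩, g6, by rw [ht]; exact g7, by rw [ht]; exact g8⟩
    · rintro j t st ⟨g1, g2, g3, g4, g5, g6, g7, g8⟩
      refine ⟨?_, ?_, ?_⟩
      · rw [g2.r10, g7.sets.size, Cfg.sets_T]
      · intro l _; rw [g2.r10, g8]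
      · have := hsp _ _ (hokC _) rfl g7; omega
    · rintro j hj t st ⟨g1, g2, g3, g4, g5, g6, g7, g8⟩ hy
      have hspace := hsp _ _ (hokC _) rfl g7
      refine Tr.seq (Q₁ := fun t s' => t = 2 ∧ s' = ⟨update st.reg 1 x, st.tab⟩) ?_ ?_
      · refine .of_exec (T := 2) (.assign st 1 (.reg 11)) (by simp [Expr.cost]) (by omega) ?_
        exact ⟨by simp [Expr.cost], by simp [Expr.eval, g3]⟩
      · rintro _ _ ⟨rfl, rfl⟩
        have hmem : e' j ∈ cut c.nb x ((range j).image e') x :=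
          mem_cut_self (fn2 j hj) (fn3 j hj)
        have hne : x ≠ e' j := fun h => hxN (h ▸ fn2 j hj)
        refine Tr.imp (Timed.tr (D.unlink_timed (hokC _) (s := ⟨update st.reg 1 x, st.tab⟩)
          (g2.congr fun y _ h1 _ _ => by simp [update_of_ne h1]) g7 (a := x) (b := e' j)
          (by simp) (by simpa [update_of_ne] using hy) hx
          (mem_range.1 (hNsub (fn2 j hj))) hne hmem) ?_) ?_
        · simp only; omega
        · rintro t' s' ⟨ht', i1, i2⟩
          have hreg : ∀ y, y ≠ 1 → y ≠ 4 → y < 22 → s'.reg y = st.reg y := fun y h1 h4 h22 => by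
            rw [i2.reg y h22 h4]; simp [update_of_ne h1]
          simp only at i1 ht'
          rw [delE_cut hc.gr (hxe j g6) hne, ← image_range_succ] at i1
          refine ⟨hreg 13 (by omega) (by omega) (by omega), by nlinarith,
            g2.congr fun y hy h1 _ h4 => hreg y h1 h4 (by omega),
            by rw [hreg 11 (by omega) (by omega) (by omega), g3],
            by rw [hreg 12 (by omega) (by omega) (by omega), g4],
            g5.trans ⟨fun y h1 h2 => hreg y (by omega) (by omega) h2,
              fun i => i2.elt _ (by omega) i⟩, hj, i1, ?_⟩
          intro l; rw [i2.elt _ (by omega), ← g8 l]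
    · refine ⟨by simp, b₁, x₁, cl₁, f₁, by omega, ?_, fun _ => rfl⟩
      simp only [Finset.range_zero, Finset.image_empty, cut_empty]
      exact rep₁
    · rintro t s' ⟨t', rfl, g1, g2, g3, g4, g5, g6, g7, g8⟩
      rw [fn1] at g7
      exact ⟨by omega, g2, g3, g4, g5, g7, g8⟩
  refine Tr.seq stage2 ?_
  rintro t₂ s₂ ⟨ht₂, b₂, x₂, cl₂, f₂, rep₂, o₂⟩
  have hspace₂ := hsp _ _ (hokC _) rfl rep₂
  -- the class of the isolated vertex is changed
  refine Tr.seq (Timed.tr (rep₂.setIns (c' := { c' with nb := cut c.nb x N, T := N }) 12 11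
    (by rw [cl₂, x₂]; exact hxcl _ _)
    (by
      rw [cl₂]
      have hB := card_le_card hc.B_sub
      have hH := card_le_card hc.H_sub
      rw [Finset.card_range] at hB hH
      rcases hcl with rfl | rfl
      · rw [Cfg.sets_B]; simp only; nlinarith
      · rw [Cfg.sets_H]; simp only; nlinarith)
    (by rw [cl₂, x₂]; exact hset _ _) (by
      funext t; rcases t with _ | _ | _ | t
      · exact congrFun hsc 0
      · exact congrFun hsc 1
      · exact congrFun hsc 2
      · exact congrFun hsc 3)) (P := Pk) (by omega)) ?_
  rintro t₃ s₃ ⟨ht₃, reg₃, rep₃, o₃⟩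
  have hiso : cut c.nb x N x = ∅ := by simp [cut, hN]
  have rep₃' : Rep n { c' with nb := cut c.nb x N, T := N } (D.F n (cut c.nb x N) c'.B c'.H)
      s₃.tab := ⟨rep₃.sets, fun key hkey => by
        rw [rep₃.aux key hkey, hF _ (hc.gr.cut x N) hiso], rep₃.scal⟩
  have f₃ : Far n s s₃ := f₂.trans ⟨fun y _ _ => by rw [reg₃], fun i => o₃ _ (by
    rw [cl₂]; omega) i⟩
  have o₃' : ∀ l, s₃.tab (5, n + 3, l, 0) = e' l := fun l => by
    rw [o₃ _ (by rw [cl₂]; omega), o₂]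
  -- the edges of `x` are added again
  have stage4 : Tr W (forSet 10 13 2 (.seq (.assign 1 (.reg 11)) D.link)) s₃ Pk (fun t s' =>
      t ≤ N.card * (A₀ + 20) + 9 ∧ Base n s'.reg ∧ s'.reg 11 = x ∧ Far n s s' ∧
      Rep n { c' with nb := c.nb, T := N } (D.F n c.nb c'.B c'.H) s'.tab) := by
    refine Tr.imp (forSet_tr (N := N.card) e' (Inv := fun j t st => t ≤ j * (A₀ + 20) ∧
      Base n st.reg ∧ st.reg 11 = x ∧ Far n s st ∧ j ≤ N.card ∧
      Rep n { c' with nb := cut c.nb x (N \ (range j).image e'), T := N }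
        (D.F n (cut c.nb x (N \ (range j).image e')) c'.B c'.H) st.tab ∧
      ∀ l, st.tab (5, n + 3, l, 0) = e' l) (by nlinarith) ?_ ?_ (by omega) ?_ s₃ ?_) ?_
    · rintro j t st st' ⟨g1, g2, g3, g5, g6, g7, g8⟩ ht hreg
      refine ⟨g1, g2.congr fun y hy _ h2 _ => hreg y (by omega) (by omega),
        by rw [hreg 11 (by omega) (by omega), g3],
        ⟨fun y h1 h2 => by rw [hreg y (by omega) (by omega), g5.reg y h1 h2],
          fun i => by rw [ht, g5.elt]⟩, g6, by rw [ht]; exact g7, by rw [ht]; exact g8⟩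
    · rintro j t st ⟨g1, g2, g3, g5, g6, g7, g8⟩
      refine ⟨?_, ?_, ?_⟩
      · rw [g2.r10, g7.sets.size, Cfg.sets_T]
      · intro l _; rw [g2.r10, g8]
      · have := hsp _ _ (hokC' _) hk' g7; omega
    · rintro j hj t st ⟨g1, g2, g3, g5, g6, g7, g8⟩ hy
      have hspace := hsp _ _ (hokC' _) hk' g7
      refine Tr.seq (Q₁ := fun t s' => t = 2 ∧ s' = ⟨update st.reg 1 x, st.tab⟩) ?_ ?_
      · refine .of_exec (T := 2) (.assign st 1 (.reg 11)) (by simp [Expr.cost]) (by omega) ?_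
        exact ⟨by simp [Expr.cost], by simp [Expr.eval, g3]⟩
      · rintro _ _ ⟨rfl, rfl⟩
        have hins := insert_sdiff_insert' (fn2 j hj) (fn3 j hj)
        have hnm : e' j ∉ cut c.nb x (N \ (range j).image e') x := by
          rw [mem_cut]
          rintro ⟨-, h2, -⟩
          exact h2 ⟨rfl, Finset.mem_sdiff.2 ⟨fn2 j hj, fn3 j hj⟩⟩
        have hne : x ≠ e' j := fun h => hxN (h ▸ fn2 j hj)
        refine Tr.imp (Timed.tr (D.link_timed (hokC' _) (s := ⟨update st.reg 1 x, st.tab⟩)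
          (g2.congr fun y _ h1 _ _ => by simp [update_of_ne h1]) g7 (a := x) (b := e' j)
          (by simp) (by simpa [update_of_ne] using hy) hx
          (mem_range.1 (hNsub (fn2 j hj))) hne hnm) ?_) ?_
        · simp only [hk']; omega
        · rintro t' s' ⟨ht', i1, i2⟩
          have hreg : ∀ y, y ≠ 1 → y ≠ 4 → y < 22 → s'.reg y = st.reg y := fun y h1 h4 h22 => by
            rw [i2.reg y h22 h4]; simp [update_of_ne h1]
          simp only [hk'] at ht'
          simp only at i1
          rw [← hins, addE_cut hc.gr (by simp [hxN]) hne (fn2 j hj) (by simp),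
            ← image_range_succ] at i1
          refine ⟨hreg 13 (by omega) (by omega) (by omega), by nlinarith,
            g2.congr fun y hy h1 _ h4 => hreg y h1 h4 (by omega),
            by rw [hreg 11 (by omega) (by omega) (by omega), g3],
            g5.trans ⟨fun y h1 h2 => hreg y (by omega) (by omega) h2,
              fun i => i2.elt _ (by omega) i⟩, hj, i1, ?_⟩
          intro l; rw [i2.elt _ (by omega), ← g8 l]
    · refine ⟨by simp, by rw [reg₃]; exact b₂, by rw [reg₃]; exact x₂, f₃, by omega, ?_, o₃'⟩
      simp only [Finset.range_zero, Finset.image_empty, Finset.sdiff_empty]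
      exact rep₃'
    · rintro t s' ⟨t', rfl, g1, g2, g3, g5, g6, g7, g8⟩
      rw [fn1, Finset.sdiff_self, cut_empty] at g7
      exact ⟨by omega, g2, g3, g5, g7⟩
  refine Tr.seq stage4 ?_
  rintro t₄ s₄ ⟨ht₄, b₄, x₄, f₄, rep₄⟩
  have hok₄ : Cfg.Ok D.sq n M { c' with nb := c.nb, T := N } :=
    hc'.shrink hc.gr (by rw [hnb]; exact fun _ => subset_rfl) hNsub hNM
  have hspace₄ := hsp _ _ hok₄ hk' rep₄
  have hcT : ({ c' with nb := c.nb, T := ∅ } : Cfg) = c' := by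
    rw [← hnb, ← hT, ← hT']
  refine Tr.imp (Timed.tr (rep₄.clear (c' := c') 10 (by omega)
    (by rw [b₄.r10, sets_update_T]; simp only; rw [hcT]) rfl) (P := Pk) ?_) ?_
  · rw [b₄.r10, Cfg.sets_T]; simp only; omega
  · rintro t₅ s₅ ⟨ht₅, reg₅, rep₅, o₅⟩
    rw [b₄.r10, Cfg.sets_T] at ht₅
    simp only at ht₅
    rw [hnb]
    refine ⟨?_, rep₅, b₄.congr fun y hy _ _ _ => reg₅ y (by omega),
      f₄.trans ⟨fun y _ h2 => reg₅ y h2, fun i => o₅ _ (by rw [b₄.r10]; omega) i⟩,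
      by rw [reg₅ 11 (by omega), x₄]⟩
    nlinarith

/-- The accounting for one class `S` of vertices with degree threshold `θ` after the addition of
`I` edges: each promoted vertex has taken up `θ` edge ends. Only vertices in `X` may wait for their
promotion. -/
structure Half (n θ I : ℕ) (nb : ℕ → Finset ℕ) (S X : Finset ℕ) : Prop where
  sum : θ * S.card + ∑ z ∈ range n \ S, (nb z).card ≤ 2 * I
  deg : ∀ z, z ∉ S → z ∉ X → (nb z).card ≤ θ
  deg' : ∀ z, z ∉ S → (nb z).card ≤ θ + 1

theorem card_addE {nb : ℕ → Finset ℕ} (a b x : ℕ) :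
    (addE nb a b x).card ≤ (nb x).card + (if x = a then 1 else 0) + if x = b then 1 else 0 := by
  unfold addE
  split_ifs with h1 h2 h2
  · have := Finset.card_insert_le b (nb x); omega
  · have := Finset.card_insert_le b (nb x); omega
  · have := Finset.card_insert_le a (nb x); omega
  · omega

theorem sum_card_addE_le (nb : ℕ → Finset ℕ) (a b : ℕ) (S : Finset ℕ) :
    ∑ z ∈ S, (addE nb a b z).card ≤ ∑ z ∈ S, (nb z).card + 2 := by
  refine (sum_le_sum fun z _ => card_addE (nb := nb) a b z).trans ?_
  rw [sum_add_distrib, sum_add_distrib, Finset.sum_ite_eq', Finset.sum_ite_eq']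
  split_ifs <;> omega

theorem Half.addE {n θ I : ℕ} {nb : ℕ → Finset ℕ} {S : Finset ℕ} (h : Half n θ I nb S ∅)
    {a b : ℕ} (hab : a ≠ b) : Half n θ (I + 1) (addE nb a b) S {a, b} where
  sum := by
    have := sum_card_addE_le nb a b (range n \ S)
    have := h.sum
    omega
  deg z hz hX := by
    have h1 := card_addE (nb := nb) a b z
    have h2 := h.deg z hz (by simp)
    simp only [mem_insert, Finset.mem_singleton, not_or] at hX
    simp only [hX.1, hX.2, if_false] at h1
    omega
  deg' z hz := by
    have h1 := card_addE (nb := nb) a b z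
    have h2 := h.deg z hz (by simp)
    split_ifs at h1 with h3 h4
    all_goals omega

theorem Half.delE {n θ I : ℕ} {nb : ℕ → Finset ℕ} {S : Finset ℕ} (h : Half n θ I nb S ∅)
    {a b : ℕ} (hab : a ≠ b) : Half n θ I (delE nb a b) S ∅ where
  sum := le_trans (Nat.add_le_add_left (sum_le_sum fun z _ =>
    card_le_card (delE_subset nb hab z)) _) h.sum
  deg z hz hX := (card_le_card (delE_subset nb hab z)).trans (h.deg z hz hX)
  deg' z hz := (card_le_card (delE_subset nb hab z)).trans (h.deg' z hz)

theorem Half.promote {n θ I x : ℕ} {nb : ℕ → Finset ℕ} {S X : Finset ℕ} (h : Half n θ I nb S X)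
    (hx : x ∉ S) (hxn : x < n) (hd : θ < (nb x).card) : Half n θ I nb (insert x S) (X.erase x) where
  sum := by
    have h1 := h.sum
    have h2 : range n \ insert x S = (range n \ S).erase x := by
      ext z; simp only [Finset.mem_sdiff, mem_insert, mem_erase]; tauto
    have h3 := Finset.add_sum_erase (range n \ S) (fun z => (nb z).card) (a := x)
      (by simp [hx, hxn])
    rw [card_insert_of_notMem hx, h2, Nat.mul_succ]
    omega
  deg z hz hX := by
    simp only [mem_insert, not_or] at hz
    exact h.deg z hz.2 fun hzX => hX (Finset.mem_erase.2 ⟨hz.1, hzX⟩)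
  deg' z hz := h.deg' z fun hzS => hz (Finset.mem_insert_of_mem hzS)

theorem Half.settle {n θ I x : ℕ} {nb : ℕ → Finset ℕ} {S X : Finset ℕ} (h : Half n θ I nb S X)
    (hx : x ∉ S → (nb x).card ≤ θ) : Half n θ I nb S (X.erase x) where
  sum := h.sum
  deg z hz hX := by
    by_cases e : z = x
    · subst e; exact hx hz
    · exact h.deg z hz fun hzX => hX (Finset.mem_erase.2 ⟨e, hzX⟩)
  deg' := h.deg'

/-- The cost of a unit of the accounting for promotions. -/
def Scheme.rate (D : Scheme P) (τ : ℕ) : ℕ := 6 * (D.C * (τ + 1)) + 2100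

theorem Scheme.rate_spec (D : Scheme P) (τ : ℕ) {θ d : ℕ} (hθ : 1 ≤ θ) (hd : d ≤ θ + 1) :
    (d + 1) * (2 * (D.C * (τ + 1) + 200) + 300) ≤ D.rate τ * θ := by
  calc (d + 1) * (2 * (D.C * (τ + 1) + 200) + 300)
      ≤ (3 * θ) * (2 * (D.C * (τ + 1) + 200) + 300) := Nat.mul_le_mul_right _ (by omega)
    _ = D.rate τ * θ := by unfold Scheme.rate; ring

theorem Rep.space_small (D : Scheme P) {n M Pk : ℕ} {c : Cfg} {μ : Tables} (hc : c.Ok D.sq n M)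
    (hr : Rep n c (D.F n c.nb c.B c.H) μ) (hP : D.peak n M c.k ≤ Pk) : space μ + 1000 ≤ Pk :=
  le_trans (Nat.add_le_add_left (le_trans (by norm_num) (Nat.le_add_left 2000 _)) _)
    (hr.space_peak D hc hP)

/-- Within a phase: both classes are accounted for. -/
structure Phase (sq : Bool) (n M I : ℕ) (c : Cfg) (X Y : Finset ℕ) : Prop where
  ok : c.Ok sq n M
  T : c.T = ∅
  half_B : Half n c.k I c.nb c.B X
  half_H : Half n c.τ I c.nb c.H Y
  I_le : I ≤ 2 * (c.k * c.τ)

theorem Phase.cheap {sq : Bool} {n I : ℕ} {c : Cfg} {X Y : Finset ℕ} (hk : 1 ≤ c.k)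
    (hτ : c.τ = tau sq c.k) (hB : Half n c.k I c.nb c.B X) (hH : Half n c.τ I c.nb c.H Y)
    (hI : I ≤ 2 * (c.k * c.τ)) : Cheap sq c.nb c.B c.H c.k where
  big := hB.deg'
  huge := by rw [← hτ]; exact hH.deg'
  B_card := by
    have h := hB.sum
    rw [← hτ]
    by_contra! hlt
    have := Nat.mul_le_mul_left c.k (show 4 * c.τ + 1 ≤ c.B.card from hlt)
    rw [Nat.mul_add, show c.k * (4 * c.τ) = 4 * (c.k * c.τ) by ring] at this
    omega
  H_card := by
    have h := hH.sum
    have h1 : 1 ≤ c.τ := by rw [hτ]; exact hk.trans (le_tau sq c.k)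
    by_contra! hlt
    have := Nat.mul_le_mul_left c.τ (show 4 * c.k + 1 ≤ c.H.card from hlt)
    rw [Nat.mul_add, show c.τ * (4 * c.k) = 4 * (c.k * c.τ) by ring] at this
    omega

/-- The weight of the classes in the accounting for promotions. -/
def Cfg.weight (c : Cfg) : ℕ := c.k * c.B.card + c.τ * c.H.card

/-- Promotes the vertex in register `11` to the class whose index is in register `cr`, if its
degree exceeds the threshold in table `t`. -/
def Scheme.promoteTo (D : Scheme P) (t cr : ℕ) : Cmd :=
  .cond (.less (.look t (.const 0) (.const 0) (.const 0))
      (.look 4 (.reg 11) (.const 0) (.const 0)))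
    (.cond (.look 6 (.reg cr) (.reg 11) (.const 0)) .skip
      (.seq (.assign 12 (.reg cr)) D.reclass)) .skip

theorem Scheme.promoteTo_tr (D : Scheme P) {n M Pk cl cr t x : ℕ} {c c' : Cfg} (ht : t < 4)
    (hc : c.Ok D.sq n M)
    (hc' : x ∉ c.sets n cl → c.scal t < (c.nb x).card → c'.Ok D.sq n M)
    (hT : c.T = ∅) (hnb : c'.nb = c.nb) (hT' : c'.T = c.T)
    (hsc : c'.scal = c.scal) (hcl : cl = n ∨ cl = n + 1)
    (hxcl : x ∉ c.sets n cl → ∀ nb T, x ∉ Cfg.sets { c with nb := nb, T := T } n cl)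
    (hset : ∀ nb T, update (Cfg.sets { c with nb := nb, T := T } n) cl
      (insert x (Cfg.sets { c with nb := nb, T := T } n cl)) =
        Cfg.sets { c' with nb := nb, T := T } n)
    (hF : ∀ nb, Gr n nb → nb x = ∅ → ∀ key, D.F n nb c'.B c'.H key = D.F n nb c.B c.H key)
    (hP : D.peak n M c.k ≤ Pk) (hx : x < n) {s : State} (hb : Base n s.reg)
    (h11 : s.reg 11 = x) (hcr : s.reg cr = cl)
    (hr : Rep n c (D.F n c.nb c.B c.H) s.tab) :
    Tr (wordBound 16 n) (D.promoteTo t cr) s Pk (fun T s' => Base n s'.reg ∧ Far n s s' ∧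
      s'.reg 11 = x ∧
      ((T ≤ 20 ∧ (x ∉ c.sets n cl → (c.nb x).card ≤ c.scal t) ∧
          Rep n c (D.F n c.nb c.B c.H) s'.tab) ∨
        (x ∉ c.sets n cl ∧ c.scal t < (c.nb x).card ∧
          T ≤ 20 + ((c.nb x).card + 1) * (2 * (D.C * (tau D.sq c.k + 1) + 200) + 300) ∧
          Rep n c' (D.F n c'.nb c'.B c'.H) s'.tab))) := by
  have hsp := hr.space_small D hc hP
  have W0 : 0 % wordBound 16 n = 0 := Nat.zero_mod _
  have hd : s.tab (4, x, 0, 0) = (c.nb x).card := by rw [hr.sets.size, c.sets_nb hx]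
  have hl : s.tab (t, 0, 0, 0) = c.scal t := by rw [hr.scal t ht, if_pos rfl]
  refine Tr.cond (fun h1 => ?_) (fun h1 => ?_)
  · have h1' : c.scal t < (c.nb x).card := by
      simp only [Expr.eval, W0, h11, hd, hl] at h1
      by_contra h; simp [h] at h1
    refine Tr.cond (fun h2 => ?_) (fun h2 => ?_)
    · simp only [Expr.eval, W0, hcr, h11] at h2
      refine .of_exec (T := 1) (.skip s) le_rfl (by omega) ⟨hb, Far.rfl', h11, Or.inl ⟨?_, ?_, hr⟩⟩
      · simp [Expr.cost]
      · intro h; exact absurd ((hr.sets.pos_ne_zero _ _).1 h2) h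
    · simp only [Expr.eval, W0, hcr, h11] at h2
      have h2' : x ∉ c.sets n cl := fun h => (hr.sets.pos_ne_zero _ _).2 h h2
      refine Tr.seq (Q₁ := fun t s' => t = 2 ∧ s' = ⟨update s.reg 12 cl, s.tab⟩) ?_ ?_
      · refine .of_exec (T := 2) (.assign s 12 (.reg cr)) (by simp [Expr.cost]) (by omega) ?_
        exact ⟨by simp [Expr.cost], by simp [Expr.eval, hcr]⟩
      · rintro _ _ ⟨rfl, rfl⟩
        refine Tr.imp (D.reclass_tr (s := ⟨update s.reg 12 cl, s.tab⟩) hc (hc' h2' h1') hT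
          hnb hT' hsc hcl (hxcl h2') hset hF hP hx
          (hb.congr fun y hy _ _ _ => by simp [update_of_ne (show y ≠ 12 by omega)])
          (by simp [h11]) (by simp) hr) ?_
        rintro t' s' ⟨ht', i1, i2, i3, i4⟩
        refine ⟨i2, ⟨fun y h1 h2 => ?_, fun i => i3.elt i⟩, i4, Or.inr ⟨h2', h1', ?_, i1⟩⟩
        · rw [i3.reg y h1 h2]; simp [update_of_ne (show y ≠ 12 by omega)]
        · simp only [Expr.cost]; omega
  · have h1' : (c.nb x).card ≤ c.scal t := by
      simp only [Expr.eval, W0, h11, hd, hl] at h1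
      by_contra h; rw [if_pos (by omega)] at h1; omega
    refine .of_exec (T := 1) (.skip s) le_rfl (by omega) ⟨hb, Far.rfl', h11, Or.inl ⟨?_, fun _ => h1', hr⟩⟩
    simp [Expr.cost]

theorem Scheme.promoteB_tr (D : Scheme P) {n M I Pk x : ℕ} {c : Cfg} {X Y : Finset ℕ}
    (hph : Phase D.sq n M I c X Y) (hk : 1 ≤ c.k)
    (hP : D.peak n M c.k ≤ Pk) (hx : x < n) {s : State} (hb : Base n s.reg)
    (h11 : s.reg 11 = x) (hr : Rep n c (D.F n c.nb c.B c.H) s.tab) :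
    Tr (wordBound 16 n) (D.promoteTo 0 0) s Pk (fun T s' => Base n s'.reg ∧ Far n s s' ∧
      s'.reg 11 = x ∧ ∃ B : Finset ℕ, Phase D.sq n M I { c with B := B } (X.erase x) Y ∧
      Rep n { c with B := B } (D.F n c.nb B c.H) s'.tab ∧
      T + D.rate c.τ * (c.k * c.B.card) ≤ 20 + D.rate c.τ * (c.k * B.card)) := by
  have hins : x ∉ c.B → c.k < (c.nb x).card →
      Phase D.sq n M I { c with B := insert x c.B } (X.erase x) Y := fun h1 h2 =>
    { ok := { hph.ok with
        B_sub := Finset.insert_subset (mem_range.2 hx) hph.ok.B_sub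
        cheap := Phase.cheap (c := { c with B := insert x c.B }) hk hph.ok.tau_eq
          (hph.half_B.promote h1 hx h2) hph.half_H hph.I_le }
      T := hph.T
      half_B := hph.half_B.promote h1 hx h2
      half_H := hph.half_H
      I_le := hph.I_le }
  refine Tr.imp (D.promoteTo_tr (cl := n) (c' := { c with B := insert x c.B }) (t := 0)
    (by omega) hph.ok ?_ hph.T rfl rfl rfl (Or.inl rfl) ?_ ?_ ?_ hP hx hb h11 hb.r0 hr) ?_
  · rw [Cfg.sets_B]
    exact fun h1 h2 => (hins h1 h2).ok
  · rw [Cfg.sets_B]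
    intro h nb T
    rw [Cfg.sets_B]; exact h
  · intro nb T
    rw [Cfg.sets_B, sets_update_B]
  · exact fun nb h1 h2 key => D.F_insert_B n nb c.B c.H x key h1 h2
  · rintro T s' ⟨b', f', h11', (⟨hT, hd, hr'⟩ | ⟨hxB, hd, hT, hr'⟩)⟩
    · rw [Cfg.sets_B] at hd
      exact ⟨b', f', h11', c.B, ⟨hph.ok, hph.T, hph.half_B.settle hd, hph.half_H, hph.I_le⟩, hr',
        by omega⟩
    · rw [Cfg.sets_B] at hxB
      refine ⟨b', f', h11', insert x c.B, hins hxB hd, hr', ?_⟩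
      have := D.rate_spec (tau D.sq c.k) hk (hph.half_B.deg' x hxB)
      rw [card_insert_of_notMem hxB, Nat.mul_succ, Nat.mul_add, hph.ok.tau_eq]
      omega

theorem Scheme.promoteH_tr (D : Scheme P) {n M I Pk x : ℕ} {c : Cfg} {X Y : Finset ℕ}
    (hph : Phase D.sq n M I c X Y) (hk : 1 ≤ c.k)
    (hP : D.peak n M c.k ≤ Pk) (hx : x < n) {s : State} (hb : Base n s.reg)
    (h11 : s.reg 11 = x) (hr : Rep n c (D.F n c.nb c.B c.H) s.tab) :
    Tr (wordBound 16 n) (D.promoteTo 1 5) s Pk (fun T s' => Base n s'.reg ∧ Far n s s' ∧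
      s'.reg 11 = x ∧ ∃ H : Finset ℕ, Phase D.sq n M I { c with H := H } X (Y.erase x) ∧
      Rep n { c with H := H } (D.F n c.nb c.B H) s'.tab ∧
      T + D.rate c.τ * (c.τ * c.H.card) ≤ 20 + D.rate c.τ * (c.τ * H.card)) := by
  have hτ : 1 ≤ c.τ := by rw [hph.ok.tau_eq]; exact hk.trans (le_tau _ _)
  have hins : x ∉ c.H → c.τ < (c.nb x).card →
      Phase D.sq n M I { c with H := insert x c.H } X (Y.erase x) := fun h1 h2 =>
    { ok := { hph.ok with
        H_sub := Finset.insert_subset (mem_range.2 hx) hph.ok.H_sub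
        cheap := Phase.cheap (c := { c with H := insert x c.H }) hk hph.ok.tau_eq
          hph.half_B (hph.half_H.promote h1 hx h2) hph.I_le }
      T := hph.T
      half_B := hph.half_B
      half_H := hph.half_H.promote h1 hx h2
      I_le := hph.I_le }
  refine Tr.imp (D.promoteTo_tr (cl := n + 1) (c' := { c with H := insert x c.H }) (t := 1)
    (by omega) hph.ok ?_ hph.T rfl rfl rfl (Or.inr rfl) ?_ ?_ ?_ hP hx hb h11 hb.r5 hr) ?_
  · rw [Cfg.sets_H]
    exact fun h1 h2 => (hins h1 h2).ok
  · rw [Cfg.sets_H]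
    intro h nb T
    rw [Cfg.sets_H]; exact h
  · intro nb T
    rw [Cfg.sets_H, sets_update_H]
  · exact fun nb h1 h2 key => D.F_insert_H n nb c.B c.H x key h1 h2
  · rintro T s' ⟨b', f', h11', (⟨hT, hd, hr'⟩ | ⟨hxH, hd, hT, hr'⟩)⟩
    · rw [Cfg.sets_H] at hd
      exact ⟨b', f', h11', c.H, ⟨hph.ok, hph.T, hph.half_B, hph.half_H.settle hd, hph.I_le⟩, hr',
        by omega⟩
    · rw [Cfg.sets_H] at hxH
      refine ⟨b', f', h11', insert x c.H, hins hxH hd, hr', ?_⟩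
      have := D.rate_spec (tau D.sq c.k) hτ (hph.half_H.deg' x hxH)
      rw [card_insert_of_notMem hxH, Nat.mul_succ c.τ, Nat.mul_add]
      rw [← hph.ok.tau_eq] at this hT
      omega

/-- The configurations that differ at most in the classes. -/
structure Cfg.Same (c c' : Cfg) : Prop where
  nb : c'.nb = c.nb
  E : c'.E = c.E
  k : c'.k = c.k
  τ : c'.τ = c.τ
  r : c'.r = c.r
  c : c'.c = c.c

/-- Promotes the vertex in register `11` to the classes for which its degree exceeds the
threshold. -/
def Scheme.promote (D : Scheme P) : Cmd := .seq (D.promoteTo 0 0) (D.promoteTo 1 5)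

theorem Scheme.promote_tr (D : Scheme P) {n M I Pk x : ℕ} {c : Cfg} {X : Finset ℕ}
    (hph : Phase D.sq n M I c X X) (hk : 1 ≤ c.k)
    (hP : D.peak n M c.k ≤ Pk) (hx : x < n) {s : State} (hb : Base n s.reg)
    (h11 : s.reg 11 = x) (hr : Rep n c (D.F n c.nb c.B c.H) s.tab) :
    Tr (wordBound 16 n) D.promote s Pk (fun T s' => Base n s'.reg ∧ Far n s s' ∧
      ∃ c' : Cfg, c.Same c' ∧ Phase D.sq n M I c' (X.erase x) (X.erase x) ∧
      Rep n c' (D.F n c'.nb c'.B c'.H) s'.tab ∧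
      T + D.rate c.τ * c.weight ≤ 40 + D.rate c.τ * c'.weight) := by
  refine Tr.seq (D.promoteB_tr hph hk hP hx hb h11 hr) ?_
  rintro t₁ s₁ ⟨b₁, f₁, h11', B, ph₁, r₁, ht₁⟩
  refine Tr.imp (D.promoteH_tr ph₁ hk hP hx b₁ h11' r₁) ?_
  rintro t₂ s₂ ⟨b₂, f₂, -, H, ph₂, r₂, ht₂⟩
  refine ⟨b₂, f₁.trans f₂, { c with B := B, H := H }, ⟨rfl, rfl, rfl, rfl, rfl, rfl⟩, ph₂,
    r₂, ?_⟩
  simp only at ht₂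
  simp only [Cfg.weight, Nat.mul_add]
  omega

/-- Adds the edge between the contents of the registers `16` and `17`, and promotes its ends if
necessary. -/
def Scheme.add (D : Scheme P) : Cmd :=
  .seq (.seq (.assign 1 (.reg 16)) (.assign 2 (.reg 17)))
  (.seq D.link
  (.seq (.assign 11 (.reg 16))
  (.seq D.promote
  (.seq (.assign 11 (.reg 17)) D.promote))))

theorem Base.update {n : ℕ} {ρ : ℕ → ℕ} (h : Base n ρ) {x : ℕ} (hx : 11 ≤ x) (v : ℕ) :
    Base n (update ρ x v) :=
  h.congr fun y hy _ _ _ => update_of_ne (show y ≠ x by omega) _ _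

theorem Scheme.add_tr (D : Scheme P) {n M I Pk a b : ℕ} {c : Cfg}
    (hph : Phase D.sq n M I c ∅ ∅) (hk : 1 ≤ c.k) (hI : I + 1 ≤ 2 * (c.k * c.τ))
    (hsum : ∑ z ∈ range n, (addE c.nb a b z).card ≤ 2 * M)
    (hP : D.peak n M c.k ≤ Pk) (ha : a < n) (hb' : b < n) (hab : a ≠ b) (hnb : b ∉ c.nb a)
    {s : State} (hb : Base n s.reg) (h16 : s.reg 16 = a) (h17 : s.reg 17 = b)
    (hr : Rep n c (D.F n c.nb c.B c.H) s.tab) :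
    Tr (wordBound 16 n) D.add s Pk (fun T s' => Base n s'.reg ∧ Far n s s' ∧
      ∃ c' : Cfg, ({ c with nb := addE c.nb a b } : Cfg).Same c' ∧ Phase D.sq n M (I + 1) c' ∅ ∅ ∧
      Rep n c' (D.F n c'.nb c'.B c'.H) s'.tab ∧
      T + D.rate c.τ * c.weight ≤ D.C * (c.τ + 1) + 200 + D.rate c.τ * c'.weight) := by
  have hsp := hr.space_small D hph.ok hP
  have hsp' := hr.space_peak D hph.ok hP
  refine Tr.seq (Q₁ := fun t s' => t = 4 ∧
    s' = ⟨update (update s.reg 1 a) 2 b, s.tab⟩) ?_ ?_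
  · refine .of_exec (T := 4) (.seq (.assign s 1 (.reg 16)) (.assign _ 2 (.reg 17)))
      (by simp [Expr.cost]) (by omega) ?_
    exact ⟨by simp [Expr.cost], by simp [Expr.eval, h16, h17]⟩
  rintro _ _ ⟨rfl, rfl⟩
  refine Tr.seq (Timed.tr (D.link_timed hph.ok
    (s := ⟨update (update s.reg 1 a) 2 b, s.tab⟩)
    (hb.congr fun y _ h1 h2 _ => by simp [update_of_ne h1, update_of_ne h2]) hr
    (a := a) (b := b) (by simp) (by simp) ha hb' hab hnb) (P := Pk) ?_) ?_
  · refine le_trans (Nat.add_le_add_left ?_ _) hsp'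
    generalize D.C * (tau D.sq c.k + 1) = A
    generalize tau D.sq c.k = B
    linarith [Nat.zero_le A, Nat.zero_le B, Nat.zero_le M]
  rintro t₂ s₂ ⟨ht₂, r₂, k₂⟩
  have hreg₂ : ∀ y, y ≠ 1 → y ≠ 2 → y ≠ 4 → y < 22 → s₂.reg y = s.reg y := fun y h1 h2 h4 h => by
    rw [k₂.reg y h h4]; simp [update_of_ne h1, update_of_ne h2]
  have b₂ : Base n s₂.reg := hb.congr fun y hy h1 h2 h4 => hreg₂ y h1 h2 h4 (by omega)
  have f₂ : Far n s s₂ := ⟨fun y h1 h2 => hreg₂ y (by omega) (by omega) (by omega) h2,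
    fun i => k₂.elt _ (by omega) i⟩
  have ph₂ : Phase D.sq n M (I + 1) { c with nb := addE c.nb a b } {a, b} {a, b} :=
    { ok := { hph.ok with
        gr := hph.ok.gr.addE hab ha hb'
        sum_le := hsum
        cheap := Phase.cheap (c := { c with nb := addE c.nb a b }) hk hph.ok.tau_eq
          (hph.half_B.addE hab) (hph.half_H.addE hab) hI }
      T := hph.T
      half_B := hph.half_B.addE hab
      half_H := hph.half_H.addE hab
      I_le := hI }
  have hsp₂ := r₂.space_small D ph₂.ok hP
  refine Tr.seq (Q₁ := fun t s' => t = 2 ∧ s' = ⟨update s₂.reg 11 a, s₂.tab⟩) ?_ ?_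
  · refine .of_exec (T := 2) (.assign s₂ 11 (.reg 16)) (by simp [Expr.cost]) (by omega) ?_
    exact ⟨by simp [Expr.cost], by simp [Expr.eval, hreg₂ 16, h16]⟩
  rintro _ _ ⟨rfl, rfl⟩
  refine Tr.seq (D.promote_tr (s := ⟨update s₂.reg 11 a, s₂.tab⟩) ph₂ hk hP ha
    (b₂.update le_rfl a) (by simp) r₂) ?_
  rintro t₃ s₃ ⟨b₃, f₃, c₃, sm₃, ph₃, r₃, ht₃⟩
  have hP₃ : D.peak n M c₃.k ≤ Pk := by rw [sm₃.k]; exact hP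
  have hsp₃ := r₃.space_small D ph₃.ok hP₃
  have f₃' : Far n s s₃ := f₂.trans ⟨fun y h1 h2 => by
    rw [f₃.reg y h1 h2]; simp [update_of_ne (show y ≠ 11 by omega)], f₃.elt⟩
  refine Tr.seq (Q₁ := fun t s' => t = 2 ∧ s' = ⟨update s₃.reg 11 b, s₃.tab⟩) ?_ ?_
  · refine .of_exec (T := 2) (.assign s₃ 11 (.reg 17)) (by simp [Expr.cost]) (by omega) ?_
    exact ⟨by simp [Expr.cost], by simp [Expr.eval, f₃'.reg 17, h17]⟩
  rintro _ _ ⟨rfl, rfl⟩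
  refine Tr.imp (D.promote_tr (s := ⟨update s₃.reg 11 b, s₃.tab⟩) ph₃
    (by rw [sm₃.k]; exact hk) hP₃ hb' (b₃.update le_rfl b) (by simp) r₃) ?_
  rintro t₄ s₄ ⟨b₄, f₄, c₄, sm₄, ph₄, r₄, ht₄⟩
  have hX : (({a, b} : Finset ℕ).erase a).erase b = ∅ := by
    ext z; simp only [mem_erase, mem_insert, Finset.mem_singleton,
      Finset.notMem_empty, iff_false]; tauto
  rw [hX] at ph₄
  refine ⟨b₄, f₃'.trans ⟨fun y h1 h2 => by
    rw [f₄.reg y h1 h2]; simp [update_of_ne (show y ≠ 11 by omega)], f₄.elt⟩, c₄,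
    ⟨sm₄.nb.trans sm₃.nb, sm₄.E.trans sm₃.E, sm₄.k.trans sm₃.k, sm₄.τ.trans sm₃.τ,
      sm₄.r.trans sm₃.r, sm₄.c.trans sm₃.c⟩, ph₄, r₄, ?_⟩
  have hτ₃ : c₃.τ = c.τ := sm₃.τ
  have hw : Cfg.weight { c with nb := addE c.nb a b } = c.weight := rfl
  rw [hτ₃] at ht₄
  rw [hw] at ht₃
  rw [← hph.ok.tau_eq] at ht₂
  simp only at ht₃
  omega

/-! ### Rebuilding -/

/-- The word that stands for the edge `xy`. -/
def code (n x y : ℕ) : ℕ := if x < y then x * n + y else y * n + x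

/-- The graph whose edges are given by the words in `E`. -/
def gOf (n : ℕ) (E : Finset ℕ) (x : ℕ) : Finset ℕ :=
  (range n).filter fun y => x < n ∧ x ≠ y ∧ code n x y ∈ E

/-- All words in `E` stand for edges. -/
def Codes (n : ℕ) (E : Finset ℕ) : Prop := ∀ e ∈ E, e / n < e % n ∧ e % n < n

theorem code_comm (n : ℕ) {x y : ℕ} (h : x ≠ y) : code n x y = code n y x := by
  unfold code; split_ifs <;> first | rfl | omega

theorem mem_gOf {n : ℕ} {E : Finset ℕ} {x y : ℕ} :
    y ∈ gOf n E x ↔ x < n ∧ y < n ∧ x ≠ y ∧ code n x y ∈ E := by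
  simp [gOf]; tauto

theorem code_div_mod {n x y : ℕ} (hx : x < n) (hy : y < n) :
    code n x y / n = min x y ∧ code n x y % n = max x y := by
  have hn : 0 < n := by omega
  unfold code
  split_ifs with h
  · rw [min_eq_left h.le, max_eq_right h.le, mul_comm, Nat.mul_add_div hn, Nat.mul_add_mod,
      Nat.div_eq_of_lt hy, mod_eq_of_lt hy]
    exact ⟨rfl, rfl⟩
  · rw [min_eq_right (by omega), max_eq_left (by omega), mul_comm, Nat.mul_add_div hn,
      Nat.mul_add_mod, Nat.div_eq_of_lt hx, mod_eq_of_lt hx]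
    exact ⟨rfl, rfl⟩

theorem code_inj {n x y a b : ℕ} (hx : x < n) (hy : y < n) (ha : a < n) (hb : b < n)
    (h : code n x y = code n a b) : (x = a ∧ y = b) ∨ (x = b ∧ y = a) := by
  have h1 := code_div_mod hx hy
  have h2 := code_div_mod ha hb
  rw [h] at h1
  have h3 := h1.1.symm.trans h2.1
  have h4 := h1.2.symm.trans h2.2
  omega

theorem code_lt {n x y : ℕ} (hx : x < n) (hy : y < n) : code n x y < n * n := by
  unfold code
  split_ifs
  · have : (x + 1) * n ≤ n * n := Nat.mul_le_mul_right _ hx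
    rw [Nat.succ_mul] at this; omega
  · have : (y + 1) * n ≤ n * n := Nat.mul_le_mul_right _ hy
    rw [Nat.succ_mul] at this; omega

theorem Codes.insert {n : ℕ} {E : Finset ℕ} (h : Codes n E) {x y : ℕ} (hx : x < n) (hy : y < n)
    (hxy : x ≠ y) : Codes n (insert (code n x y) E) := by
  intro e he
  rcases Finset.mem_insert.1 he with rfl | he
  · obtain ⟨h1, h2⟩ := code_div_mod hx hy
    rw [h1, h2]; omega
  · exact h e he

theorem Codes.mono {n : ℕ} {E E' : Finset ℕ} (h : Codes n E) (hE : E' ⊆ E) : Codes n E' :=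
  fun e he => h e (hE he)

theorem Codes.eq {n : ℕ} {E : Finset ℕ} (h : Codes n E) {e : ℕ} (he : e ∈ E) :
    code n (e / n) (e % n) = e := by
  unfold code
  rw [if_pos (h e he).1, mul_comm]
  exact Nat.div_add_mod e n

theorem gr_gOf (n : ℕ) (E : Finset ℕ) : Gr n (gOf n E) where
  symm x y h := by
    rw [mem_gOf] at h ⊢
    exact ⟨h.2.1, h.1, h.2.2.1.symm, by rw [← code_comm n h.2.2.1]; exact h.2.2.2⟩
  irrefl x h := (mem_gOf.1 h).2.2.1 rfl
  lt x y h := (mem_gOf.1 h).1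

theorem gOf_empty (n : ℕ) : gOf n ∅ = fun _ => ∅ := by
  funext x; simp [gOf]

theorem gOf_mono {n : ℕ} {E E' : Finset ℕ} (h : E ⊆ E') (x : ℕ) : gOf n E x ⊆ gOf n E' x := by
  intro y hy
  rw [mem_gOf] at hy ⊢
  exact ⟨hy.1, hy.2.1, hy.2.2.1, h hy.2.2.2⟩

theorem addE_gOf {n : ℕ} (E : Finset ℕ) {a b : ℕ} (ha : a < n) (hb : b < n) (hab : a ≠ b) :
    addE (gOf n E) a b = gOf n (insert (code n a b) E) := by
  funext x; ext y
  rw [mem_addE hab, mem_gOf, mem_gOf, mem_insert]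
  constructor
  · rintro (h | ⟨rfl, rfl⟩ | ⟨rfl, rfl⟩)
    · exact ⟨h.1, h.2.1, h.2.2.1, Or.inr h.2.2.2⟩
    · exact ⟨ha, hb, hab, Or.inl rfl⟩
    · exact ⟨hb, ha, hab.symm, Or.inl (code_comm n hab.symm)⟩
  · rintro ⟨h1, h2, h3, h4 | h4⟩
    · exact Or.inr (code_inj h1 h2 ha hb h4)
    · exact Or.inl ⟨h1, h2, h3, h4⟩

theorem delE_gOf {n : ℕ} (E : Finset ℕ) {a b : ℕ} (ha : a < n) (hb : b < n) (hab : a ≠ b) :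
    delE (gOf n E) a b = gOf n (E.erase (code n a b)) := by
  funext x; ext y
  rw [mem_delE hab, mem_gOf, mem_gOf, mem_erase]
  constructor
  · rintro ⟨⟨h1, h2, h3, h4⟩, h5, h6⟩
    refine ⟨h1, h2, h3, fun h => ?_, h4⟩
    rcases code_inj h1 h2 ha hb h with h | h
    · exact h5 h
    · exact h6 h
  · rintro ⟨h1, h2, h3, h4, h5⟩
    refine ⟨⟨h1, h2, h3, h5⟩, ?_, ?_⟩
    · rintro ⟨rfl, rfl⟩; exact h4 rfl
    · rintro ⟨rfl, rfl⟩; exact h4 (code_comm n hab.symm)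

theorem sum_card_gOf_le {n : ℕ} {E : Finset ℕ} (h : Codes n E) :
    ∑ x ∈ range n, (gOf n E x).card ≤ 2 * E.card := by
  induction E using Finset.induction_on with
  | empty => simp [gOf_empty]
  | insert e E he ih =>
    have h' : Codes n E := h.mono (Finset.subset_insert _ _)
    obtain ⟨h1, h2⟩ := h e (Finset.mem_insert_self _ _)
    have h3 := h.eq (Finset.mem_insert_self _ _)
    rw [card_insert_of_notMem he]
    have h4 := addE_gOf E (a := e / n) (b := e % n) (by omega) h2 (by omega)
    rw [h3] at h4
    rw [← h4]
    have := sum_card_addE_le (gOf n E) (e / n) (e % n) (range n)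
    have := ih h'
    omega

/-- Splits the word in register `15` into the ends of the edge. -/
def decode : Cmd :=
  .seq (.assign 16 (.quot (.reg 15) (.reg 0)))
    (.assign 17 (.minus (.reg 15) (.times (.reg 16) (.reg 0))))

theorem decode_tr {n e Pk : ℕ} {s : State} (h0 : s.reg 0 = n) (h15 : s.reg 15 = e)
    (he : e < n * n) (hP : space s.tab + 10 ≤ Pk) : Tr (wordBound 16 n) decode s Pk (fun t s' =>
      t = 10 ∧ s' = ⟨update (update s.reg 16 (e / n)) 17 (e % n), s.tab⟩) := by
  have hW := modulus_sq_le n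
  have hm := modulus_ge n
  refine .of_exec (T := 10) (.seq (.assign s 16 _) (.assign _ 17 _)) (by simp [Expr.cost]) hP ?_
  refine ⟨by simp [Expr.cost], ?_⟩
  have h1 : e / n * n ≤ e := Nat.div_mul_le_self e n
  have h2 : e / n * n % wordBound 16 n = e / n * n := mod_eq_of_lt (by nlinarith)
  have h3 : e - e / n * n = e % n := by
    have := Nat.div_add_mod e n
    rw [mul_comm] at this; omega
  simp [Expr.eval, h0, h15, h2, h3]

/-- Removes all edges from the graph, but keeps the set of their codes. -/
def Scheme.teardown (D : Scheme P) : Cmd :=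
  forSet 9 14 15 (.seq decode (.seq (.seq (.assign 1 (.reg 16)) (.assign 2 (.reg 17))) D.unlink))

/-- The registers with the arguments of the operation are unchanged. -/
def Args (s s' : State) : Prop := s'.reg 18 = s.reg 18 ∧ s'.reg 19 = s.reg 19

theorem Args.trans {s s' s'' : State} (h : Args s s') (h' : Args s' s'') : Args s s'' :=
  ⟨h'.1.trans h.1, h'.2.trans h.2⟩

theorem Scheme.space_link (D : Scheme P) {n M Pk : ℕ} {c : Cfg} {μ : Tables} (hc : c.Ok D.sq n M)
    (hr : Rep n c (D.F n c.nb c.B c.H) μ) (hP : D.peak n M c.k ≤ Pk) :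
    space μ + (D.C * (tau D.sq c.k + 1) + 200) ≤ Pk := by
  refine le_trans (Nat.add_le_add_left ?_ _) (hr.space_peak D hc hP)
  generalize D.C * (tau D.sq c.k + 1) = A
  generalize tau D.sq c.k = B
  linarith [Nat.zero_le A, Nat.zero_le B, Nat.zero_le M]

theorem Scheme.space_clear (D : Scheme P) {n M Pk : ℕ} {c : Cfg} {μ : Tables} (hc : c.Ok D.sq n M)
    (hr : Rep n c (D.F n c.nb c.B c.H) μ) (hP : D.peak n M c.k ≤ Pk) :
    space μ + (800 * tau D.sq c.k + 200) ≤ Pk := by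
  refine le_trans (Nat.add_le_add_left ?_ _) (hr.space_peak D hc hP)
  generalize D.C * (tau D.sq c.k + 1) = A
  generalize tau D.sq c.k = B
  linarith [Nat.zero_le A, Nat.zero_le B, Nat.zero_le M]

theorem lt_wordBound {n x : ℕ} (h : x ≤ n * n + n + 4) : x + 1 < wordBound 16 n := by
  have := modulus_sq_le n
  have := modulus_ge n
  nlinarith

set_option maxHeartbeats 1000000 in
theorem Scheme.teardown_tr (D : Scheme P) {n M Pk : ℕ} {c : Cfg} (hc : c.Ok D.sq n M)
    (hE : Codes n c.E) (hnb : c.nb = gOf n c.E) (hP : D.peak n M c.k ≤ Pk)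
    {s : State} (hb : Base n s.reg) (hr : Rep n c (D.F n c.nb c.B c.H) s.tab) :
    Tr (wordBound 16 n) D.teardown s Pk (fun t s' =>
      t ≤ c.E.card * (D.C * (tau D.sq c.k + 1) + 250) + 9 ∧ Base n s'.reg ∧ Args s s' ∧
      Rep n { c with nb := fun _ => ∅ } (D.F n (fun _ => ∅) c.B c.H) s'.tab) := by
  set e : ℕ → ℕ := fun i => s.tab (5, n + 2, i, 0) with he
  obtain ⟨en1, en2, en3, en4⟩ := hr.sets.enum (n + 2) (e := e) (fun _ => rfl)
  rw [Cfg.sets_E] at en1 en2 en3 en4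
  have hEn : c.E.card ≤ n * n := by simpa using card_le_card hc.E_sub
  have hok : ∀ S : Finset ℕ, S ⊆ c.E → Cfg.Ok D.sq n M { c with nb := gOf n S, T := c.T } :=
    fun S hS => hc.shrink (gr_gOf n S) (by rw [hnb]; exact gOf_mono hS) hc.T_sub hc.T_card
  refine Tr.imp (forSet_tr (N := c.E.card) e (Inv := fun j t st =>
    t ≤ j * (D.C * (tau D.sq c.k + 1) + 250) ∧ Base n st.reg ∧ Args s st ∧ j ≤ c.E.card ∧
    Rep n { c with nb := gOf n (c.E \ (range j).image e), T := c.T }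
      (D.F n (gOf n (c.E \ (range j).image e)) c.B c.H) st.tab ∧
    ∀ l, st.tab (5, n + 2, l, 0) = e l) (lt_wordBound (by omega)) ?_ ?_ (by omega) ?_ s ?_) ?_
  · rintro j t st st' ⟨g1, g2, g3, g4, g5, g6⟩ ht hreg
    refine ⟨g1, g2.congr fun y hy _ h2 _ => hreg y (by omega) (by omega),
      ⟨by rw [hreg 18 (by omega) (by omega), g3.1], by rw [hreg 19 (by omega) (by omega), g3.2]⟩,
      g4, by rw [ht]; exact g5, by rw [ht]; exact g6⟩
  · rintro j t st ⟨g1, g2, g3, g4, g5, g6⟩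
    refine ⟨by rw [g2.r9, g5.sets.size, Cfg.sets_E], fun l _ => by rw [g2.r9, g6], ?_⟩
    have := g5.space_small D (hok _ Finset.sdiff_subset) hP; omega
  · rintro j hj t st ⟨g1, g2, g3, g4, g5, g6⟩ hy
    have hsp := g5.space_small D (hok _ Finset.sdiff_subset) hP
    have hej := en2 j hj
    obtain ⟨v1, v2⟩ := hE _ hej
    refine Tr.seq (decode_tr g2.r0 hy (mem_range.1 (hc.E_sub hej)) (by omega)) ?_
    rintro _ _ ⟨rfl, rfl⟩
    refine Tr.seq (Q₁ := fun t s' => t = 4 ∧ s' = ⟨update (update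
      (update (update st.reg 16 (e j / n)) 17 (e j % n)) 1 (e j / n)) 2
      (e j % n), st.tab⟩) ?_ ?_
    · refine .of_exec (T := 4) (.seq (.assign _ 1 (.reg 16)) (.assign _ 2 (.reg 17)))
        (by simp [Expr.cost]) (by simp only; omega) ?_
      exact ⟨by simp [Expr.cost], by simp [Expr.eval]⟩
    rintro _ _ ⟨rfl, rfl⟩
    set st₁ : State := ⟨update (update
      (update (update st.reg 16 (e j / n)) 17 (e j % n)) 1 (e j / n)) 2
      (e j % n), st.tab⟩ with hst₁
    have hreg₁ : ∀ y, y ≠ 1 → y ≠ 2 → y ≠ 16 → y ≠ 17 → st₁.reg y = st.reg y :=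
      fun y h1 h2 h3 h4 => by simp [hst₁, h1, h2, h3, h4]
    have hmem : e j ∈ c.E \ (range j).image e := Finset.mem_sdiff.2 ⟨hej, en3 j hj⟩
    have hcode := hE.eq hej
    refine Tr.imp (Timed.tr (D.unlink_timed (hok _ Finset.sdiff_subset) (s := st₁)
      (g2.congr fun y _ h1 h2 _ => hreg₁ y h1 h2 (by omega) (by omega)) g5 (a := e j / n)
      (b := e j % n) (by simp [hst₁]) (by simp [hst₁]) (by omega) v2 (by omega)
      (mem_gOf.2 ⟨by omega, v2, by omega, by rw [hcode]; exact hmem⟩))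
      (D.space_link (hok _ Finset.sdiff_subset) g5 hP)) ?_
    rintro t' s' ⟨ht', i1, i2⟩
    have hreg : ∀ y, y ≠ 1 → y ≠ 2 → y ≠ 4 → y ≠ 16 → y ≠ 17 → y < 22 → s'.reg y = st.reg y :=
      fun y h1 h2 h3 h4 h5 h6 => by rw [i2.reg y h6 h3, hreg₁ y h1 h2 h4 h5]
    simp only at i1 ht'
    rw [delE_gOf _ (by omega) v2 (by omega), hcode, ← Finset.sdiff_insert, ← image_range_succ] at i1
    refine ⟨hreg 14 (by omega) (by omega) (by omega) (by omega) (by omega) (by omega), ?_,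
      g2.congr fun y hy h1 h2 h4 => hreg y h1 h2 h4 (by omega) (by omega) (by omega),
      ⟨by rw [hreg 18 (by omega) (by omega) (by omega) (by omega) (by omega) (by omega), g3.1],
        by rw [hreg 19 (by omega) (by omega) (by omega) (by omega) (by omega) (by omega), g3.2]⟩,
      hj, i1, ?_⟩
    · rw [Nat.succ_mul]; omega
    · intro l; rw [i2.elt _ (by omega), ← g6 l]
  · refine ⟨by simp, hb, ⟨rfl, rfl⟩, by omega, ?_, fun _ => rfl⟩
    simp only [Finset.range_zero, Finset.image_empty, Finset.sdiff_empty]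
    rw [← hnb]; exact hr
  · rintro t s' ⟨t', rfl, g1, g2, g3, g4, g5, g6⟩
    rw [en1, Finset.sdiff_self, gOf_empty] at g5
    exact ⟨by omega, g2, g3, g5⟩

/-- Adds the edges in the set of edge codes to the empty graph. -/
def Scheme.buildup (D : Scheme P) : Cmd := forSet 9 14 15 (.seq decode D.add)

set_option maxHeartbeats 1000000 in
theorem Scheme.buildup_tr (D : Scheme P) {n M Pk : ℕ} {c : Cfg}
    (hph : Phase D.sq n M 0 c ∅ ∅) (hk : 1 ≤ c.k) (hE : Codes n c.E)
    (hkτ : c.E.card ≤ c.k * c.τ) (hnb : c.nb = fun _ => ∅) (hB : c.B = ∅) (hH : c.H = ∅)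
    (hP : D.peak n M c.k ≤ Pk)
    {s : State} (hb : Base n s.reg) (hr : Rep n c (D.F n c.nb c.B c.H) s.tab) :
    Tr (wordBound 16 n) D.buildup s Pk (fun t s' => Base n s'.reg ∧ Args s s' ∧
      ∃ c' : Cfg, ({ c with nb := gOf n c.E } : Cfg).Same c' ∧
        Phase D.sq n M c.E.card c' ∅ ∅ ∧ Rep n c' (D.F n c'.nb c'.B c'.H) s'.tab ∧
        t ≤ c.E.card * (D.C * (c.τ + 1) + 250) + 9 + D.rate c.τ * c'.weight) := by
  set e : ℕ → ℕ := fun i => s.tab (5, n + 2, i, 0) with he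
  obtain ⟨en1, en2, en3, en4⟩ := hr.sets.enum (n + 2) (e := e) (fun _ => rfl)
  rw [Cfg.sets_E] at en1 en2 en3 en4
  have hEn : c.E.card ≤ n * n := by simpa using card_le_card hph.ok.E_sub
  refine Tr.imp (forSet_tr (N := c.E.card) e (Inv := fun j t st =>
    Base n st.reg ∧ Args s st ∧ j ≤ c.E.card ∧ (∀ l, st.tab (5, n + 2, l, 0) = e l) ∧
    ∃ c' : Cfg, ({ c with nb := gOf n ((range j).image e) } : Cfg).Same c' ∧
      Phase D.sq n M j c' ∅ ∅ ∧ Rep n c' (D.F n c'.nb c'.B c'.H) st.tab ∧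
      t ≤ j * (D.C * (c.τ + 1) + 250) + D.rate c.τ * c'.weight)
    (lt_wordBound (by omega)) ?_ ?_ (by omega) ?_ s ?_) ?_
  · rintro j t st st' ⟨g2, g3, g4, g6, c', sm, ph, rep, ht⟩ htab hreg
    refine ⟨g2.congr fun y hy _ h2 _ => hreg y (by omega) (by omega),
      ⟨by rw [hreg 18 (by omega) (by omega), g3.1], by rw [hreg 19 (by omega) (by omega), g3.2]⟩,
      g4, by rw [htab]; exact g6, c', sm, ph, by rw [htab]; exact rep, ht⟩
  · rintro j t st ⟨g2, g3, g4, g6, c', sm, ph, rep, ht⟩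
    refine ⟨by rw [g2.r9, rep.sets.size, Cfg.sets_E, sm.E], fun l _ => by rw [g2.r9, g6], ?_⟩
    have := rep.space_small D (Pk := Pk) ph.ok (by rw [sm.k]; exact hP); omega
  · rintro j hj t st ⟨g2, g3, g4, g6, c', sm, ph, rep, ht⟩ hy
    have hsp := rep.space_small D (Pk := Pk) ph.ok (by rw [sm.k]; exact hP)
    have hej := en2 j hj
    obtain ⟨v1, v2⟩ := hE _ hej
    have hcode := hE.eq hej
    have hadd : addE c'.nb (e j / n) (e j % n) = gOf n ((range (j + 1)).image e) := by
      rw [sm.nb, image_range_succ]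
      simp only
      rw [addE_gOf _ (by omega) v2 (by omega), hcode]
    refine Tr.seq (decode_tr g2.r0 hy (mem_range.1 (hph.ok.E_sub hej)) (by omega)) ?_
    rintro _ _ ⟨rfl, rfl⟩
    set st₁ : State := ⟨update (update st.reg 16 (e j / n)) 17 (e j % n),
      st.tab⟩ with hst₁
    have hreg₁ : ∀ y, y ≠ 16 → y ≠ 17 → st₁.reg y = st.reg y :=
      fun y h3 h4 => by simp [hst₁, h3, h4]
    refine Tr.imp (D.add_tr (s := st₁) ph (by rw [sm.k]; exact hk)
      (by rw [sm.k, sm.τ]; simp only; omega) ?_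
      (by rw [sm.k]; exact hP) (a := e j / n) (b := e j % n) (by omega) v2 (by omega) ?_
      (g2.congr fun y _ h1 h2 _ => hreg₁ y (by omega) (by omega)) (by simp [hst₁])
      (by simp [hst₁]) rep) ?_
    · rw [hadd]
      have h1 := sum_card_gOf_le (hE.mono (en4 (j + 1) hj))
      have h2 := card_le_card (en4 (j + 1) hj)
      have h3 := hph.ok.E_card
      omega
    · rw [sm.nb]
      intro h
      have := (mem_gOf.1 h).2.2.2
      rw [hcode] at this
      exact en3 j hj this
    rintro t' s' ⟨b', f', c'', sm', ph', rep', ht'⟩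
    refine ⟨by rw [f'.reg 14 (by omega) (by omega), hreg₁ 14 (by omega) (by omega)], b',
      ⟨by rw [f'.reg 18 (by omega) (by omega), hreg₁ 18 (by omega) (by omega), g3.1],
        by rw [f'.reg 19 (by omega) (by omega), hreg₁ 19 (by omega) (by omega), g3.2]⟩, hj,
      fun l => by rw [f'.elt, ← g6 l], c'', ⟨?_, sm'.E.trans sm.E, sm'.k.trans sm.k,
        sm'.τ.trans sm.τ, sm'.r.trans sm.r, sm'.c.trans sm.c⟩, ph', rep', ?_⟩
    · rw [sm'.nb]; exact hadd
    · rw [sm.τ] at ht'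
      simp only at ht'
      rw [Nat.succ_mul]; omega
  · refine ⟨hb, ⟨rfl, rfl⟩, by omega, fun _ => rfl, c, ⟨?_, rfl, rfl, rfl, rfl, rfl⟩, hph, hr, by simp⟩
    rw [Finset.range_zero, Finset.image_empty, gOf_empty]; exact hnb
  · rintro t s' ⟨t', rfl, g2, g3, g4, g6, c', sm, ph, rep, ht⟩
    rw [en1] at sm
    exact ⟨g2, g3, c', sm, ph, rep, by omega⟩

theorem exists_threshold (sq : Bool) (m : ℕ) : ∃ k, 1 ≤ k ∧ m + 1 ≤ k * tau sq k :=
  ⟨m + 1, by omega, by have := le_tau sq (m + 1); nlinarith⟩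

/-- The threshold `k` for a phase that starts with `m` edges. -/
def threshold (sq : Bool) (m : ℕ) : ℕ := Nat.find (exists_threshold sq m)

theorem threshold_pos (sq : Bool) (m : ℕ) : 1 ≤ threshold sq m :=
  (Nat.find_spec (exists_threshold sq m)).1

theorem le_threshold (sq : Bool) (m : ℕ) :
    m + 1 ≤ threshold sq m * tau sq (threshold sq m) :=
  (Nat.find_spec (exists_threshold sq m)).2

theorem lt_of_lt_threshold {sq : Bool} {m k : ℕ} (hk : 1 ≤ k) (h : k < threshold sq m) :
    k * tau sq k < m + 1 := by
  by_contra! h1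
  exact Nat.find_min (exists_threshold sq m) h ⟨hk, h1⟩

theorem threshold_le {sq : Bool} {m k : ℕ} (hk : 1 ≤ k) (h : m + 1 ≤ k * tau sq k) :
    threshold sq m ≤ k := Nat.find_min' _ ⟨hk, h⟩

theorem mul_tau_two_mul_le (sq : Bool) (k : ℕ) : 2 * k * tau sq (2 * k) ≤ 8 * (k * tau sq k) := by
  unfold tau
  split_ifs
  · exact le_of_eq (by ring)
  · nlinarith [Nat.zero_le (k * k)]

theorem mul_tau_mono (sq : Bool) {k k' : ℕ} (h : k ≤ k') : k * tau sq k ≤ k' * tau sq k' :=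
  Nat.mul_le_mul h (tau_mono sq h)

theorem threshold_mul_le (sq : Bool) (m : ℕ) :
    threshold sq m * tau sq (threshold sq m) ≤ 8 * (m + 1) := by
  by_cases h : threshold sq m ≤ 1
  · have h1 : threshold sq m = 1 := le_antisymm h (threshold_pos sq m)
    rw [h1]
    have : tau sq 1 = 1 := by unfold tau; simp
    omega
  · have h1 := lt_of_lt_threshold (sq := sq) (m := m) (k := threshold sq m - 1) (by omega) (by omega)
    have h2 := mul_tau_mono sq (k := threshold sq m) (k' := 2 * (threshold sq m - 1)) (by omega)
    have h3 := mul_tau_two_mul_le sq (threshold sq m - 1)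
    omega

theorem le_mul_tau (sq : Bool) {k : ℕ} (hk : 1 ≤ k) : tau sq k ≤ k * tau sq k :=
  Nat.le_mul_of_pos_left _ hk

theorem mul_self_le_mul_tau (sq : Bool) (k : ℕ) : k * k ≤ k * tau sq k :=
  Nat.mul_le_mul_left _ (le_tau sq k)

theorem small_lt_modulus {n m : ℕ} (hm : m ≤ n * n) : 8 * (m + 1) + 8 ≤ modulus n := by
  have h : modulus n = (n + 2) ^ 2 * (n + 2) ^ 4 := by unfold modulus; ring
  have h4 : 2 ^ 4 ≤ (n + 2) ^ 4 := Nat.pow_le_pow_left (by omega) _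
  rw [h]
  nlinarith

/-- The threshold for huge vertices, computed from the content of register `25`. -/
def tauExpr (sq : Bool) : Expr := if sq then .times (.reg 25) (.reg 25) else .reg 25

theorem tauExpr_cost (sq : Bool) : (tauExpr sq).cost ≤ 3 := by
  unfold tauExpr; split_ifs <;> simp [Expr.cost]

theorem tauExpr_eval {W : ℕ} {sq : Bool} {s : State} {k : ℕ} (h : s.reg 25 = k)
    (hk : tau sq k < W) : (tauExpr sq).eval W s = tau sq k := by
  unfold tau at hk ⊢
  unfold tauExpr
  split_ifs at hk ⊢
  · simp only [Expr.eval, h]; exact mod_eq_of_lt hk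
  · exact h

/-- Computes the threshold for the current number of edges. -/
def computeThreshold (sq : Bool) : Cmd :=
  .seq (.assign 25 (.const 1))
    (.loop (.less (.times (.reg 25) (tauExpr sq))
        (.plus (.look 4 (.reg 9) (.const 0) (.const 0)) (.const 1)))
      (.assign 25 (.plus (.reg 25) (.const 1))))

theorem computeThreshold_tr {n m Pk : ℕ} (sq : Bool) {s : State} (hm : m ≤ n * n)
    (h : s.tab (4, s.reg 9, 0, 0) = m) (hP : space s.tab + 10 ≤ Pk) :
    Tr (wordBound 16 n) (computeThreshold sq) s Pk (fun t s' =>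
      t ≤ 20 * (threshold sq m + 1) ∧
        s' = ⟨update s.reg 25 (threshold sq m), s.tab⟩) := by
  set W := wordBound 16 n with hW
  have hmod := small_lt_modulus hm
  have hWm : modulus n < W := by have := modulus_sq_le n; nlinarith
  have W0 : 0 % W = 0 := Nat.zero_mod _
  have W1 : 1 % W = 1 := mod_eq_of_lt (by omega)
  set K := threshold sq m with hK
  have hK1 : 1 ≤ K := threshold_pos sq m
  have hKτ : K * tau sq K ≤ 8 * (m + 1) := threshold_mul_le sq m
  have hcost := tauExpr_cost sq
  have heval : ∀ j, 1 ≤ j → j ≤ K → ∀ st : State, st.reg 25 = j → st.reg 9 = s.reg 9 →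
      st.tab = s.tab → (Expr.less (.times (.reg 25) (tauExpr sq))
        (.plus (.look 4 (.reg 9) (.const 0) (.const 0)) (.const 1))).eval W st =
        if j * tau sq j < m + 1 then 1 else 0 := by
    intro j hj1 hj st h1 h2 h3
    have h4 := mul_tau_mono sq hj
    have h5 := le_mul_tau sq hj1
    have h6 : (tauExpr sq).eval W st = tau sq j := tauExpr_eval h1 (by omega)
    simp only [Expr.eval, h6, h1, h2, h3, W0, W1, h]
    rw [mod_eq_of_lt (show j * tau sq j < W by omega),
      mod_eq_of_lt (show m + 1 < W by omega)]
  refine Tr.seq (Q₁ := fun t s' => t = 2 ∧ s' = ⟨update s.reg 25 1, s.tab⟩) ?_ ?_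
  · refine .of_exec (T := 2) (.assign s 25 (.const 1)) (by simp [Expr.cost]) (by omega) ?_
    exact ⟨by simp [Expr.cost], by simp [Expr.eval, W1]⟩
  rintro _ _ ⟨rfl, rfl⟩
  refine Tr.imp (Tr.loop (Inv := fun i t st => ∃ j, j + i = K ∧ 1 ≤ j ∧ t + 20 ≤ 20 * j ∧
    st = ⟨update s.reg 25 j, s.tab⟩) ?_ ?_ (K - 1) 0 _ ⟨1, by omega, le_rfl, by omega, rfl⟩)
    ?_
  · rintro i t st ⟨j, hj, hj1, ht, rfl⟩
    refine ⟨?_, ?_⟩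
    · rw [heval j hj1 (by omega) ⟨update s.reg 25 j, s.tab⟩ (by simp) (by simp) rfl,
        if_pos (lt_of_lt_threshold hj1 (by omega))]
      exact one_ne_zero
    · refine .of_exec (T := 4) (.assign _ 25 (.plus (.reg 25) (.const 1))) (by simp [Expr.cost])
        (by simp only; omega) ?_
      refine ⟨j + 1, by omega, by omega, ?_, ?_⟩
      · simp only [Expr.cost]; omega
      · have := mul_tau_mono sq (show j ≤ K by omega)
        have h5 := mul_self_le_mul_tau sq j
        have h6 := Nat.le_mul_self j
        simp [Expr.eval, W1, mod_eq_of_lt (show j + 1 < W by omega)]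
  · rintro t st ⟨j, hj, hj1, ht, rfl⟩
    obtain rfl : j = K := by omega
    refine ⟨?_, by simp only; omega⟩
    rw [heval K hj1 le_rfl ⟨update s.reg 25 K, s.tab⟩ (by simp) (by simp) rfl, if_neg (by have := le_threshold sq m; rw [← hK] at this; omega)]
  · rintro t s' ⟨t₁, ht, j, hj, hj1, ht₁, rfl⟩
    obtain rfl : j = K := by omega
    refine ⟨?_, rfl⟩
    simp only [Expr.cost] at ht
    omega

/-- Stores the parameters of a new phase, with the threshold in register `25`. -/
def storeParameters (sq : Bool) : Cmd :=
  .seq (.store 0 (.const 0) (.const 0) (.const 0) (.reg 25))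
  (.seq (.store 1 (.const 0) (.const 0) (.const 0) (tauExpr sq))
    (.store 2 (.const 0) (.const 0) (.const 0) (.plus
      (.quot (.look 4 (.reg 9) (.const 0) (.const 0)) (.const 2)) (.const 1))))

theorem storeParameters_timed {n m k : ℕ} {sq : Bool} {c : Cfg} {A : Key → ℕ}
    {s : State} (hm : m ≤ n * n) (h : s.tab (4, s.reg 9, 0, 0) = m) (hk : s.reg 25 = k)
    (hτ : tau sq k < modulus n) (hr : Rep n c A s.tab) :
    Timed (wordBound 16 n) (storeParameters sq) s 30 (fun s' => s'.reg = s.reg ∧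
      Rep n { c with k := k, τ := tau sq k, r := m / 2 + 1 } A s'.tab) := by
  set W := wordBound 16 n with hW
  have hmod := small_lt_modulus hm
  have hWm : modulus n < W := by have := modulus_sq_le n; nlinarith
  have W0 : 0 % W = 0 := Nat.zero_mod _
  have W1 : 1 % W = 1 := mod_eq_of_lt (by omega)
  have W2 : 2 % W = 2 := mod_eq_of_lt (by omega)
  have W3 : (m / 2 + 1) % W = m / 2 + 1 := mod_eq_of_lt (by omega)
  have hcost := tauExpr_cost sq
  have htab : ∀ key, ((storeParameters sq).run W s).tab key =
      if key = (2, 0, 0, 0) then m / 2 + 1 else if key = (1, 0, 0, 0) then tau sq k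
      else if key = (0, 0, 0, 0) then k else s.tab key := by
    intro key
    have e1 : ∀ μ : Tables, (tauExpr sq).eval W ⟨s.reg, μ⟩ = tau sq k := fun μ =>
      tauExpr_eval hk (by omega)
    simp [storeParameters, Cmd.run, Expr.eval, Finsupp.coe_update, Function.update_apply, W0, W1,
      W2, e1, h, hk, W3]
  refine Timed.mono (Timed.plain (p := storeParameters sq) rfl (Q := fun s' => s'.reg = s.reg ∧
      Rep n { c with k := k, τ := tau sq k, r := m / 2 + 1 } A s'.tab) ⟨rfl, ?_, ?_, ?_⟩)
    (by simp only [storeParameters, Cmd.steps, Expr.cost]; omega) (fun _ h => h)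
  · refine hr.sets.congr fun key hkey => ?_
    rw [htab, if_neg, if_neg, if_neg] <;> rintro rfl <;> simp at hkey
  · intro key hkey
    rw [htab, if_neg, if_neg, if_neg, hr.aux key hkey] <;> rintro rfl <;> simp at hkey
  · intro t ht a
    rw [htab]
    have := hr.scal t ht a
    interval_cases t
    · by_cases ha : a = (0, 0, 0)
      · subst ha; simp [Cfg.scal]
      · simp [ha] at this ⊢; exact this
    · by_cases ha : a = (0, 0, 0)
      · subst ha; simp [Cfg.scal]
      · simp [ha] at this ⊢; exact this
    · by_cases ha : a = (0, 0, 0)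
      · subst ha; simp [Cfg.scal]
      · simp [ha] at this ⊢; exact this
    · simpa [Cfg.scal] using this

/-- Starts a new phase: both classes are emptied, the thresholds are computed anew, and all edges
are added again. -/
def Scheme.rebuild (D : Scheme P) : Cmd :=
  .seq D.teardown
  (.seq (.seq (clear 0) (clear 5))
  (.seq (computeThreshold D.sq)
  (.seq (storeParameters D.sq) D.buildup)))

set_option maxHeartbeats 1000000 in
theorem Scheme.rebuild_tr (D : Scheme P) {n M Pk : ℕ} {c : Cfg} (hc : c.Ok D.sq n M)
    (hT : c.T = ∅) (hE : Codes n c.E) (hnb : c.nb = gOf n c.E) {k : ℕ}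
    (hk : k = threshold D.sq c.E.card) (hP : D.peak n M c.k ≤ Pk) (hP' : D.peak n M k ≤ Pk)
    {s : State} (hb : Base n s.reg) (hr : Rep n c (D.F n c.nb c.B c.H) s.tab) :
    Tr (wordBound 16 n) D.rebuild s Pk (fun t s' => Base n s'.reg ∧ Args s s' ∧
      ∃ c' : Cfg, ({ c with k := k, τ := tau D.sq k, r := c.E.card / 2 + 1 } : Cfg).Same c' ∧
        Phase D.sq n M c.E.card c' ∅ ∅ ∧ Rep n c' (D.F n c'.nb c'.B c'.H) s'.tab ∧
        t ≤ c.E.card * (D.C * (tau D.sq c.k + 1) + 250) +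
          c.E.card * (D.C * (tau D.sq k + 1) + 250) + 800 * tau D.sq c.k + 20 * tau D.sq k + 100 +
          D.rate (tau D.sq k) * c'.weight) := by
  have hEn : c.E.card ≤ n * n := by simpa using card_le_card hc.E_sub
  have hmod := small_lt_modulus hEn
  have hk1 : 1 ≤ k := by rw [hk]; exact threshold_pos _ _
  have hkle : k * tau D.sq k ≤ 8 * (c.E.card + 1) := by rw [hk]; exact threshold_mul_le _ _
  have hlek : c.E.card + 1 ≤ k * tau D.sq k := by rw [hk]; exact le_threshold _ _
  have hτle := le_mul_tau D.sq hk1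
  have hkτ := le_tau D.sq k
  refine Tr.seq (D.teardown_tr hc hE hnb hP hb hr) ?_
  rintro t₁ s₁ ⟨ht₁, b₁, a₁, r₁⟩
  -- all auxiliary tables are empty now, whatever the classes are
  have haux : ∀ B H, D.F n (fun _ => ∅) B H = D.F n (fun _ => ∅) ∅ ∅ := fun B H => by
    funext key; rw [D.F_empty, D.F_empty]
  have gr0 : Gr n (fun _ => ∅) := ⟨by simp, by simp, by simp⟩
  have ok₁ : Cfg.Ok D.sq n M { c with nb := fun _ => ∅, T := c.T } :=
    hc.shrink gr0 (by simp) hc.T_sub hc.T_card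
  have sp₁ := D.space_clear ok₁ r₁ hP
  have hBc := hc.cheap.B_card
  have hHc := hc.cheap.H_card
  have hlt := le_tau D.sq c.k
  refine Tr.seq (Q₁ := fun t s' => t ≤ 800 * tau D.sq c.k + 10 ∧ Base n s'.reg ∧ Args s s' ∧
      Rep n { c with nb := fun _ => ∅, B := ∅, H := ∅ } (D.F n (fun _ => ∅) ∅ ∅) s'.tab) ?_ ?_
  · have h1 : Timed (wordBound 16 n) (DynCount.clear 0) s₁ (100 * c.B.card + 5) (fun s' =>
        (∀ r < 22, s'.reg r = s₁.reg r) ∧ Rep n { c with nb := fun _ => ∅, B := ∅ }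
          (D.F n (fun _ => ∅) c.B c.H) s'.tab) := by
      refine Timed.mono (r₁.clear (c' := { c with nb := fun _ => ∅, B := ∅ }) 0 (by omega)
        (by rw [b₁.r0, sets_update_B]) rfl) ?_ (fun s' h => ⟨h.1, h.2.1⟩)
      rw [b₁.r0, Cfg.sets_B]
    have h2 : Timed (wordBound 16 n) (.seq (DynCount.clear 0) (DynCount.clear 5)) s₁
        (100 * c.B.card + 5 + (100 * c.H.card + 5)) (fun s' => (∀ r < 22, s'.reg r = s₁.reg r) ∧
          Rep n { c with nb := fun _ => ∅, B := ∅, H := ∅ } (D.F n (fun _ => ∅) c.B c.H) s'.tab) := by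
      refine Timed.seq h1 ?_
      rintro s₂ ⟨i1, i2⟩
      have b5 : s₂.reg 5 = n + 1 := by rw [i1 5 (by omega), b₁.r5]
      refine Timed.mono (i2.clear (c' := { c with nb := fun _ => ∅, B := ∅, H := ∅ }) 5 (by omega)
        (by rw [b5, sets_update_H]) rfl) ?_ (fun s' h => ⟨fun r hr => by rw [h.1 r hr, i1 r hr], h.2.1⟩)
      rw [b5, Cfg.sets_H]
    refine Tr.imp (h2.tr (P := Pk) ?_) ?_
    · simp only at sp₁
      omega
    · rintro t s' ⟨ht, i1, i2⟩
      rw [haux] at i2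
      exact ⟨by omega, b₁.congr fun y hy _ _ _ => i1 y (by omega),
        ⟨by rw [i1 18 (by omega), a₁.1], by rw [i1 19 (by omega), a₁.2]⟩, i2⟩
  rintro t₂ s₂ ⟨ht₂, b₂, a₂, r₂⟩
  have ok₂ : Cfg.Ok D.sq n M { c with nb := fun _ => ∅, B := ∅, H := ∅ } :=
    { ok₁ with
      B_sub := Finset.empty_subset _
      H_sub := Finset.empty_subset _
      cheap := ⟨fun _ _ => by simp, fun _ _ => by simp, by simp, by simp⟩ }
  have sp₂ := r₂.space_small D ok₂ hP
  have hm₂ : s₂.tab (4, s₂.reg 9, 0, 0) = c.E.card := by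
    rw [b₂.r9, r₂.sets.size, Cfg.sets_E]
  refine Tr.seq (computeThreshold_tr D.sq hEn hm₂ (by omega)) ?_
  rw [← hk]
  rintro t₃ s₃ ⟨ht₃, rfl⟩
  refine Tr.seq (Timed.tr (storeParameters_timed (s := ⟨update s₂.reg 25 k, s₂.tab⟩)
    hEn (by simpa using hm₂) (k := k) (by simp) (sq := D.sq) (by omega) r₂) (by simp only; omega)) ?_
  rintro t₄ s₄ ⟨ht₄, reg₄, r₄⟩
  have b₄ : Base n s₄.reg := by rw [reg₄]; exact b₂.update (by omega) k
  have hhalf : ∀ θ, Half n θ 0 (fun _ => ∅) ∅ ∅ := fun θ =>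
    ⟨by simp, fun _ _ _ => by simp, fun _ _ => by simp⟩
  have ph₄ : Phase D.sq n M 0
      { c with
        nb := fun _ => ∅, B := ∅, H := ∅, k := k, τ := tau D.sq k, r := c.E.card / 2 + 1 } ∅ ∅ :=
    { ok := { ok₂ with
        scal_lt := by
          intro t
          rcases t with _ | _ | _ | t
          · simp only [Cfg.scal]; omega
          · simp only [Cfg.scal]; omega
          · simp only [Cfg.scal]; omega
          · exact hc.scal_lt 3
        tau_eq := rfl
        cheap := ⟨fun _ _ => by simp, fun _ _ => by simp, by simp, by simp⟩ }
      T := hT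
      half_B := hhalf _
      half_H := hhalf _
      I_le := Nat.zero_le _ }
  refine Tr.imp (D.buildup_tr ph₄ hk1 hE (by simp only; omega) rfl rfl rfl hP' b₄ r₄) ?_
  rintro t₅ s₅ ⟨b₅, a₅, c', sm, ph, r₅, ht₅⟩
  refine ⟨b₅, a₂.trans (Args.trans ⟨by rw [reg₄]; simp, by rw [reg₄]; simp⟩ a₅), c',
    ⟨sm.nb.trans hnb.symm, sm.E, sm.k, sm.τ, sm.r, sm.c⟩, ph, r₅, ?_⟩
  simp only at ht₅
  omega

/-! ### Copies of a pattern -/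

section Copies

variable {U V : Type*} {P : SimpleGraph U} {G : SimpleGraph V}

open SimpleGraph

theorem Copy.toSubgraph_adj (f : Copy P G) (x y : V) :
    f.toSubgraph.Adj x y ↔ ∃ i j, P.Adj i j ∧ f i = x ∧ f j = y := by
  simp [Copy.toSubgraph, Relation.Map]

theorem Copy.toSubgraph_adj_iff (f : Copy P G) (i j : U) :
    f.toSubgraph.Adj (f i) (f j) ↔ P.Adj i j := by
  rw [Copy.toSubgraph_adj]
  constructor
  · rintro ⟨i', j', h, h1, h2⟩
    rwa [f.injective h1, f.injective h2] at h
  · exact fun h => ⟨i, j, h, rfl, rfl⟩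

theorem Copy.mem_verts (f : Copy P G) (x : V) : x ∈ f.toSubgraph.verts ↔ ∃ i, f i = x := by
  simp [Copy.toSubgraph]

/-- The labelled copies with a given image are a torsor for the automorphisms of the pattern. -/
theorem card_copies_fiber (f₀ : Copy P G) :
    Nat.card {f : Copy P G // f.toSubgraph = f₀.toSubgraph} = Nat.card (P ≃g P) := by
  have hinj : Function.Injective f₀ := f₀.injective
  have hsub : ∀ σ : P ≃g P, (f₀.comp σ.toCopy).toSubgraph = f₀.toSubgraph := by
    intro σ
    ext x y
    · rw [Copy.mem_verts, Copy.mem_verts]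
      constructor
      · rintro ⟨i, rfl⟩; exact ⟨σ i, rfl⟩
      · rintro ⟨i, rfl⟩; exact ⟨σ.symm i, by simp [Copy.comp_apply]⟩
    · rw [Copy.toSubgraph_adj, Copy.toSubgraph_adj]
      constructor
      · rintro ⟨i, j, h, rfl, rfl⟩
        exact ⟨σ i, σ j, σ.map_adj_iff.2 h, rfl, rfl⟩
      · rintro ⟨i, j, h, rfl, rfl⟩
        exact ⟨σ.symm i, σ.symm j, σ.symm.map_adj_iff.2 h, by simp [Copy.comp_apply],
          by simp [Copy.comp_apply]⟩
  refine (Nat.card_eq_of_bijective (fun σ : P ≃g P =>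
    (⟨f₀.comp σ.toCopy, hsub σ⟩ : {f : Copy P G // f.toSubgraph = f₀.toSubgraph})) ⟨?_, ?_⟩).symm
  · intro σ σ' h
    ext i
    have := congrArg (fun f => f.1 i) h
    simp only [Copy.comp_apply] at this
    exact hinj this
  · rintro ⟨f, hf⟩
    have hfinj : Function.Injective f := f.injective
    have h1 : ∀ i, ∃ j, f₀ j = f i := fun i => by
      rw [← Copy.mem_verts, ← hf, Copy.mem_verts]; exact ⟨i, rfl⟩
    have h2 : ∀ i, ∃ j, f j = f₀ i := fun i => by
      rw [← Copy.mem_verts, hf, Copy.mem_verts]; exact ⟨i, rfl⟩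
    choose a ha using h1
    choose b hb using h2
    let σ : P ≃g P :=
      { toFun := a
        invFun := b
        left_inv := fun i => hfinj (by rw [hb, ha])
        right_inv := fun i => hinj (by rw [ha, hb])
        map_rel_iff' := by
          intro i j
          change P.Adj (a i) (a j) ↔ P.Adj i j
          rw [← Copy.toSubgraph_adj_iff f₀, ha, ha, ← hf, Copy.toSubgraph_adj_iff] }
    refine ⟨σ, Subtype.ext (Copy.ext fun i => ?_)⟩
    exact ha i

variable [Finite U] [Finite V]

instance Copy.finite : Finite (Copy P G) :=
  Finite.of_injective (fun f : Copy P G => (f : U → V)) DFunLike.coe_injective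

instance Iso.finite : Finite (P ≃g P) :=
  Finite.of_injective (fun f : P ≃g P => (f : U → U)) DFunLike.coe_injective

/-- Each copy is the image of as many labelled copies as the pattern has automorphisms. -/
theorem card_copies_of (X : Set G.Subgraph) :
    Nat.card {f : Copy P G // f.toSubgraph ∈ X} =
      Nat.card (P ≃g P) * {H : G.Subgraph | H ∈ X ∧ Nonempty (P ≃g H.coe)}.ncard := by
  classical
  cases nonempty_fintype U
  cases nonempty_fintype V
  have : Fintype (Copy P G) := Fintype.ofFinite _
  have : Finite G.Subgraph := inferInstance
  set Y : Finset G.Subgraph := (Finset.univ.filter fun f : Copy P G => f.toSubgraph ∈ X).image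
    Copy.toSubgraph with hY
  have h1 : {H : G.Subgraph | H ∈ X ∧ Nonempty (P ≃g H.coe)} = Y := by
    ext H
    have h := Set.ext_iff.1 (Copy.range_toSubgraph (A := P) (B := G)) H
    simp only [Set.mem_range, Set.mem_ofPred_eq] at h
    simp only [hY, Finset.coe_image, Finset.coe_filter, Finset.mem_univ, true_and, Set.mem_image,
      Set.mem_ofPred_eq, ← h]
    constructor
    · rintro ⟨h1, f, rfl⟩; exact ⟨f, h1, rfl⟩
    · rintro ⟨f, h1, rfl⟩; exact ⟨h1, f, rfl⟩
  rw [h1, Set.ncard_coe_finset, Nat.card_eq_fintype_card, Fintype.card_subtype,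
    Finset.card_eq_sum_card_image Copy.toSubgraph, mul_comm, ← smul_eq_mul, ← Finset.sum_const]
  refine sum_congr rfl fun H hH => ?_
  obtain ⟨f₀, hf₀, rfl⟩ := Finset.mem_image.1 hH
  rw [← card_copies_fiber f₀, Nat.card_eq_fintype_card, Fintype.card_subtype]
  congr 1
  ext f
  simp only [Finset.mem_filter, Finset.mem_univ, true_and] at hf₀ ⊢
  constructor
  · exact fun h => h.2
  · exact fun h => ⟨by rw [h]; exact hf₀, h⟩

theorem aut_pos : 0 < Nat.card (P ≃g P) := Nat.card_pos_iff.2 ⟨⟨Iso.refl⟩, inferInstance⟩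

end Copies

section

open SimpleGraph

variable {U : Type*} {P : SimpleGraph U} {n : ℕ} {G : SimpleGraph (Fin n)}

theorem copyCount_eq_ncard (P : SimpleGraph U) (G : SimpleGraph (Fin n)) :
    G.copyCount P = {H : G.Subgraph | Nonempty (P ≃g H.coe)}.ncard := by
  classical
  unfold SimpleGraph.copyCount
  rw [← Set.ncard_coe_finset]
  congr 1
  ext H; simp

theorem copyCount_eq_add [Finite U] (P : SimpleGraph U) (G : SimpleGraph (Fin n)) (e : Sym2 (Fin n)) :
    G.copyCount P = (G.deleteEdges {e}).copyCount P + copyCountEdge G P e := by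
  have h1 : {H : G.Subgraph | Nonempty (P ≃g H.coe)} =
      {H : G.Subgraph | e ∉ H.edgeSet ∧ Nonempty (P ≃g H.coe)} ∪
        {H : G.Subgraph | e ∈ H.edgeSet ∧ Nonempty (P ≃g H.coe)} := by
    ext H; simp only [Set.mem_ofPred_eq, Set.mem_union]; tauto
  rw [copyCount_eq_ncard, h1, Set.ncard_union_eq (by
    rw [Set.disjoint_left]; exact fun H h h' => h.1 h'.1) (Set.toFinite _) (Set.toFinite _)]
  unfold copyCountEdge
  congr 1
  refine Nat.eq_of_mul_eq_mul_left (aut_pos (P := P)) ?_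
  rw [copyCount_eq_ncard]
  have h2 := card_copies_of (P := P) (G := G) {H | e ∉ H.edgeSet}
  have h3 := card_copies_of (P := P) (G := G.deleteEdges {e}) Set.univ
  simp only [Set.mem_ofPred_eq] at h2
  simp only [Set.mem_univ, true_and] at h3
  rw [← h2, ← h3]
  refine Nat.card_eq_of_bijective (fun f => ⟨⟨⟨f.1, fun {i j} h => ?_⟩, f.1.injective⟩, trivial⟩)
    ⟨?_, ?_⟩
  · refine SimpleGraph.deleteEdges_adj.2 ⟨f.1.toHom.map_adj h, fun he => f.2 ?_⟩
    have h5 : s(f.1 i, f.1 j) ∈ f.1.toSubgraph.edgeSet := (Copy.toSubgraph_adj_iff f.1 i j).2 h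
    have h6 : s(f.1 i, f.1 j) = e := he
    generalize f.1 = g at h5 h6 ⊢
    rw [h6] at h5; exact h5
  · rintro ⟨f, hf⟩ ⟨g, hg⟩ h
    refine Subtype.ext (Copy.ext fun i => ?_)
    exact congrArg (fun f => f.1 i) h
  · rintro ⟨f, -⟩
    refine ⟨⟨(Copy.ofLE _ _ (SimpleGraph.deleteEdges_le _)).comp f, fun he => ?_⟩,
      Subtype.ext (Copy.ext fun i => rfl)⟩
    induction e using Sym2.ind with
    | h x y =>
      obtain ⟨i, j, h, h1, h2⟩ := (Copy.toSubgraph_adj _ x y).1 he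
      have := SimpleGraph.deleteEdges_adj.1 (f.toHom.map_adj h)
      refine this.2 ?_
      rw [Set.mem_singleton_iff]
      exact congrArg₂ (fun a b => s(a, b)) h1 h2

theorem copyCount_le (P : SimpleGraph (Fin 4)) (G : SimpleGraph (Fin n)) :
    G.copyCount P ≤ n ^ 4 := by
  have h := card_copies_of (P := P) (G := G) Set.univ
  simp only [Set.mem_univ, true_and] at h
  rw [copyCount_eq_ncard]
  refine (Nat.le_mul_of_pos_left _ (aut_pos (P := P))).trans (h.symm.le.trans ?_)
  rw [Nat.card_congr (Equiv.subtypeUnivEquiv fun _ => trivial)]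
  refine (Nat.card_le_card_of_injective (fun f : Copy P G => (f : Fin 4 → Fin n))
    DFunLike.coe_injective).trans ?_
  rw [Nat.card_fun]; simp

theorem copyCountEdge_le (P : SimpleGraph (Fin 4)) (G : SimpleGraph (Fin n)) (e : Sym2 (Fin n)) :
    copyCountEdge G P e ≤ n ^ 4 := by
  have := copyCount_eq_add P G e
  have := copyCount_le P G
  omega

theorem two_mul_pow_lt_modulus (n : ℕ) : 2 * n ^ 4 < modulus n := by
  have h : modulus n = (n + 2) ^ 4 * (n + 2) ^ 2 := by unfold modulus; ring
  have h1 : n ^ 4 ≤ (n + 2) ^ 4 := Nat.pow_le_pow_left (by omega) _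
  have h2 : 1 ≤ (n + 2) ^ 4 := Nat.one_le_pow _ _ (by omega)
  have h3 : 2 ^ 2 ≤ (n + 2) ^ 2 := Nat.pow_le_pow_left (by omega) _
  rw [h]; nlinarith

theorem deleteEdges_sup_edge {u v : Fin n} (hG : ¬ G.Adj u v) (huv : u ≠ v) :
    (G ⊔ SimpleGraph.edge u v).deleteEdges {s(u, v)} = G := by
  ext x y
  rw [SimpleGraph.deleteEdges_adj, SimpleGraph.sup_adj, SimpleGraph.edge_adj, Set.mem_singleton_iff,
    Sym2.eq_iff]
  constructor
  · rintro ⟨h1 | h1, h2⟩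
    · exact h1
    · exact absurd h1.1 h2
  · intro h
    refine ⟨Or.inl h, ?_⟩
    rintro (⟨rfl, rfl⟩ | ⟨rfl, rfl⟩)
    · exact hG h
    · exact hG h.symm

theorem ncard_edgeSet_deleteEdges {u v : Fin n} (h : G.Adj u v) :
    (G.deleteEdges {s(u, v)}).edgeSet.ncard + 1 = G.edgeSet.ncard := by
  rw [SimpleGraph.edgeSet_deleteEdges]
  exact Set.ncard_sdiff_singleton_add_one h (Set.toFinite _)

theorem adj_sup_edge {u v : Fin n} (huv : u ≠ v) : (G ⊔ SimpleGraph.edge u v).Adj u v := by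
  rw [SimpleGraph.sup_adj, SimpleGraph.edge_adj]
  exact Or.inr ⟨Or.inl ⟨rfl, rfl⟩, huv⟩

theorem mem_nbOf {x y : ℕ} : y ∈ nbOf G x ↔ ∃ (hx : x < n) (hy : y < n),
    G.Adj ⟨x, hx⟩ ⟨y, hy⟩ := by
  classical
  unfold nbOf
  rw [Finset.mem_filter, mem_range]
  exact ⟨fun h => h.2, fun h => ⟨h.choose_spec.choose, h⟩⟩

theorem mem_nbOf_fin {u v : Fin n} : (v : ℕ) ∈ nbOf G u ↔ G.Adj u v := by
  rw [mem_nbOf]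
  exact ⟨fun ⟨_, _, h⟩ => h, fun h => ⟨u.2, v.2, h⟩⟩

theorem nbOf_bot : nbOf (⊥ : SimpleGraph (Fin n)) = fun _ => ∅ := by
  funext x; ext y; simp [mem_nbOf]

theorem nbOf_deleteEdges {u v : Fin n} (huv : u ≠ v) :
    nbOf (G.deleteEdges {s(u, v)}) = delE (nbOf G) u v := by
  have huv' : (u : ℕ) ≠ v := fun h => huv (Fin.ext h)
  funext x; ext y
  rw [mem_delE huv', mem_nbOf, mem_nbOf]
  simp only [SimpleGraph.deleteEdges_adj, Set.mem_singleton_iff, Sym2.eq_iff, Fin.ext_iff]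
  constructor
  · rintro ⟨hx, hy, h1, h2⟩; exact ⟨⟨hx, hy, h1⟩, by tauto, by tauto⟩
  · rintro ⟨⟨hx, hy, h1⟩, h2, h3⟩; exact ⟨hx, hy, h1, by tauto⟩

theorem gr_nbOf (G : SimpleGraph (Fin n)) : Gr n (nbOf G) where
  symm x y h := by
    rw [mem_nbOf] at h ⊢
    obtain ⟨hx, hy, h⟩ := h
    exact ⟨hy, hx, h.symm⟩
  irrefl x h := by
    rw [mem_nbOf] at h
    obtain ⟨hx, hy, h⟩ := h
    exact G.irrefl h
  lt x y h := (mem_nbOf.1 h).choose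

theorem nbOf_sup_edge {u v : Fin n} (hG : ¬ G.Adj u v) (huv : u ≠ v) :
    nbOf (G ⊔ SimpleGraph.edge u v) = addE (nbOf G) u v := by
  have huv' : (u : ℕ) ≠ v := fun h => huv (Fin.ext h)
  rw [← addE_delE (gr_nbOf (G ⊔ SimpleGraph.edge u v)) huv' (mem_nbOf_fin.2 (adj_sup_edge huv)),
    ← nbOf_deleteEdges huv, deleteEdges_sup_edge hG huv]

end

/-! ### Operations -/

/-- Puts the number of copies that contain the edge between the contents of the registers `1` and
`2` into register `20`. -/
def Scheme.answer (D : Scheme P) : Cmd :=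
  .seq (.assign 4 (.const 1))
  (.seq (D.q₁.compile 30)
  (.seq (D.q₂.compile 30)
  (.seq (.assign 20 (.quot (.look 15 (.const 0) (.const 0) (.const 0)) (.const 2)))
  (.seq (.store 14 (.const 0) (.const 0) (.const 0) (.const 0))
    (.store 15 (.const 0) (.const 0) (.const 0) (.const 0))))))

theorem Timed.seq_exec {W : ℕ} {p q : Cmd} {s s₁ : State} {T₁ T₂ t k : ℕ} {Q : State → Prop}
    (h : Exec W p s s₁ t k) (ht : t ≤ T₁) (h' : Timed W q s₁ T₂ Q) :
    Timed W (.seq p q) s (T₁ + T₂) Q := by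
  obtain ⟨s₂, t₂, k₂, e₂, l₂, q₂⟩ := h'
  exact ⟨s₂, _, _, .seq h e₂, by omega, q₂⟩

set_option maxHeartbeats 400000 in
theorem Scheme.answer_timed (D : Scheme P) {n M : ℕ} {c : Cfg} {G : SimpleGraph (Fin n)}
    {u v : Fin n} (hc : c.Ok D.sq n M) (hnb : c.nb = nbOf G) (huv : G.Adj u v) {s : State}
    (hb : Base n s.reg) (hr : Rep n c (D.F n c.nb c.B c.H) s.tab) (r1 : s.reg 1 = u)
    (r2 : s.reg 2 = v) :
    Timed (wordBound 16 n) D.answer s (D.C * (tau D.sq c.k + 1) + 30) (fun s' =>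
      (∀ y < 22, y ≠ 4 → y ≠ 20 → s'.reg y = s.reg y) ∧
      s'.reg 20 = copyCountEdge G P s(u, v) ∧ s'.tab = s.tab) := by
  set W := wordBound 16 n with hW
  have hm := modulus_ge n
  have hmW : modulus n < W := by have := modulus_sq_le n; nlinarith
  have hb0 : Base n (update s.reg 4 1) :=
    hb.congr fun x _ _ _ hx => update_of_ne hx _ _
  have hlt := hr.lt hc.gr hc.B_sub hc.H_sub hc.T_sub hc.E_sub hc.scal_lt
    (fun key _ => D.F_lt n c.nb c.B c.H key hc.gr)
  have h0 : ∀ key : Key, 14 ≤ key.1 → s.tab key = 0 := fun key hkey => by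
    rw [hr.aux key (by omega), D.F_scratch _ _ _ _ _ hkey]
  have W0 : 0 % W = 0 := Nat.zero_mod _
  have W2 : 2 % W = 2 := mod_eq_of_lt (by omega)
  obtain ⟨s₂, t₂, k₂, e₂, l₂, g₂, lt₂, d₂, w₂⟩ := Prog.timed (n := n) (σ := 1) le_rfl (by omega)
    (by simp) D.q₁_ok ⟨update s.reg 4 1, s.tab⟩ (by simpa using hb.r3) (by simp) hlt
  simp only at g₂ d₂ w₂ l₂
  have hb₂ : Base n s₂.reg := hb0.congr fun x hx _ _ _ => g₂ x (by omega)
  have hcost := D.query_cost n c s.tab s₂.tab s₂.reg u v hr.sets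
    (hr.sets.congr fun key hkey => w₂ key (by simp; omega)) hc.gr hc.B_sub hc.H_sub
    hc.cheap hb₂ (by rw [g₂ 1 (by omega)]; simpa using r1) (by rw [g₂ 2 (by omega)]; simpa using r2)
    u.2 v.2
  have hcost₁ : D.q₁.cost 30 s₂.reg s.tab = D.q₁.cost 30 (update s.reg 4 1) s.tab :=
    Prog.cost_congr (by simp) (by simp) D.q₁_ok g₂ (fun _ _ => rfl)
  refine Timed.mono (T := 2 + (D.q₁.cost 30 (update s.reg 4 1) s.tab +
    (D.q₂.cost 30 s₂.reg s₂.tab + 17))) ?_ (by omega) (fun _ h => h)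
  refine Timed.seq (Timed.plain (p := .assign 4 (.const 1)) rfl
    (Q := fun s₁ => s₁ = ⟨update s.reg 4 1, s.tab⟩) ?_) ?_
  · simp [Cmd.run, Expr.eval, mod_eq_of_lt (show 1 < W by omega)]
  rintro s₁ rfl
  refine Timed.seq_exec e₂ l₂ ?_
  refine Timed.seq (Prog.timed (σ := 1) le_rfl (by omega) (by simp) D.q₂_ok s₂
    (by rw [g₂ 3 (by omega)]; simpa using hb.r3) (by rw [g₂ 4 (by omega)]; simp) lt₂) ?_
  rintro s₃ ⟨g₃, lt₃, d₃, w₃⟩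
  have hreg₃ : ∀ x < 30, s₃.reg x = update s.reg 4 1 x := fun x hx => by
    rw [g₃ x hx, g₂ x hx]
  have h14 : ∀ key : Key, key ≠ (14, 0, 0, 0) → s₂.tab key = s.tab key := by
    intro key hkey
    refine cast_inj_of_lt (lt₂ key) (hlt key) ?_
    rw [d₂, Prog.delta_scalar _ (by omega) D.q₁_scalar _ hb0.r6 _ _ hkey]; simp
  have h15 : ∀ key : Key, key ≠ (15, 0, 0, 0) → s₃.tab key = s₂.tab key := by
    intro key hkey
    refine cast_inj_of_lt (lt₃ key) (lt₂ key) ?_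
    rw [d₃, Prog.delta_scalar _ (by omega) D.q₂_scalar _
      (by rw [g₂ 6 (by omega)]; exact hb0.r6) _ _ hkey]; simp
  have hans : s₃.tab (15, 0, 0, 0) = 2 * copyCountEdge G P s(u, v) := by
    refine cast_inj_of_lt (lt₃ _) ?_ ?_
    · exact lt_of_le_of_lt (Nat.mul_le_mul_left _ (copyCountEdge_le P G _)) (two_mul_pow_lt_modulus n)
    · have hq := D.query (ZMod (modulus n)) n G u v c s.tab s₂.tab s₂.reg huv hnb hc.gr hc.B_sub
        hc.H_sub hr (fun key hkey => h14 key (fun h => hkey (by rw [h]))) ?_ hb₂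
        (by rw [g₂ 1 (by omega)]; simpa using r1) (by rw [g₂ 2 (by omega)]; simpa using r2)
      · rw [d₃, hq, h14 _ (by simp), h0 _ (by simp)]; push_cast; ring
      · rw [d₂, h0 _ (by simp),
          Prog.delta_congr (ZMod (modulus n)) (by simp) (by simp) D.q₁_ok g₂ (fun _ _ => rfl)]
        simp
  set last : Cmd := .seq (.assign 20 (.quot (.look 15 (.const 0) (.const 0) (.const 0)) (.const 2)))
    (.seq (.store 14 (.const 0) (.const 0) (.const 0) (.const 0))
    (.store 15 (.const 0) (.const 0) (.const 0) (.const 0))) with hlast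
  refine Timed.plain (p := last) rfl ⟨?_, ?_, ?_⟩
  · intro y hy h4 h20
    simp [hlast, Cmd.run, update_of_ne h20, hreg₃ y (by omega), update_of_ne h4]
  · simp [hlast, Cmd.run, Expr.eval, W0, W2, hans]
  · ext key
    simp only [hlast, Cmd.run, Expr.eval, W0, Finsupp.coe_update, Function.update_apply]
    split_ifs with h1 h2
    · rw [h1, h0 _ (by simp)]
    · rw [h2, h0 _ (by simp)]
    · rw [h15 key h1, h14 key h2]

/-- Sets the registers with fixed content, and saves the arguments of the operation. -/
def prelude : Cmd :=
  .seq (.assign 18 (.reg 1))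
  (.seq (.assign 19 (.reg 2))
  (.seq (.assign 5 (.plus (.reg 0) (.const 1)))
  (.seq (.assign 9 (.plus (.reg 0) (.const 2)))
  (.seq (.assign 10 (.plus (.reg 0) (.const 3)))
    (.assign 3 (.times (.times (.times (.reg 9) (.reg 9)) (.times (.reg 9) (.reg 9)))
      (.times (.reg 9) (.reg 9))))))))

theorem prelude_timed {n a b : ℕ} {s : State} (h0 : s.reg 0 = n) (h6 : s.reg 6 = 0)
    (h1 : s.reg 1 = a) (h2 : s.reg 2 = b) : Timed (wordBound 16 n) prelude s 30 (fun s' =>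
      Base n s'.reg ∧ s'.reg 1 = a ∧ s'.reg 2 = b ∧ s'.reg 18 = a ∧ s'.reg 19 = b ∧
      s'.tab = s.tab) := by
  set W := wordBound 16 n with hW
  have hm := modulus_ge n
  have hmW : modulus n < W := by have := modulus_sq_le n; nlinarith
  have e1 : 1 % W = 1 := mod_eq_of_lt (by omega)
  have e2 : 2 % W = 2 := mod_eq_of_lt (by omega)
  have e3 : 3 % W = 3 := mod_eq_of_lt (by omega)
  have f1 : (n + 1) % W = n + 1 := mod_eq_of_lt (by omega)
  have f2 : (n + 2) % W = n + 2 := mod_eq_of_lt (by omega)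
  have f3 : (n + 3) % W = n + 3 := mod_eq_of_lt (by omega)
  have h46 : (n + 2) ^ 4 ≤ modulus n := Nat.pow_le_pow_right (by omega) (by omega)
  have h26 : (n + 2) ^ 2 ≤ modulus n := Nat.pow_le_pow_right (by omega) (by omega)
  have g2 : (n + 2) * (n + 2) % W = (n + 2) * (n + 2) := mod_eq_of_lt (by
    rw [← pow_two]; omega)
  have g4 : (n + 2) * (n + 2) * ((n + 2) * (n + 2)) % W = (n + 2) * (n + 2) * ((n + 2) * (n + 2)) :=
    mod_eq_of_lt (by
      rw [show (n + 2) * (n + 2) * ((n + 2) * (n + 2)) = (n + 2) ^ 4 by ring]; omega)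
  have g6 : (n + 2) * (n + 2) * ((n + 2) * (n + 2)) * ((n + 2) * (n + 2)) % W = modulus n := by
    rw [show (n + 2) * (n + 2) * ((n + 2) * (n + 2)) * ((n + 2) * (n + 2)) = modulus n by
      unfold modulus; ring]
    exact mod_eq_of_lt hmW
  refine Timed.mono (Timed.plain (p := prelude) rfl (Q := fun s' =>
      Base n s'.reg ∧ s'.reg 1 = a ∧ s'.reg 2 = b ∧ s'.reg 18 = a ∧ s'.reg 19 = b ∧
      s'.tab = s.tab) ⟨⟨?_, ?_, ?_, ?_, ?_, ?_⟩, ?_, ?_, ?_, ?_, ?_⟩)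
    (by simp [prelude, Cmd.steps, Expr.cost]) (fun _ h => h)
  all_goals simp [prelude, Cmd.run, Expr.eval, h0, h6, h1, h2, e1, e2, e3, f1, f2, f3, g2, g4, g6]

/-- The numbers that describe the state of a phase: it started with `m₀` edges and was to last for
`L` updates; since then `I` edges have been added, including those of the rebuilding. -/
structure Ledger (c : Cfg) (m₀ L I : ℕ) : Prop where
  I_le : I + c.r ≤ 2 * (c.k * c.τ)
  live : 1 ≤ c.k ∨ (c.r = 0 ∧ c.E = ∅ ∧ c.k = 0)
  start_le : m₀ ≤ c.k * c.τ
  le_start : c.k * c.τ ≤ 8 * (m₀ + 1)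
  r_le : c.r ≤ L
  L_le : L ≤ m₀ / 2 + 1
  le_L : m₀ ≤ 2 * L
  L_pos : 1 ≤ c.k → 1 ≤ L
  up : c.E.card + c.r ≤ m₀ + L
  down : m₀ + c.r ≤ c.E.card + L

/-- What each update pays for the next rebuilding. -/
def Scheme.dues (D : Scheme P) (τ : ℕ) : ℕ := 800 * (D.C + 401) * (τ + 1)

/-- The potential. -/
def Scheme.pot (D : Scheme P) (c : Cfg) (L I : ℕ) : ℕ :=
  D.rate c.τ * (4 * I - c.weight) + D.dues c.τ * (L - c.r)

theorem Phase.weight_le {sq : Bool} {n M I : ℕ} {c : Cfg} {X Y : Finset ℕ}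
    (h : Phase sq n M I c X Y) : c.weight ≤ 4 * I := by
  have h1 := h.half_B.sum
  have h2 := h.half_H.sum
  unfold Cfg.weight
  omega

theorem tau_two_mul_succ_le (sq : Bool) (k : ℕ) : tau sq (2 * k + 1) ≤ 9 * tau sq k + 1 := by
  unfold tau
  split_ifs
  · nlinarith [Nat.le_mul_self k]
  · omega

theorem threshold_le_of_ledger {sq : Bool} {c : Cfg} {m₀ L I : ℕ} (h : Ledger c m₀ L I)
    (hτ : c.τ = tau sq c.k) (hr : c.r = 0) : threshold sq c.E.card ≤ 2 * c.k + 1 := by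
  refine threshold_le (by omega) ?_
  rcases h.live with h1 | ⟨-, h1, h2⟩
  · have a1 := h.up
    have a2 := h.L_le
    have a3 := h.start_le
    have h2 : 2 * tau sq c.k ≤ tau sq (2 * c.k + 1) := by
      unfold tau; split_ifs
      · nlinarith
      · omega
    have h3 : 2 * c.k * (2 * tau sq c.k) ≤ (2 * c.k + 1) * tau sq (2 * c.k + 1) :=
      Nat.mul_le_mul (by omega) h2
    rw [show 2 * c.k * (2 * tau sq c.k) = 4 * (c.k * c.τ) by rw [hτ]; ring] at h3
    have h4 : 1 ≤ c.k * c.τ := by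
      rw [hτ]; exact Nat.mul_pos h1 (lt_of_lt_of_le h1 (le_tau sq c.k))
    omega
  · rw [h1, h2]
    simp [tau]

theorem dues_suffice {C m L a b : ℕ} (ha : 1 ≤ a) (h1 : m ≤ 3 * L) (h2 : b ≤ 10 * a) :
    m * (C * a + 250) + m * (C * b + 250) + (6 * (C * b) + 2100) * (4 * m) + 800 * a * L ≤
      800 * (C + 401) * a * L := by
  have e1 : C * b ≤ C * (10 * a) := Nat.mul_le_mul_left _ h2
  have e2 : 1 * L ≤ a * L := Nat.mul_le_mul_right _ ha
  calc _ ≤ 3 * L * (C * a + 250) + 3 * L * (C * (10 * a) + 250) +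
        (6 * (C * (10 * a)) + 2100) * (4 * (3 * L)) + 800 * a * L := by gcongr
    _ = 753 * (C * a * L) + 800 * (a * L) + 26700 * (1 * L) := by ring
    _ ≤ 800 * (C * a * L) + 800 * 401 * (a * L) := by omega
    _ = _ := by ring

/-- Starts a new phase when the current one is over, and counts the current update. -/
def Scheme.tick (D : Scheme P) : Cmd :=
  .seq (.cond (.look 2 (.const 0) (.const 0) (.const 0)) .skip D.rebuild)
    (.store 2 (.const 0) (.const 0) (.const 0)
      (.minus (.look 2 (.const 0) (.const 0) (.const 0)) (.const 1)))

theorem Rep.store_scal {n : ℕ} {c c' : Cfg} {A : Key → ℕ} {μ μ' : Tables}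
    (hr : Rep n c A μ) {t v : ℕ} (ht : t < 4) (hμ : μ' = μ.update (t, 0, 0, 0) v)
    (hsets : c'.sets n = c.sets n) (hv : c'.scal t = v)
    (hs : ∀ t' < 4, t' ≠ t → c'.scal t' = c.scal t') : Rep n c' A μ' := by
  have htab : ∀ key, μ' key = if key = (t, 0, 0, 0) then v else μ key := fun key => by
    rw [hμ]; simp [Finsupp.coe_update, Function.update_apply]
  refine ⟨?_, ?_, ?_⟩
  · rw [hsets]
    refine hr.sets.congr fun key hkey => ?_
    rw [htab, if_neg]
    rintro rfl
    simp only at hkey; omega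
  · intro key hkey
    rw [htab, if_neg, hr.aux key hkey]
    rintro rfl
    simp only at hkey; omega
  · intro t' ht' a
    rw [htab]
    by_cases h : t' = t
    · subst h
      by_cases ha : a = (0, 0, 0)
      · subst ha; simp [hv]
      · have := hr.scal t' ht a
        simp only [ha, if_false] at this ⊢
        rw [if_neg (by simp [ha]), this]
    · rw [if_neg (by simp [h]), hr.scal t' ht' a, hs t' ht' h]

set_option maxHeartbeats 1000000 in
theorem Scheme.tick_tr (D : Scheme P) {n M Pk m₀ L I : ℕ} {c : Cfg}
    (hph : Phase D.sq n M I c ∅ ∅) (hl : Ledger c m₀ L I) (hE : Codes n c.E)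
    (hnb : c.nb = gOf n c.E) (hP : D.peak n M c.k ≤ Pk)
    (hP' : D.peak n M (threshold D.sq c.E.card) ≤ Pk)
    {s : State} (hb : Base n s.reg) (hr : Rep n c (D.F n c.nb c.B c.H) s.tab) :
    Tr (wordBound 16 n) D.tick s Pk (fun t s' => Base n s'.reg ∧ Args s s' ∧
      ∃ (c' : Cfg) (m₀' L' I' : ℕ), c'.nb = c.nb ∧ c'.E = c.E ∧ c'.c = c.c ∧
        Phase D.sq n M I' c' ∅ ∅ ∧ Ledger c' m₀' L' I' ∧ 1 ≤ c'.k ∧ 1 ≤ c'.r ∧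
        (c'.k = c.k ∨ c'.k = threshold D.sq c.E.card) ∧
        Rep n { c' with r := c'.r - 1 } (D.F n c'.nb c'.B c'.H) s'.tab ∧
        t + D.pot c' L' I' ≤ D.pot c L I + 20 * c'.τ + 130) := by
  have hsp := hr.space_small D hph.ok hP
  have W0 : 0 % wordBound 16 n = 0 := Nat.zero_mod _
  have W1 : 1 % wordBound 16 n = 1 := mod_eq_of_lt (by have := wordBound_two_le n; omega)
  have hr2 : s.tab (2, 0, 0, 0) = c.r := by rw [hr.scal 2 (by omega), if_pos rfl]; rfl
  -- the state before the counter is decremented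
  refine Tr.seq (Q₁ := fun t s' => Base n s'.reg ∧ Args s s' ∧
      ∃ (c' : Cfg) (m₀' L' I' : ℕ), c'.nb = c.nb ∧ c'.E = c.E ∧ c'.c = c.c ∧
        Phase D.sq n M I' c' ∅ ∅ ∧ Ledger c' m₀' L' I' ∧ 1 ≤ c'.k ∧ 1 ≤ c'.r ∧
        (c'.k = c.k ∨ c'.k = threshold D.sq c.E.card) ∧
        Rep n c' (D.F n c'.nb c'.B c'.H) s'.tab ∧
        t + D.pot c' L' I' ≤ D.pot c L I + 20 * c'.τ + 110) ?_ ?_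
  · refine Tr.cond (fun h => ?_) (fun h => ?_)
    · simp only [Expr.eval, W0, hr2] at h
      refine .of_exec (T := 1) (.skip s) le_rfl (by omega) ⟨hb, ⟨rfl, rfl⟩, c, m₀, L, I, rfl, rfl,
        rfl, hph, hl, ?_, by omega, Or.inl rfl, hr, ?_⟩
      · rcases hl.live with h1 | h1
        · exact h1
        · exact absurd h1.1 h
      · simp only [Expr.cost]; omega
    · simp only [Expr.eval, W0, hr2] at h
      have hth := threshold_le_of_ledger hl hph.ok.tau_eq h
      set k := threshold D.sq c.E.card with hk
      have hk1 : 1 ≤ k := threshold_pos _ _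
      refine Tr.imp (D.rebuild_tr hph.ok hph.T hE hnb hk hP hP' hb hr) ?_
      rintro t s' ⟨b', a', c', sm, ph', r', ht⟩
      have smk : c'.k = k := sm.k
      have smτ : c'.τ = tau D.sq k := sm.τ
      have smr : c'.r = c.E.card / 2 + 1 := sm.r
      have smE : c'.E = c.E := sm.E
      have q1 : k * tau D.sq k ≤ 8 * (c.E.card + 1) := threshold_mul_le _ _
      have q2 : c.E.card + 1 ≤ k * tau D.sq k := le_threshold _ _
      refine ⟨b', a', c', c.E.card, c.E.card / 2 + 1, c.E.card, sm.nb, sm.E, sm.c, ph', ?_,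
        by rw [smk]; exact hk1, by omega, Or.inr smk, r', ?_⟩
      · refine ⟨?_, Or.inl (by omega), ?_, ?_, by omega, le_rfl, by omega, fun _ => by omega,
          by rw [smE, smr], by rw [smE, smr]⟩
        · rw [smk, smτ, smr]; omega
        · rw [smk, smτ]; omega
        · rw [smk, smτ]; exact q1
      · have hw := ph'.weight_le
        obtain ⟨d, hd⟩ := Nat.exists_eq_add_of_le hw
        have hm : c.E.card ≤ 3 * L := by have := hl.up; have := hl.le_L; omega
        have hτ : tau D.sq k + 1 ≤ 10 * (tau D.sq c.k + 1) := by
          have h1 := tau_mono D.sq hth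
          have h2 := tau_two_mul_succ_le D.sq c.k
          omega
        have key := dues_suffice (C := D.C) (Nat.le_add_left 1 (tau D.sq c.k)) hm hτ
        have h800 : 800 * tau D.sq c.k ≤ 800 * (tau D.sq c.k + 1) * L := by
          rcases hl.live with h1 | h1
          · have := Nat.mul_le_mul_left (800 * (tau D.sq c.k + 1)) (hl.L_pos h1)
            omega
          · rw [h1.2.2]; simp [tau]
        unfold Scheme.pot Scheme.dues
        rw [smr, smτ, h, hph.ok.tau_eq, Nat.sub_self, Nat.mul_zero, Nat.sub_zero, hd,
          Nat.add_sub_cancel_left]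
        have e2 : D.rate (tau D.sq k) * (4 * c.E.card) =
            D.rate (tau D.sq k) * c'.weight + D.rate (tau D.sq k) * d := by rw [hd, Nat.mul_add]
        have e3 : D.rate (tau D.sq k) = 6 * (D.C * (tau D.sq k + 1)) + 2100 := rfl
        rw [← e3] at key
        simp only [Expr.cost]
        omega
  · rintro t₁ s₁ ⟨b₁, a₁, c', m₀', L', I', h1, h2, h3, h4, h5, h6, h7, h8, h9, h10⟩
    have hP₁ : D.peak n M c'.k ≤ Pk := by rcases h8 with h | h <;> rw [h] <;> assumption
    have hsp₁ := h9.space_small D h4.ok hP₁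
    have hr2' : s₁.tab (2, 0, 0, 0) = c'.r := by rw [h9.scal 2 (by omega), if_pos rfl]; rfl
    refine .of_exec (T := 11) (.store s₁ 2 _ _ _ _ _ rfl) (by simp [Expr.cost]) (by omega) ?_
    refine ⟨b₁, a₁, c', m₀', L', I', h1, h2, h3, h4, h5, h6, h7, h8, ?_, ?_⟩
    · refine h9.store_scal (t := 2) (v := c'.r - 1) (by omega) ?_ rfl rfl ?_
      · simp [Expr.eval, hr2', W1]
      · intro t' ht' hne
        interval_cases t'
        · rfl
        · rfl
        · exact absurd rfl hne
        · rfl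
    · simp only [Expr.cost]; omega

/-- The state between two operations. -/
structure Steady (D : Scheme P) {n : ℕ} (G : SimpleGraph (Fin n)) (c : Cfg) (m₀ L I : ℕ) : Prop where
  phase : Phase D.sq n c.E.card I c ∅ ∅
  ledger : Ledger c m₀ L I
  codes : Codes n c.E
  nb : c.nb = nbOf G
  nb' : c.nb = gOf n c.E
  card : c.E.card = G.edgeSet.ncard
  count : c.c = G.copyCount P

theorem Phase.mono {sq : Bool} {n M M' I : ℕ} {c : Cfg} {X Y : Finset ℕ} (h : Phase sq n M I c X Y)
    (hM : M ≤ M') : Phase sq n M' I c X Y :=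
  { h with
    ok := { h.ok with
      sum_le := h.ok.sum_le.trans (by omega)
      E_card := h.ok.E_card.trans hM
      T_card := h.ok.T_card.trans (by omega) } }

theorem Phase.withCount {sq : Bool} {n M I : ℕ} {c : Cfg} {X Y : Finset ℕ} (h : Phase sq n M I c X Y)
    {x : ℕ} (hx : x < modulus n) : Phase sq n M I { c with c := x } X Y :=
  { ok := { h.ok with
      scal_lt := by
        intro t
        rcases t with _ | _ | _ | t
        · exact h.ok.scal_lt 0
        · exact h.ok.scal_lt 1
        · exact h.ok.scal_lt 2
        · exact hx }
    T := h.T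
    half_B := h.half_B
    half_H := h.half_H
    I_le := h.I_le }

theorem Phase.dec {sq : Bool} {n M I : ℕ} {c : Cfg} {X Y : Finset ℕ} (h : Phase sq n M I c X Y) :
    Phase sq n M I { c with r := c.r - 1 } X Y :=
  { ok := { h.ok with
      scal_lt := by
        intro t
        rcases t with _ | _ | _ | t
        · exact h.ok.scal_lt 0
        · exact h.ok.scal_lt 1
        · exact lt_of_le_of_lt (Nat.sub_le _ _) (h.ok.scal_lt 2)
        · exact h.ok.scal_lt 3 }
    T := h.T
    half_B := h.half_B
    half_H := h.half_H
    I_le := h.I_le }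

theorem Phase.resize {sq : Bool} {n M I : ℕ} {c : Cfg} {X Y : Finset ℕ} (h : Phase sq n M I c X Y)
    (hnb : c.nb = gOf n c.E) (hE : Codes n c.E) : Phase sq n c.E.card I c X Y :=
  { h with
    ok := { h.ok with
      sum_le := by rw [hnb]; exact sum_card_gOf_le hE
      E_card := le_rfl
      T_card := by rw [h.T]; simp } }

/-- Puts the code of the edge between the contents of the registers `18` and `19` into register
`15`. -/
def encode : Cmd :=
  .cond (.less (.reg 18) (.reg 19))
    (.assign 15 (.plus (.times (.reg 18) (.reg 0)) (.reg 19)))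
    (.assign 15 (.plus (.times (.reg 19) (.reg 0)) (.reg 18)))

theorem encode_timed {n a b : ℕ} {s : State} (h0 : s.reg 0 = n) (h1 : s.reg 18 = a)
    (h2 : s.reg 19 = b) (ha : a < n) (hb : b < n) : Timed (wordBound 16 n) encode s 10 (fun s' =>
      (∀ y, y ≠ 15 → s'.reg y = s.reg y) ∧ s'.reg 15 = code n a b ∧ s'.tab = s.tab) := by
  have hl := code_lt ha hb
  have hW := lt_wordBound (n := n) (x := code n a b) (by omega)
  refine Timed.mono (Timed.plain (p := encode) rfl (Q := fun s' =>
      (∀ y, y ≠ 15 → s'.reg y = s.reg y) ∧ s'.reg 15 = code n a b ∧ s'.tab = s.tab) ?_)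
    (by simp [encode, Cmd.steps, Expr.cost]) (fun _ h => h)
  unfold code at hW ⊢
  by_cases h : a < b
  · rw [if_pos h] at hW ⊢
    simp +contextual [encode, Cmd.run, Expr.eval, h0, h1, h2, h, update_of_ne]
    exact mod_eq_of_lt (by omega)
  · rw [if_neg h] at hW ⊢
    simp +contextual [encode, Cmd.run, Expr.eval, h0, h1, h2, h, update_of_ne]
    exact mod_eq_of_lt (by omega)

/-- The insertion of an edge. -/
def Scheme.insertOp (D : Scheme P) : Cmd :=
  .seq prelude
  (.seq D.tick
  (.seq encode
  (.seq (setIns 9 15)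
  (.seq (.seq (.assign 16 (.reg 18)) (.assign 17 (.reg 19)))
  (.seq D.add
  (.seq (.seq (.assign 1 (.reg 18)) (.assign 2 (.reg 19)))
  (.seq D.answer
    (.store 3 (.const 0) (.const 0) (.const 0)
      (.plus (.look 3 (.const 0) (.const 0) (.const 0)) (.reg 20))))))))))

/-- The deletion of an edge. -/
def Scheme.deleteOp (D : Scheme P) : Cmd :=
  .seq prelude
  (.seq D.tick
  (.seq (.seq (.assign 1 (.reg 18)) (.assign 2 (.reg 19)))
  (.seq D.answer
  (.seq (.store 3 (.const 0) (.const 0) (.const 0)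
      (.minus (.look 3 (.const 0) (.const 0) (.const 0)) (.reg 20)))
  (.seq encode
  (.seq (setRem 9 15)
    D.unlink))))))

/-- The query for the number of copies that contain a given edge. -/
def Scheme.countEdgeOp (D : Scheme P) : Cmd :=
  .seq prelude (.seq D.answer (.assign 0 (.reg 20)))

/-- The query for the number of copies. -/
def countOp : Cmd := .assign 0 (.look 3 (.const 0) (.const 0) (.const 0))

/-- The amortized cost of an update is at most this, times `τ + 1`. -/
def Scheme.unitCost (D : Scheme P) : ℕ := 1000 * (D.C + 1000)

theorem Scheme.unitCost_ge (D : Scheme P) (τ : ℕ) :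
    2 * (D.C * (τ + 1)) + 4 * D.rate τ + D.dues τ + 20 * τ + 1000 ≤ D.unitCost * (τ + 1) := by
  unfold Scheme.rate Scheme.dues Scheme.unitCost
  have e1 : 800 * (D.C + 401) * (τ + 1) = 800 * (D.C * (τ + 1)) + 320800 * (τ + 1) := by ring
  have e2 : 1000 * (D.C + 1000) * (τ + 1) = 1000 * (D.C * (τ + 1)) + 1000000 * (τ + 1) := by ring
  rw [e1, e2]
  generalize D.C * (τ + 1) = X
  omega

/-- Copies register `18` to `x` and register `19` to `y`. -/
theorem copyArgs_tr {n a b x y Pk : ℕ} {s : State} (h1 : s.reg 18 = a) (h2 : s.reg 19 = b)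
    (hx : x ≠ 19) (hxy : x ≠ y) (hP : space s.tab + 10 ≤ Pk) :
    Tr (wordBound 16 n) (.seq (.assign x (.reg 18)) (.assign y (.reg 19))) s Pk (fun t s' =>
      t = 4 ∧ (∀ z, z ≠ x → z ≠ y → s'.reg z = s.reg z) ∧ s'.reg x = a ∧ s'.reg y = b ∧
      s'.tab = s.tab) := by
  refine .of_exec (T := 4) (.seq (.assign s x (.reg 18)) (.assign _ y (.reg 19)))
    (by simp [Expr.cost]) (by omega) ⟨by simp [Expr.cost], ?_, ?_, ?_, rfl⟩
  · intro z h3 h4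
    simp [update_of_ne h3, update_of_ne h4]
  · simp [update_of_ne hxy, Expr.eval, h1]
  · simp [Expr.eval, update_of_ne hx.symm, h2]

set_option maxHeartbeats 2000000 in
theorem Scheme.insertOp_tr (D : Scheme P) {n Pk m₀ L I : ℕ} {G : SimpleGraph (Fin n)} {u v : Fin n}
    (huv : u ≠ v) (hG : ¬ G.Adj u v) {c : Cfg} (hs : Steady D G c m₀ L I)
    (hP : D.peak n (c.E.card + 1) c.k ≤ Pk)
    (hP' : D.peak n (c.E.card + 1) (threshold D.sq c.E.card) ≤ Pk)
    {s : State} (h0 : s.reg 0 = n) (h6 : s.reg 6 = 0) (h1 : s.reg 1 = u) (h2 : s.reg 2 = v)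
    (hr : Rep n c (D.F n c.nb c.B c.H) s.tab) :
    Tr (wordBound 16 n) D.insertOp s Pk (fun t s' => ∃ (c' : Cfg) (m₀' L' I' : ℕ),
      Steady D (G ⊔ SimpleGraph.edge u v) c' m₀' L' I' ∧
      Rep n c' (D.F n c'.nb c'.B c'.H) s'.tab ∧
      t + D.pot c' L' I' ≤ D.pot c L I + D.unitCost * (c'.τ + 1)) := by
  set W := wordBound 16 n with hW
  have hm := modulus_ge n
  have hmW : modulus n < W := by have := modulus_sq_le n; nlinarith
  have hph := hs.phase.mono (Nat.le_succ _)
  have hsp := hr.space_small D hph.ok hP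
  have huv' : (u : ℕ) ≠ v := fun h => huv (Fin.ext h)
  refine Tr.seq ((prelude_timed h0 h6 h1 h2).tr (by omega)) ?_
  rintro t₁ s₁ ⟨ht₁, b₁, -, -, g18, g19, tab₁⟩
  rw [← tab₁] at hr
  refine Tr.seq (D.tick_tr hph hs.ledger hs.codes hs.nb' hP hP' b₁ hr) ?_
  rintro t₂ s₂ ⟨b₂, ⟨a18, a19⟩, c₁, m₁, L₁, I₁, nb₁, E₁, cc₁, ph₁, led₁, k₁, rr₁, kk₁, rep₁, ht₂⟩
  rw [g18] at a18
  rw [g19] at a19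
  have hP₁ : D.peak n (c.E.card + 1) c₁.k ≤ Pk := by rcases kk₁ with h | h <;> rw [h] <;> assumption
  -- the set of edges
  set e := code n u v with he
  have heE : e ∉ c₁.E := by
    intro h
    refine hG (mem_nbOf_fin.1 ?_)
    rw [← hs.nb, hs.nb', mem_gOf, ← E₁]
    exact ⟨u.2, v.2, huv', h⟩
  have hlt := code_lt u.2 v.2
  have ph₂ : Phase D.sq n (c.E.card + 1) I₁ { c₁ with r := c₁.r - 1 } ∅ ∅ := ph₁.dec
  have ph₃ : Phase D.sq n (c.E.card + 1) I₁ { c₁ with r := c₁.r - 1, E := insert e c₁.E } ∅ ∅ :=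
    { ok := { ph₂.ok with
        E_sub := Finset.insert_subset (mem_range.2 hlt) ph₁.ok.E_sub
        E_card := by
          simp only
          rw [card_insert_of_notMem heE, E₁] }
      T := ph₁.T
      half_B := ph₁.half_B
      half_H := ph₁.half_H
      I_le := ph₁.I_le }
  have sp₂ := rep₁.space_small D ph₂.ok hP₁
  refine Tr.seq ((encode_timed b₂.r0 a18 a19 u.2 v.2).tr (by omega)) ?_
  rintro t₃ s₃ ⟨ht₃, reg₃, r15, tab₃⟩
  rw [← tab₃] at rep₁ sp₂
  have b₃ : Base n s₃.reg := b₂.congr fun y hy _ _ _ => reg₃ y (by omega)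
  have hEc : c₁.E.card ≤ n * n := by simpa using card_le_card ph₁.ok.E_sub
  refine Tr.seq ((rep₁.setIns (c' := { c₁ with r := c₁.r - 1, E := insert e c₁.E }) 9 15
    (by rw [b₃.r9, r15, Cfg.sets_E]; exact heE)
    (by rw [b₃.r9, Cfg.sets_E]; simp only; omega)
    (by rw [b₃.r9, r15, Cfg.sets_E, sets_update_E]) rfl).tr (P := Pk) (by omega)) ?_
  rintro t₄ s₄ ⟨ht₄, reg₄, rep₄, -⟩
  have b₄ : Base n s₄.reg := by rw [reg₄]; exact b₃
  have sp₄ := rep₄.space_small D ph₃.ok hP₁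
  refine Tr.seq (copyArgs_tr (a := u) (b := v) (by rw [reg₄, reg₃ _ (by omega), a18])
    (by rw [reg₄, reg₃ _ (by omega), a19]) (by omega) (by omega) (by omega)) ?_
  rintro _ s₅ ⟨rfl, reg₅, x16, x17, tab₅⟩
  have b₅ : Base n s₅.reg := b₄.congr fun y hy _ _ _ => reg₅ y (by omega) (by omega)
  rw [← tab₅] at rep₄ sp₄
  have hgOf : addE c₁.nb u v = gOf n (insert e c₁.E) := by
    rw [nb₁, hs.nb', ← E₁, addE_gOf _ u.2 v.2 huv']
  have hcodes : Codes n (insert e c₁.E) := by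
    rw [E₁]; exact hs.codes.insert u.2 v.2 huv'
  refine Tr.seq (D.add_tr ph₃ k₁ (by have := led₁.I_le; simp only; omega) ?_ hP₁ u.2 v.2 huv' ?_ b₅
    x16 x17 rep₄) ?_
  · simp only
    rw [hgOf]
    refine (sum_card_gOf_le hcodes).trans ?_
    rw [card_insert_of_notMem heE, E₁]
  · simp only
    rw [nb₁, hs.nb, mem_nbOf_fin]; exact hG
  rintro t₆ s₆ ⟨b₆, f₆, c₄, sm₄, ph₄, rep₆, ht₆⟩
  have sm_nb : c₄.nb = addE c₁.nb u v := sm₄.nb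
  have sm_E : c₄.E = insert e c₁.E := sm₄.E
  have sm_k : c₄.k = c₁.k := sm₄.k
  have sm_τ : c₄.τ = c₁.τ := sm₄.τ
  have sm_r : c₄.r = c₁.r - 1 := sm₄.r
  have sm_c : c₄.c = c₁.c := sm₄.c
  have hP₄ : D.peak n (c.E.card + 1) c₄.k ≤ Pk := by rw [sm_k]; exact hP₁
  have sp₆ := rep₆.space_small D ph₄.ok hP₄
  have x18 : s₅.reg 18 = u := by rw [reg₅ _ (by omega) (by omega), reg₄, reg₃ _ (by omega), a18]
  have x19 : s₅.reg 19 = v := by rw [reg₅ _ (by omega) (by omega), reg₄, reg₃ _ (by omega), a19]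
  refine Tr.seq (copyArgs_tr (a := u) (b := v) (by rw [f₆.reg _ (by omega) (by omega), x18])
    (by rw [f₆.reg _ (by omega) (by omega), x19]) (by omega) (by omega) (by omega)) ?_
  rintro _ s₇ ⟨rfl, reg₇, y1, y2, tab₇⟩
  have b₇ : Base n s₇.reg := b₆.congr fun y hy h1 h2 _ => reg₇ y h1 h2
  rw [← tab₇] at rep₆ sp₆
  have hnb₄ : c₄.nb = nbOf (G ⊔ SimpleGraph.edge u v) := by
    rw [sm_nb, nb₁, hs.nb, nbOf_sup_edge hG huv]
  refine Tr.seq ((D.answer_timed ph₄.ok hnb₄ (adj_sup_edge huv) b₇ rep₆ y1 y2).tr (P := Pk)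
    (le_trans (by omega) (D.space_link ph₄.ok rep₆ hP₄))) ?_
  rintro t₈ s₈ ⟨ht₈, reg₈, r20, tab₈⟩
  rw [← tab₈] at rep₆ sp₆
  have hr3 : s₈.tab (3, 0, 0, 0) = c₄.c := by rw [rep₆.scal 3 (by omega), if_pos rfl]; rfl
  have hcount : c₄.c + copyCountEdge (G ⊔ SimpleGraph.edge u v) P s(u, v) =
      (G ⊔ SimpleGraph.edge u v).copyCount P := by
    rw [copyCount_eq_add P (G ⊔ SimpleGraph.edge u v) s(u, v), deleteEdges_sup_edge hG huv, sm_c,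
      cc₁, hs.count]
  have hcle := copyCount_le P (G ⊔ SimpleGraph.edge u v)
  have hpow := two_mul_pow_lt_modulus n
  have W0 : 0 % W = 0 := Nat.zero_mod _
  have Wc : (c₄.c + copyCountEdge (G ⊔ SimpleGraph.edge u v) P s(u, v)) % W =
      (G ⊔ SimpleGraph.edge u v).copyCount P := by
    rw [hcount]; exact mod_eq_of_lt (by omega)
  have hcard : c₄.E.card = c.E.card + 1 := by
    rw [sm_E, card_insert_of_notMem heE, E₁]
  refine .of_exec (T := 10) (.store s₈ 3 _ _ _ _ _ rfl) (by simp [Expr.cost]) (by omega) ?_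
  refine ⟨{ c₄ with c := (G ⊔ SimpleGraph.edge u v).copyCount P }, m₁, L₁, I₁ + 1,
    { phase := ?_, ledger := ?_, codes := ?_, nb := hnb₄, nb' := ?_, card := ?_, count := rfl },
    ?_, ?_⟩
  · have := ph₄
    rw [← hcard] at this
    exact this.withCount (by omega)
  · obtain ⟨l1, l2, l3, l4, l5, l6, l7, l8, l9, l10⟩ := led₁
    have hE' := congrArg Finset.card E₁
    constructor
    all_goals try simp only [sm_k, sm_τ, sm_r, hcard]
    all_goals omega
  · simp only [sm_E]; exact hcodes
  · simp only [sm_nb, sm_E]; exact hgOf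
  · simp only [hcard]
    rw [← ncard_edgeSet_deleteEdges (adj_sup_edge huv), deleteEdges_sup_edge hG huv, hs.card]
  · refine rep₆.store_scal (t := 3) (by omega) ?_ rfl rfl ?_
    · simp only [Expr.eval, W0, hr3, r20]
      rw [Wc]; rfl
    · intro t' ht' hne
      interval_cases t'
      · rfl
      · rfl
      · rfl
      · exact absurd rfl hne
  · have w₁ := ph₁.weight_le
    have w₄ := ph₄.weight_le
    obtain ⟨d₁, hd₁⟩ := Nat.exists_eq_add_of_le w₁
    obtain ⟨d₂, hd₂⟩ := Nat.exists_eq_add_of_le w₄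
    obtain ⟨d₃, hd₃⟩ := Nat.exists_eq_add_of_le led₁.r_le
    have hw : Cfg.weight { c₄ with c := (G ⊔ SimpleGraph.edge u v).copyCount P } = c₄.weight := rfl
    have hw' : Cfg.weight { c₁ with r := c₁.r - 1, E := insert e c₁.E } = c₁.weight := rfl
    have hz := D.unitCost_ge c₁.τ
    have e1 : D.rate c₁.τ * (4 * (I₁ + 1)) = D.rate c₁.τ * c₄.weight + D.rate c₁.τ * d₂ := by
      rw [hd₂, Nat.mul_add]
    have e2 : D.rate c₁.τ * (4 * I₁) = D.rate c₁.τ * c₁.weight + D.rate c₁.τ * d₁ := by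
      rw [hd₁, Nat.mul_add]
    have e3 : D.rate c₁.τ * (4 * (I₁ + 1)) = D.rate c₁.τ * (4 * I₁) + 4 * D.rate c₁.τ := by ring
    have e4 : L₁ - (c₁.r - 1) = d₃ + 1 := by omega
    have e5 : L₁ - c₁.r = d₃ := by omega
    rw [sm_k, ← ph₁.ok.tau_eq] at ht₈
    rw [hw'] at ht₆
    unfold Scheme.pot at ht₂ ⊢
    rw [hd₁, Nat.add_sub_cancel_left, e5] at ht₂
    rw [hw]
    simp only [sm_τ, sm_r]
    rw [hd₂, Nat.add_sub_cancel_left, e4, Nat.mul_add]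
    simp only [Expr.cost] at *
    omega

set_option maxHeartbeats 2000000 in
theorem Scheme.deleteOp_tr (D : Scheme P) {n Pk m₀ L I : ℕ} {G : SimpleGraph (Fin n)} {u v : Fin n}
    (hG : G.Adj u v) {c : Cfg} (hs : Steady D G c m₀ L I)
    (hP : D.peak n c.E.card c.k ≤ Pk) (hP' : D.peak n c.E.card (threshold D.sq c.E.card) ≤ Pk)
    {s : State} (h0 : s.reg 0 = n) (h6 : s.reg 6 = 0) (h1 : s.reg 1 = u) (h2 : s.reg 2 = v)
    (hr : Rep n c (D.F n c.nb c.B c.H) s.tab) :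
    Tr (wordBound 16 n) D.deleteOp s Pk (fun t s' => ∃ (c' : Cfg) (m₀' L' I' : ℕ),
      Steady D (G.deleteEdges {s(u, v)}) c' m₀' L' I' ∧
      Rep n c' (D.F n c'.nb c'.B c'.H) s'.tab ∧
      t + D.pot c' L' I' ≤ D.pot c L I + D.unitCost * (c'.τ + 1)) := by
  set W := wordBound 16 n with hW
  have hm := modulus_ge n
  have hph := hs.phase
  have hsp := hr.space_small D hph.ok hP
  have huv : u ≠ v := hG.ne
  have huv' : (u : ℕ) ≠ v := fun h => huv (Fin.ext h)
  have W0 : 0 % W = 0 := Nat.zero_mod _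
  refine Tr.seq ((prelude_timed h0 h6 h1 h2).tr (by omega)) ?_
  rintro t₁ s₁ ⟨ht₁, b₁, -, -, g18, g19, tab₁⟩
  rw [← tab₁] at hr
  refine Tr.seq (D.tick_tr hph hs.ledger hs.codes hs.nb' hP hP' b₁ hr) ?_
  rintro t₂ s₂ ⟨b₂, ⟨a18, a19⟩, c₁, m₁, L₁, I₁, nb₁, E₁, cc₁, ph₁, led₁, k₁, rr₁, kk₁, rep₁, ht₂⟩
  rw [g18] at a18
  rw [g19] at a19
  have hP₁ : D.peak n c.E.card c₁.k ≤ Pk := by rcases kk₁ with h | h <;> rw [h] <;> assumption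
  have ph₂ := ph₁.dec
  have sp₂ := rep₁.space_small D ph₂.ok hP₁
  refine Tr.seq (copyArgs_tr (a := u) (b := v) a18 a19 (by omega) (by omega) (by omega)) ?_
  rintro _ s₃ ⟨rfl, reg₃, y1, y2, tab₃⟩
  rw [← tab₃] at rep₁ sp₂
  have b₃ : Base n s₃.reg := b₂.congr fun y hy h1 h2 _ => reg₃ y h1 h2
  have hnb₁ : c₁.nb = nbOf G := by rw [nb₁, hs.nb]
  refine Tr.seq ((D.answer_timed ph₂.ok hnb₁ hG b₃ rep₁ y1 y2).tr (P := Pk)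
    (le_trans (by omega) (D.space_link ph₂.ok rep₁ hP₁))) ?_
  rintro t₄ s₄ ⟨ht₄, reg₄, r20, tab₄⟩
  rw [← tab₄] at rep₁ sp₂
  have b₄ : Base n s₄.reg := b₃.congr fun y hy h1 h2 h4 => reg₄ y (by omega) h4 (by omega)
  have hr3 : s₄.tab (3, 0, 0, 0) = c₁.c := by rw [rep₁.scal 3 (by omega), if_pos rfl]; rfl
  have hcount := copyCount_eq_add P G s(u, v)
  have hcle := copyCount_le P G
  have hpow := two_mul_pow_lt_modulus n
  have hsub : c₁.c - copyCountEdge G P s(u, v) = (G.deleteEdges {s(u, v)}).copyCount P := by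
    rw [cc₁, hs.count]; omega
  have ph₅ := ph₂.withCount (x := (G.deleteEdges {s(u, v)}).copyCount P) (by omega)
  refine Tr.seq (Q₁ := fun t s' => t = 10 ∧ s'.reg = s₄.reg ∧
    Rep n { c₁ with r := c₁.r - 1, c := (G.deleteEdges {s(u, v)}).copyCount P }
      (D.F n c₁.nb c₁.B c₁.H) s'.tab) ?_ ?_
  · refine .of_exec (T := 10) (.store s₄ 3 _ _ _ _ _ rfl) (by simp [Expr.cost]) (by omega) ?_
    refine ⟨by simp [Expr.cost], rfl, rep₁.store_scal (t := 3) (by omega) ?_ rfl rfl ?_⟩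
    · simp only [Expr.eval, W0, hr3, r20]
      rw [hsub]; rfl
    · intro t' ht' hne
      interval_cases t'
      · rfl
      · rfl
      · rfl
      · exact absurd rfl hne
  rintro _ s₅ ⟨rfl, reg₅, rep₅⟩
  have b₅ : Base n s₅.reg := by rw [reg₅]; exact b₄
  have sp₅ := rep₅.space_small D ph₅.ok hP₁
  have hreg₅ : ∀ y < 22, y ≠ 1 → y ≠ 2 → y ≠ 4 → y ≠ 20 → s₅.reg y = s₂.reg y :=
    fun y h h1 h2 h4 h20 => by rw [reg₅, reg₄ y h h4 h20, reg₃ y h1 h2]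
  set e := code n u v with he
  have heE : e ∈ c₁.E := by
    have h : (v : ℕ) ∈ nbOf G u := mem_nbOf_fin.2 hG
    rw [← hs.nb, hs.nb', mem_gOf, ← E₁] at h
    exact h.2.2.2
  refine Tr.seq ((encode_timed b₅.r0
    (by rw [hreg₅ 18 (by omega) (by omega) (by omega) (by omega) (by omega), a18])
    (by rw [hreg₅ 19 (by omega) (by omega) (by omega) (by omega) (by omega), a19])
    u.2 v.2).tr (by omega)) ?_
  rintro t₆ s₆ ⟨ht₆, reg₆, r15, tab₆⟩
  rw [← tab₆] at rep₅ sp₅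
  have b₆ : Base n s₆.reg := b₅.congr fun y hy _ _ _ => reg₆ y (by omega)
  have ph₇ : Phase D.sq n c.E.card I₁ { c₁ with
      r := c₁.r - 1, c := (G.deleteEdges {s(u, v)}).copyCount P, E := c₁.E.erase e } ∅ ∅ :=
    { ok := { ph₅.ok with
        E_sub := (Finset.erase_subset _ _).trans ph₁.ok.E_sub
        E_card := (card_le_card (Finset.erase_subset _ _)).trans ph₁.ok.E_card }
      T := ph₁.T
      half_B := ph₁.half_B
      half_H := ph₁.half_H
      I_le := ph₁.I_le }
  refine Tr.seq ((rep₅.setRem (c' := { c₁ with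
      r := c₁.r - 1, c := (G.deleteEdges {s(u, v)}).copyCount P, E := c₁.E.erase e }) 9 15
    (by omega) (by omega)
    (by rw [b₆.r9, r15, Cfg.sets_E]; exact heE)
    (by rw [b₆.r9, r15, Cfg.sets_E, sets_update_E]) rfl).tr (P := Pk) (by omega)) ?_
  rintro t₇ s₇ ⟨ht₇, reg₇, rep₇⟩
  have b₇ : Base n s₇.reg := b₆.congr fun y hy _ _ _ => reg₇ y (by omega)
  have z1 : s₇.reg 1 = u := by
    rw [reg₇ 1 (by omega), reg₆ 1 (by omega), reg₅, reg₄ 1 (by omega) (by omega) (by omega), y1]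
  have z2 : s₇.reg 2 = v := by
    rw [reg₇ 2 (by omega), reg₆ 2 (by omega), reg₅, reg₄ 2 (by omega) (by omega) (by omega), y2]
  refine Tr.imp ((D.unlink_timed ph₇.ok b₇ rep₇ z1 z2 u.2 v.2 huv'
    (by simp only; rw [hnb₁]; exact mem_nbOf_fin.2 hG)).tr (P := Pk)
    (D.space_link ph₇.ok rep₇ hP₁)) ?_
  rintro t₈ s₈ ⟨ht₈, rep₈, -⟩
  have hgOf : delE c₁.nb u v = gOf n (c₁.E.erase e) := by
    rw [nb₁, hs.nb', ← E₁, delE_gOf _ u.2 v.2 huv']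
  have hcodes : Codes n (c₁.E.erase e) := by
    rw [E₁]; exact hs.codes.mono (Finset.erase_subset _ _)
  have hcard : (c₁.E.erase e).card + 1 = c.E.card := by
    rw [Finset.card_erase_add_one heE, E₁]
  refine ⟨{ c₁ with
      r := c₁.r - 1, c := (G.deleteEdges {s(u, v)}).copyCount P, E := c₁.E.erase e,
      nb := delE c₁.nb u v }, m₁, L₁, I₁,
    { phase := ?_, ledger := ?_, codes := hcodes, nb := ?_, nb' := hgOf, card := ?_, count := rfl },
    rep₈, ?_⟩
  · refine Phase.resize (M := c.E.card) ?_ hgOf hcodes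
    exact
      { ok :=
          { ph₇.ok with
            gr := ph₁.ok.gr.delE huv'
            sum_le := (sum_le_sum fun x _ =>
              card_le_card (delE_subset _ huv' x)).trans ph₁.ok.sum_le
            cheap :=
              { big := fun x hx => (card_le_card (delE_subset _ huv' x)).trans
                  (ph₁.ok.cheap.big x hx)
                huge := fun x hx => (card_le_card (delE_subset _ huv' x)).trans
                  (ph₁.ok.cheap.huge x hx)
                B_card := ph₁.ok.cheap.B_card
                H_card := ph₁.ok.cheap.H_card } }
        T := ph₁.T
        half_B := ph₁.half_B.delE huv'
        half_H := ph₁.half_H.delE huv'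
        I_le := ph₁.I_le }
  · obtain ⟨l1, l2, l3, l4, l5, l6, l7, l8, l9, l10⟩ := led₁
    have hE' := congrArg Finset.card E₁
    constructor
    all_goals try simp only
    all_goals omega
  · simp only
    rw [hnb₁, nbOf_deleteEdges huv]
  · simp only
    have := ncard_edgeSet_deleteEdges hG
    rw [← hs.card] at this
    omega
  · have w₁ := ph₁.weight_le
    obtain ⟨d₁, hd₁⟩ := Nat.exists_eq_add_of_le w₁
    obtain ⟨d₃, hd₃⟩ := Nat.exists_eq_add_of_le led₁.r_le
    have hz := D.unitCost_ge c₁.τ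
    have e4 : L₁ - (c₁.r - 1) = d₃ + 1 := by omega
    have e5 : L₁ - c₁.r = d₃ := by omega
    simp only at ht₄ ht₈
    rw [← ph₁.ok.tau_eq] at ht₄ ht₈
    unfold Scheme.pot at ht₂ ⊢
    simp only [Cfg.weight] at ht₂ hd₁ ⊢
    rw [hd₁, Nat.add_sub_cancel_left] at ht₂ ⊢
    rw [e5] at ht₂
    rw [e4, Nat.mul_add]
    omega

theorem Scheme.countEdgeOp_tr (D : Scheme P) {n Pk m₀ L I : ℕ} {G : SimpleGraph (Fin n)}
    {u v : Fin n} (hG : G.Adj u v) {c : Cfg} (hs : Steady D G c m₀ L I)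
    (hP : D.peak n c.E.card c.k ≤ Pk)
    {s : State} (h0 : s.reg 0 = n) (h6 : s.reg 6 = 0) (h1 : s.reg 1 = u) (h2 : s.reg 2 = v)
    (hr : Rep n c (D.F n c.nb c.B c.H) s.tab) :
    Tr (wordBound 16 n) D.countEdgeOp s Pk (fun t s' => s'.tab = s.tab ∧
      s'.reg 0 = copyCountEdge G P s(u, v) ∧ t ≤ D.unitCost * (c.τ + 1)) := by
  have hph := hs.phase
  have hsp := hr.space_small D hph.ok hP
  refine Tr.seq ((prelude_timed h0 h6 h1 h2).tr (by omega)) ?_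
  rintro t₁ s₁ ⟨ht₁, b₁, g1, g2, -, -, tab₁⟩
  rw [← tab₁] at hr hsp
  refine Tr.seq ((D.answer_timed hph.ok hs.nb hG b₁ hr g1 g2).tr (P := Pk)
    (le_trans (by omega) (D.space_link hph.ok hr hP))) ?_
  rintro t₄ s₄ ⟨ht₄, reg₄, r20, tab₄⟩
  rw [← tab₄] at hsp
  refine .of_exec (T := 2) (.assign s₄ 0 (.reg 20)) (by simp [Expr.cost]) (by omega) ?_
  refine ⟨by simp only [tab₄, tab₁], by simp [Expr.eval, r20], ?_⟩
  have := D.unitCost_ge c.τ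
  rw [← hph.ok.tau_eq] at ht₄
  simp only [Expr.cost]
  omega

theorem Scheme.countOp_tr (D : Scheme P) {n Pk m₀ L I : ℕ} {G : SimpleGraph (Fin n)}
    {c : Cfg} (hs : Steady D G c m₀ L I) (hP : D.peak n c.E.card c.k ≤ Pk)
    {s : State} (hr : Rep n c (D.F n c.nb c.B c.H) s.tab) :
    Tr (wordBound 16 n) countOp s Pk (fun t s' => s'.tab = s.tab ∧
      s'.reg 0 = G.copyCount P ∧ t ≤ 10) := by
  have hsp := hr.space_small D hs.phase.ok hP
  have hr3 : s.tab (3, 0, 0, 0) = G.copyCount P := by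
    rw [hr.scal 3 (by omega), if_pos rfl, ← hs.count]; rfl
  refine .of_exec (T := 10) (.assign s 0 _) (by simp [Expr.cost]) (by omega) ?_
  exact ⟨rfl, by simp [Expr.eval, hr3], by simp [Expr.cost]⟩

/-! ### Sequences of operations -/

/-- The dynamic algorithm given by a scheme. -/
def Scheme.algorithm (D : Scheme P) : Algorithm :=
  ⟨D.insertOp, D.deleteOp, countOp, D.countEdgeOp⟩

/-- What is known between two operations: the tables and the ghost variables. -/
structure Snapshot (D : Scheme P) {n : ℕ} (G : SimpleGraph (Fin n)) where
  c : Cfg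
  m₀ : ℕ
  L : ℕ
  I : ℕ
  μ : Tables
  steady : Steady D G c m₀ L I
  rep : Rep n c (D.F n c.nb c.B c.H) μ

/-- The initial state, in which nothing is stored. -/
theorem exists_snapshot_bot (D : Scheme P) (n : ℕ) (hP : P ≠ ⊥) :
    ∃ x : Snapshot D (⊥ : SimpleGraph (Fin n)), x.μ = 0 ∧ D.pot x.c x.L x.I = 0 := by
  let c : Cfg := ⟨fun _ => ∅, ∅, ∅, ∅, ∅, 0, 0, 0, 0⟩
  have hm := modulus_ge n
  have hsc : ∀ t, c.scal t = 0 := by rintro (_ | _ | _ | t) <;> rfl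
  have hset : ∀ s, c.sets n s = ∅ := by
    intro s
    rcases c.sets_cases n s with h | h | h | h | h | h <;> rw [h.2]
  have hτ : tau D.sq 0 = 0 := by unfold tau; split_ifs <;> rfl
  have hcnt : (⊥ : SimpleGraph (Fin n)).copyCount P = 0 := by
    rw [SimpleGraph.copyCount_eq_zero]
    exact SimpleGraph.free_bot hP
  have hsteady : Steady D (⊥ : SimpleGraph (Fin n)) c 0 0 0 :=
    { phase :=
        { ok :=
            { gr := ⟨by simp [c], by simp [c], by simp [c]⟩
              B_sub := by simp [c]
              H_sub := by simp [c]
              T_sub := by simp [c]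
              E_sub := by simp [c]
              scal_lt := fun t => by rw [hsc]; omega
              tau_eq := hτ.symm
              sum_le := by simp [c]
              E_card := le_rfl
              T_card := by simp [c]
              cheap := ⟨by simp [c], by simp [c], by simp [c], by simp [c]⟩ }
          T := rfl
          half_B := ⟨by simp [c], by simp [c], by simp [c]⟩
          half_H := ⟨by simp [c], by simp [c], by simp [c]⟩
          I_le := by simp }
      ledger := by
        constructor <;> simp [c]
      codes := by intro e he; simp [c] at he
      nb := nbOf_bot.symm
      nb' := (gOf_empty n).symm
      card := by simp [c]
      count := hcnt.symm }
  refine ⟨⟨c, 0, 0, 0, 0, hsteady, ⟨⟨?_, ?_, ?_, ?_, ?_, ?_, ?_, ?_⟩, ?_, ?_⟩⟩, rfl, ?_⟩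
  · intro s; simp [hset]
  · intro s i hi; simp [hset] at hi
  · intro s x hx; simp [hset] at hx
  · intros; simp
  · intros; simp
  · intros; simp
  · intros; simp
  · intros; simp
  · intro key _
    simp [c, D.F_empty]
  · intro t _ a
    simp [hsc]
  · simp [Scheme.pot, Cfg.weight, c]

/-- What is claimed about one operation. -/
structure Step (D : Scheme P) {n : ℕ} {G : SimpleGraph (Fin n)} (op : Op n) (x : Snapshot D G)
    (y : Snapshot D (op.apply G)) (time peak out : ℕ) : Prop where
  performs : D.algorithm.Performs 16 op x.μ y.μ time peak out
  correct : op.Correct P G out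
  update : op.isUpdate = true →
    time + D.pot y.c y.L y.I ≤ D.pot x.c x.L x.I + D.unitCost * (y.c.τ + 1)
  query : op.isUpdate = false → D.pot y.c y.L y.I = D.pot x.c x.L x.I
  space : ∃ k, k * tau D.sq k ≤ 40 * ((op.apply G).edgeSet.ncard + 1) ∧
    peak ≤ D.peak n ((op.apply G).edgeSet.ncard + 1) k
  count : op = .count → time ≤ 10
  countEdge : ∀ u v, op = .countEdge u v → time ≤ D.unitCost * (x.c.τ + 1)

theorem Snapshot.mul_tau_le {D : Scheme P} {n : ℕ} {G : SimpleGraph (Fin n)} (x : Snapshot D G) :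
    x.c.k * tau D.sq x.c.k ≤ 16 * G.edgeSet.ncard + 24 := by
  have l := x.steady.ledger
  have h1 := l.le_start
  have h2 := l.down
  have h3 := l.r_le
  have h4 := l.L_le
  have h5 := x.steady.card
  rw [x.steady.phase.ok.tau_eq] at h1
  generalize x.c.k * tau D.sq x.c.k = q at *
  omega

theorem Snapshot.exists_peak {D : Scheme P} {n m : ℕ} {G : SimpleGraph (Fin n)} (x : Snapshot D G)
    (hm : G.edgeSet.ncard ≤ m + 1) : ∃ k, k * tau D.sq k ≤ 40 * (m + 1) ∧ x.c.k ≤ k ∧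
      threshold D.sq x.c.E.card ≤ k := by
  have h1 := x.mul_tau_le
  have h2 := threshold_mul_le D.sq x.c.E.card
  rw [x.steady.card] at h2 ⊢
  refine ⟨max x.c.k (threshold D.sq G.edgeSet.ncard), ?_, le_max_left _ _, le_max_right _ _⟩
  rcases max_cases x.c.k (threshold D.sq G.edgeSet.ncard) with h | h <;> rw [h.1] <;> omega

theorem exists_step {D : Scheme P} {n : ℕ} {G : SimpleGraph (Fin n)} (op : Op n) (hv : op.Valid G)
    (x : Snapshot D G) : ∃ (y : Snapshot D (op.apply G)) (time peak out : ℕ),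
      Step D op x y time peak out := by
  rcases op with ⟨u, v⟩ | ⟨u, v⟩ | _ | ⟨u, v⟩
  · have hcard : (G ⊔ SimpleGraph.edge u v).edgeSet.ncard = G.edgeSet.ncard + 1 := by
      rw [← ncard_edgeSet_deleteEdges (adj_sup_edge hv.1), deleteEdges_sup_edge hv.2 hv.1]
    obtain ⟨k, k1, k2, k3⟩ := x.exists_peak (m := (G ⊔ SimpleGraph.edge u v).edgeSet.ncard) (by omega)
    obtain ⟨s', t, p, ex, hp, c', m₀', L', I', st, rep, ht⟩ := D.insertOp_tr hv.1 hv.2 x.steady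
      (Pk := D.peak n ((G ⊔ SimpleGraph.edge u v).edgeSet.ncard + 1) k)
      (D.peak_mono (by rw [x.steady.card]; omega) k2) (D.peak_mono (by rw [x.steady.card]; omega) k3)
      (s := ⟨(Op.insert u v).input, x.μ⟩) rfl rfl rfl rfl x.rep
    exact ⟨⟨c', m₀', L', I', s'.tab, st, rep⟩, t, p, _,
      { performs := ⟨s'.reg, ex, rfl⟩
        correct := trivial
        update := fun _ => ht
        query := fun h => by simp [Op.isUpdate] at h
        space := ⟨k, k1, hp⟩
        count := by simp
        countEdge := by simp }⟩
  · have hv' : G.Adj u v := hv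
    have hcard := ncard_edgeSet_deleteEdges hv'
    obtain ⟨k, k1, k2, k3⟩ := x.exists_peak (m := (G.deleteEdges {s(u, v)}).edgeSet.ncard) (by omega)
    obtain ⟨s', t, p, ex, hp, c', m₀', L', I', st, rep, ht⟩ := D.deleteOp_tr hv' x.steady
      (Pk := D.peak n ((G.deleteEdges {s(u, v)}).edgeSet.ncard + 1) k)
      (D.peak_mono (by rw [x.steady.card]; omega) k2) (D.peak_mono (by rw [x.steady.card]; omega) k3)
      (s := ⟨(Op.delete u v).input, x.μ⟩) rfl rfl rfl rfl x.rep
    exact ⟨⟨c', m₀', L', I', s'.tab, st, rep⟩, t, p, _,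
      { performs := ⟨s'.reg, ex, rfl⟩
        correct := trivial
        update := fun _ => ht
        query := fun h => by simp [Op.isUpdate] at h
        space := ⟨k, k1, hp⟩
        count := by simp
        countEdge := by simp }⟩
  · obtain ⟨k, k1, k2, k3⟩ := x.exists_peak (m := G.edgeSet.ncard) (by omega)
    obtain ⟨⟨ρ, μ'⟩, t, p, ex, hp, tab, out, ht⟩ := D.countOp_tr x.steady
      (Pk := D.peak n (G.edgeSet.ncard + 1) k)
      (D.peak_mono (by rw [x.steady.card]; omega) k2)
      (s := ⟨(Op.count : Op n).input, x.μ⟩) x.rep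
    obtain rfl : μ' = x.μ := tab
    exact ⟨x, t, p, _,
      { performs := ⟨ρ, ex, rfl⟩
        correct := out
        update := fun h => by simp [Op.isUpdate] at h
        query := fun _ => rfl
        space := ⟨k, k1, hp⟩
        count := fun _ => ht
        countEdge := by simp }⟩
  · have hv' : G.Adj u v := hv
    obtain ⟨k, k1, k2, k3⟩ := x.exists_peak (m := G.edgeSet.ncard) (by omega)
    obtain ⟨⟨ρ, μ'⟩, t, p, ex, hp, tab, out, ht⟩ := D.countEdgeOp_tr hv' x.steady
      (Pk := D.peak n (G.edgeSet.ncard + 1) k)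
      (D.peak_mono (by rw [x.steady.card]; omega) k2)
      (s := ⟨(Op.countEdge u v).input, x.μ⟩) rfl rfl rfl rfl x.rep
    obtain rfl : μ' = x.μ := tab
    exact ⟨x, t, p, _,
      { performs := ⟨ρ, ex, rfl⟩
        correct := out
        update := fun h => by simp [Op.isUpdate] at h
        query := fun _ => rfl
        space := ⟨k, k1, hp⟩
        count := by simp
        countEdge := fun _ _ _ => ht }⟩

/-- A scheme gives a dynamic algorithm with the bounds `upd`, `qry` and `spc`, if these majorize
the threshold for huge vertices and the size of the tables. -/
theorem Scheme.maintains (D : Scheme P) (hP : P ≠ ⊥) {upd qry spc : ℕ → ℕ → ℝ} {C₀ : ℕ}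
    (hupd : ∀ n m k, k * tau D.sq k ≤ 40 * (m + 1) → (tau D.sq k : ℝ) ≤ C₀ * (upd n m + 1))
    (hqry : ∀ n m k, k * tau D.sq k ≤ 40 * (m + 1) → (tau D.sq k : ℝ) ≤ C₀ * (qry n m + 1))
    (hspc : ∀ n m k, k * tau D.sq k ≤ 40 * (m + 1) → m ≤ n ^ 2 →
      (D.peak n (m + 1) k : ℝ) ≤ C₀ * (spc n m + 1))
    (hupd0 : ∀ n m, 0 ≤ upd n m) (hqry0 : ∀ n m, 0 ≤ qry n m) (hspc0 : ∀ n m, 0 ≤ spc n m) :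
    Maintains P upd qry spc := by
  refine ⟨D.algorithm, 16, D.unitCost * (C₀ + 1) + C₀ + 10, by omega, fun n ops hv => ?_⟩
  obtain ⟨x₀, hμ₀, hpot₀⟩ := exists_snapshot_bot D n hP
  choose next time peak out hstep using fun (i : ℕ) (x : Snapshot D (graphAt ops i)) =>
    exists_step (ops i) (hv i) x
  obtain ⟨X, X0, hX⟩ : ∃ X : (i : ℕ) → Snapshot D (graphAt ops i), X 0 = x₀ ∧ ∀ i,
      Step D (ops i) (X i) (X (i + 1)) (time i (X i)) (peak i (X i)) (out i (X i)) :=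
    ⟨fun i => Nat.rec x₀ (fun i x => next i x) i, rfl, fun i => hstep i _⟩
  rw [← X0] at hμ₀ hpot₀
  have hm : ∀ i, edgesAt ops i ≤ n ^ 2 := by
    intro i
    have h := (X i).steady.phase.ok.E_sub
    have h1 := card_le_card h
    rw [(X i).steady.card, Finset.card_range] at h1
    unfold edgesAt
    rw [pow_two]; exact h1
  have hτ : ∀ i, (X i).c.k * tau D.sq (X i).c.k ≤ 40 * (edgesAt ops i + 1) := by
    intro i
    have := (X i).mul_tau_le
    unfold edgesAt
    omega
  have hτ' : ∀ i, ((X i).c.τ : ℝ) = tau D.sq (X i).c.k := fun i => by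
    rw [(X i).steady.phase.ok.tau_eq]
  have hU : (0 : ℝ) ≤ D.unitCost := Nat.cast_nonneg _
  have hC : (0 : ℝ) ≤ C₀ := Nat.cast_nonneg _
  refine ⟨fun i => (X i).μ, fun i => time i (X i), fun i => peak i (X i), fun i => out i (X i),
    hμ₀, fun i => (hX i).performs, fun i => (hX i).correct, ?_, ?_, ?_, ?_⟩
  · intro N
    have key : (∑ i ∈ range N with (ops i).isUpdate, time i (X i)) +
        D.pot (X N).c (X N).L (X N).I ≤
        ∑ i ∈ range N with (ops i).isUpdate, D.unitCost * ((X (i + 1)).c.τ + 1) := by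
      induction N with
      | zero => simp [hpot₀]
      | succ N ih =>
        rw [Finset.range_add_one, Finset.filter_insert]
        by_cases h : (ops N).isUpdate = true
        · rw [if_pos h, Finset.sum_insert (by simp), Finset.sum_insert (by simp)]
          have := (hX N).update h
          omega
        · rw [if_neg h]
          have := (hX N).query (by simpa using h)
          omega
    have key' : ((∑ i ∈ range N with (ops i).isUpdate, time i (X i) : ℕ) : ℝ) ≤
        ((∑ i ∈ range N with (ops i).isUpdate, D.unitCost * ((X (i + 1)).c.τ + 1) : ℕ) : ℝ) := by
      exact_mod_cast le_trans (Nat.le_add_right _ _) key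
    refine key'.trans ?_
    push_cast
    rw [mul_sum]
    refine sum_le_sum fun i _ => ?_
    have h1 := hupd n _ _ (hτ (i + 1))
    have h2 := hupd0 n (edgesAt ops (i + 1))
    rw [hτ']
    generalize upd n (edgesAt ops (i + 1)) = y at *
    calc (D.unitCost : ℝ) * (tau D.sq (X (i + 1)).c.k + 1)
        ≤ D.unitCost * ((C₀ + 1) * (y + 1)) := by gcongr; linarith
      _ ≤ _ := by nlinarith [mul_nonneg hC h2]
  · intro i
    obtain ⟨k, h1, h2⟩ := (hX i).space
    have h3 := hspc n (edgesAt ops (i + 1)) k h1 (hm _)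
    have h4 := hspc0 n (edgesAt ops (i + 1))
    have h5 : (peak i (X i) : ℝ) ≤ D.peak n (edgesAt ops (i + 1) + 1) k := by exact_mod_cast h2
    push_cast
    nlinarith [mul_nonneg hU hC, mul_nonneg (mul_nonneg hU hC) h4, mul_nonneg hU h4]
  · intro i hi
    exact ((hX i).count hi).trans (Nat.le_add_left _ _)
  · intro i u v hi
    have h0 := (hX i).countEdge u v hi
    have h1 := hqry n _ _ (hτ i)
    have h2 := hqry0 n (edgesAt ops i)
    have h3 : (time i (X i) : ℝ) ≤ D.unitCost * ((X i).c.τ + 1) := by exact_mod_cast h0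
    rw [hτ'] at h3
    refine h3.trans ?_
    push_cast
    generalize qry n (edgesAt ops i) = y at *
    calc (D.unitCost : ℝ) * (tau D.sq (X i).c.k + 1)
        ≤ D.unitCost * ((C₀ + 1) * (y + 1)) := by refine mul_le_mul_of_nonneg_left ?_ hU; linarith
      _ ≤ _ := by nlinarith [mul_nonneg hC h2]

/-! ### Counting the copies that contain an edge -/

/-- The indicator of a proposition. -/
def ind (R : Type*) [Zero R] [One R] (p : Prop) [Decidable p] : R := if p then 1 else 0

theorem ind_and {R : Type*} [CommSemiring R] (p q : Prop) [Decidable p] [Decidable q] :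
    ind R (p ∧ q) = ind R p * ind R q := by
  unfold ind; by_cases p <;> by_cases q <;> simp [*]

/-- The indicator of adjacency or, for two vertices of the pattern that are not adjacent, of being
different. -/
def factor (R : Type*) [CommSemiring R] (nb : ℕ → Finset ℕ) (e : Bool) (x y : ℕ) : R :=
  if e then ind R (y ∈ nb x) else ind R (x ≠ y)

/-- The number of ways to extend the edge `uv` by two vertices to a labelled copy of the graph on
`{0, 1, 2, 3}` in which `0` and `1` are adjacent and the other adjacencies are given. -/
def extensions (R : Type*) [CommSemiring R] (n : ℕ) (nb : ℕ → Finset ℕ)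
    (e₀₂ e₀₃ e₁₂ e₁₃ e₂₃ : Bool) (u v : ℕ) : R :=
  ∑ x ∈ range n, ∑ y ∈ range n, factor R nb e₀₂ u x * factor R nb e₀₃ u y *
    (factor R nb e₁₂ v x * factor R nb e₁₃ v y * factor R nb e₂₃ x y)

theorem extensions_swap (R : Type*) [CommSemiring R] {n : ℕ} {nb : ℕ → Finset ℕ} (h : Gr n nb)
    (e₀₂ e₀₃ e₁₂ e₁₃ e₂₃ : Bool) (u v : ℕ) : extensions R n nb e₀₂ e₀₃ e₁₂ e₁₃ e₂₃ u v =
      extensions R n nb e₀₃ e₀₂ e₁₃ e₁₂ e₂₃ u v := by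
  unfold extensions
  rw [sum_comm]
  refine sum_congr rfl fun x _ => sum_congr rfl fun y _ => ?_
  have : factor R nb e₂₃ y x = factor R nb e₂₃ x y := by
    unfold factor
    split_ifs
    · have : x ∈ nb y ↔ y ∈ nb x := ⟨h.symm _ _, h.symm _ _⟩
      unfold ind; simp only [this]
    · unfold ind; simp only [ne_comm]
  rw [this]; ring

/-- The vertices of the pattern, with the distinct vertices `i` and `j` moved to the front. -/
def toFront (i j : Fin 4) : Fin 4 → Fin 4 :=
  ![i, j, ![![1, 2, 1, 1], ![2, 0, 0, 0], ![1, 0, 0, 0], ![1, 0, 0, 0]] i j,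
    ![![2, 3, 3, 2], ![3, 0, 3, 2], ![3, 3, 0, 1], ![2, 2, 1, 0]] i j]

theorem toFront_bijective : ∀ i j : Fin 4, i ≠ j → Function.Bijective (toFront i j) := by
  simp only [Function.Bijective, Function.Injective, Function.Surjective]
  decide

section

open SimpleGraph

variable {P : SimpleGraph (Fin 4)} {n : ℕ} {G : SimpleGraph (Fin n)}

theorem card_copies_eq (R : Type*) [CommSemiring R] {b : Fin 4 → Fin 4 → Bool}
    (hb : ∀ i j, P.Adj i j ↔ b i j = true) {σ : Fin 4 → Fin 4} (hσ : Function.Bijective σ)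
    (h01 : b (σ 0) (σ 1) = true) {u v : Fin n} (huv : G.Adj u v) :
    (Nat.card {f : Copy P G // f (σ 0) = u ∧ f (σ 1) = v} : R) =
      extensions R n (nbOf G) (b (σ 0) (σ 2)) (b (σ 0) (σ 3)) (b (σ 1) (σ 2)) (b (σ 1) (σ 3))
        (b (σ 2) (σ 3)) u v := by
  classical
  have hsymm : ∀ i j, b i j = b j i := fun i j => by
    rw [Bool.eq_iff_iff, ← hb, ← hb, P.adj_comm]
  have hirr : ∀ i, b i i = false := fun i => by
    rw [Bool.eq_false_iff, Ne, ← hb]; exact P.irrefl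
  let C : Bool → Fin n → Fin n → Prop := fun e x y => if e then G.Adj x y else x ≠ y
  have hC : ∀ (e : Bool) (x y : Fin n), factor R (nbOf G) e x y = ind R (C e x y) := by
    intro e x y
    cases e
    · simp [factor, C, ind, Fin.ext_iff]
    · simp [factor, C, ind, mem_nbOf_fin]
  have hCs : ∀ e x y, C e x y → C e y x := by
    intro e x y h
    cases e
    · simpa [C, eq_comm] using h
    · simpa [C, G.adj_comm] using h
  have hCn : ∀ e x y, C e x y → x ≠ y := by
    intro e x y h
    cases e
    · simpa [C] using h
    · exact G.ne_of_adj (by simpa [C] using h)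
  let Φ : Fin n × Fin n → Prop := fun p =>
    (C (b (σ 0) (σ 2)) u p.1 ∧ C (b (σ 0) (σ 3)) u p.2) ∧
    (C (b (σ 1) (σ 2)) v p.1 ∧ C (b (σ 1) (σ 3)) v p.2) ∧ C (b (σ 2) (σ 3)) p.1 p.2
  have hcopy : ∀ (f : Copy P G) i j, i ≠ j → C (b i j) (f i) (f j) := by
    intro f i j hij
    by_cases h : b i j = true
    · simp only [C, h, if_true]
      exact f.toHom.map_adj ((hb i j).2 h)
    · simp only [Bool.not_eq_true] at h
      simp only [C, h, Bool.false_eq_true, if_false]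
      exact fun h => hij (f.injective h)
  have hne : ∀ p q : Fin 4, p ≠ q → σ p ≠ σ q := fun p q h h' => h (hσ.1 h')
  let F : {f : Copy P G // f (σ 0) = u ∧ f (σ 1) = v} → {p : Fin n × Fin n // Φ p} := fun f =>
    ⟨(f.1 (σ 2), f.1 (σ 3)), by
      obtain ⟨f, rfl, rfl⟩ := f
      have := hcopy f
      exact ⟨⟨this _ _ (hne _ _ (by decide)), this _ _ (hne _ _ (by decide))⟩,
        ⟨this _ _ (hne _ _ (by decide)), this _ _ (hne _ _ (by decide))⟩,
        this _ _ (hne _ _ (by decide))⟩⟩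
  have hF : Function.Bijective F := by
    constructor
    · rintro ⟨f, hf⟩ ⟨g, hg⟩ h
      have h1 := congrArg (fun p => p.1.1) h
      have h2 := congrArg (fun p => p.1.2) h
      simp only [F] at h1 h2
      refine Subtype.ext (Copy.ext fun i => ?_)
      obtain ⟨p, rfl⟩ := hσ.2 i
      fin_cases p
      · exact hf.1.trans hg.1.symm
      · exact hf.2.trans hg.2.symm
      · exact h1
      · exact h2
    · rintro ⟨⟨x, y⟩, ⟨c02, c03⟩, ⟨c12, c13⟩, c23⟩
      obtain ⟨τ, hτ, hτ'⟩ := Function.bijective_iff_has_inverse.1 hσ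
      have c01 : C (b (σ 0) (σ 1)) u v := by simp only [C, h01, if_true]; exact huv
      let g : Fin 4 → Fin n := ![u, v, x, y]
      have key : ∀ p q, p ≠ q → C (b (σ p) (σ q)) (g p) (g q) := by
        intro p q hpq
        fin_cases p <;> fin_cases q
        · exact absurd rfl hpq
        · exact c01
        · exact c02
        · exact c03
        · rw [hsymm]; exact hCs _ _ _ c01
        · exact absurd rfl hpq
        · exact c12
        · exact c13
        · rw [hsymm]; exact hCs _ _ _ c02
        · rw [hsymm]; exact hCs _ _ _ c12
        · exact absurd rfl hpq
        · exact c23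
        · rw [hsymm]; exact hCs _ _ _ c03
        · rw [hsymm]; exact hCs _ _ _ c13
        · rw [hsymm]; exact hCs _ _ _ c23
        · exact absurd rfl hpq
      have key' : ∀ i j, i ≠ j → C (b i j) (g (τ i)) (g (τ j)) := by
        intro i j hij
        have := key (τ i) (τ j) (fun h => hij (by rw [← hτ' i, ← hτ' j, h]))
        rwa [hτ', hτ'] at this
      let f : Copy P G := ⟨⟨fun i => g (τ i), by
        intro i j hij
        have := key' i j hij.ne
        rw [(hb i j).1 hij] at this
        simpa [C] using this⟩, by
        intro i j h
        by_contra hij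
        exact hCn _ _ _ (key' i j hij) h⟩
      have hf : ∀ p, f (σ p) = g p := fun p => congrArg g (hτ p)
      exact ⟨⟨f, hf 0, hf 1⟩, Subtype.ext (Prod.ext (hf 2) (hf 3))⟩
  rw [Nat.card_eq_of_bijective F hF, Nat.card_eq_fintype_card, Fintype.card_subtype,
    Finset.card_filter]
  push_cast
  rw [Fintype.sum_prod_type]
  unfold extensions
  rw [Finset.sum_range]
  refine sum_congr rfl fun x _ => ?_
  rw [Finset.sum_range]
  refine sum_congr rfl fun y _ => ?_
  simp only [hC, ← ind_and]
  rfl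

/-- The copies of the pattern that contain the edge `uv`, by the edge of the pattern and the
direction in which it is mapped to `uv`. -/
theorem card_aut_mul_copyCountEdge (R : Type*) [CommSemiring R] {b : Fin 4 → Fin 4 → Bool}
    (hb : ∀ i j, P.Adj i j ↔ b i j = true) {u v : Fin n} (huv : G.Adj u v) :
    ((Nat.card (P ≃g P) * copyCountEdge G P s(u, v) : ℕ) : R) = ∑ i, ∑ j, if b i j then
      extensions R n (nbOf G) (b i (toFront i j 2)) (b i (toFront i j 3)) (b j (toFront i j 2))
        (b j (toFront i j 3)) (b (toFront i j 2) (toFront i j 3)) u v else 0 := by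
  classical
  have : Fintype (Copy P G) := Fintype.ofFinite _
  have h := card_copies_of (P := P) (G := G) {H | s(u, v) ∈ H.edgeSet}
  simp only [Set.mem_ofPred_eq] at h
  unfold copyCountEdge
  rw [← h, Nat.card_eq_fintype_card, Fintype.card_subtype, Finset.card_filter]
  have h1 : ∀ f : Copy P G, (if s(u, v) ∈ f.toSubgraph.edgeSet then 1 else 0) =
      ∑ i, ∑ j, if b i j then if f i = u ∧ f j = v then 1 else 0 else 0 := by
    intro f
    split_ifs with hf
    · rw [Subgraph.mem_edgeSet, Copy.toSubgraph_adj] at hf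
      obtain ⟨i, j, hij, rfl, rfl⟩ := hf
      rw [Finset.sum_eq_single i, Finset.sum_eq_single j]
      · simp [(hb i j).1 hij]
      · intro j' _ hj'
        have : f j' ≠ f j := fun h => hj' (f.injective h)
        simp [this]
      · simp
      · intro i' _ hi'
        have : f i' ≠ f i := fun h => hi' (f.injective h)
        simp [this]
      · simp
    · symm
      refine sum_eq_zero fun i _ => sum_eq_zero fun j _ => ?_
      split_ifs with h2 h3
      · refine absurd ?_ hf
        rw [Subgraph.mem_edgeSet, Copy.toSubgraph_adj]
        exact ⟨i, j, (hb i j).2 h2, h3.1, h3.2⟩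
      · rfl
      · rfl
  simp only [h1]
  rw [sum_comm]
  push_cast
  refine sum_congr rfl fun i _ => ?_
  rw [sum_comm]
  refine sum_congr rfl fun j _ => ?_
  by_cases h2 : b i j = true
  · have hij : i ≠ j := ((hb i j).2 h2).ne
    have h3 := card_copies_eq R hb (toFront_bijective i j hij) h2 huv
    simp only [h2, if_true]
    refine Eq.trans ?_ h3
    rw [Nat.card_eq_fintype_card, Fintype.card_subtype, Finset.card_filter]
    push_cast
    rfl
  · simp [h2]

theorem card_aut_eq {b : Fin 4 → Fin 4 → Bool} (hb : ∀ i j, P.Adj i j ↔ b i j = true) :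
    Nat.card (P ≃g P) = (Finset.univ.filter fun σ : Equiv.Perm (Fin 4) =>
      ∀ i j, b (σ i) (σ j) = b i j).card := by
  rw [← Fintype.card_subtype, ← Nat.card_eq_fintype_card]
  refine Nat.card_congr ⟨fun σ => ⟨σ.toEquiv, fun i j => ?_⟩, fun σ => ⟨σ.1, ?_⟩, ?_, ?_⟩
  · rw [Bool.eq_iff_iff, ← hb, ← hb]; exact σ.map_adj_iff
  · intro i j
    rw [hb, hb, ← Bool.eq_iff_iff]; exact σ.2 i j
  · intro σ; rfl
  · intro σ; rfl

/-- The adjacency matrix of the pattern, in a form on which `decide` can run; likewise below. -/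
def path3Adj : Fin 4 → Fin 4 → Bool :=
  ![![false, true, false, false], ![true, false, true, false], ![false, true, false, true],
    ![false, false, true, false]]

def pawAdj : Fin 4 → Fin 4 → Bool :=
  ![![false, true, true, false], ![true, false, true, false], ![true, true, false, true],
    ![false, false, true, false]]

def fourCycleAdj : Fin 4 → Fin 4 → Bool :=
  ![![false, true, false, true], ![true, false, true, false], ![false, true, false, true],
    ![true, false, true, false]]

def diamondAdj : Fin 4 → Fin 4 → Bool :=
  ![![false, true, true, true], ![true, false, true, false], ![true, true, false, true],
    ![true, false, true, false]]

theorem path3_adj : ∀ i j, path3.Adj i j ↔ path3Adj i j = true := by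
  intro i j
  rw [path3, pathGraph_adj]
  revert i j
  decide

theorem paw_adj : ∀ i j, paw.Adj i j ↔ pawAdj i j = true := by
  simp only [paw, fromEdgeSet_adj, Set.mem_insert_iff, Set.mem_singleton_iff]
  decide

theorem fourCycle_adj : ∀ i j, fourCycle.Adj i j ↔ fourCycleAdj i j = true := by
  simp only [fourCycle, cycleGraph_adj]
  decide

theorem diamond_adj : ∀ i j, diamond.Adj i j ↔ diamondAdj i j = true := by
  simp only [diamond, fromEdgeSet_adj, Set.mem_insert_iff, Set.mem_singleton_iff]
  decide

theorem card_aut_path3 : Nat.card (path3 ≃g path3) = 2 := by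
  rw [card_aut_eq path3_adj]; decide

theorem card_aut_paw : Nat.card (paw ≃g paw) = 2 := by
  rw [card_aut_eq paw_adj]; decide

theorem card_aut_fourCycle : Nat.card (fourCycle ≃g fourCycle) = 8 := by
  rw [card_aut_eq fourCycle_adj]; decide

theorem card_aut_diamond : Nat.card (diamond ≃g diamond) = 4 := by
  rw [card_aut_eq diamond_adj]; decide

end

/-! ### Closed formulas for the number of copies that contain an edge -/

section

variable (R : Type*) [CommRing R] (n : ℕ) (nb : ℕ → Finset ℕ)

/-- The adjacency matrix. -/
def adj (R : Type*) [Zero R] [One R] (nb : ℕ → Finset ℕ) (x y : ℕ) : R := ind R (y ∈ nb x)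

/-- The degree of a vertex. -/
def deg (R : Type*) [CommSemiring R] (n : ℕ) (nb : ℕ → Finset ℕ) (x : ℕ) : R :=
  ∑ y ∈ range n, adj R nb x y

/-- The walks of length two from `u` to `v`, weighted by their middle vertices. -/
def walk₂ (R : Type*) [CommSemiring R] (n : ℕ) (nb : ℕ → Finset ℕ) (w : ℕ → R) (u v : ℕ) : R :=
  ∑ c ∈ range n, w c * (adj R nb u c * adj R nb c v)

/-- The walks of length three from `u` to `v`. -/
def walk₃ (R : Type*) [CommSemiring R] (n : ℕ) (nb : ℕ → Finset ℕ) (u v : ℕ) : R :=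
  ∑ x ∈ range n, ∑ y ∈ range n, adj R nb u x * (adj R nb x y * adj R nb y v)

/-- The sum of the degrees of the neighbours of `v`, weighted by `w`. -/
def degSum (R : Type*) [CommSemiring R] (n : ℕ) (nb : ℕ → Finset ℕ) (w : ℕ → R) (v : ℕ) : R :=
  ∑ x ∈ range n, w x * (adj R nb v x * deg R n nb x)

/-- The pairs of a walk `ucv` of length two and a triangle on the edge `uc`. -/
def fan (R : Type*) [CommSemiring R] (n : ℕ) (nb : ℕ → Finset ℕ) (u v : ℕ) : R :=
  ∑ c ∈ range n, adj R nb u c * adj R nb c v *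
    ∑ d ∈ range n, adj R nb u d * adj R nb d c

variable {R n nb}

theorem Gr.adj_comm (h : Gr n nb) (x y : ℕ) : adj R nb x y = adj R nb y x := by
  have : y ∈ nb x ↔ x ∈ nb y := ⟨h.symm _ _, h.symm _ _⟩
  unfold adj ind
  simp only [this]

theorem Gr.adj_self (h : Gr n nb) (x : ℕ) : adj R nb x x = 0 := by
  simp [adj, ind, h.irrefl x]

theorem adj_mul_self (x y : ℕ) : adj R nb x y * adj R nb x y = adj R nb x y := by
  unfold adj ind; split_ifs <;> simp

theorem factor_true (x y : ℕ) : factor R nb true x y = adj R nb x y := by simp [factor, adj]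

theorem factor_false (x y : ℕ) : factor R nb false x y = 1 - ind R (x = y) := by
  unfold factor ind; by_cases h : x = y <;> simp [h]

theorem extensions_flip (e₀₂ e₀₃ e₁₂ e₁₃ e₂₃ : Bool) (u v : ℕ) :
    extensions R n nb e₀₂ e₀₃ e₁₂ e₁₃ e₂₃ u v = extensions R n nb e₁₂ e₁₃ e₀₂ e₀₃ e₂₃ v u := by
  unfold extensions
  exact sum_congr rfl fun x _ => sum_congr rfl fun y _ => by ring

theorem sum_ind_mul {x₀ : ℕ} (h : x₀ < n) (f : ℕ → R) :
    ∑ x ∈ range n, ind R (x₀ = x) * f x = f x₀ := by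
  simp [ind, ite_mul, h]

theorem sum_off {x₀ : ℕ} (h : x₀ < n) (f : ℕ → R) :
    ∑ x ∈ range n, (1 - ind R (x₀ = x)) * f x = ∑ x ∈ range n, f x - f x₀ := by
  simp only [sub_mul, one_mul, sum_sub_distrib, sum_ind_mul h]

theorem sum_off_two {x₀ x₁ : ℕ} (h : x₀ < n) (h' : x₁ < n) (hne : x₀ ≠ x₁) (f : ℕ → R) :
    ∑ x ∈ range n, (1 - ind R (x₀ = x)) * ((1 - ind R (x₁ = x)) * f x) =
      ∑ x ∈ range n, f x - f x₀ - f x₁ := by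
  rw [sum_off h, sum_off h']
  simp only [ind, hne.symm, if_false]; ring

theorem Gr.walk₂_comm (h : Gr n nb) (w : ℕ → R) (u v : ℕ) :
    walk₂ R n nb w u v = walk₂ R n nb w v u := by
  unfold walk₂
  refine sum_congr rfl fun c _ => ?_
  rw [h.adj_comm u c, h.adj_comm c v]; ring

theorem Gr.walk₂_self (h : Gr n nb) (u : ℕ) : walk₂ R n nb 1 u u = deg R n nb u := by
  unfold walk₂ deg
  refine sum_congr rfl fun c _ => ?_
  rw [h.adj_comm c u, adj_mul_self, Pi.one_apply, one_mul]

variable {u v : ℕ}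

/-- A path `uvxy`. -/
theorem Gr.extensions_end (h : Gr n nb) (hu : u < n) (hv : v < n) (huv : v ∈ nb u) :
    extensions R n nb false false true false true u v =
      degSum R n nb 1 v - walk₂ R n nb 1 u v - deg R n nb v - deg R n nb u + 1 := by
  have hne : u ≠ v := fun e => h.irrefl u (e ▸ huv)
  have h1 : adj R nb u v = 1 := by simp [adj, ind, huv]
  have key : extensions R n nb false false true false true u v = ∑ x ∈ range n,
      (1 - ind R (u = x)) * (adj R nb v x * (deg R n nb x - adj R nb x u - adj R nb x v)) := by
    refine sum_congr rfl fun x _ => ?_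
    rw [deg, ← sum_off_two hu hv hne, mul_sum, mul_sum]
    refine sum_congr rfl fun y _ => ?_
    simp only [factor_true, factor_false]; ring
  rw [key, sum_off hu, h.adj_self, h1, h.adj_comm v u, h1]
  simp only [mul_sub, sum_sub_distrib]
  have e1 : ∑ x ∈ range n, adj R nb v x * adj R nb x u = walk₂ R n nb 1 u v := by
    rw [h.walk₂_comm]; simp [walk₂]
  have e2 : ∑ x ∈ range n, adj R nb v x * adj R nb x v = deg R n nb v := by
    rw [← h.walk₂_self]; simp [walk₂]
  rw [e1, e2]; simp only [degSum, Pi.one_apply, one_mul]; ring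

theorem Gr.adj_mul_ind (h : Gr n nb) (x y : ℕ) : adj R nb x y * ind R (y = x) = 0 := by
  by_cases e : y = x
  · rw [e, h.adj_self, zero_mul]
  · simp [ind, e]

/-- A path `xuvy`. -/
theorem Gr.extensions_middle (h : Gr n nb) (hu : u < n) (hv : v < n) (huv : v ∈ nb u) :
    extensions R n nb true false false true false u v =
      (deg R n nb u - 1) * (deg R n nb v - 1) - walk₂ R n nb 1 u v := by
  have h1 : adj R nb u v = 1 := by simp [adj, ind, huv]
  have key : extensions R n nb true false false true false u v = ∑ x ∈ range n,
      (1 - ind R (v = x)) * (adj R nb u x * (deg R n nb v - 1) - adj R nb u x * adj R nb x v) := by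
    refine sum_congr rfl fun x hx => ?_
    trans (1 - ind R (v = x)) * adj R nb u x * ∑ y ∈ range n,
      (1 - ind R (u = y)) * ((1 - ind R (x = y)) * adj R nb v y)
    · rw [mul_sum]
      refine sum_congr rfl fun y _ => ?_
      simp only [factor_true, factor_false]; ring
    · rw [sum_off hu, sum_off (mem_range.1 hx), h.adj_comm v u, h1, ← deg,
        h.adj_comm v x]
      linear_combination (1 - ind R (v = x)) * h.adj_mul_ind (R := R) u x
  have e1 : ∑ x ∈ range n, adj R nb u x * adj R nb x v = walk₂ R n nb 1 u v := by
    simp [walk₂]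
  rw [key, sum_off hv, sum_sub_distrib, ← sum_mul, e1, ← deg, h.adj_self, h1]
  ring

/-- A cycle `uvxy`. -/
theorem Gr.extensions_cycle (h : Gr n nb) (hu : u < n) (hv : v < n) (huv : v ∈ nb u) :
    extensions R n nb false true true false true u v =
      walk₃ R n nb u v - deg R n nb u - deg R n nb v + 1 := by
  have h1 : adj R nb u v = 1 := by simp [adj, ind, huv]
  have key : extensions R n nb false true true false true u v = ∑ x ∈ range n,
      (1 - ind R (u = x)) * (adj R nb v x * walk₂ R n nb 1 x u - adj R nb v x * adj R nb x v) := by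
    refine sum_congr rfl fun x _ => ?_
    trans (1 - ind R (u = x)) * adj R nb v x * ∑ y ∈ range n,
      (1 - ind R (v = y)) * (adj R nb x y * adj R nb y u)
    · rw [mul_sum]
      refine sum_congr rfl fun y _ => ?_
      simp only [factor_true, factor_false]; rw [h.adj_comm u y]; ring
    · rw [sum_off hv, h.adj_comm v u, h1, walk₂]
      simp only [Pi.one_apply, one_mul]
      ring
  have e1 : ∑ x ∈ range n, adj R nb v x * walk₂ R n nb 1 x u = walk₃ R n nb u v := by
    unfold walk₃ walk₂
    rw [sum_comm]
    refine sum_congr rfl fun x _ => ?_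
    rw [mul_sum]
    refine sum_congr rfl fun y _ => ?_
    rw [Pi.one_apply, h.adj_comm u y, h.adj_comm x v, h.adj_comm y x]; ring
  have e2 : ∑ x ∈ range n, adj R nb v x * adj R nb x v = deg R n nb v := by
    rw [← h.walk₂_self]; simp [walk₂]
  rw [key, sum_off hu, sum_sub_distrib, e1, e2, h.walk₂_self, h.adj_comm v u, h1]
  ring

/-- A triangle `uvx` and an edge `xy`. -/
theorem Gr.extensions_paw (h : Gr n nb) (hu : u < n) (hv : v < n) (huv : v ∈ nb u) :
    extensions R n nb true false true false true u v =
      walk₂ R n nb (deg R n nb) u v - 2 * walk₂ R n nb 1 u v := by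
  have hne : u ≠ v := fun e => h.irrefl u (e ▸ huv)
  have key : extensions R n nb true false true false true u v = ∑ x ∈ range n,
      (deg R n nb x * (adj R nb u x * adj R nb x v) - 2 * (adj R nb u x * adj R nb x v)) := by
    refine sum_congr rfl fun x _ => ?_
    trans adj R nb u x * adj R nb v x * ∑ y ∈ range n,
      (1 - ind R (u = y)) * ((1 - ind R (v = y)) * adj R nb x y)
    · rw [mul_sum]
      refine sum_congr rfl fun y _ => ?_
      simp only [factor_true, factor_false]; ring
    · rw [sum_off_two hu hv hne, ← deg, h.adj_comm x u, h.adj_comm v x]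
      linear_combination (-adj R nb x v) * adj_mul_self (R := R) (nb := nb) u x -
        adj R nb u x * adj_mul_self (R := R) (nb := nb) x v
  rw [key, sum_sub_distrib, ← mul_sum]
  simp [walk₂]

/-- A triangle `uvx` and an edge `vy`. -/
theorem Gr.extensions_paw' (h : Gr n nb) (hu : u < n) (huv : v ∈ nb u) :
    extensions R n nb true false true true false u v =
      walk₂ R n nb 1 u v * (deg R n nb v - 2) := by
  have h1 : adj R nb u v = 1 := by simp [adj, ind, huv]
  have key : extensions R n nb true false true true false u v = ∑ x ∈ range n,
      adj R nb u x * adj R nb x v * (deg R n nb v - 2) := by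
    refine sum_congr rfl fun x hx => ?_
    trans adj R nb u x * adj R nb v x * ∑ y ∈ range n,
      (1 - ind R (u = y)) * ((1 - ind R (x = y)) * adj R nb v y)
    · rw [mul_sum]
      refine sum_congr rfl fun y _ => ?_
      simp only [factor_true, factor_false]; ring
    · rw [sum_off hu, sum_off (mem_range.1 hx), h.adj_comm v u, h1, ← deg,
        h.adj_comm v x]
      linear_combination adj R nb x v * h.adj_mul_ind (R := R) u x -
        adj R nb u x * adj_mul_self (R := R) (nb := nb) x v
  rw [key, ← sum_mul]
  simp [walk₂]

/-- An edge `uv` and a triangle `uxy`. -/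
theorem Gr.extensions_paw'' (h : Gr n nb) (hv : v < n) (huv : v ∈ nb u) :
    extensions R n nb true true false false true u v =
      walk₃ R n nb u u - 2 * walk₂ R n nb 1 u v := by
  have h1 : adj R nb u v = 1 := by simp [adj, ind, huv]
  have key : extensions R n nb true true false false true u v = ∑ x ∈ range n,
      (1 - ind R (v = x)) * (adj R nb u x * walk₂ R n nb 1 x u - adj R nb u x * adj R nb x v) := by
    refine sum_congr rfl fun x _ => ?_
    trans (1 - ind R (v = x)) * adj R nb u x * ∑ y ∈ range n,
      (1 - ind R (v = y)) * (adj R nb x y * adj R nb y u)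
    · rw [mul_sum]
      refine sum_congr rfl fun y _ => ?_
      simp only [factor_true, factor_false]; rw [h.adj_comm u y]; ring
    · rw [sum_off hv, h.adj_comm v u, h1, walk₂]
      simp only [Pi.one_apply, one_mul]
      ring
  have e1 : ∑ x ∈ range n, adj R nb u x * walk₂ R n nb 1 x u = walk₃ R n nb u u := by
    unfold walk₃ walk₂
    refine sum_congr rfl fun x _ => ?_
    rw [mul_sum]
    refine sum_congr rfl fun y _ => ?_
    rw [Pi.one_apply]; ring
  have e2 : ∑ x ∈ range n, adj R nb u x * adj R nb x v = walk₂ R n nb 1 u v := by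
    simp [walk₂]
  rw [key, sum_off hv, sum_sub_distrib, e1, e2, h1, h.adj_self, h.walk₂_comm 1 v u]
  ring

/-- Two triangles `uvx` and `uvy`. -/
theorem Gr.extensions_chord (h : Gr n nb) :
    extensions R n nb true true true true false u v =
      walk₂ R n nb 1 u v * (walk₂ R n nb 1 u v - 1) := by
  have key : extensions R n nb true true true true false u v = ∑ x ∈ range n,
      adj R nb u x * adj R nb x v * (walk₂ R n nb 1 u v - 1) := by
    refine sum_congr rfl fun x hx => ?_
    trans adj R nb u x * adj R nb v x * ∑ y ∈ range n,
      (1 - ind R (x = y)) * (adj R nb u y * adj R nb y v)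
    · rw [mul_sum]
      refine sum_congr rfl fun y _ => ?_
      simp only [factor_true, factor_false]; rw [h.adj_comm v y]; ring
    · rw [sum_off (mem_range.1 hx), h.adj_comm v x, walk₂]
      simp only [Pi.one_apply, one_mul]
      linear_combination (-adj R nb x v * adj R nb x v) * adj_mul_self (R := R) (nb := nb) u x -
        adj R nb u x * adj_mul_self (R := R) (nb := nb) x v
  rw [key, ← sum_mul]
  simp [walk₂]

/-- Two triangles `uvx` and `uxy`. -/
theorem Gr.extensions_rim (h : Gr n nb) (hv : v < n) (huv : v ∈ nb u) :
    extensions R n nb true true true false true u v = fan R n nb u v - walk₂ R n nb 1 u v := by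
  have h1 : adj R nb u v = 1 := by simp [adj, ind, huv]
  have key : extensions R n nb true true true false true u v = ∑ x ∈ range n,
      (adj R nb u x * adj R nb x v * ∑ d ∈ range n, adj R nb u d * adj R nb d x -
        adj R nb u x * adj R nb x v) := by
    refine sum_congr rfl fun x hx => ?_
    trans adj R nb u x * adj R nb v x * ∑ y ∈ range n,
      (1 - ind R (v = y)) * (adj R nb u y * adj R nb y x)
    · rw [mul_sum]
      refine sum_congr rfl fun y _ => ?_
      simp only [factor_true, factor_false]; rw [h.adj_comm y x]; ring
    · rw [sum_off hv, h1, h.adj_comm v x]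
      linear_combination (-adj R nb u x) * adj_mul_self (R := R) (nb := nb) x v
  rw [key, sum_sub_distrib, ← fan]
  simp [walk₂]

end

section

variable {R S : Type*} [CommSemiring R] [CommSemiring S] (f : S →+* R) (n : ℕ) (nb : ℕ → Finset ℕ)

theorem map_ind (p : Prop) [Decidable p] : f (ind S p) = ind R p := by
  unfold ind; split_ifs <;> simp

theorem map_adj (x y : ℕ) : f (adj S nb x y) = adj R nb x y := map_ind f _

theorem map_deg (x : ℕ) : f (deg S n nb x) = deg R n nb x := by
  simp only [deg, map_sum, map_adj]

theorem map_walk₂ (w : ℕ → S) (u v : ℕ) :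
    f (walk₂ S n nb w u v) = walk₂ R n nb (fun c => f (w c)) u v := by
  simp only [walk₂, map_sum, map_mul, map_adj]

theorem map_walk₂_one (u v : ℕ) : f (walk₂ S n nb 1 u v) = walk₂ R n nb 1 u v := by
  simp only [map_walk₂, Pi.one_apply, map_one]; rfl

theorem map_walk₃ (u v : ℕ) : f (walk₃ S n nb u v) = walk₃ R n nb u v := by
  simp only [walk₃, map_sum, map_mul, map_adj]

theorem map_degSum (w : ℕ → S) (v : ℕ) :
    f (degSum S n nb w v) = degSum R n nb (fun c => f (w c)) v := by
  simp only [degSum, map_sum, map_mul, map_adj, map_deg]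

theorem map_fan (u v : ℕ) : f (fan S n nb u v) = fan R n nb u v := by
  simp only [fan, map_sum, map_mul, map_adj]

end

/-! In each of the following formulas, the number of automorphisms is cancelled in `ℤ` before
passing to `R`. -/

section

variable (R : Type*) [CommRing R] {n : ℕ} {G : SimpleGraph (Fin n)} {u v : Fin n}

theorem two_mul_copyCountEdge_path3 (huv : G.Adj u v) (hgr : Gr n (nbOf G)) :
    2 * (copyCountEdge G path3 s(u, v) : R) =
      2 * ((deg R n (nbOf G) u - 3) * (deg R n (nbOf G) v - 3) + degSum R n (nbOf G) 1 u +
        degSum R n (nbOf G) 1 v - 6 - 3 * walk₂ R n (nbOf G) 1 u v) := by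
  have h := card_aut_mul_copyCountEdge ℤ path3_adj huv
  have huv' := mem_nbOf_fin.2 huv
  have hvu' := mem_nbOf_fin.2 huv.symm
  rw [card_aut_path3] at h
  simp [Fin.sum_univ_four, path3Adj, toFront] at h
  rw [extensions_swap ℤ hgr false true true false false,
    extensions_swap ℤ hgr false true false false true,
    extensions_swap ℤ hgr false false false true true,
    extensions_flip true false false false true, hgr.extensions_end u.2 v.2 huv',
    hgr.extensions_end v.2 u.2 hvu', hgr.extensions_middle u.2 v.2 huv', hgr.walk₂_comm 1 v u] at h
  have h' := congrArg (Int.castRingHom R) h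
  simp only [map_add, map_sub, map_mul, map_one, map_ofNat, map_deg, map_walk₂_one,
    map_natCast] at h'
  simp only [map_degSum, Pi.one_apply, map_one] at h'
  rw [h', ← Pi.one_def]; ring

theorem two_mul_copyCountEdge_paw (huv : G.Adj u v) (hgr : Gr n (nbOf G)) :
    2 * (copyCountEdge G paw s(u, v) : R) =
      walk₃ R n (nbOf G) u u + walk₃ R n (nbOf G) v v +
        2 * (walk₂ R n (nbOf G) (deg R n (nbOf G)) u v +
          walk₂ R n (nbOf G) 1 u v * (deg R n (nbOf G) u + deg R n (nbOf G) v - 8)) := by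
  have h := card_aut_mul_copyCountEdge ℤ paw_adj huv
  have huv' := mem_nbOf_fin.2 huv
  have hvu' := mem_nbOf_fin.2 huv.symm
  rw [card_aut_paw] at h
  simp [Fin.sum_univ_four, pawAdj, toFront] at h
  rw [extensions_flip true true true false false, extensions_flip false false true true true,
    hgr.extensions_paw u.2 v.2 huv', hgr.extensions_paw' u.2 huv', hgr.extensions_paw' v.2 hvu',
    hgr.extensions_paw'' v.2 huv', hgr.extensions_paw'' u.2 hvu', hgr.walk₂_comm 1 v u] at h
  have h' := congrArg (Int.castRingHom R) h
  simp only [map_add, map_sub, map_mul, map_ofNat, map_deg, map_walk₂_one, map_walk₃,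
    map_natCast] at h'
  simp only [map_walk₂, map_deg] at h'
  rw [h']; ring

theorem two_mul_copyCountEdge_fourCycle (huv : G.Adj u v) (hgr : Gr n (nbOf G)) :
    2 * (copyCountEdge G fourCycle s(u, v) : R) =
      2 * (walk₃ R n (nbOf G) u v - deg R n (nbOf G) u - deg R n (nbOf G) v + 1) := by
  have h := card_aut_mul_copyCountEdge ℤ fourCycle_adj huv
  have huv' := mem_nbOf_fin.2 huv
  rw [card_aut_fourCycle] at h
  simp [Fin.sum_univ_four, fourCycleAdj, toFront] at h
  rw [extensions_swap ℤ hgr true false false true true,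
    hgr.extensions_cycle u.2 v.2 huv'] at h
  have h₁ : (copyCountEdge G fourCycle s(u, v) : ℤ) =
      walk₃ ℤ n (nbOf G) u v - deg ℤ n (nbOf G) u - deg ℤ n (nbOf G) v + 1 := by linarith
  have h' := congrArg (Int.castRingHom R) h₁
  simp only [map_add, map_sub, map_one, map_deg, map_walk₃, map_natCast] at h'
  rw [h']

theorem two_mul_copyCountEdge_diamond (huv : G.Adj u v) (hgr : Gr n (nbOf G)) :
    2 * (copyCountEdge G diamond s(u, v) : R) =
      walk₂ R n (nbOf G) 1 u v * (walk₂ R n (nbOf G) 1 u v - 5) +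
        2 * (fan R n (nbOf G) u v + fan R n (nbOf G) v u) := by
  have h := card_aut_mul_copyCountEdge ℤ diamond_adj huv
  have huv' := mem_nbOf_fin.2 huv
  have hvu' := mem_nbOf_fin.2 huv.symm
  rw [card_aut_diamond] at h
  simp [Fin.sum_univ_four, diamondAdj, toFront] at h
  rw [extensions_flip true false true true true, extensions_flip false true true true true,
    extensions_swap ℤ hgr true true false true true u v,
    extensions_swap ℤ hgr true true false true true v u, hgr.extensions_chord,
    hgr.extensions_rim v.2 huv', hgr.extensions_rim u.2 hvu', hgr.walk₂_comm 1 v u] at h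
  have h₁ : 2 * (copyCountEdge G diamond s(u, v) : ℤ) =
      walk₂ ℤ n (nbOf G) 1 u v * (walk₂ ℤ n (nbOf G) 1 u v - 5) +
        2 * (fan ℤ n (nbOf G) u v + fan ℤ n (nbOf G) v u) := by linarith
  have h' := congrArg (Int.castRingHom R) h₁
  simp only [map_add, map_sub, map_mul, map_ofNat, map_walk₂_one, map_fan, map_natCast] at h'
  rw [h']

end

/-! ### Evaluation of summation programs -/

/-- Whether the element in register `x` is in the set whose index is in register `s`; register `6`
holds zero. -/
def mem (s x : ℕ) : Atom := ⟨6, s, x, 6⟩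

/-- The size of the set whose index is in register `s`. -/
def size (s : ℕ) : Atom := ⟨4, s, 6, 6⟩

/-- The entry of table `t` for the vertices in the registers `x` and `y`. -/
def entry (t x y : ℕ) : Atom := ⟨t, x, y, 6⟩

theorem SetsRep.sum {M : Type*} [AddCommMonoid M] {μ : Key → ℕ} {S : ℕ → Finset ℕ}
    (h : SetsRep μ S) (s : ℕ) (f : ℕ → M) :
    ∑ i ∈ range (μ (4, s, 0, 0)), f (μ (5, s, i, 0)) = ∑ x ∈ S s, f x := by
  rw [h.size]
  refine Finset.sum_bij (fun i _ => μ (5, s, i, 0)) (fun i hi => (h.elt s i (mem_range.1 hi)).1)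
    ?_ ?_ (fun _ _ => rfl)
  · intro i hi j hj hij
    have h1 := (h.elt s i (mem_range.1 hi)).2
    have h2 := (h.elt s j (mem_range.1 hj)).2
    rw [hij, h2] at h1
    omega
  · intro x hx
    obtain ⟨h1, h2, h3⟩ := h.pos s x hx
    exact ⟨_, mem_range.2 (by omega), h3⟩

section

variable {R : Type*} [CommRing R] {N : ℕ} {ρ : ℕ → ℕ} {μ : Key → ℕ} {S : ℕ → Finset ℕ}

theorem delta_emit (t x y z : ℕ) (neg : Bool) (vs : List Atom) (t' u v w : ℕ) :
    (Prog.emit t x y z neg vs).delta R N ρ μ (t', u, v, w) =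
      ind R (t' = t) * ind R (w = ρ z) * (ind R (u = ρ x) * ind R (v = ρ y)) *
        ((if neg then -1 else 1) * (vs.map fun a => (a.val ρ μ : R)).prod) := by
  simp only [Prog.delta, Prod.mk.injEq, ind]
  by_cases h1 : t' = t <;> by_cases h2 : u = ρ x <;> by_cases h3 : v = ρ y <;>
    by_cases h4 : w = ρ z <;> simp [h1, h2, h3, h4]

theorem SetsRep.delta_iter (h : SetsRep μ S) {n : ℕ} (s : ℕ) (p : Prog) (key : Key)
    (hs : S (ρ s) ⊆ range n) : (Prog.iter s p).delta R N ρ μ key =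
      ∑ x ∈ range n, ind R (x ∈ S (ρ s)) * p.delta R (N + 1) (update ρ N x) μ key := by
  simp only [Prog.delta, ind, ite_mul, one_mul, zero_mul]
  rw [h.sum (ρ s) fun x => p.delta R (N + 1) (update ρ N x) μ key, ← Finset.sum_filter,
    Finset.filter_mem_eq_inter, Finset.inter_eq_right.2 hs]

theorem SetsRep.val_mem (h : SetsRep μ S) (h6 : ρ 6 = 0) (s x : ℕ) :
    (mem s x).val ρ μ = 0 ↔ ρ x ∉ S (ρ s) := by
  rw [mem, Atom.val, h6, ← h.pos_ne_zero, not_not]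

theorem SetsRep.delta_ifnz (h : SetsRep μ S) (h6 : ρ 6 = 0) (s x : ℕ) (p : Prog)
    (key : Key) : (Prog.ifnz (mem s x) p).delta R N ρ μ key =
      ind R (ρ x ∈ S (ρ s)) * p.delta R N ρ μ key := by
  by_cases hx : ρ x ∈ S (ρ s) <;> simp [Prog.delta, h.val_mem h6, ind, hx]

theorem SetsRep.delta_ifz (h : SetsRep μ S) (h6 : ρ 6 = 0) (s x : ℕ) (p : Prog)
    (key : Key) : (Prog.ifz (mem s x) p).delta R N ρ μ key =
      ind R (ρ x ∉ S (ρ s)) * p.delta R N ρ μ key := by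
  by_cases hx : ρ x ∈ S (ρ s) <;> simp [Prog.delta, h.val_mem h6, ind, hx]

theorem delta_seq (p q : Prog) (key : Key) : (Prog.seq p q).delta R N ρ μ key =
    p.delta R N ρ μ key + q.delta R N ρ μ key := rfl

theorem delta_skip (key : Key) : Prog.skip.delta R N ρ μ key = 0 := rfl

end

/-! ### Running times of summation programs

Every loop runs over the class `B`, over the class `H`, or over the neighbourhood of a vertex that
has been tested not to be in one of these classes. Such a loop has `O(k)` or `O(τ)` rounds, and so
the running time of a nested loop can be read off from the program. -/

/-- The exponent of `k` in the threshold for huge vertices. -/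
def expo (sq : Bool) : ℕ := if sq then 2 else 1

/-- Whether register `x` holds a vertex at nesting depth `N`. -/
def isVertex (N x : ℕ) : Bool := x == 1 || x == 2 || (decide (30 ≤ x) && decide (x < N))

/-- Whether all loops are of the form described above; the vertices in the registers `low` are
known to be outside of `B`, and those in the registers `mid` outside of `H`. -/
def Prog.frugal : Prog → ℕ → List ℕ → List ℕ → Bool
  | .skip, _, _, _ => true
  | .emit _ _ _ _ _ _, _, _, _ => true
  | .iter s p, N, low, mid =>
      (s == 0 || s == 5 || low.contains s || mid.contains s) && p.frugal (N + 1) low mid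
  | .ifnz _ p, N, low, mid => p.frugal N low mid
  | .ifz a p, N, low, mid =>
      if a.t = 6 ∧ a.x = 0 ∧ a.z = 6 ∧ isVertex N a.y then p.frugal N (a.y :: low) mid
      else if a.t = 6 ∧ a.x = 5 ∧ a.z = 6 ∧ isVertex N a.y then p.frugal N low (a.y :: mid)
      else p.frugal N low mid
  | .seq p q, N, low, mid => p.frugal N low mid && q.frugal N low mid

/-- The number of nested loops, each counted with its exponent of `k`. -/
def Prog.order (sq : Bool) : Prog → ℕ → List ℕ → ℕ
  | .skip, _, _ => 0
  | .emit _ _ _ _ _ _, _, _ => 0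
  | .iter s p, N, low =>
      (if s = 5 ∨ s ∈ low then 1 else expo sq) + p.order sq (N + 1) low
  | .ifnz _ p, N, low => p.order sq N low
  | .ifz a p, N, low =>
      if a.t = 6 ∧ a.x = 0 ∧ a.z = 6 ∧ isVertex N a.y then p.order sq N (a.y :: low)
      else p.order sq N low
  | .seq p q, N, low => max (p.order sq N low) (q.order sq N low)

/-- The implied constant. -/
def Prog.const : Prog → ℕ
  | .skip => 1
  | .emit _ _ _ _ _ vs => 25 + 15 * vs.length
  | .iter _ p => 10 + 4 * (p.const + 20)
  | .ifnz _ p => 6 + p.const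
  | .ifz _ p => 6 + p.const
  | .seq p q => p.const + q.const

theorem tau_le_pow (sq : Bool) (k : ℕ) : tau sq k + 1 ≤ (k + 1) ^ expo sq := by
  unfold tau expo
  split_ifs <;> nlinarith

theorem Prog.cost_le {sq : Bool} {n : ℕ} {c : Cfg} {μ : Key → ℕ}
    (hs : SetsRep μ (c.sets n)) (hgr : Gr n c.nb) (hB : c.B ⊆ range n)
    (hH : c.H ⊆ range n) (hc : Cheap sq c.nb c.B c.H c.k) (p : Prog) {N : ℕ} {ρ : ℕ → ℕ}
    {low mid : List ℕ} (hN : 30 ≤ N) (hp : p.frugal N low mid = true) (h0 : ρ 0 = n)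
    (h5 : ρ 5 = n + 1) (h6 : ρ 6 = 0) (hv : ∀ x, isVertex N x = true → ρ x < n)
    (hlow : ∀ x ∈ low, isVertex N x = true ∧ (c.nb (ρ x)).card ≤ c.k + 1)
    (hmid : ∀ x ∈ mid, isVertex N x = true ∧ (c.nb (ρ x)).card ≤ tau sq c.k + 1) :
    p.cost N ρ μ ≤ p.const * (c.k + 1) ^ p.order sq N low := by
  have hk : 1 ≤ c.k + 1 := by omega
  have hpow : ∀ {i}, 1 ≤ (c.k + 1) ^ i := Nat.one_le_pow _ _ (by omega)
  have hle : ∀ {i j}, i ≤ j → (c.k + 1) ^ i ≤ (c.k + 1) ^ j := Nat.pow_le_pow_right hk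
  induction p generalizing N ρ low mid with
  | skip => simp [Prog.cost, Prog.const, Prog.order]
  | emit t x y z neg vs => simp [Prog.cost, Prog.const, Prog.order]
  | iter s p ih =>
    simp only [Prog.frugal, Bool.and_eq_true, Bool.or_eq_true, beq_iff_eq, List.contains_iff_mem] at hp
    simp only [Prog.cost, Prog.const, Prog.order]
    have hvert : ∀ x, isVertex N x = true → x ≠ N ∧ isVertex (N + 1) x = true := by
      intro x hx
      simp only [isVertex, Bool.or_eq_true, Bool.and_eq_true, beq_iff_eq, decide_eq_true_eq] at hx ⊢
      omega
    -- the number of rounds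
    obtain ⟨hsub, hcard⟩ : c.sets n (ρ s) ⊆ range n ∧
        (c.sets n (ρ s)).card ≤ 4 * (c.k + 1) ^ (if s = 5 ∨ s ∈ low then 1 else expo sq) := by
      have ht := tau_le_pow sq c.k
      have he : (c.k + 1) ^ 1 ≤ (c.k + 1) ^ expo sq := hle (by unfold expo; split_ifs <;> omega)
      by_cases h : s = 5 ∨ s ∈ low
      · rw [if_pos h, pow_one]
        rcases h with rfl | h
        · rw [h5, Cfg.sets_H]
          exact ⟨hH, hc.H_card.trans (by omega)⟩
        · rw [Cfg.sets_nb _ (hv s (hlow s h).1)]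
          exact ⟨hgr.subset _, (hlow s h).2.trans (by omega)⟩
      · rw [if_neg h]
        push Not at h
        rcases hp.1 with ((rfl | h') | h') | h'
        · rw [h0, Cfg.sets_B]
          exact ⟨hB, hc.B_card.trans (by omega)⟩
        · exact absurd h' h.1
        · exact absurd h' h.2
        · rw [Cfg.sets_nb _ (hv s (hmid s h').1)]
          exact ⟨hgr.subset _, (hmid s h').2.trans (by omega)⟩
    rw [hs.sum (ρ s) fun x => p.cost (N + 1) (update ρ N x) μ + 20]
    set e := if s = 5 ∨ s ∈ low then 1 else expo sq with he
    set d := p.order sq (N + 1) low with hd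
    have key : ∀ x ∈ c.sets n (ρ s), p.cost (N + 1) (update ρ N x) μ + 20 ≤
        (p.const + 20) * (c.k + 1) ^ d := by
      intro x hx
      have hx' := mem_range.1 (hsub hx)
      have := ih (N := N + 1) (ρ := update ρ N x) (low := low) (mid := mid) (by omega) hp.2
        (by rwa [update_of_ne (by omega)]) (by rwa [update_of_ne (by omega)])
        (by rwa [update_of_ne (by omega)]) ?_ ?_ ?_
      · rw [add_mul]
        have := hpow (i := d)
        rw [← hd] at *
        omega
      · intro y hy
        by_cases hyN : y = N
        · rw [hyN, update_self]; exact hx'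
        · rw [update_of_ne hyN]
          refine hv y ?_
          simp only [isVertex, Bool.or_eq_true, Bool.and_eq_true, beq_iff_eq,
            decide_eq_true_eq] at hy ⊢
          omega
      · intro y hy
        rw [update_of_ne (hvert y (hlow y hy).1).1]
        exact ⟨(hvert y (hlow y hy).1).2, (hlow y hy).2⟩
      · intro y hy
        rw [update_of_ne (hvert y (hmid y hy).1).1]
        exact ⟨(hvert y (hmid y hy).1).2, (hmid y hy).2⟩
    have h1 := sum_le_sum key
    rw [Finset.sum_const, smul_eq_mul] at h1
    have h2 := Nat.mul_le_mul_right ((p.const + 20) * (c.k + 1) ^ d) hcard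
    have h3 : 4 * (c.k + 1) ^ e * ((p.const + 20) * (c.k + 1) ^ d) =
        4 * (p.const + 20) * (c.k + 1) ^ (e + d) := by rw [pow_add]; ring
    have h4 := hpow (i := e + d)
    rw [add_mul]
    omega
  | ifnz a p ih =>
    have := ih hN hp h0 h5 h6 hv hlow hmid
    simp only [Prog.cost, Prog.const, Prog.order]
    rw [add_mul]
    have := hpow (i := p.order sq N low)
    split_ifs <;> omega
  | ifz a p ih =>
    obtain ⟨t, s, x, z⟩ := a
    simp only [Prog.frugal, Prog.order, Prog.cost, Prog.const, add_mul] at hp ⊢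
    by_cases h : t = 6 ∧ s = 0 ∧ z = 6 ∧ isVertex N x = true
    · rw [if_pos h] at hp ⊢
      obtain ⟨rfl, rfl, rfl, hx⟩ := h
      have := hpow (i := p.order sq N (x :: low))
      split_ifs with h'
      · have h'' := (hs.val_mem h6 0 x).1 h'
        rw [h0, Cfg.sets_B] at h''
        have := ih hN hp h0 h5 h6 hv (List.forall_mem_cons.2 ⟨⟨hx, hc.big _ h''⟩, hlow⟩) hmid
        omega
      · omega
    · rw [if_neg h] at hp ⊢
      have := hpow (i := p.order sq N low)
      by_cases h2 : t = 6 ∧ s = 5 ∧ z = 6 ∧ isVertex N x = true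
      · rw [if_pos h2] at hp
        obtain ⟨rfl, rfl, rfl, hx⟩ := h2
        split_ifs with h'
        · have h'' := (hs.val_mem h6 5 x).1 h'
          rw [h5, Cfg.sets_H] at h''
          have := ih hN hp h0 h5 h6 hv hlow (List.forall_mem_cons.2 ⟨⟨hx, hc.huge _ h''⟩, hmid⟩)
          omega
        · omega
      · rw [if_neg h2] at hp
        have := ih hN hp h0 h5 h6 hv hlow hmid
        split_ifs <;> omega
  | seq p q ihp ihq =>
    simp only [Prog.frugal, Bool.and_eq_true] at hp
    simp only [Prog.cost, Prog.const, Prog.order, add_mul]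
    have h1 := ihp hN hp.1 h0 h5 h6 hv hlow hmid
    have h2 := ihq hN hp.2 h0 h5 h6 hv hlow hmid
    have h3 := Nat.mul_le_mul_left p.const
      (hle (le_max_left (p.order sq N low) (q.order sq N low)))
    have h4 := Nat.mul_le_mul_left q.const
      (hle (le_max_right (p.order sq N low) (q.order sq N low)))
    omega

/-- A program whose nested loops have at most the exponent of `τ` runs in time `O(τ)`. -/
theorem Prog.cost_le_tau {sq : Bool} {n : ℕ} {c : Cfg} {μ : Key → ℕ} {ρ : ℕ → ℕ}
    (hs : SetsRep μ (c.sets n)) (hgr : Gr n c.nb) (hB : c.B ⊆ range n)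
    (hH : c.H ⊆ range n) (hc : Cheap sq c.nb c.B c.H c.k) (hρ : Base n ρ) (h1 : ρ 1 < n)
    (h2 : ρ 2 < n) (p : Prog) (hp : p.frugal 30 [] [] = true) (hp' : p.order sq 30 [] ≤ expo sq) :
    p.cost 30 ρ μ ≤ 2 * p.const * (tau sq c.k + 1) := by
  have h := Prog.cost_le hs hgr hB hH hc p le_rfl hp hρ.r0 hρ.r5 hρ.r6 (by
    intro x hx
    simp only [isVertex, Bool.or_eq_true, Bool.and_eq_true, beq_iff_eq, decide_eq_true_eq] at hx
    rcases hx with (rfl | rfl) | hx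
    · exact h1
    · exact h2
    · omega) (by simp) (by simp)
  have h3 : (c.k + 1) ^ p.order sq 30 [] ≤ (c.k + 1) ^ expo sq :=
    Nat.pow_le_pow_right (by omega) hp'
  have h4 : (c.k + 1) ^ expo sq ≤ 2 * (tau sq c.k + 1) := by
    unfold tau expo
    split_ifs
    · have : 2 * c.k ≤ c.k * c.k + 1 := by
        rcases Nat.lt_or_ge c.k 2 with h | h
        · interval_cases c.k <;> omega
        · nlinarith
      nlinarith
    · rw [pow_one]; omega
  calc _ ≤ _ := h
    _ ≤ p.const * (2 * (tau sq c.k + 1)) := Nat.mul_le_mul_left _ (h3.trans h4)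
    _ = _ := by ring

/-! ### The effect of a new edge -/

section

variable {R : Type*} [CommRing R] {n : ℕ} {nb : ℕ → Finset ℕ}

theorem ind_mul_self (p : Prop) [Decidable p] : ind R p * ind R p = ind R p := by
  unfold ind; split_ifs <;> simp

theorem ind_add_not (p : Prop) [Decidable p] : ind R p + ind R (¬ p) = 1 := by
  by_cases h : p <;> simp [ind, h]

theorem ind_eq_mul (x a : ℕ) (f : ℕ → R) : ind R (x = a) * f x = ind R (x = a) * f a := by
  by_cases h : x = a <;> simp [ind, h]

/-- The new walks of length two from `u` to `v` whose middle vertex is the endpoint `b` of the new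
edge `ab`. -/
def newWalk₂ (R : Type*) [CommSemiring R] (nb : ℕ → Finset ℕ) (a b : ℕ) (w : ℕ → R) (u v : ℕ) : R :=
  w b * (ind R (u = a) * adj R nb b v + ind R (v = a) * adj R nb b u +
    ind R (u = a) * ind R (v = a))

variable (h : Gr n nb) {a b : ℕ} (hab : a ≠ b) (ha : a < n) (hb : b < n) (hnb : b ∉ nb a)

include h hab hnb

theorem Gr.adj_addE (x y : ℕ) : adj R (addE nb a b) x y =
    adj R nb x y + (ind R (x = a) * ind R (y = b) + ind R (x = b) * ind R (y = a)) := by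
  have hnb' : a ∉ nb b := fun h' => hnb (h.symm _ _ h')
  unfold adj ind
  simp only [mem_addE hab]
  by_cases h1 : x = a
  · subst h1
    by_cases h2 : y = b
    · subst h2; simp [hnb, hab]
    · simp [h2, hab]
  · by_cases h2 : x = b
    · subst h2
      by_cases h3 : y = a
      · subst h3; simp [hnb', hab.symm]
      · simp [h3, h1]
    · simp [h1, h2]

include ha hb

theorem Gr.deg_addE (x : ℕ) : deg R n (addE nb a b) x =
    deg R n nb x + (ind R (x = a) + ind R (x = b)) := by
  unfold deg
  simp only [h.adj_addE hab hnb, sum_add_distrib, ← mul_sum]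
  simp [ind, ha, hb]

/-- The change of a sum over the middle vertices: only the endpoints of the new edge matter. -/
theorem sum_add_two {f f' : ℕ → R} (hf : ∀ c, c ≠ a → c ≠ b → f' c = f c) :
    ∑ c ∈ range n, f' c = ∑ c ∈ range n, f c + (f' b - f b) + (f' a - f a) := by
  have : ∀ c, f' c = f c + ind R (b = c) * (f' c - f c) + ind R (a = c) * (f' c - f c) := by
    intro c
    by_cases h1 : c = a
    · subst h1; simp [ind, hab.symm]
    · by_cases h2 : c = b
      · subst h2; simp [ind, hab]
      · rw [hf c h1 h2]; simp
  rw [sum_congr rfl fun c _ => this c, sum_add_distrib, sum_add_distrib,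
    sum_ind_mul hb, sum_ind_mul ha]

theorem Gr.walk₂_addE (w : ℕ → R) (u v : ℕ) : walk₂ R n (addE nb a b) w u v =
    walk₂ R n nb w u v + newWalk₂ R nb a b w u v + newWalk₂ R nb b a w u v := by
  unfold walk₂ newWalk₂
  rw [sum_add_two h hab ha hb hnb (f := fun c => w c * (adj R nb u c * adj R nb c v))]
  · simp only [h.adj_addE hab hnb, h.adj_comm u]
    simp only [ind, hab, hab.symm, if_true, if_false]
    ring
  · intro c h1 h2
    simp only [h.adj_addE hab hnb]
    simp [ind, h1, h2]

theorem Gr.degSum_addE (w : ℕ → R) (v : ℕ) : degSum R n (addE nb a b) w v = degSum R n nb w v +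
    w b * (ind R (v = a) * (deg R n nb b + 1) + adj R nb b v) +
    w a * (ind R (v = b) * (deg R n nb a + 1) + adj R nb a v) := by
  unfold degSum
  rw [sum_add_two h hab ha hb hnb (f := fun x => w x * (adj R nb v x * deg R n nb x))]
  · simp only [h.adj_addE hab hnb, h.deg_addE hab ha hb hnb, h.adj_comm v]
    simp only [ind, hab, hab.symm, if_true, if_false]
    ring
  · intro c h1 h2
    simp only [h.adj_addE hab hnb, h.deg_addE hab ha hb hnb]
    simp [ind, h1, h2]

theorem Gr.walk₂_deg_addE (w : ℕ → R) (u v : ℕ) :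
    walk₂ R n (addE nb a b) (fun c => w c * deg R n (addE nb a b) c) u v =
      walk₂ R n nb (fun c => w c * deg R n nb c) u v +
      (newWalk₂ R nb a b (fun c => w c * (deg R n nb c + 1)) u v +
        w b * (adj R nb b u * adj R nb b v)) +
      (newWalk₂ R nb b a (fun c => w c * (deg R n nb c + 1)) u v +
        w a * (adj R nb a u * adj R nb a v)) := by
  unfold walk₂ newWalk₂
  rw [sum_add_two h hab ha hb hnb
    (f := fun c => w c * deg R n nb c * (adj R nb u c * adj R nb c v))]
  · simp only [h.adj_addE hab hnb, h.deg_addE hab ha hb hnb, h.adj_comm u]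
    simp only [ind, hab, hab.symm, if_true, if_false]
    ring
  · intro c h1 h2
    simp only [h.adj_addE hab hnb, h.deg_addE hab ha hb hnb]
    simp [ind, h1, h2]

end

/-! ### The auxiliary tables -/

section

variable (R : Type*) [CommSemiring R] (n : ℕ) (nb : ℕ → Finset ℕ) (B H : Finset ℕ)

/-- The indicator of the complement of a class. -/
def out (R : Type*) [CommSemiring R] (S : Finset ℕ) (x : ℕ) : R := ind R (x ∉ S)

/-- The walks of length three between huge vertices whose inner vertices are not huge. -/
def tableQ (u v : ℕ) : R := ind R (u ∈ H) * ind R (v ∈ H) *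
  ∑ x ∈ range n, out R H x * (adj R nb u x * walk₂ R n nb (out R H) x v)

/-- For an edge `uc` with `c` big but not huge, the huge common neighbours of `u` and `c`. -/
def tableZ (u c : ℕ) : R := ind R (c ∈ B) * out R H c *
  (adj R nb u c * walk₂ R n nb (fun d => ind R (d ∈ H)) u c)

/-- The claws with given leaves and a centre that is not big. -/
def tableC (u v w : ℕ) : R :=
  ∑ c ∈ range n, out R B c * (adj R nb c u * adj R nb c v * adj R nb c w)

/-- The pairs of a walk `ucv` and a triangle `ucd` such that neither `c` nor `d` is big. -/
def tableY (u v : ℕ) : R :=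
  walk₂ R n nb (fun c => out R B c * walk₂ R n nb (out R B) u c) u v

end

section

variable {R : Type*} [CommRing R] {n : ℕ} {nb : ℕ → Finset ℕ} {B H : Finset ℕ}
  (h : Gr n nb) {a b : ℕ} (hab : a ≠ b) (ha : a < n) (hb : b < n) (hnb : b ∉ nb a)

/-- The contribution of the endpoints `a` and `b` of a new edge, in this order, to `tableQ`. -/
def newQ (R : Type*) [CommSemiring R] (n : ℕ) (nb : ℕ → Finset ℕ) (H : Finset ℕ) (a b u v : ℕ) : R :=
  ind R (a ∈ H) * (out R H b *
    (ind R (u = a) * (ind R (v ∈ H) * walk₂ R n nb (out R H) b v) +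
      ind R (v = a) * (ind R (u ∈ H) * walk₂ R n nb (out R H) b u))) +
  out R H a * (out R H b *
    (ind R (u ∈ H) * (adj R nb a u * (ind R (v ∈ H) * adj R nb b v))))

/-- The contribution of the endpoints `a` and `b` of a new edge, in this order, to `tableZ`. -/
def newZ (R : Type*) [CommSemiring R] (n : ℕ) (nb : ℕ → Finset ℕ) (B H : Finset ℕ)
    (a b u c : ℕ) : R :=
  ind R (b ∈ B) * (out R H b * (ind R (u = a) * (ind R (c = b) *
    walk₂ R n nb (fun d => ind R (d ∈ H)) a b))) +
  ind R (b ∈ H) * (ind R (u = a) *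
    (ind R (c ∈ B) * (out R H c * (adj R nb a c * adj R nb b c)))) +
  ind R (b ∈ H) * (ind R (a ∈ B) * (out R H a * (ind R (c = a) * (adj R nb a u * adj R nb b u))))

/-- The contribution of the endpoints `a` and `b` of a new edge, in this order, to `tableC`. The
terms are sorted by the set of leaves that coincide with `a`. -/
def newC (R : Type*) [CommSemiring R] (nb : ℕ → Finset ℕ) (B : Finset ℕ) (a b u v w : ℕ) : R :=
  out R B b * (ind R (u = a) * (adj R nb b v * adj R nb b w) +
    ind R (v = a) * (adj R nb b u * adj R nb b w) + ind R (w = a) * (adj R nb b u * adj R nb b v) +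
    ind R (u = a) * (ind R (v = a) * adj R nb b w) + ind R (u = a) * (ind R (w = a) * adj R nb b v) +
    ind R (v = a) * (ind R (w = a) * adj R nb b u) + ind R (u = a) * (ind R (v = a) * ind R (w = a)))

/-- The contribution of the endpoints `a` and `b` of a new edge, in this order, to `tableY`. -/
def newY (R : Type*) [CommSemiring R] (n : ℕ) (nb : ℕ → Finset ℕ) (B : Finset ℕ) (a b u v : ℕ) : R :=
  out R B b * (ind R (u = a) * ((adj R nb b v + ind R (v = a)) * walk₂ R n nb (out R B) a b)) +
  out R B b * (ind R (v = a) * (adj R nb b u * walk₂ R n nb (out R B) u b)) +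
  out R B b * (ind R (u = a) *
    ∑ c ∈ range n, out R B c * (adj R nb b c * (adj R nb a c * adj R nb c v))) +
  out R B a * (out R B b * (adj R nb a u * adj R nb b u * (adj R nb b v + ind R (v = a))))

include h hab ha hb hnb

theorem Gr.tableC_addE (u v w : ℕ) : tableC R n (addE nb a b) B u v w =
    tableC R n nb B u v w + newC R nb B a b u v w + newC R nb B b a u v w := by
  unfold tableC newC
  rw [sum_add_two h hab ha hb hnb
    (f := fun c => out R B c * (adj R nb c u * adj R nb c v * adj R nb c w))]
  · simp only [h.adj_addE hab hnb]
    simp only [ind, hab, hab.symm, if_true, if_false]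
    ring
  · intro c h1 h2
    simp only [h.adj_addE hab hnb]
    simp [ind, h1, h2]

theorem Gr.tableZ_addE (u c : ℕ) : tableZ R n (addE nb a b) B H u c =
    tableZ R n nb B H u c + newZ R n nb B H a b u c + newZ R n nb B H b a u c := by
  have hba : a ∉ nb b := fun h' => hnb (h.symm _ _ h')
  have z1 : adj R nb a b = 0 := by simp [adj, ind, hnb]
  have z2 : adj R nb b a = 0 := by simp [adj, ind, hba]
  unfold tableZ newZ
  rw [h.walk₂_addE hab ha hb hnb, h.adj_addE hab hnb]
  unfold newWalk₂ out
  have e1 := h.adj_self (R := R) a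
  have e2 := h.adj_self (R := R) b
  by_cases h3 : c = a
  · subst h3
    by_cases h1 : u = c
    · subst h1
      simp only [ind, hab, hab.symm, if_true, if_false, e1, z1, z2]; ring
    · by_cases h2 : u = b
      · subst h2
        simp only [ind, hab, hab.symm, if_true, if_false, e1, e2, z1, z2]; ring
      · simp only [ind, h1, h2, hab, hab.symm, if_true, if_false, h.adj_comm u]; ring
  · by_cases h4 : c = b
    · subst h4
      by_cases h1 : u = a
      · subst h1
        simp only [ind, hab, hab.symm, if_true, if_false, e1, e2, z1, z2]; ring
      · by_cases h2 : u = c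
        · subst h2
          simp only [ind, hab, hab.symm, if_true, if_false, e2, z1, z2]; ring
        · simp only [ind, h1, h2, hab, hab.symm, if_true, if_false, h.adj_comm u]; ring
    · simp only [ind, h3, h4, if_false]
      by_cases h1 : u = a
      · subst h1
        simp only [hab, if_true, if_false]; ring
      · by_cases h2 : u = b
        · subst h2
          simp only [hab.symm, if_true, if_false]; ring
        · simp only [h1, h2, if_false]; ring

omit hnb hb hab in
theorem Gr.sum_newWalk₂ (g w : ℕ → R) (v : ℕ) :
    ∑ x ∈ range n, g x * newWalk₂ R nb a b w v x =
      w b * (g a * (adj R nb b v + ind R (v = a)) +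
        ind R (v = a) * ∑ x ∈ range n, g x * adj R nb x b) := by
  have : ∀ x, g x * newWalk₂ R nb a b w v x =
      ind R (a = x) * (g x * (w b * (adj R nb b v + ind R (v = a)))) +
        w b * ind R (v = a) * (g x * adj R nb x b) := by
    intro x
    unfold newWalk₂
    rw [h.adj_comm x b]
    unfold ind
    simp only [eq_comm (a := x)]
    ring
  simp only [this, sum_add_distrib, ← mul_sum, sum_ind_mul ha]
  ring

theorem Gr.tableY_addE (u v : ℕ) : tableY R n (addE nb a b) B u v =
    tableY R n nb B u v + newY R n nb B a b u v + newY R n nb B b a u v := by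
  have hba : a ∉ nb b := fun h' => hnb (h.symm _ _ h')
  have z1 : adj R nb a b = 0 := by simp [adj, ind, hnb]
  have z2 : adj R nb b a = 0 := by simp [adj, ind, hba]
  have z3 := h.adj_self (R := R) a
  have z4 := h.adj_self (R := R) b
  have key : walk₂ R n nb (fun c => out R B c * walk₂ R n (addE nb a b) (out R B) u c) u v =
      tableY R n nb B u v +
      ∑ c ∈ range n, out R B c * (adj R nb u c * adj R nb c v) *
        newWalk₂ R nb a b (out R B) u c +
      ∑ c ∈ range n, out R B c * (adj R nb u c * adj R nb c v) *
        newWalk₂ R nb b a (out R B) u c := by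
    unfold tableY
    rw [walk₂, walk₂, ← sum_add_distrib, ← sum_add_distrib]
    refine sum_congr rfl fun c _ => ?_
    rw [h.walk₂_addE hab ha hb hnb]; ring
  have e : ∀ (x y : ℕ), ind R (u = y) * ∑ c ∈ range n,
      out R B c * (adj R nb u c * adj R nb c v) * adj R nb c x =
      ind R (u = y) * ∑ c ∈ range n,
        out R B c * (adj R nb x c * (adj R nb y c * adj R nb c v)) := by
    intro x y
    rw [mul_sum, mul_sum]
    refine sum_congr rfl fun c _ => ?_
    rw [h.adj_comm x c]
    have : ind R (u = y) * adj R nb u c = ind R (u = y) * adj R nb y c :=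
      ind_eq_mul u y fun z => adj R nb z c
    linear_combination out R B c * adj R nb c v * adj R nb c x * this
  rw [tableY, h.walk₂_addE hab ha hb hnb, key, h.sum_newWalk₂ ha, h.sum_newWalk₂ hb, e, e]
  unfold newWalk₂ newY
  beta_reduce
  rw [h.walk₂_addE hab ha hb hnb, h.walk₂_addE hab ha hb hnb]
  unfold newWalk₂
  by_cases h1 : u = a
  · subst h1
    simp only [ind, hab, hab.symm, if_true, if_false, z1, z2, z3, z4]; ring
  · by_cases h2 : u = b
    · subst h2
      simp only [ind, hab, hab.symm, if_true, if_false, z1, z2, z3, z4]; ring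
    · simp only [ind, h1, h2, hab, hab.symm, if_true, if_false, h.adj_comm u]
      by_cases h3 : v = a
      · subst h3
        simp only [hab, if_true, if_false, z1, z2, z3]; ring
      · by_cases h4 : v = b
        · subst h4
          simp only [hab.symm, if_true, if_false, z1, z2, z4]; ring
        · simp only [h3, h4, if_false]; ring

theorem Gr.tableQ_addE (u v : ℕ) : tableQ R n (addE nb a b) H u v =
    tableQ R n nb H u v + newQ R n nb H a b u v + newQ R n nb H b a u v := by
  have hba : a ∉ nb b := fun h' => hnb (h.symm _ _ h')
  have z1 : adj R nb a b = 0 := by simp [adj, ind, hnb]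
  have z2 : adj R nb b a = 0 := by simp [adj, ind, hba]
  have z3 := h.adj_self (R := R) a
  have z4 := h.adj_self (R := R) b
  have key : ∑ x ∈ range n, out R H x *
      (adj R (addE nb a b) u x * walk₂ R n (addE nb a b) (out R H) x v) =
      ∑ x ∈ range n, out R H x * (adj R nb u x * walk₂ R n nb (out R H) x v) +
      ∑ x ∈ range n, out R H x * adj R nb u x * newWalk₂ R nb a b (out R H) v x +
      ∑ x ∈ range n, out R H x * adj R nb u x * newWalk₂ R nb b a (out R H) v x +
      out R H b * (ind R (u = a) * walk₂ R n (addE nb a b) (out R H) b v) +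
      out R H a * (ind R (u = b) * walk₂ R n (addE nb a b) (out R H) a v) := by
    rw [sum_add_two h hab ha hb hnb (f := fun x => out R H x *
      (adj R nb u x * walk₂ R n (addE nb a b) (out R H) v x)),
      ← sum_add_distrib, ← sum_add_distrib]
    · have hG := h.addE hab ha hb
      rw [hG.walk₂_comm _ b v, hG.walk₂_comm _ a v, h.adj_addE hab hnb, h.adj_addE hab hnb,
        sum_congr rfl (g := fun x => out R H x * (adj R nb u x * walk₂ R n nb (out R H) x v) +
          out R H x * adj R nb u x * newWalk₂ R nb a b (out R H) v x +
          out R H x * adj R nb u x * newWalk₂ R nb b a (out R H) v x) fun x _ => by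
            rw [h.walk₂_addE hab ha hb hnb, h.walk₂_comm _ x v]; ring]
      simp only [ind, hab, hab.symm, if_true, if_false]
      ring
    · intro c h1 h2
      rw [h.adj_addE hab hnb, (h.addE hab ha hb).walk₂_comm _ c v]
      simp [ind, h1, h2]
  have e : ∀ x, ∑ c ∈ range n, out R H c * adj R nb u c * adj R nb c x =
      walk₂ R n nb (out R H) u x := fun x => by simp only [walk₂, mul_assoc]
  rw [tableQ, key, h.sum_newWalk₂ ha, h.sum_newWalk₂ hb, e, e, h.walk₂_addE hab ha hb hnb,
    h.walk₂_addE hab ha hb hnb, h.walk₂_comm _ u a, h.walk₂_comm _ u b]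
  unfold newWalk₂ newQ tableQ out
  by_cases haH : a ∈ H <;> by_cases hbH : b ∈ H <;>
  by_cases h1 : u = a <;> by_cases h2 : u = b <;> by_cases h3 : v = a <;> by_cases h4 : v = b <;>
  simp [ind, h1, h2, h3, h4, hab, hab.symm, z1, z2, z3, z4, haH, hbH, h.adj_comm u] <;>
  (try split_ifs) <;> ring

end

/-! ### Programs that update the auxiliary tables -/

/-- The sets that the summation programs run over. -/
structure Env (n : ℕ) (c : Cfg) (μ : Key → ℕ) : Prop where
  sets : SetsRep μ (c.sets n)
  gr : Gr n c.nb
  B_sub : c.B ⊆ range n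
  H_sub : c.H ⊆ range n

section

variable {R : Type*} [CommRing R] {n : ℕ} {c : Cfg} {μ : Key → ℕ} (e : Env n c μ)
  {N : ℕ} {ρ : ℕ → ℕ} {p : Prog} {key : Key}

include e

theorem Env.iter {s : ℕ} (hs : ρ s < n) : (Prog.iter s p).delta R N ρ μ key =
    ∑ x ∈ range n, adj R c.nb (ρ s) x * p.delta R (N + 1) (update ρ N x) μ key := by
  have h := c.sets_nb hs
  rw [e.sets.delta_iter (n := n) s p key (by rw [h]; exact e.gr.subset _), h]
  rfl

theorem Env.iter_B {s : ℕ} (hs : ρ s = n) : (Prog.iter s p).delta R N ρ μ key =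
    ∑ x ∈ range n, ind R (x ∈ c.B) * p.delta R (N + 1) (update ρ N x) μ key := by
  rw [e.sets.delta_iter (n := n) s p key] <;> rw [hs, Cfg.sets_B]
  exact e.B_sub

theorem Env.iter_H {s : ℕ} (hs : ρ s = n + 1) : (Prog.iter s p).delta R N ρ μ key =
    ∑ x ∈ range n, ind R (x ∈ c.H) * p.delta R (N + 1) (update ρ N x) μ key := by
  rw [e.sets.delta_iter (n := n) s p key] <;> rw [hs, Cfg.sets_H]
  exact e.H_sub

theorem Env.ifnz {s x : ℕ} (h6 : ρ 6 = 0) (hs : ρ s < n) :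
    (Prog.ifnz (mem s x) p).delta R N ρ μ key =
      adj R c.nb (ρ s) (ρ x) * p.delta R N ρ μ key := by
  rw [e.sets.delta_ifnz h6, c.sets_nb hs]; rfl

theorem Env.iter' {s : ℕ} (hs : ρ s ∈ range n) : (Prog.iter s p).delta R N ρ μ key =
    ∑ x ∈ range n, adj R c.nb (ρ s) x * p.delta R (N + 1) (update ρ N x) μ key :=
  e.iter (mem_range.1 hs)

theorem Env.ifnz' {s x : ℕ} (h6 : ρ 6 = 0) (hs : ρ s ∈ range n) :
    (Prog.ifnz (mem s x) p).delta R N ρ μ key =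
      adj R c.nb (ρ s) (ρ x) * p.delta R N ρ μ key :=
  e.ifnz h6 (mem_range.1 hs)

theorem Env.ifnz_B {s x : ℕ} (h6 : ρ 6 = 0) (hs : ρ s = n) :
    (Prog.ifnz (mem s x) p).delta R N ρ μ key = ind R (ρ x ∈ c.B) * p.delta R N ρ μ key := by
  rw [e.sets.delta_ifnz h6, hs, Cfg.sets_B]

theorem Env.ifnz_H {s x : ℕ} (h6 : ρ 6 = 0) (hs : ρ s = n + 1) :
    (Prog.ifnz (mem s x) p).delta R N ρ μ key = ind R (ρ x ∈ c.H) * p.delta R N ρ μ key := by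
  rw [e.sets.delta_ifnz h6, hs, Cfg.sets_H]

theorem Env.ifz_B {s x : ℕ} (h6 : ρ 6 = 0) (hs : ρ s = n) :
    (Prog.ifz (mem s x) p).delta R N ρ μ key = out R c.B (ρ x) * p.delta R N ρ μ key := by
  rw [e.sets.delta_ifz h6, hs, Cfg.sets_B]; rfl

theorem Env.ifz_H {s x : ℕ} (h6 : ρ 6 = 0) (hs : ρ s = n + 1) :
    (Prog.ifz (mem s x) p).delta R N ρ μ key = out R c.H (ρ x) * p.delta R N ρ μ key := by
  rw [e.sets.delta_ifz h6, hs, Cfg.sets_H]; rfl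

theorem Env.size {x : ℕ} (h6 : ρ 6 = 0) (hx : ρ x < n) :
    ((DynCount.size x).val ρ μ : R) = deg R n c.nb (ρ x) := by
  rw [DynCount.size, Atom.val, h6, e.sets.size, c.sets_nb hx, deg]
  unfold adj ind
  rw [Finset.sum_ite_mem, Finset.inter_eq_right.2 (e.gr.subset _)]
  simp

theorem Env.sum_adj_ind (b v : ℕ) (f : ℕ → R) :
    ∑ x ∈ range n, adj R c.nb b x * (ind R (v = x) * f x) = adj R c.nb b v * f v := by
  by_cases hv : v < n
  · rw [← sum_ind_mul hv fun x => adj R c.nb b x * f x]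
    exact sum_congr rfl fun x _ => by ring
  · have h1 : adj R c.nb b v = 0 := by
      unfold adj ind
      rw [if_neg fun h => hv (e.gr.lt' h)]
    rw [h1, zero_mul]
    refine sum_eq_zero fun x hx => ?_
    have : v ≠ x := fun h => hv (h ▸ mem_range.1 hx)
    simp [ind, this]

theorem Env.sum_H_ind (v : ℕ) (f : ℕ → R) :
    ∑ x ∈ range n, ind R (x ∈ c.H) * (ind R (v = x) * f x) = ind R (v ∈ c.H) * f v := by
  by_cases hv : v < n
  · rw [← sum_ind_mul hv fun x => ind R (x ∈ c.H) * f x]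
    exact sum_congr rfl fun x _ => by ring
  · have h1 : ind R (v ∈ c.H) = 0 := by
      unfold ind
      rw [if_neg fun h => hv (mem_range.1 (e.H_sub h))]
    rw [h1, zero_mul]
    refine sum_eq_zero fun x hx => ?_
    have : v ≠ x := fun h => hv (h ▸ mem_range.1 hx)
    simp [ind, this]

end

/-- The part of an entry that does not depend on the vertices in the key. -/
def slot (R : Type*) [CommSemiring R] (t : ℕ) (key : Key) (x : R) : R :=
  ind R (key.1 = t) * ind R (key.2.2.2 = 0) * x

/-! Each of the following programs adds to a table what is new because of the endpoints `a`, `b`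
of an edge, in this order, that the registers `i` and `j` hold. -/

/-- Table `7` holds the walks of length two whose middle vertex is not huge. -/
def progT (i j : ℕ) : Prog :=
  .ifz (mem 5 j) (.seq
    (.iter j (.seq (.emit 7 i 30 6 false []) (.emit 7 30 i 6 false [])))
    (.emit 7 i i 6 false []))

/-- Table `9` holds the sums of the degrees of the neighbours that are not huge. -/
def progS (i j : ℕ) : Prog :=
  .ifz (mem 5 j) (.seq
    (.seq (.emit 9 i 6 6 false [size j]) (.emit 9 i 6 6 false []))
    (.iter j (.emit 9 30 6 6 false [])))

/-- Table `10` holds the walks of length two whose middle vertex is not big, weighted by the degree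
of that vertex. -/
def progD (i j : ℕ) : Prog :=
  .ifz (mem 0 j) (.seq
    (.iter j (.seq
      (.seq (.emit 10 i 30 6 false [size j]) (.emit 10 i 30 6 false []))
      (.seq (.seq (.emit 10 30 i 6 false [size j]) (.emit 10 30 i 6 false []))
        (.iter j (.emit 10 30 31 6 false [])))))
    (.seq (.emit 10 i i 6 false [size j]) (.emit 10 i i 6 false [])))

/-- Table `8` holds `tableQ`. -/
def progQ (i j : ℕ) : Prog :=
  .seq
    (.ifnz (mem 5 i) (.ifz (mem 5 j) (.iter 5
      (.seq (.emit 8 i 30 6 false [entry 7 j 30]) (.emit 8 30 i 6 false [entry 7 j 30])))))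
    (.ifz (mem 5 i) (.ifz (mem 5 j)
      (.iter 5 (.ifnz (mem i 30) (.iter 5 (.ifnz (mem j 31) (.emit 8 30 31 6 false [])))))))

/-- Table `11` holds `tableZ`. -/
def progZ (i j : ℕ) : Prog :=
  .seq (.ifnz (mem 0 j) (.ifz (mem 5 j)
      (.iter 5 (.ifnz (mem i 30) (.ifnz (mem j 30) (.emit 11 i j 6 false []))))))
    (.seq (.ifnz (mem 5 j) (.iter 0 (.ifz (mem 5 30)
        (.ifnz (mem i 30) (.ifnz (mem j 30) (.emit 11 i 30 6 false []))))))
      (.ifnz (mem 5 j) (.ifnz (mem 0 i) (.ifz (mem 5 i)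
        (.iter i (.ifnz (mem j 30) (.emit 11 30 i 6 false [])))))))

/-- Table `12` holds `tableC`. -/
def progC (i j : ℕ) : Prog :=
  .ifz (mem 0 j) (.seq
    (.iter j (.seq
      (.iter j (.seq (.emit 12 i 30 31 false [])
        (.seq (.emit 12 30 i 31 false []) (.emit 12 30 31 i false []))))
      (.seq (.emit 12 i i 30 false []) (.seq (.emit 12 i 30 i false []) (.emit 12 30 i i false [])))))
    (.emit 12 i i i false []))

/-- Table `13` holds `tableY`. -/
def progY (i j : ℕ) : Prog :=
  .ifz (mem 0 j) (.seq
    (.iter j (.ifz (mem 0 30) (.seq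
      (.ifnz (mem i 30) (.seq
        (.iter j (.emit 13 i 31 6 false []))
        (.seq (.emit 13 i i 6 false []) (.iter 30 (.emit 13 i 31 6 false [])))))
      (.iter j (.ifnz (mem 30 31) (.emit 13 31 i 6 false []))))))
    (.ifz (mem 0 i) (.iter j (.ifnz (mem i 30)
      (.seq (.iter j (.emit 13 30 31 6 false [])) (.emit 13 30 i 6 false []))))))

section

variable {R : Type*} [CommRing R] {n : ℕ} {c : Cfg} {μ : Key → ℕ} (e : Env n c μ)
  {ρ : ℕ → ℕ} (hρ : Base n ρ) {i j : ℕ} (hi : i < 30) (hj : j < 30) (ha : ρ i < n) (hb : ρ j < n)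
  (t u v w : ℕ)

include e hρ hi hj ha hb

theorem delta_progT : (progT i j).delta R 30 ρ μ (t, u, v, w) =
    slot R 7 (t, u, v, w) (newWalk₂ R c.nb (ρ i) (ρ j) (out R c.H) u v) := by
  have i1 : i ≠ 30 := by omega
  simp [progT, delta_seq, delta_emit, hρ.r6, hρ.r5, e.ifz_H, e.iter hb, i1, slot]
  generalize ind R (t = 7) * ind R (w = 0) = K
  unfold newWalk₂
  generalize ind R (u = ρ i) = p, ind R (v = ρ i) = q
  have h1 : ∀ x, adj R c.nb (ρ j) x * (K * (p * ind R (v = x)) + K * (ind R (u = x) * q)) =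
      adj R c.nb (ρ j) x * (ind R (v = x) * (K * p)) +
      adj R c.nb (ρ j) x * (ind R (u = x) * (K * q)) := fun x => by ring
  simp only [h1, sum_add_distrib, e.sum_adj_ind]
  ring

theorem delta_progS : (progS i j).delta R 30 ρ μ (t, u, v, w) =
    slot R 9 (t, u, v, w) (ind R (v = 0) * (out R c.H (ρ j) *
      (ind R (u = ρ i) * (deg R n c.nb (ρ j) + 1) + adj R c.nb (ρ j) u))) := by
  simp [progS, delta_seq, delta_emit, hρ.r6, hρ.r5, e.ifz_H, e.iter hb, e.size hρ.r6 hb, slot]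
  generalize ind R (t = 9) * ind R (w = 0) = K
  have h1 : ∀ x, adj R c.nb (ρ j) x * (K * (ind R (u = x) * ind R (v = 0))) =
      adj R c.nb (ρ j) x * (ind R (u = x) * (K * ind R (v = 0))) := fun x => by ring
  simp only [h1, e.sum_adj_ind]
  ring

theorem delta_progD : (progD i j).delta R 30 ρ μ (t, u, v, w) =
    slot R 10 (t, u, v, w)
      (newWalk₂ R c.nb (ρ i) (ρ j) (fun x => out R c.B x * (deg R n c.nb x + 1)) u v +
        out R c.B (ρ j) * (adj R c.nb (ρ j) u * adj R c.nb (ρ j) v)) := by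
  have i1 : i ≠ 30 := by omega
  have j1 : j ≠ 30 := by omega
  simp [progD, delta_seq, delta_emit, hρ.r6, hρ.r0, e.ifz_B, e.iter, hb, e.size, i1, j1, slot]
  generalize ind R (t = 10) * ind R (w = 0) = K
  unfold newWalk₂
  beta_reduce
  generalize ind R (u = ρ i) = p, ind R (v = ρ i) = q, deg R n c.nb (ρ j) = d
  have h1 : ∀ x y, adj R c.nb (ρ j) y * (K * (ind R (u = x) * ind R (v = y))) =
      adj R c.nb (ρ j) y * (ind R (v = y) * (K * ind R (u = x))) := fun x y => by ring
  simp only [h1, e.sum_adj_ind]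
  have h2 : ∀ x, adj R c.nb (ρ j) x * (K * (p * ind R (v = x)) * d + K * (p * ind R (v = x)) +
      (K * (ind R (u = x) * q) * d + K * (ind R (u = x) * q) +
        adj R c.nb (ρ j) v * (K * ind R (u = x)))) =
      adj R c.nb (ρ j) x * (ind R (v = x) * (K * p * (d + 1))) +
      adj R c.nb (ρ j) x * (ind R (u = x) * (K * (q * (d + 1) + adj R c.nb (ρ j) v))) :=
    fun x => by ring
  simp only [h2, sum_add_distrib, e.sum_adj_ind]
  ring

theorem delta_progQ (T : ℕ → ℕ → R) (hT : ∀ x y, (μ (7, x, y, 0) : R) = T x y) :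
    (progQ i j).delta R 30 ρ μ (t, u, v, w) =
    slot R 8 (t, u, v, w) (ind R (ρ i ∈ c.H) * (out R c.H (ρ j) *
    (ind R (u = ρ i) * (ind R (v ∈ c.H) * T (ρ j) v) +
      ind R (v = ρ i) * (ind R (u ∈ c.H) * T (ρ j) u))) +
  out R c.H (ρ i) * (out R c.H (ρ j) *
    (ind R (u ∈ c.H) * (adj R c.nb (ρ i) u * (ind R (v ∈ c.H) * adj R c.nb (ρ j) v))))) := by
  have i1 : i ≠ 30 := by omega
  have j1 : j ≠ 30 := by omega
  have j2 : j ≠ 31 := by omega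
  simp [progQ, delta_seq, delta_emit, hρ.r6, hρ.r5, e.ifz_H, e.ifnz_H, e.ifnz, e.iter_H, ha, hb,
    i1, j1, j2, entry, Atom.val, hT, slot]
  generalize ind R (t = 8) * ind R (w = 0) = K
  generalize ind R (u = ρ i) = p, ind R (v = ρ i) = q
  have h1 : ∀ x, ind R (x ∈ c.H) * (K * (p * ind R (v = x)) * T (ρ j) x +
      K * (ind R (u = x) * q) * T (ρ j) x) =
      ind R (x ∈ c.H) * (ind R (v = x) * (K * p * T (ρ j) x)) +
      ind R (x ∈ c.H) * (ind R (u = x) * (K * q * T (ρ j) x)) := fun x => by ring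
  have h2 : ∀ x y, ind R (y ∈ c.H) * (adj R c.nb (ρ j) y * (K * (ind R (u = x) * ind R (v = y)))) =
      ind R (y ∈ c.H) * (ind R (v = y) * (K * ind R (u = x) * adj R c.nb (ρ j) y)) :=
    fun x y => by ring
  have h3 : ∀ x, ind R (x ∈ c.H) * (adj R c.nb (ρ i) x *
      (ind R (v ∈ c.H) * (K * ind R (u = x) * adj R c.nb (ρ j) v))) =
      ind R (x ∈ c.H) * (ind R (u = x) * (adj R c.nb (ρ i) x *
        (ind R (v ∈ c.H) * (K * adj R c.nb (ρ j) v)))) := fun x => by ring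
  simp only [h1, h2, e.sum_H_ind, h3, sum_add_distrib]
  ring

theorem delta_progZ : (progZ i j).delta R 30 ρ μ (t, u, v, w) =
    slot R 11 (t, u, v, w) (newZ R n c.nb c.B c.H (ρ i) (ρ j) u v) := by
  have i1 : i ≠ 30 := by omega
  have j1 : j ≠ 30 := by omega
  simp [progZ, delta_seq, delta_emit, hρ.r6, hρ.r5, hρ.r0, e.ifz_H, e.ifnz_H, e.ifnz_B, e.ifnz,
    e.iter_H, e.iter_B, e.iter, ha, hb, i1, j1, slot]
  generalize ind R (t = 11) * ind R (w = 0) = K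
  have h1 : ∀ x, ind R (x ∈ c.H) * (adj R c.nb (ρ i) x * (adj R c.nb (ρ j) x *
      (K * (ind R (u = ρ i) * ind R (v = ρ j))))) =
      ind R (x ∈ c.H) * (adj R c.nb (ρ i) x * adj R c.nb x (ρ j)) *
        (K * (ind R (u = ρ i) * ind R (v = ρ j))) :=
    fun x => by rw [e.gr.adj_comm x]; ring
  have h2 : ∀ x, ind R (x ∈ c.B) * (out R c.H x * (adj R c.nb (ρ i) x * (adj R c.nb (ρ j) x *
      (K * (ind R (u = ρ i) * ind R (v = x)))))) =
      adj R c.nb (ρ i) x * (ind R (v = x) * (ind R (x ∈ c.B) * (out R c.H x * (adj R c.nb (ρ j) x *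
        (K * ind R (u = ρ i)))))) := fun x => by ring
  have h3 : ∀ x, adj R c.nb (ρ i) x * (adj R c.nb (ρ j) x * (K * (ind R (u = x) *
      ind R (v = ρ i)))) =
      adj R c.nb (ρ i) x * (ind R (u = x) * (adj R c.nb (ρ j) x * (K * ind R (v = ρ i)))) :=
    fun x => by ring
  simp only [h1, ← sum_mul, h2, h3, e.sum_adj_ind, newZ, walk₂]
  ring

theorem delta_progC : (progC i j).delta R 30 ρ μ (t, u, v, w) =
    ind R (t = 12) * newC R c.nb c.B (ρ i) (ρ j) u v w := by
  have i1 : i ≠ 30 := by omega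
  have j1 : j ≠ 30 := by omega
  have i2 : i ≠ 31 := by omega
  simp [progC, delta_seq, delta_emit, hρ.r0, hρ.r6, e.ifz_B, e.iter, hb, i1, i2, j1]
  generalize ind R (t = 12) = K
  unfold newC
  generalize ind R (u = ρ i) = p, ind R (v = ρ i) = q, ind R (w = ρ i) = r
  have h1 : ∀ x y, adj R c.nb (ρ j) y * (K * ind R (w = y) * (p * ind R (v = x)) +
      (K * ind R (w = y) * (ind R (u = x) * q) + K * r * (ind R (u = x) * ind R (v = y)))) =
      adj R c.nb (ρ j) y * (ind R (w = y) * (K * (p * ind R (v = x) + ind R (u = x) * q))) +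
      adj R c.nb (ρ j) y * (ind R (v = y) * (K * (r * ind R (u = x)))) := fun x y => by ring
  simp only [h1, e.sum_adj_ind, sum_add_distrib]
  have h2 : ∀ x, adj R c.nb (ρ j) x *
      (adj R c.nb (ρ j) w * (K * (p * ind R (v = x) + ind R (u = x) * q)) +
        adj R c.nb (ρ j) v * (K * (r * ind R (u = x))) +
        (K * ind R (w = x) * (p * q) + (K * r * (p * ind R (v = x)) + K * r * (ind R (u = x) * q)))) =
      adj R c.nb (ρ j) x * (ind R (v = x) * (K * p * (adj R c.nb (ρ j) w + r))) +
      adj R c.nb (ρ j) x * (ind R (u = x) * (K * (adj R c.nb (ρ j) w * q + adj R c.nb (ρ j) v * r +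
        r * q))) + adj R c.nb (ρ j) x * (ind R (w = x) * (K * (p * q))) := fun x => by ring
  simp only [h2, e.sum_adj_ind, sum_add_distrib]
  ring

attribute [local congr] sum_congr in
theorem delta_progY : (progY i j).delta R 30 ρ μ (t, u, v, w) =
    slot R 13 (t, u, v, w) (newY R n c.nb c.B (ρ i) (ρ j) u v) := by
  have i1 : i ≠ 30 := by omega
  have j1 : j ≠ 30 := by omega
  have i2 : i ≠ 31 := by omega
  have ha' := mem_range.2 ha
  have hb' := mem_range.2 hb
  simp +contextual [-mem_range, progY, delta_seq, delta_emit, hρ.r0, hρ.r6, e.ifz_B, e.iter',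
    e.ifnz', ha', hb', i1, i2, j1, slot]
  unfold newY
  generalize ind R (t = 13) * ind R (w = 0) = K
  generalize ind R (u = ρ i) = p, ind R (v = ρ i) = q
  have h1 : ∀ z y, adj R c.nb z y * (K * (p * ind R (v = y))) =
      adj R c.nb z y * (ind R (v = y) * (K * p)) := fun z y => by ring
  have h2 : ∀ x y, adj R c.nb (ρ j) y * (adj R c.nb x y * (K * (ind R (u = y) * q))) =
      adj R c.nb (ρ j) y * (ind R (u = y) * (adj R c.nb x y * (K * q))) := fun x y => by ring
  have h3 : ∀ x y, adj R c.nb (ρ j) y * (K * (ind R (u = x) * ind R (v = y))) =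
      adj R c.nb (ρ j) y * (ind R (v = y) * (K * ind R (u = x))) := fun x y => by ring
  simp only [h1, h2, h3, e.sum_adj_ind]
  have h4 : ∀ x, adj R c.nb (ρ j) x * (adj R c.nb (ρ i) x *
      (adj R c.nb (ρ j) v * (K * ind R (u = x)) + K * (ind R (u = x) * q))) =
      adj R c.nb (ρ j) x * (ind R (u = x) * (adj R c.nb (ρ i) x * (K * (adj R c.nb (ρ j) v + q)))) :=
    fun x => by ring
  have h5 : ∀ x, adj R c.nb (ρ j) x * (out R c.B x * (adj R c.nb (ρ i) x *
      (adj R c.nb (ρ j) v * (K * p) + (K * (p * q) + adj R c.nb x v * (K * p))) +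
        adj R c.nb (ρ j) u * (adj R c.nb x u * (K * q)))) =
      out R c.B x * (adj R c.nb (ρ i) x * adj R c.nb x (ρ j)) * (K * p * (adj R c.nb (ρ j) v + q)) +
      out R c.B x * (adj R c.nb (ρ j) x * (adj R c.nb (ρ i) x * adj R c.nb x v)) * (K * p) +
      out R c.B x * (adj R c.nb u x * adj R c.nb x (ρ j)) * (adj R c.nb (ρ j) u * K * q) :=
    fun x => by rw [e.gr.adj_comm x u, e.gr.adj_comm x (ρ j)]; ring
  simp only [h4, h5, e.sum_adj_ind, sum_add_distrib, ← sum_mul, walk₂]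
  ring

end

/-! ### Programs that answer queries -/

section

variable {R : Type*} [CommRing R] {n : ℕ} {nb : ℕ → Finset ℕ}

theorem sum_split (S : Finset ℕ) (f : ℕ → R) : ∑ x ∈ range n, f x =
    ∑ x ∈ range n, out R S x * f x + ∑ x ∈ range n, ind R (x ∈ S) * f x := by
  rw [← sum_add_distrib]
  refine sum_congr rfl fun x _ => ?_
  rw [← add_mul, out, add_comm, ind_add_not, one_mul]

theorem walk₂_split (S : Finset ℕ) (u v : ℕ) : walk₂ R n nb 1 u v =
    walk₂ R n nb (out R S) u v + ∑ x ∈ range n, ind R (x ∈ S) * (adj R nb u x * adj R nb x v) := by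
  unfold walk₂
  simp only [Pi.one_apply, one_mul]
  rw [sum_split S]

/-- The walks of length three, sorted by whether their third and then their second vertex is in
`S`. -/
theorem Gr.walk₃_split (h : Gr n nb) (S : Finset ℕ) (u v : ℕ) : walk₃ R n nb u v =
    ∑ x ∈ range n, adj R nb u x * walk₂ R n nb (out R S) x v +
    ∑ y ∈ range n, ind R (y ∈ S) * (adj R nb v y * (walk₂ R n nb (out R S) u y +
      ∑ x ∈ range n, ind R (x ∈ S) * (adj R nb u x * adj R nb y x))) := by
  have h1 : walk₃ R n nb u v = ∑ x ∈ range n, adj R nb u x * walk₂ R n nb (out R S) x v +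
      ∑ x ∈ range n, adj R nb u x *
        ∑ y ∈ range n, ind R (y ∈ S) * (adj R nb x y * adj R nb y v) := by
    rw [← sum_add_distrib]
    refine sum_congr rfl fun x _ => ?_
    rw [← mul_add, ← walk₂_split, walk₂, mul_sum]
    exact sum_congr rfl fun y _ => by simp
  rw [h1]
  congr 1
  have h2 : ∀ y, walk₂ R n nb (out R S) u y +
      ∑ x ∈ range n, ind R (x ∈ S) * (adj R nb u x * adj R nb y x) = walk₂ R n nb 1 u y := by
    intro y
    simp only [walk₂_split S, h.adj_comm y]
  simp only [h2, h.adj_comm v, mul_sum]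
  rw [sum_comm]
  refine sum_congr rfl fun y _ => ?_
  simp only [walk₂, Pi.one_apply, one_mul, mul_sum]
  exact sum_congr rfl fun x _ => by ring

theorem Gr.walk₃_comm (h : Gr n nb) (u v : ℕ) : walk₃ R n nb u v = walk₃ R n nb v u := by
  unfold walk₃
  rw [sum_comm]
  refine sum_congr rfl fun x _ => sum_congr rfl fun y _ => ?_
  rw [h.adj_comm u y, h.adj_comm y x, h.adj_comm x v]; ring

end

/-- The `m`-fold repetition of a program. -/
def Prog.times (p : Prog) : ℕ → Prog
  | 0 => .skip
  | m + 1 => .seq (p.times m) p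

theorem Prog.delta_times {R : Type*} [CommRing R] (p : Prog) (m N : ℕ) (ρ : ℕ → ℕ)
    (μ : Key → ℕ) (key : Key) :
    (p.times m).delta R N ρ μ key = m * p.delta R N ρ μ key := by
  induction m with
  | zero => simp [Prog.times, delta_skip]
  | succ m ih => rw [Prog.times, delta_seq, ih]; push_cast; ring

/-- Adds a product of table entries to the result in table `t`. -/
def put (t : ℕ) (neg : Bool) (vs : List Atom) : Prog := .emit t 6 6 6 neg vs

/-- The common neighbours of the vertices in the registers `1` and `2`. -/
def askCommon : Prog :=
  .seq (put 14 false [entry 7 1 2]) (.iter 5 (.ifnz (mem 1 30) (.ifnz (mem 2 30) (put 14 false []))))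

/-- The sum of the degrees of the neighbours. -/
def askDegSum (i : ℕ) : Prog :=
  .seq (put 15 false [⟨9, i, 6, 6⟩]) (.iter 5 (.ifnz (mem i 30) (put 15 false [size 30])))

/-- The sum of the degrees of the common neighbours. -/
def askDegCommon : Prog :=
  .seq (put 15 false [entry 10 1 2])
    (.iter 0 (.ifnz (mem 1 30) (.ifnz (mem 2 30) (put 15 false [size 30]))))

/-- The walks of length three; a loop over a neighbourhood is needed only if an end is not huge. -/
def askWalk (i j : ℕ) : Prog :=
  .seq
    (.ifz (mem 5 i) (.seq (.iter i (put 15 false [entry 7 30 j]))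
      (.iter 5 (.ifnz (mem j 30) (.seq (put 15 false [entry 7 i 30])
        (.iter 5 (.ifnz (mem i 31) (.ifnz (mem 30 31) (put 15 false [])))))))))
    (.ifnz (mem 5 i) (.seq
      (.ifz (mem 5 j) (.seq (.iter j (put 15 false [entry 7 30 i]))
        (.iter 5 (.ifnz (mem i 30) (.seq (put 15 false [entry 7 j 30])
          (.iter 5 (.ifnz (mem j 31) (.ifnz (mem 30 31) (put 15 false [])))))))))
      (.ifnz (mem 5 j) (.seq (.seq (put 15 false [entry 8 i j])
          (.iter 5 (.ifnz (mem i 30) (put 15 false [entry 7 30 j]))))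
        (.iter 5 (.ifnz (mem j 30) (.seq (put 15 false [entry 7 i 30])
          (.iter 5 (.ifnz (mem i 31) (.ifnz (mem 30 31) (put 15 false []))))))))))) 

/-- The pairs of a walk of length two and a triangle on its first edge, sorted by whether the apex
of the walk and then that of the triangle is big or huge. -/
def askFan (i j : ℕ) : Prog :=
  .seq (.seq (put 15 false [entry 13 i j]) (.iter 0 (.ifnz (mem i 30) (put 15 false [⟨12, i, j, 30⟩]))))
    (.seq (.iter 0 (.ifnz (mem i 30) (.ifnz (mem j 30)
        (.seq (put 15 false [entry 7 i 30]) (put 15 false [entry 11 i 30])))))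
      (.iter 5 (.ifnz (mem 0 30) (.ifnz (mem i 30) (.ifnz (mem j 30)
        (.iter 5 (.ifnz (mem i 31) (.ifnz (mem 30 31) (put 15 false [])))))))))

section

variable {R : Type*} [CommRing R] {n : ℕ} {c : Cfg} {μ : Key → ℕ} (e : Env n c μ)
  {ρ : ℕ → ℕ} (hρ : Base n ρ)

theorem val_mk (t x y z : ℕ) : (⟨t, x, y, z⟩ : Atom).val ρ μ = μ (t, ρ x, ρ y, ρ z) := rfl

theorem delta_put (h6 : ρ 6 = 0) (N t : ℕ) (neg : Bool) (vs : List Atom) :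
    (put t neg vs).delta R N ρ μ (t, 0, 0, 0) =
      (if neg then -1 else 1) * (vs.map fun a => (a.val ρ μ : R)).prod := by
  rw [put, delta_emit]
  simp [h6, ind]

include e hρ

theorem delta_askCommon (h1 : ρ 1 < n) (h2 : ρ 2 < n)
    (hT : ∀ x y, (μ (7, x, y, 0) : R) = walk₂ R n c.nb (out R c.H) x y) :
    askCommon.delta R 30 ρ μ (14, 0, 0, 0) = walk₂ R n c.nb 1 (ρ 1) (ρ 2) := by
  rw [walk₂_split c.H]
  simp [askCommon, delta_seq, delta_put, hρ.r6, hρ.r5, e.iter_H, e.ifnz, h1, h2, entry, val_mk, hT,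
    e.gr.adj_comm (ρ 2)]

theorem delta_askDegCommon (h1 : ρ 1 < n) (h2 : ρ 2 < n)
    (hD : ∀ x y, (μ (10, x, y, 0) : R) = walk₂ R n c.nb (fun z => out R c.B z * deg R n c.nb z) x y) :
    askDegCommon.delta R 30 ρ μ (15, 0, 0, 0) = walk₂ R n c.nb (deg R n c.nb) (ρ 1) (ρ 2) := by
  rw [walk₂, sum_split c.B]
  have h : ∀ x ∈ range n, (size 30).val (update ρ 30 x) μ = deg R n c.nb x := by
    intro x hx
    rw [e.size] <;> simp [hρ.r6, mem_range.1 hx]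
  simp [askDegCommon, delta_seq, delta_put, hρ.r6, hρ.r0, e.iter_B, e.ifnz, h1, h2, entry, val_mk, hD]
  rw [walk₂]
  congr 1
  · exact sum_congr rfl fun x _ => by ring
  · refine sum_congr rfl fun x hx => ?_
    rw [h x hx, e.gr.adj_comm (ρ 2)]; ring

theorem delta_askDegSum {i : ℕ} (hi : i < 30) (h1 : ρ i < n)
    (hS : ∀ x, (μ (9, x, 0, 0) : R) = degSum R n c.nb (out R c.H) x) :
    (askDegSum i).delta R 30 ρ μ (15, 0, 0, 0) = degSum R n c.nb 1 (ρ i) := by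
  have i1 : i ≠ 30 := by omega
  rw [degSum, sum_split c.H]
  have h : ∀ x ∈ range n, (size 30).val (update ρ 30 x) μ = deg R n c.nb x := by
    intro x hx
    rw [e.size] <;> simp [hρ.r6, mem_range.1 hx]
  simp [askDegSum, delta_seq, delta_put, hρ.r6, hρ.r5, e.iter_H, e.ifnz, h1, i1, val_mk, hS]
  rw [degSum]
  congr 1
  exact sum_congr rfl fun x hx => by rw [h x hx]

attribute [local congr] sum_congr in
theorem delta_askWalk {i j : ℕ} (hi : i < 30) (hj : j < 30) (ha : ρ i < n) (hb : ρ j < n)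
    (hT : ∀ x y, (μ (7, x, y, 0) : R) = walk₂ R n c.nb (out R c.H) x y)
    (hQ : ∀ x y, (μ (8, x, y, 0) : R) = tableQ R n c.nb c.H x y) :
    (askWalk i j).delta R 30 ρ μ (15, 0, 0, 0) = walk₃ R n c.nb (ρ i) (ρ j) := by
  have i1 : i ≠ 30 := by omega
  have j1 : j ≠ 30 := by omega
  have i2 : i ≠ 31 := by omega
  have j2 : j ≠ 31 := by omega
  have ha' := mem_range.2 ha
  have hb' := mem_range.2 hb
  simp +contextual [-mem_range, askWalk, delta_seq, delta_put, hρ.r5, hρ.r6, e.ifz_H, e.ifnz_H,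
    e.iter_H, e.iter', e.ifnz', ha', hb', i1, i2, j1, j2, entry, val_mk, hT, hQ]
  by_cases h1 : ρ i ∈ c.H
  · by_cases h2 : ρ j ∈ c.H
    · rw [e.gr.walk₃_split c.H, sum_split c.H]
      simp [h1, h2, ind, out, tableQ]
    · rw [e.gr.walk₃_comm, e.gr.walk₃_split c.H]
      simp [h1, h2, ind, out]
  · rw [e.gr.walk₃_split c.H]
    simp [h1, ind, out]

attribute [local congr] sum_congr in
theorem delta_askFan {i j : ℕ} (hi : i < 30) (hj : j < 30) (ha : ρ i < n) (hb : ρ j < n)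
    (hT : ∀ x y, (μ (7, x, y, 0) : R) = walk₂ R n c.nb (out R c.H) x y)
    (hZ : ∀ x y, (μ (11, x, y, 0) : R) = tableZ R n c.nb c.B c.H x y)
    (hC : ∀ x y z, (μ (12, x, y, z) : R) = tableC R n c.nb c.B x y z)
    (hY : ∀ x y, (μ (13, x, y, 0) : R) = tableY R n c.nb c.B x y) :
    (askFan i j).delta R 30 ρ μ (15, 0, 0, 0) = fan R n c.nb (ρ i) (ρ j) := by
  have i1 : i ≠ 30 := by omega
  have j1 : j ≠ 30 := by omega
  have i2 : i ≠ 31 := by omega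
  have ha' := mem_range.2 ha
  have hb' := mem_range.2 hb
  simp +contextual [-mem_range, askFan, delta_seq, delta_put, hρ.r0, hρ.r5, hρ.r6, e.ifnz_B,
    e.iter_H, e.iter_B, e.ifnz', ha', hb', i1, i2, j1, entry, val_mk, hT, hZ, hC, hY]
  have f1 : fan R n c.nb (ρ i) (ρ j) = 
      ∑ x ∈ range n, out R c.B x *
        (adj R c.nb (ρ i) x * adj R c.nb x (ρ j) * walk₂ R n c.nb 1 (ρ i) x) +
      ∑ x ∈ range n, ind R (x ∈ c.B) *
        (adj R c.nb (ρ i) x * adj R c.nb x (ρ j) * walk₂ R n c.nb 1 (ρ i) x) := by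
    rw [← sum_split]; simp [fan, walk₂]
  rw [f1]
  have f2 : ∀ x, ind R (x ∈ c.B) * (adj R c.nb (ρ i) x * tableC R n c.nb c.B (ρ i) (ρ j) x) =
      ∑ z ∈ range n, out R c.B z * (adj R c.nb (ρ i) z * adj R c.nb z (ρ j)) *
        (ind R (x ∈ c.B) * (adj R c.nb (ρ i) x * adj R c.nb x z)) := by
    intro x
    rw [tableC, mul_sum, mul_sum]
    refine sum_congr rfl fun z _ => ?_
    rw [e.gr.adj_comm (ρ i) z, e.gr.adj_comm x z]; ring
  rw [sum_congr rfl fun x _ => f2 x, sum_comm, tableY, walk₂,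
    ← sum_add_distrib, ← sum_add_distrib]
  congr 1
  · refine sum_congr rfl fun x _ => ?_
    rw [walk₂_split c.B, ← mul_sum]; ring
  · refine sum_congr rfl fun x _ => ?_
    rw [walk₂_split c.H, e.gr.adj_comm x (ρ j), tableZ, walk₂]
    have h1 : out R c.H x = 1 - ind R (x ∈ c.H) := by
      rw [out, ← ind_add_not (R := R) (x ∈ c.H)]; ring
    have h2 : ∀ y, adj R c.nb x y = adj R c.nb y x := e.gr.adj_comm x
    simp only [h2]
    rw [show walk₂ R n c.nb (fun d => ind R (d ∈ c.H)) (ρ i) x = ∑ y ∈ range n,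
      ind R (y ∈ c.H) * (adj R c.nb (ρ i) y * adj R c.nb y x) from rfl]
    generalize ∑ y ∈ range n, ind R (y ∈ c.H) * (adj R c.nb (ρ i) y * adj R c.nb y x) = s
    have h3 := ind_mul_self (R := R) (x ∈ c.B)
    have h4 := adj_mul_self (R := R) (nb := c.nb) (ρ i) x
    rw [h1]
    linear_combination (adj R c.nb (ρ j) x * (1 - ind R (x ∈ c.H)) * s *
      adj R c.nb (ρ i) x * adj R c.nb (ρ i) x) * h3 + (adj R c.nb (ρ j) x * (1 - ind R (x ∈ c.H)) * s *
      ind R (x ∈ c.B)) * h4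

end

/-! ### Auxiliary tables as building blocks -/

/-- At most `b` entries are nonzero. -/
def Few (F : Key → ℕ) (b : ℕ) : Prop :=
  ∃ S : Finset Key, S.card ≤ b ∧ ∀ key, F key ≠ 0 → key ∈ S

theorem Few.min {F : Key → ℕ} {a b : ℕ} (ha : Few F a) (hb : Few F b) :
    Few F (min a b) := by
  rcases min_choice a b with h | h <;> rw [h] <;> assumption

theorem Few.add {F G : Key → ℕ} {a b : ℕ} (ha : Few F a) (hb : Few G b) :
    Few (fun key => F key + G key) (a + b) := by
  classical
  obtain ⟨S, h1, h2⟩ := ha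
  obtain ⟨T, h3, h4⟩ := hb
  refine ⟨S ∪ T, (Finset.card_union_le _ _).trans (by omega), fun key h => ?_⟩
  by_cases h5 : F key = 0
  · exact Finset.mem_union_right _ (h4 _ fun h6 => h (by simp only [h5, h6]))
  · exact Finset.mem_union_left _ (h2 _ h5)

theorem Few.of_cover {F : Key → ℕ} {n b : ℕ} (g : ℕ → Finset Key) (β : ℕ → ℕ)
    (h : ∀ key, F key ≠ 0 → ∃ c < n, key ∈ g c) (hβ : ∀ c, (g c).card ≤ β c)
    (hb : ∑ c ∈ range n, β c ≤ b) : Few F b := by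
  classical
  refine ⟨(range n).biUnion g,
    Finset.card_biUnion_le.trans ((sum_le_sum fun c _ => hβ c).trans hb), fun key hk => ?_⟩
  obtain ⟨c, hc, h'⟩ := h key hk
  exact Finset.mem_biUnion.2 ⟨c, mem_range.2 hc, h'⟩

/-- An auxiliary table: its entries as polynomials in the adjacency matrix, over any ring, and a
program for the contribution of the endpoints of a new edge, taken in one order. -/
structure Table where
  val : (R : Type) → [CommSemiring R] → ℕ → (ℕ → Finset ℕ) → Finset ℕ → Finset ℕ →
    Key → R
  prog : ℕ → ℕ → Prog
  /-- A bound for the number of entries. -/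
  size : Bool → ℕ → ℕ → ℕ → ℕ
  cast : ∀ (R : Type) [CommRing R] (n nb B H key), ((val ℕ n nb B H key : ℕ) : R) = val R n nb B H key
  le : ∀ n nb B H key, val ℕ n nb B H key ≤ n * n
  empty : ∀ n B H key, val ℕ n (fun _ => ∅) B H key = 0
  scratch : ∀ n nb B H (key : Key), 14 ≤ key.1 → val ℕ n nb B H key = 0
  insert : ∀ n nb B H x key, Gr n nb → nb x = ∅ →
    val ℕ n nb (insert x B) H key = val ℕ n nb B H key ∧
      val ℕ n nb B (insert x H) key = val ℕ n nb B H key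
  step : ∀ (R : Type) [CommRing R] (n : ℕ) (c : Cfg) (μ : Key → ℕ) (ρ : ℕ → ℕ) (key),
    Env n c μ → Base n ρ → ρ 1 < n → ρ 2 < n → ρ 1 ≠ ρ 2 → ρ 2 ∉ c.nb (ρ 1) →
    (∀ x y, (μ (7, x, y, 0) : R) = walk₂ R n c.nb (out R c.H) x y) →
    val R n (addE c.nb (ρ 1) (ρ 2)) c.B c.H key = val R n c.nb c.B c.H key +
      (prog 1 2).delta R 30 ρ μ key + (prog 2 1).delta R 30 ρ μ key
  size_mono : ∀ sq n M M' k k', M ≤ M' → k ≤ k' → size sq n M k ≤ size sq n M' k'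
  few : ∀ sq n nb B H M k, Gr n nb → B ⊆ range n → H ⊆ range n → Cheap sq nb B H k →
    ∑ x ∈ range n, (nb x).card ≤ 2 * M → Few (val ℕ n nb B H) (size sq n M k)

/-- The sum of several tables, which are supposed to have disjoint supports. -/
def total (L : List Table) (R : Type) [CommSemiring R] (n : ℕ) (nb : ℕ → Finset ℕ) (B H : Finset ℕ)
    (key : Key) : R :=
  (L.map fun T => T.val R n nb B H key).sum

/-- The program that adds the contributions of both orders of the endpoints of a new edge to every
table of the list. -/
def updates : List Table → Prog
  | [] => .skip
  | T :: L => .seq (.seq (T.prog 1 2) (T.prog 2 1)) (updates L)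

theorem total_cast (L : List Table) (R : Type) [CommRing R] (n nb B H key) :
    ((total L ℕ n nb B H key : ℕ) : R) = total L R n nb B H key := by
  induction L with
  | nil => simp [total]
  | cons T L ih =>
    simp only [total, List.map_cons, List.sum_cons, Nat.cast_add, T.cast] at ih ⊢
    rw [ih]

theorem total_append (L L' : List Table) (R : Type) [CommSemiring R] (n nb B H key) :
    total (L ++ L') R n nb B H key = total L R n nb B H key + total L' R n nb B H key := by
  simp [total]

theorem total_le (L : List Table) (n nb B H key) : total L ℕ n nb B H key ≤ L.length * (n * n) := by
  induction L with
  | nil => simp [total]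
  | cons T L ih =>
    simp only [total, List.map_cons, List.sum_cons, List.length_cons, add_mul] at ih ⊢
    have := T.le n nb B H key
    omega

theorem total_congr (L : List Table) {n n' nb nb' B B' H H' key key'}
    (h : ∀ T : Table, T.val ℕ n nb B H key = T.val ℕ n' nb' B' H' key') :
    total L ℕ n nb B H key = total L ℕ n' nb' B' H' key' := by
  simp only [total, h]

theorem total_zero (L : List Table) {n nb B H key} (h : ∀ T : Table, T.val ℕ n nb B H key = 0) :
    total L ℕ n nb B H key = 0 := by
  simp [total, h]

theorem few_total (L : List Table) {sq n nb B H M k} (hgr : Gr n nb) (hB : B ⊆ range n)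
    (hH : H ⊆ range n) (hc : Cheap sq nb B H k)
    (hM : ∑ x ∈ range n, (nb x).card ≤ 2 * M) :
    Few (total L ℕ n nb B H) (L.map fun T => T.size sq n M k).sum := by
  induction L with
  | nil => exact ⟨∅, by simp, by simp [total]⟩
  | cons T L ih => exact (T.few sq n nb B H M k hgr hB hH hc hM).add ih

theorem total_addE (L : List Table) (R : Type) [CommRing R] {n : ℕ} {c : Cfg}
    {μ : Key → ℕ} {ρ : ℕ → ℕ} (e : Env n c μ) (hρ : Base n ρ) (h1 : ρ 1 < n) (h2 : ρ 2 < n)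
    (h3 : ρ 1 ≠ ρ 2) (h4 : ρ 2 ∉ c.nb (ρ 1))
    (hT : ∀ x y, (μ (7, x, y, 0) : R) = walk₂ R n c.nb (out R c.H) x y) (key) :
    total L R n (addE c.nb (ρ 1) (ρ 2)) c.B c.H key =
      total L R n c.nb c.B c.H key + (updates L).delta R 30 ρ μ key := by
  induction L with
  | nil => simp [total, updates, delta_skip]
  | cons T L ih =>
    simp only [total, updates, delta_seq, List.map_cons, List.sum_cons] at ih ⊢
    rw [ih, T.step R n c μ ρ key e hρ h1 h2 h3 h4 hT]
    ring

/-- A scheme whose first table is that of the walks of length two; `L₁` is the list of the tables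
whose updates depend on the old entries of this table. -/
def Scheme.ofTables {P : SimpleGraph (Fin 4)} (sq : Bool) (L₁ L₂ : List Table) (q : Prog)
    (w₁ w₂ : List ℕ) (hlen : (L₁ ++ L₂).length ≤ 4)
    (hw₁ : (updates L₁).ok w₁ 30 = true) (hw₂ : (updates L₂).ok (w₁ ++ w₂) 30 = true)
    (hw : (updates L₂).ok w₂ 30 = true) (hdisj : ∀ t ∈ w₁, t ∉ w₂) (hge : ∀ t ∈ w₁ ++ w₂, 7 ≤ t)
    (hq : q.ok [15] 30 = true) (hq' : q.scalar 15 = true)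
    (hfr : ∀ p ∈ [updates L₁, updates L₂, askCommon, q],
      p.frugal 30 [] [] = true ∧ p.order sq 30 [] ≤ expo sq)
    (hT : ∀ (R : Type) [CommRing R] (n nb B H x y),
      total (L₁ ++ L₂) R n nb B H (7, x, y, 0) = walk₂ R n nb (out R H) x y)
    (hquery : ∀ (R : Type) [CommRing R] (n : ℕ) (G : SimpleGraph (Fin n)) (u v : Fin n) (c : Cfg)
      (μ : Key → ℕ) (ρ : ℕ → ℕ), G.Adj u v → c.nb = nbOf G → Env n c μ → Base n ρ →
      ρ 1 = u → ρ 2 = v →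
      (∀ key : Key, 7 ≤ key.1 → key.1 ≠ 14 →
        (μ key : R) = total (L₁ ++ L₂) R n c.nb c.B c.H key) →
      (μ (14, 0, 0, 0) : R) = walk₂ R n c.nb 1 u v →
      q.delta R 30 ρ μ (15, 0, 0, 0) = 2 * (copyCountEdge G P s(u, v) : R)) :
    Scheme P where
  sq := sq
  F := total (L₁ ++ L₂) ℕ
  pre := updates L₁
  post := updates L₂
  q₁ := askCommon
  q₂ := q
  wrPre := w₁
  wr := w₁ ++ w₂
  entries n M k := ((L₁ ++ L₂).map fun T => T.size sq n M k).sum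
  C := 2 * ((updates L₁).const + (updates L₂).const + askCommon.const + q.const)
  wrPre_sub t ht := List.mem_append_left _ ht
  wr_ge := hge
  pre_ok := hw₁
  post_ok := hw₂
  post_wrPre R _ ρ μ key hkey := Prog.delta_eq_zero R hw ρ μ key (hdisj _ hkey)
  q₁_ok := by decide
  q₂_ok := hq
  q₁_scalar := by decide
  q₂_scalar := hq'
  F_lt n nb B H key _ := by
    have h1 := total_le (L₁ ++ L₂) n nb B H key
    have h2 := Nat.mul_le_mul_right (n * n) hlen
    have h3 : modulus n = (n + 2) * (n + 2) * (n + 2) ^ 4 := by unfold modulus; ring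
    have h4 : 2 ^ 4 ≤ (n + 2) ^ 4 := Nat.pow_le_pow_left (by omega) _
    rw [h3]
    nlinarith
  F_empty n B H key := total_zero _ fun T => T.empty n B H key
  F_scratch n nb B H key hk := total_zero _ fun T => T.scratch n nb B H key hk
  F_insert_B n nb B H x key hgr hx := total_congr _ fun T => (T.insert n nb B H x key hgr hx).1
  F_insert_H n nb B H x key hgr hx := total_congr _ fun T => (T.insert n nb B H x key hgr hx).2
  F_addE R _ n c μ ρ a b key hμ hgr hB hH hρ h1 h2 ha hb hab hnb _ := by
    subst h1 h2
    have hT' : ∀ x y, (μ (7, x, y, 0) : R) = walk₂ R n c.nb (out R c.H) x y := fun x y => by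
      rw [hμ.aux _ (by simp), total_cast, hT]
    have e : Env n c μ := ⟨hμ.sets, hgr, hB, hH⟩
    rw [total_cast, total_cast, total_append, total_append, total_addE L₁ R e hρ ha hb hab hnb hT',
      total_addE L₂ R e hρ ha hb hab hnb hT']
    ring
  query R _ n G u v c μ μ' ρ hadj hnb hgr hB hH hμ hμ' h14 hρ h1 h2 := by
    have hs : SetsRep μ' (c.sets n) := hμ.sets.congr fun key hk => hμ' key (by omega)
    have hT' : ∀ x y, (μ (7, x, y, 0) : R) = walk₂ R n c.nb (out R c.H) x y := fun x y => by
      rw [hμ.aux _ (by simp), total_cast, hT]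
    refine hquery R n G u v c μ' ρ hadj hnb ⟨hs, hgr, hB, hH⟩ hρ h1 h2 (fun key hk hk' => ?_) ?_
    · rw [hμ' key hk', hμ.aux key hk, total_cast]
    · rw [h14, delta_askCommon ⟨hμ.sets, hgr, hB, hH⟩ hρ (h1 ▸ u.2) (h2 ▸ v.2) hT', h1, h2]
  upd_cost n c A μ ρ a b hμ hgr hB hH hc hρ h1 h2 ha hb := by
    subst h1 h2
    have f := fun p hp => Prog.cost_le_tau hμ.sets hgr hB hH hc hρ ha hb p (hfr p hp).1 (hfr p hp).2
    have f1 := f (updates L₁) (by simp)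
    have f2 := f (updates L₂) (by simp)
    rw [mul_assoc] at f1 f2 ⊢
    simp only [add_mul, mul_add]
    simp only [mul_add] at f1 f2
    omega
  query_cost n c μ μ' ρ a b hμ hμ' hgr hB hH hc hρ h1 h2 ha hb := by
    subst h1 h2
    have f1 := Prog.cost_le_tau hμ hgr hB hH hc hρ ha hb askCommon (hfr _ (by simp)).1
      (hfr _ (by simp)).2
    have f2 := Prog.cost_le_tau hμ' hgr hB hH hc hρ ha hb q (hfr _ (by simp)).1 (hfr _ (by simp)).2
    rw [mul_assoc] at f1 f2 ⊢
    simp only [add_mul, mul_add]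
    simp only [mul_add] at f1 f2
    omega
  entries_mono n M M' k k' hM hk :=
    List.sum_le_sum fun T _ => T.size_mono sq n M M' k k' hM hk
  F_entries n nb B H M k hgr hB hH hc hM := few_total _ hgr hB hH hc hM

/-! ### The seven auxiliary tables -/

section

variable {n : ℕ} {nb : ℕ → Finset ℕ}

theorem ind_le_one (p : Prop) [Decidable p] : ind ℕ p ≤ 1 := by
  unfold ind; split_ifs <;> simp

theorem sum_range_le {f : ℕ → ℕ} {K : ℕ} (h : ∀ x, f x ≤ K) :
    ∑ x ∈ range n, f x ≤ n * K := by
  simpa using Finset.sum_le_card_nsmul (range n) f K fun x _ => h x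

theorem ind_mul_le {f : ℕ} {K : ℕ} (p : Prop) [Decidable p] (h : f ≤ K) : ind ℕ p * f ≤ K := by
  unfold ind; split_ifs <;> simp [h]

theorem walk₂_le {w : ℕ → ℕ} {K : ℕ} (h : ∀ x, w x ≤ K) (u v : ℕ) : walk₂ ℕ n nb w u v ≤ n * K :=
  sum_range_le fun _ => mul_comm (w _) _ ▸ mul_assoc (adj ℕ nb u _) _ _ ▸
    ind_mul_le _ (ind_mul_le _ (h _))

theorem deg_le (x : ℕ) : deg ℕ n nb x ≤ n :=
  (sum_range_le fun y => ind_le_one (y ∈ nb x)).trans_eq (mul_one n)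

theorem Gr.adj_isolated (h : Gr n nb) {x : ℕ} (hx : nb x = ∅) (y : ℕ) : adj ℕ nb y x = 0 :=
  if_neg fun hy => by simpa [hx] using h.symm _ _ hy

/-- The weight of an isolated vertex does not matter. -/
theorem Gr.walk₂_congr {R : Type*} [CommSemiring R] (h : Gr n nb) {x : ℕ} (hx : nb x = ∅) {w w' : ℕ → R}
    (hw : ∀ y, y ≠ x → w y = w' y) (u v : ℕ) : walk₂ R n nb w u v = walk₂ R n nb w' u v := by
  refine sum_congr rfl fun c _ => ?_
  by_cases hc : c = x
  · simp [hc, adj, ind, hx]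
  · rw [hw c hc]

theorem out_insert {S : Finset ℕ} {x y : ℕ} (h : y ≠ x) : out ℕ (insert x S) y = out ℕ S y := by
  simp [out, ind, h]

theorem ind_insert {S : Finset ℕ} {x y : ℕ} (h : y ≠ x) :
    ind ℕ (y ∈ insert x S) = ind ℕ (y ∈ S) := by
  simp [ind, h]

theorem map_out {R S : Type*} [CommSemiring R] [CommSemiring S] (f : S →+* R) (A : Finset ℕ) (x : ℕ) :
    f (out S A x) = out R A x := map_ind f _

theorem map_slot {R S : Type*} [CommSemiring R] [CommSemiring S] (f : S →+* R) (t : ℕ) (key) (x : S) :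
    f (slot S t key x) = slot R t key (f x) := by
  simp only [slot, map_mul, map_ind]

theorem slot_le {f K : ℕ} (t : ℕ) (key) (h : f ≤ K) : slot ℕ t key f ≤ K := by
  unfold slot
  rw [mul_assoc]
  exact ind_mul_le _ (ind_mul_le _ h)

theorem slot_scratch {t f : ℕ} {key : Key} (h : 14 ≤ key.1) (ht : t < 14) :
    slot ℕ t key f = 0 := by
  have : key.1 ≠ t := by omega
  simp [slot, ind, this]

theorem ind_ne_zero {p : Prop} [Decidable p] (h : ind ℕ p ≠ 0) : p := by
  by_contra h'; exact h (by simp [ind, h'])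

theorem slot_ne_zero {t f : ℕ} {key : Key} (h : slot ℕ t key f ≠ 0) :
    key = (t, key.2.1, key.2.2.1, 0) ∧ f ≠ 0 := by
  obtain ⟨a, b, c, d⟩ := key
  simp only [slot, mul_ne_zero_iff] at h
  have h1 := ind_ne_zero h.1.1
  have h2 := ind_ne_zero h.1.2
  exact ⟨by simp only [h1, h2], h.2⟩

theorem walk₂_ne_zero {w : ℕ → ℕ} {u v : ℕ} (h : walk₂ ℕ n nb w u v ≠ 0) :
    ∃ c < n, w c ≠ 0 ∧ c ∈ nb u ∧ v ∈ nb c := by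
  obtain ⟨c, hc, h'⟩ := Finset.exists_ne_zero_of_sum_ne_zero h
  simp only [mul_ne_zero_iff] at h'
  exact ⟨c, mem_range.1 hc, h'.1, ind_ne_zero h'.2.1, ind_ne_zero h'.2.2⟩

theorem few_slot_square {t : ℕ} {f : ℕ → ℕ → ℕ} (h : ∀ u v, f u v ≠ 0 → u < n ∧ v < n) :
    Few (fun key => slot ℕ t key (f key.2.1 key.2.2.1)) (n * n) := by
  classical
  refine Few.of_cover (n := n) (fun u => (range n).image fun v => (t, u, v, 0)) (fun _ => n)
    (fun key hk => ?_) (fun u => Finset.card_image_le.trans (by simp)) (by simp)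
  obtain ⟨h1, h2⟩ := slot_ne_zero hk
  rw [h1]
  exact ⟨_, (h _ _ h2).1, Finset.mem_image.2 ⟨_, mem_range.2 (h _ _ h2).2, rfl⟩⟩

/-- There are at most `∑ d ^ 2` pairs with a common neighbour of degree `d ≤ K`. -/
theorem Gr.few_slot_walk (hgr : Gr n nb) {t K M : ℕ} {S : Finset ℕ} {f : ℕ → ℕ → ℕ}
    (h : ∀ u v, f u v ≠ 0 → ∃ c < n, c ∉ S ∧ c ∈ nb u ∧ v ∈ nb c)
    (hK : ∀ c, c ∉ S → (nb c).card ≤ K) (hM : ∑ x ∈ range n, (nb x).card ≤ 2 * M) :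
    Few (fun key => slot ℕ t key (f key.2.1 key.2.2.1)) (2 * M * K) := by
  classical
  refine Few.of_cover (n := n)
    (fun c => if c ∈ S then ∅ else (nb c ×ˢ nb c).image fun x => (t, x.1, x.2, 0))
    (fun c => (nb c).card * K) (fun key hk => ?_) (fun c => ?_) ?_
  · obtain ⟨h1, h2⟩ := slot_ne_zero hk
    obtain ⟨c, hc, h3, h4, h5⟩ := h _ _ h2
    refine ⟨c, hc, ?_⟩
    rw [h1, if_neg h3]
    exact Finset.mem_image.2 ⟨(key.2.1, key.2.2.1), Finset.mk_mem_product (hgr.symm _ _ h4) h5, rfl⟩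
  · split_ifs with hc
    · simp
    · refine Finset.card_image_le.trans ?_
      rw [Finset.card_product]
      exact Nat.mul_le_mul_left _ (hK c hc)
  · rw [← sum_mul]
    exact Nat.mul_le_mul_right _ hM

end

/-- The walks of length two whose middle vertex is not huge. -/
def tabT : Table where
  val R _ n nb _ H key := slot R 7 key (walk₂ R n nb (out R H) key.2.1 key.2.2.1)
  prog := progT
  size sq n M k := min (2 * M * min (tau sq k + 1) n) (n * n)
  cast R _ n nb B H key := by
    rw [← Nat.coe_castRingHom, map_slot, map_walk₂]; simp only [map_out]
  le n nb B H key := slot_le _ _ ((walk₂_le (fun x => ind_le_one _) _ _).trans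
    ((mul_one n).trans_le n.le_mul_self))
  empty n B H key := by simp [slot, walk₂, adj, ind]
  scratch n nb B H key h := slot_scratch h (by omega)
  insert n nb B H x key h hx := ⟨rfl, by
    rw [h.walk₂_congr hx fun y hy => out_insert hy]⟩
  step R _ n c μ ρ key e hρ h1 h2 h3 h4 hT := by
    obtain ⟨t, u, v, w⟩ := key
    rw [delta_progT e hρ (by omega) (by omega) h1 h2, delta_progT e hρ (by omega) (by omega) h2 h1,
      e.gr.walk₂_addE h3 h1 h2 h4]
    unfold slot; ring
  size_mono sq n M M' k k' hM hk := by
    have := tau_mono sq hk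
    gcongr
  few sq n nb B H M k hgr hB hH hc hM := by
    refine Few.min (hgr.few_slot_walk (S := H) (f := fun u v => walk₂ ℕ n nb (out ℕ H) u v)
      (fun u v h => ?_) (fun c hc' => le_min (hc.huge c hc') (hgr.card_le c)) hM)
      (few_slot_square (f := fun u v => walk₂ ℕ n nb (out ℕ H) u v) fun u v h => ?_)
    all_goals obtain ⟨c, h1, h2, h3, h4⟩ := walk₂_ne_zero h
    · exact ⟨c, h1, ind_ne_zero h2, h3, h4⟩
    · exact ⟨hgr.lt _ _ h3, hgr.lt' h4⟩

/-- The sums of the degrees of the neighbours that are not huge. -/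
def tabS : Table where
  val R _ n nb _ H key :=
    slot R 9 key (ind R (key.2.2.1 = 0) * degSum R n nb (out R H) key.2.1)
  prog := progS
  size _ n M _ := min (2 * M) n
  cast R _ n nb B H key := by
    rw [← Nat.coe_castRingHom, map_slot, map_mul, map_ind, map_degSum]; simp only [map_out]
  le n nb B H key := slot_le _ _ (ind_mul_le _ (sum_range_le fun x =>
    ind_mul_le _ (ind_mul_le _ (deg_le x))))
  empty n B H key := by simp [slot, degSum, adj, ind]
  scratch n nb B H key h := slot_scratch h (by omega)
  insert n nb B H x key h hx := ⟨rfl, by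
    congr 2
    refine sum_congr rfl fun c _ => ?_
    by_cases hc : c = x
    · simp [hc, deg, adj, ind, hx]
    · rw [out_insert hc]⟩
  step R _ n c μ ρ key e hρ h1 h2 h3 h4 hT := by
    obtain ⟨t, u, v, w⟩ := key
    rw [delta_progS e hρ (by omega) (by omega) h1 h2, delta_progS e hρ (by omega) (by omega) h2 h1,
      e.gr.degSum_addE h3 h1 h2 h4]
    unfold slot; ring
  size_mono sq n M M' k k' hM hk := by gcongr
  few sq n nb B H M k hgr hB hH hc hM := by
    classical
    have key : ∀ key : Key,
        slot ℕ 9 key (ind ℕ (key.2.2.1 = 0) * degSum ℕ n nb (out ℕ H) key.2.1) ≠ 0 →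
        ∃ u c, key = (9, u, 0, 0) ∧ c < n ∧ u ∈ nb c := by
      intro key hk
      obtain ⟨h1, h2⟩ := slot_ne_zero hk
      rw [mul_ne_zero_iff] at h2
      obtain ⟨c, h3, h4⟩ := Finset.exists_ne_zero_of_sum_ne_zero h2.2
      simp only [mul_ne_zero_iff] at h4
      exact ⟨key.2.1, c, by rw [h1, ind_ne_zero h2.1], mem_range.1 h3,
        hgr.symm _ _ (ind_ne_zero h4.2.1)⟩
    refine Few.min (Few.of_cover (n := n) (fun c => (nb c).image fun u => (9, u, 0, 0)) _
      (fun k hk => ?_) (fun c => card_image_le) hM)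
      (Few.of_cover (n := n) (fun c => {(9, c, 0, 0)}) 1 (fun k hk => ?_) (fun c => by simp)
        (by simp))
    all_goals obtain ⟨u, c, rfl, h1, h2⟩ := key k hk
    · exact ⟨c, h1, Finset.mem_image_of_mem _ h2⟩
    · exact ⟨u, hgr.lt' h2, by simp⟩

/-- The walks of length three between huge vertices whose inner vertices are not huge. -/
def tabQ : Table where
  val R _ n nb _ H key := slot R 8 key (tableQ R n nb H key.2.1 key.2.2.1)
  prog := progQ
  size _ n _ _ := n * n
  cast R _ n nb B H key := by
    rw [← Nat.coe_castRingHom, map_slot]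
    simp only [tableQ, map_mul, map_sum, map_walk₂, map_ind, map_out, map_adj]
  le n nb B H key := slot_le _ _ (by
    rw [tableQ, mul_assoc]
    refine ind_mul_le _ (ind_mul_le _ (sum_range_le fun x => ind_mul_le _ (ind_mul_le _ ?_)))
    exact (walk₂_le (fun _ => ind_le_one _) _ _).trans_eq (mul_one n))
  empty n B H key := by simp [slot, tableQ, adj, ind]
  scratch n nb B H key h := slot_scratch h (by omega)
  insert n nb B H x key h hx := ⟨rfl, by
    congr 1
    have h1 : ∀ y, adj ℕ nb x y = 0 := fun y => by simp [adj, ind, hx]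
    have h2 : ∀ y, adj ℕ nb y x = 0 := h.adj_isolated hx
    unfold tableQ
    by_cases hu : key.2.1 = x
    · simp [hu, h1]
    by_cases hv : key.2.2.1 = x
    · simp [hv, walk₂, h2]
    rw [ind_insert hu, ind_insert hv]
    congr 1
    refine sum_congr rfl fun c _ => ?_
    by_cases hc : c = x
    · simp [hc, h2]
    · rw [out_insert hc, h.walk₂_congr hx fun y hy => out_insert hy]⟩
  step R _ n c μ ρ key e hρ h1 h2 h3 h4 hT := by
    obtain ⟨t, u, v, w⟩ := key
    rw [delta_progQ e hρ (by omega) (by omega) h1 h2 t u v w _ hT,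
      delta_progQ e hρ (by omega) (by omega) h2 h1 t u v w _ hT, e.gr.tableQ_addE h3 h1 h2 h4]
    unfold slot newQ; ring
  size_mono sq n M M' k k' hM hk := le_rfl
  few sq n nb B H M k hgr hB hH hc hM :=
    few_slot_square (f := fun u v => tableQ ℕ n nb H u v) fun u v h => by
      simp only [tableQ, mul_ne_zero_iff] at h
      exact ⟨mem_range.1 (hH (ind_ne_zero h.1.1)), mem_range.1 (hH (ind_ne_zero h.1.2))⟩

/-- The walks of length two whose middle vertex is not big, weighted by the degree of that
vertex. -/
def tabD : Table where
  val R _ n nb B _ key :=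
    slot R 10 key (walk₂ R n nb (fun x => out R B x * deg R n nb x) key.2.1 key.2.2.1)
  prog := progD
  size _ n _ _ := n * n
  cast R _ n nb B H key := by
    rw [← Nat.coe_castRingHom, map_slot, map_walk₂]; simp only [map_out, map_mul, map_deg]
  le n nb B H key := slot_le _ _ (walk₂_le (fun x => ind_mul_le _ (deg_le x)) _ _)
  empty n B H key := by simp [slot, walk₂, adj, ind]
  scratch n nb B H key h := slot_scratch h (by omega)
  insert n nb B H x key h hx := ⟨by
    rw [h.walk₂_congr hx fun y hy => by rw [out_insert hy]], rfl⟩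
  step R _ n c μ ρ key e hρ h1 h2 h3 h4 hT := by
    obtain ⟨t, u, v, w⟩ := key
    rw [delta_progD e hρ (by omega) (by omega) h1 h2, delta_progD e hρ (by omega) (by omega) h2 h1,
      e.gr.walk₂_deg_addE h3 h1 h2 h4]
    unfold slot; ring
  size_mono sq n M M' k k' hM hk := le_rfl
  few sq n nb B H M k hgr hB hH hc hM :=
    few_slot_square (f := fun u v => walk₂ ℕ n nb (fun x => out ℕ B x * deg ℕ n nb x) u v)
      fun u v h => by
        obtain ⟨c, h1, h2, h3, h4⟩ := walk₂_ne_zero h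
        exact ⟨hgr.lt _ _ h3, hgr.lt' h4⟩

/-- The numbers of huge common neighbours of the ends of an edge, one of which is big but not
huge. -/
def tabZ : Table where
  val R _ n nb B H key := slot R 11 key (tableZ R n nb B H key.2.1 key.2.2.1)
  prog := progZ
  size _ _ M _ := 2 * M
  cast R _ n nb B H key := by
    rw [← Nat.coe_castRingHom, map_slot]
    simp only [tableZ, map_mul, map_walk₂, map_ind, map_out, map_adj]
  le n nb B H key := slot_le _ _ (by
    rw [tableZ, mul_assoc]
    exact ind_mul_le _ (ind_mul_le _ (ind_mul_le _ ((walk₂_le (fun _ => ind_le_one _) _ _).trans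
      ((mul_one n).trans_le n.le_mul_self)))))
  empty n B H key := by simp [slot, tableZ, adj, ind]
  scratch n nb B H key h := slot_scratch h (by omega)
  insert n nb B H x key h hx := by
    have h2 : ∀ y, adj ℕ nb y x = 0 := h.adj_isolated hx
    unfold tableZ
    by_cases hc : key.2.2.1 = x
    · simp [hc, h2]
    · rw [ind_insert hc, out_insert hc]
      exact ⟨rfl, by rw [h.walk₂_congr hx fun y hy => ind_insert hy]⟩
  step R _ n c μ ρ key e hρ h1 h2 h3 h4 hT := by
    obtain ⟨t, u, v, w⟩ := key
    rw [delta_progZ e hρ (by omega) (by omega) h1 h2, delta_progZ e hρ (by omega) (by omega) h2 h1,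
      e.gr.tableZ_addE h3 h1 h2 h4]
    unfold slot; ring
  size_mono sq n M M' k k' hM hk := by gcongr
  few sq n nb B H M k hgr hB hH hc hM := by
    classical
    refine Few.of_cover (n := n) (fun u => (nb u).image fun v => (11, u, v, 0)) _
      (fun key hk => ?_) (fun c => card_image_le) hM
    obtain ⟨h1, h2⟩ := slot_ne_zero hk
    simp only [tableZ, mul_ne_zero_iff] at h2
    have h3 := ind_ne_zero h2.2.1
    rw [h1]
    exact ⟨_, hgr.lt _ _ h3, Finset.mem_image_of_mem _ h3⟩

/-- The claws whose centre is not big. -/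
def tabC : Table where
  val R _ n nb B _ key := ind R (key.1 = 12) * tableC R n nb B key.2.1 key.2.2.1 key.2.2.2
  prog := progC
  size _ n M k := min (2 * M * (k + 1) ^ 2) (n * (k + 1) ^ 3)
  cast R _ n nb B H key := by
    rw [← Nat.coe_castRingHom]
    simp only [tableC, map_mul, map_sum, map_ind, map_out, map_adj]
  le n nb B H key := ind_mul_le _ ((sum_range_le (K := 1) fun x => by
    rw [mul_assoc]
    exact ind_mul_le _ (ind_mul_le _ (ind_mul_le _ (ind_le_one _)))).trans
      ((mul_one n).trans_le n.le_mul_self))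
  empty n B H key := by simp [tableC, adj, ind]
  scratch n nb B H key h := by
    have : key.1 ≠ 12 := by omega
    simp [ind, this]
  insert n nb B H x key h hx := ⟨by
    congr 1
    refine sum_congr rfl fun c _ => ?_
    by_cases hc : c = x
    · simp [hc, adj, ind, hx]
    · rw [out_insert hc], rfl⟩
  step R _ n c μ ρ key e hρ h1 h2 h3 h4 hT := by
    obtain ⟨t, u, v, w⟩ := key
    rw [delta_progC e hρ (by omega) (by omega) h1 h2, delta_progC e hρ (by omega) (by omega) h2 h1,
      e.gr.tableC_addE h3 h1 h2 h4]
    ring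
  size_mono sq n M M' k k' hM hk := by gcongr
  few sq n nb B H M k hgr hB hH hc hM := by
    classical
    have key : ∀ key : Key,
        ind ℕ (key.1 = 12) * tableC ℕ n nb B key.2.1 key.2.2.1 key.2.2.2 ≠ 0 →
        ∃ c < n, key ∈ if c ∈ B then ∅ else (nb c ×ˢ nb c ×ˢ nb c).image fun x => (12, x) := by
      rintro ⟨t, u, v, w⟩ hk
      rw [mul_ne_zero_iff] at hk
      obtain ⟨c, h3, h4⟩ := Finset.exists_ne_zero_of_sum_ne_zero hk.2
      simp only [mul_ne_zero_iff] at h4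
      refine ⟨c, mem_range.1 h3, ?_⟩
      rw [if_neg (ind_ne_zero h4.1)]
      obtain rfl : t = 12 := ind_ne_zero hk.1
      exact Finset.mem_image_of_mem _ (Finset.mk_mem_product (ind_ne_zero h4.2.1.1)
        (Finset.mk_mem_product (ind_ne_zero h4.2.1.2) (ind_ne_zero h4.2.2)))
    have hcard : ∀ c, (if c ∈ B then ∅ else
        (nb c ×ˢ nb c ×ˢ nb c).image fun x => (12, x)).card ≤
        min ((nb c).card * (k + 1) ^ 2) ((k + 1) ^ 3) := by
      intro c
      split_ifs with hcB
      · simp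
      · refine Finset.card_image_le.trans ?_
        have h1 := hc.big c hcB
        rw [Finset.card_product, Finset.card_product]
        refine le_min ?_ ?_
        · rw [pow_two]; gcongr
        · rw [pow_succ, pow_two, mul_assoc]; gcongr
    refine Few.min (Few.of_cover (n := n) _ _ key (fun c => (hcard c).trans (min_le_left _ _)) ?_)
      (Few.of_cover (n := n) _ _ key (fun c => (hcard c).trans (min_le_right _ _)) (by simp))
    rw [← sum_mul]
    exact Nat.mul_le_mul_right _ hM

/-- The walks of length two with a triangle attached to the first step, where neither the middle
vertex nor the apex of the triangle is big. -/
def tabY : Table where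
  val R _ n nb B _ key := slot R 13 key (tableY R n nb B key.2.1 key.2.2.1)
  prog := progY
  size _ n M k := 2 * M * min (k + 1) n
  cast R _ n nb B H key := by
    rw [← Nat.coe_castRingHom, map_slot]
    simp only [tableY, map_walk₂, map_mul, map_out]
  le n nb B H key := slot_le _ _ (walk₂_le (fun x => ind_mul_le _
    ((walk₂_le (fun _ => ind_le_one _) _ _).trans_eq (mul_one n))) _ _)
  empty n B H key := by simp [slot, tableY, walk₂, adj, ind]
  scratch n nb B H key h := slot_scratch h (by omega)
  insert n nb B H x key h hx := ⟨by
    unfold tableY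
    rw [h.walk₂_congr hx fun y hy => by
      rw [out_insert hy, h.walk₂_congr hx fun y hy => out_insert hy]], rfl⟩
  step R _ n c μ ρ key e hρ h1 h2 h3 h4 hT := by
    obtain ⟨t, u, v, w⟩ := key
    rw [delta_progY e hρ (by omega) (by omega) h1 h2, delta_progY e hρ (by omega) (by omega) h2 h1,
      e.gr.tableY_addE h3 h1 h2 h4]
    unfold slot; ring
  size_mono sq n M M' k k' hM hk := by gcongr
  few sq n nb B H M k hgr hB hH hc hM := by
    refine hgr.few_slot_walk (S := B) (f := fun u v => tableY ℕ n nb B u v)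
      (fun u v h => ?_) (fun c hc' => le_min (hc.big c hc') (hgr.card_le c)) hM
    obtain ⟨c, h1, h2, h3, h4⟩ := walk₂_ne_zero h
    exact ⟨c, h1, ind_ne_zero (mul_ne_zero_iff.1 h2).1, h3, h4⟩

/-! ### The four schemes -/

/-- The scheme for the path of length three: the entries of scratch table `15` add up to
`2 * (d u * d v + S u + S v - 3 * (d u + d v - 1) - 3 * t)`, where `S` is the sum of the degrees of
the neighbours and `t` the number of common neighbours of `u` and `v`. -/
noncomputable def schemePath3 : Scheme path3 :=
  .ofTables false [] [tabT, tabS]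
    ((Prog.seq (.seq (put 15 false [size 1, size 2]) (.seq (askDegSum 1) (askDegSum 2)))
      ((Prog.seq (.seq (put 15 true [size 1]) (put 15 true [size 2]))
        (.seq (put 15 false []) (put 15 true [entry 14 6 6]))).times 3)).times 2)
    [] [7, 9] (by decide) (by decide) (by decide) (by decide) (by decide) (by decide) (by decide)
    (by decide) (by decide)
    (fun R _ n nb B H x y => by simp [total, tabT, tabS, slot, ind])
    (fun R _ n G u v c μ ρ huv hnb e hρ h1 h2 hμ ht => by
      have s1 := e.size (R := R) (x := 1) hρ.r6 (h1 ▸ u.2)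
      have s2 := e.size (R := R) (x := 2) hρ.r6 (h2 ▸ v.2)
      have hS : ∀ x, (μ (9, x, 0, 0) : R) = degSum R n c.nb (out R c.H) x := fun x => by
        rw [hμ _ (by simp) (by simp)]
        simp [total, tabT, tabS, slot, ind]
      simp only [Prog.delta_times, delta_seq, delta_put hρ.r6]
      rw [delta_askDegSum e hρ (by omega) (h1 ▸ u.2) hS, delta_askDegSum e hρ (by omega) (h2 ▸ v.2) hS,
        two_mul_copyCountEdge_path3 R huv (hnb ▸ e.gr), ← hnb]
      simp [s1, s2, entry, val_mk, hρ.r6, ht, h1, h2]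
      ring)

/-- The scheme for the paw. The closed walks of length three at `u` and at `v` count the triangles
there, and `askDegCommon` adds up the degrees of the common neighbours. -/
noncomputable def schemePaw : Scheme paw :=
  .ofTables true [tabQ] [tabT, tabD]
    (.seq (.seq (askWalk 1 1) (askWalk 2 2)) ((Prog.seq askDegCommon
      (.seq (.seq (put 15 false [entry 14 6 6, size 1]) (put 15 false [entry 14 6 6, size 2]))
        ((put 15 true [entry 14 6 6]).times 8))).times 2))
    [8] [7, 10] (by decide) (by decide) (by decide) (by decide) (by decide) (by decide) (by decide)
    (by decide) (by decide)
    (fun R _ n nb B H x y => by simp [total, tabT, tabQ, tabD, slot, ind])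
    (fun R _ n G u v c μ ρ huv hnb e hρ h1 h2 hμ ht => by
      have s1 := e.size (R := R) (x := 1) hρ.r6 (h1 ▸ u.2)
      have s2 := e.size (R := R) (x := 2) hρ.r6 (h2 ▸ v.2)
      have hT : ∀ x y, (μ (7, x, y, 0) : R) = walk₂ R n c.nb (out R c.H) x y := fun x y => by
        rw [hμ _ (by simp) (by simp)]
        simp [total, tabT, tabQ, tabD, slot, ind]
      have hQ : ∀ x y, (μ (8, x, y, 0) : R) = tableQ R n c.nb c.H x y := fun x y => by
        rw [hμ _ (by simp) (by simp)]
        simp [total, tabT, tabQ, tabD, slot, ind]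
      have hD : ∀ x y, (μ (10, x, y, 0) : R) =
          walk₂ R n c.nb (fun z => out R c.B z * deg R n c.nb z) x y := fun x y => by
        rw [hμ _ (by simp) (by simp)]
        simp [total, tabT, tabQ, tabD, slot, ind]
      simp only [Prog.delta_times, delta_seq, delta_put hρ.r6]
      rw [delta_askWalk e hρ (by omega) (by omega) (h1 ▸ u.2) (h1 ▸ u.2) hT hQ,
        delta_askWalk e hρ (by omega) (by omega) (h2 ▸ v.2) (h2 ▸ v.2) hT hQ,
        delta_askDegCommon e hρ (h1 ▸ u.2) (h2 ▸ v.2) hD,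
        two_mul_copyCountEdge_paw R huv (hnb ▸ e.gr), ← hnb]
      simp [s1, s2, entry, val_mk, hρ.r6, ht, h1, h2]
      ring)

/-- The scheme for the four-cycle: the walks of length three from `u` to `v`, without those that
use the edge `uv`. -/
noncomputable def schemeFourCycle : Scheme fourCycle :=
  .ofTables true [tabQ] [tabT]
    ((Prog.seq (askWalk 1 2) (.seq (.seq (put 15 true [size 1]) (put 15 true [size 2]))
      (put 15 false []))).times 2)
    [8] [7] (by decide) (by decide) (by decide) (by decide) (by decide) (by decide) (by decide)
    (by decide) (by decide)
    (fun R _ n nb B H x y => by simp [total, tabT, tabQ, slot, ind])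
    (fun R _ n G u v c μ ρ huv hnb e hρ h1 h2 hμ ht => by
      have s1 := e.size (R := R) (x := 1) hρ.r6 (h1 ▸ u.2)
      have s2 := e.size (R := R) (x := 2) hρ.r6 (h2 ▸ v.2)
      have hT : ∀ x y, (μ (7, x, y, 0) : R) = walk₂ R n c.nb (out R c.H) x y := fun x y => by
        rw [hμ _ (by simp) (by simp)]
        simp [total, tabT, tabQ, slot, ind]
      have hQ : ∀ x y, (μ (8, x, y, 0) : R) = tableQ R n c.nb c.H x y := fun x y => by
        rw [hμ _ (by simp) (by simp)]
        simp [total, tabT, tabQ, slot, ind]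
      simp only [Prog.delta_times, delta_seq, delta_put hρ.r6]
      rw [delta_askWalk e hρ (by omega) (by omega) (h1 ▸ u.2) (h2 ▸ v.2) hT hQ,
        two_mul_copyCountEdge_fourCycle R huv (hnb ▸ e.gr), ← hnb]
      simp [s1, s2, h1, h2]
      ring)

/-- The scheme for the diamond. The pairs of common neighbours of `u` and `v` give the diamonds in
which `uv` is the chord; `askFan` counts those in which it is an outer edge. -/
noncomputable def schemeDiamond : Scheme diamond :=
  .ofTables true [] [tabT, tabZ, tabC, tabY]
    (.seq (.seq (put 15 false [entry 14 6 6, entry 14 6 6]) ((put 15 true [entry 14 6 6]).times 5))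
      ((Prog.seq (askFan 1 2) (askFan 2 1)).times 2))
    [] [7, 11, 12, 13] (by decide) (by decide) (by decide) (by decide) (by decide) (by decide)
    (by decide) (by decide) (by decide)
    (fun R _ n nb B H x y => by simp [total, tabT, tabZ, tabC, tabY, slot, ind])
    (fun R _ n G u v c μ ρ huv hnb e hρ h1 h2 hμ ht => by
      have hT : ∀ x y, (μ (7, x, y, 0) : R) = walk₂ R n c.nb (out R c.H) x y := fun x y => by
        rw [hμ _ (by simp) (by simp)]
        simp [total, tabT, tabZ, tabC, tabY, slot, ind]
      have hZ : ∀ x y, (μ (11, x, y, 0) : R) = tableZ R n c.nb c.B c.H x y := fun x y => by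
        rw [hμ _ (by simp) (by simp)]
        simp [total, tabT, tabZ, tabC, tabY, slot, ind]
      have hC : ∀ x y z, (μ (12, x, y, z) : R) = tableC R n c.nb c.B x y z := fun x y z => by
        rw [hμ _ (by simp) (by simp)]
        simp [total, tabT, tabZ, tabC, tabY, slot, ind]
      have hY : ∀ x y, (μ (13, x, y, 0) : R) = tableY R n c.nb c.B x y := fun x y => by
        rw [hμ _ (by simp) (by simp)]
        simp [total, tabT, tabZ, tabC, tabY, slot, ind]
      simp only [Prog.delta_times, delta_seq, delta_put hρ.r6]
      rw [delta_askFan e hρ (by omega) (by omega) (h1 ▸ u.2) (h2 ▸ v.2) hT hZ hC hY,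
        delta_askFan e hρ (by omega) (by omega) (h2 ▸ v.2) (h1 ▸ u.2) hT hZ hC hY,
        two_mul_copyCountEdge_diamond R huv (hnb ▸ e.gr), ← hnb]
      simp [entry, val_mk, hρ.r6, ht, h1, h2]
      ring)

/-! ### Bounds in terms of the number of edges -/

theorem tau_le_linear {sq : Bool} {m k : ℕ} (h : k * tau sq k ≤ 40 * (m + 1)) :
    tau sq k ≤ 40 * (m + 1) := by
  rcases Nat.eq_zero_or_pos k with rfl | hk
  · unfold tau; split_ifs <;> simp
  · exact (Nat.le_mul_of_pos_left _ hk).trans h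

/-- The implied constant in the bound for the space that is not used by auxiliary tables. -/
def Scheme.slack {P : SimpleGraph (Fin 4)} (D : Scheme P) : ℕ := 41 * (D.C + 1000)

theorem Scheme.peak_le {P : SimpleGraph (Fin 4)} (D : Scheme P) {n m k : ℕ}
    (h : k * tau D.sq k ≤ 40 * (m + 1)) :
    D.peak n (m + 1) k ≤ D.entries n (m + 1) k + D.slack * (m + 1) := by
  have h1 := tau_le_linear h
  have h2 := Nat.mul_le_mul_left D.C (show tau D.sq k + 1 ≤ 41 * (m + 1) by omega)
  have h3 : D.slack * (m + 1) = D.C * (41 * (m + 1)) + 41000 * (m + 1) := by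
    unfold Scheme.slack; ring
  unfold Scheme.peak Scheme.base
  omega

theorem le_sqrt_of_mul_le {m k : ℕ} (h : k * k ≤ 40 * (m + 1)) : (k : ℝ) ≤ 7 * (√m + 1) := by
  have h' : (k : ℝ) * k ≤ 40 * (m + 1) := by exact_mod_cast h
  have h1 := Real.sq_sqrt (Nat.cast_nonneg (α := ℝ) m)
  have h2 := Real.sqrt_nonneg (m : ℝ)
  refine abs_le_of_sq_le_sq' ?_ (by positivity) |>.2
  nlinarith

theorem rpow_natCast_div {m : ℕ} (a b : ℕ) (hb : b ≠ 0) :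
    (m : ℝ) ^ ((a : ℝ) / b) = ((m : ℝ) ^ ((b : ℝ)⁻¹)) ^ a := by
  rw [← Real.rpow_natCast, ← Real.rpow_mul (Nat.cast_nonneg m)]
  congr 1
  field_simp

/-- The cube root of the number of edges bounds the threshold for big vertices. -/
theorem exists_cbrt (m : ℕ) : ∃ y : ℝ, 0 ≤ y ∧ y ^ 3 = m ∧ (m : ℝ) ^ (2 / 3 : ℝ) = y ^ 2 ∧
    (m : ℝ) ^ (5 / 3 : ℝ) = y ^ 5 ∧ ∀ k : ℕ, k * (k * k) ≤ 40 * (m + 1) → (k : ℝ) ≤ 4 * (y + 1) := by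
  have hm := Nat.cast_nonneg (α := ℝ) m
  have h3 : ((m : ℝ) ^ ((3 : ℕ) : ℝ)⁻¹) ^ 3 = m := Real.rpow_inv_natCast_pow hm (by simp)
  refine ⟨(m : ℝ) ^ ((3 : ℕ) : ℝ)⁻¹, by positivity, h3, ?_, ?_, fun k hk => ?_⟩
  · exact_mod_cast rpow_natCast_div 2 3 (by simp)
  · exact_mod_cast rpow_natCast_div 5 3 (by simp)
  · have h' : (k : ℝ) * (k * k) ≤ 40 * (m + 1) := by exact_mod_cast hk
    set y := (m : ℝ) ^ ((3 : ℕ) : ℝ)⁻¹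
    have hy : 0 ≤ y := by positivity
    refine le_of_pow_le_pow_left₀ (n := 3) (by simp) (by positivity) ?_
    have : (0 : ℝ) ≤ y * (y + 1) := by positivity
    calc (k : ℝ) ^ 3 = k * (k * k) := by ring
      _ ≤ 40 * (y ^ 3 + 1) := by rw [h3]; exact h'
      _ ≤ (4 * (y + 1)) ^ 3 := by nlinarith

theorem le_mul_min_add_one {p a b : ℝ} {C : ℝ} (ha : p ≤ C * (a + 1)) (hb : p ≤ C * (b + 1)) :
    p ≤ C * (min a b + 1) := by
  rcases min_choice a b with h | h <;> rw [h] <;> assumption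

theorem tau_le_rpow {m k : ℕ} (h : k * tau true k ≤ 40 * (m + 1)) :
    (tau true k : ℝ) ≤ 32 * ((m : ℝ) ^ (2 / 3 : ℝ) + 1) := by
  obtain ⟨y, hy, -, h2, -, hk⟩ := exists_cbrt m
  have h' := hk k h
  rw [h2]
  simp only [tau, if_true, Nat.cast_mul]
  nlinarith [mul_self_le_mul_self (Nat.cast_nonneg (α := ℝ) k) h', sq_nonneg (y - 1)]

theorem pow_le_pow_add_one {y : ℝ} (hy : 0 ≤ y) {i j : ℕ} (h : i ≤ j) : y ^ i ≤ y ^ j + 1 := by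
  rcases le_total y 1 with h1 | h1
  · exact (pow_le_one₀ hy h1).trans (le_add_of_nonneg_left (by positivity))
  · exact (pow_le_pow_right₀ h1 h).trans (by simp)

section


/-- The claims about the running time hold for all schemes with `τ = k ^ 2`. -/
theorem Scheme.maintains_of_sq (D : Scheme P) (hD : D.sq = true) (hP : P ≠ ⊥) {spc : ℕ → ℕ → ℝ}
    {C₀ : ℕ} (hspc : ∀ n m k, k * tau true k ≤ 40 * (m + 1) → m ≤ n ^ 2 →
      (D.peak n (m + 1) k : ℝ) ≤ C₀ * (spc n m + 1)) (hspc0 : ∀ n m, 0 ≤ spc n m) :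
    Maintains P (fun _ m => (m : ℝ) ^ (2 / 3 : ℝ)) (fun _ m => (m : ℝ) ^ (2 / 3 : ℝ)) spc := by
  have h : ∀ m k, k * tau D.sq k ≤ 40 * (m + 1) →
      (tau D.sq k : ℝ) ≤ ((32 + C₀ : ℕ) : ℝ) * ((m : ℝ) ^ (2 / 3 : ℝ) + 1) := by
    intro m k hk
    rw [hD] at hk ⊢
    exact (tau_le_rpow hk).trans (by push_cast; gcongr; simp)
  refine D.maintains hP (fun _ => h) (fun _ => h) (fun n m k hk hm => ?_)
    (fun n m => by positivity) (fun n m => by positivity) hspc0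
  refine (hspc n m k (hD ▸ hk) hm).trans ?_
  have := hspc0 n m
  push_cast
  gcongr
  simp

theorem Scheme.peak_le_sq (D : Scheme P) (hD : D.sq = true)
    (h : ∀ n M k, D.entries n M k ≤ 3 * (n * n)) (n m k : ℕ) (hk : k * tau true k ≤ 40 * (m + 1))
    (hm : m ≤ n ^ 2) :
    (D.peak n (m + 1) k : ℝ) ≤ (3 + D.slack : ℕ) * ((n : ℝ) ^ 2 + 1) := by
  have h1 := D.peak_le (n := n) (hD ▸ hk)
  have h2 := h n (m + 1) k
  have h3 := Nat.mul_le_mul_left D.slack (Nat.succ_le_succ hm)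
  have h4 : D.peak n (m + 1) k ≤ (3 + D.slack) * (n ^ 2 + 1) := by
    simp only [Nat.succ_eq_add_one] at h3
    rw [add_mul 3]
    rw [← pow_two] at h2
    omega
  exact_mod_cast h4

end

theorem peak_path3_le (n m k : ℕ) (hk : k * k ≤ 40 * (m + 1)) (hm : m ≤ n ^ 2) :
    (schemePath3.peak n (m + 1) k : ℝ) ≤ (50 + 2 * schemePath3.slack : ℕ) *
      (min ((m : ℝ) ^ (3 / 2 : ℝ)) ((n : ℝ) ^ 2) + 1) := by
  have h1 := schemePath3.peak_le (n := n) (m := m) (k := k) hk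
  have h2 : schemePath3.entries n (m + 1) k = min (2 * (m + 1) * min (k + 1) n) (n * n) +
    (min (2 * (m + 1)) n + 0) := rfl
  generalize schemePath3.slack = K at h1 ⊢
  refine le_mul_min_add_one ?_ ?_
  · have h3 : schemePath3.peak n (m + 1) k ≤ 2 * (m + 1) * (k + 1) + 2 * (m + 1) + K * (m + 1) := by
      have := Nat.mul_le_mul_left (2 * (m + 1)) (min_le_left (k + 1) n)
      omega
    have h4 : (schemePath3.peak n (m + 1) k : ℝ) ≤
        2 * (m + 1) * (k + 1) + 2 * (m + 1) + K * (m + 1) := by exact_mod_cast h3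
    have h5 := le_sqrt_of_mul_le hk
    have h6 : (m : ℝ) ^ (3 / 2 : ℝ) = √m ^ 3 := by
      rw [Real.sqrt_eq_rpow, one_div]
      exact_mod_cast rpow_natCast_div (m := m) 3 2 (by simp)
    have h7 := Real.sq_sqrt (Nat.cast_nonneg (α := ℝ) m)
    have hx := Real.sqrt_nonneg (m : ℝ)
    rw [h6]
    generalize √(m : ℝ) = x at *
    rw [← h7] at h4
    have h8 := pow_le_pow_add_one hx (show 2 ≤ 3 by simp)
    have h9 := pow_le_pow_add_one hx (show 1 ≤ 3 by simp)
    have hx3 := pow_nonneg hx 3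
    have hK : (0 : ℝ) ≤ K := Nat.cast_nonneg _
    calc _ ≤ _ := h4
      _ ≤ 2 * (x ^ 2 + 1) * (7 * (x + 1) + 1) + 2 * (x ^ 2 + 1) + K * (x ^ 2 + 1) := by gcongr
      _ ≤ 50 * (x ^ 3 + 1) + K * (2 * (x ^ 3 + 1)) :=
        add_le_add (by nlinarith) (by gcongr; linarith)
      _ = _ := by push_cast; ring
  · have h3 : schemePath3.peak n (m + 1) k ≤ (50 + 2 * K) * (n ^ 2 + 1) := by
      have h4 := Nat.mul_le_mul_left K hm
      have h5 := n.le_mul_self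
      rw [← pow_two] at h5 h2
      simp only [add_mul, mul_add, mul_assoc] at h1 ⊢
      omega
    exact_mod_cast h3

theorem entries_diamond (n M k : ℕ) : schemeDiamond.entries n M k =
    min (2 * M * min (k * k + 1) n) (n * n) + (2 * M + (min (2 * M * (k + 1) ^ 2) (n * (k + 1) ^ 3) +
      (2 * M * min (k + 1) n + 0))) := rfl

theorem peak_diamond_le_rpow (n m k : ℕ) (hk : k * tau true k ≤ 40 * (m + 1)) :
    (schemeDiamond.peak n (m + 1) k : ℝ) ≤ (1600 + 2 * schemeDiamond.slack : ℕ) *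
      ((m : ℝ) ^ (5 / 3 : ℝ) + 1) := by
  have h1 := schemeDiamond.peak_le (n := n) (m := m) (k := k) hk
  have h2 := entries_diamond n (m + 1) k
  generalize schemeDiamond.slack = K at h1 ⊢
  have h3 : schemeDiamond.peak n (m + 1) k ≤ 8 * (m + 1) * (k + 1) ^ 2 + K * (m + 1) := by
    have e1 : 2 * (m + 1) * min (k * k + 1) n ≤ 2 * (m + 1) * (k + 1) ^ 2 :=
      Nat.mul_le_mul_left _ ((min_le_left _ _).trans (by nlinarith))
    have e2 : 2 * (m + 1) * min (k + 1) n ≤ 2 * (m + 1) * (k + 1) ^ 2 :=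
      Nat.mul_le_mul_left _ ((min_le_left _ _).trans (by nlinarith))
    have e3 : 2 * (m + 1) ≤ 2 * (m + 1) * (k + 1) ^ 2 :=
      Nat.le_mul_of_pos_right _ (by positivity)
    have e4 : 8 * (m + 1) * (k + 1) ^ 2 = 4 * (2 * (m + 1) * (k + 1) ^ 2) := by ring
    omega
  have h4 : (schemeDiamond.peak n (m + 1) k : ℝ) ≤ 8 * (m + 1) * (k + 1) ^ 2 + K * (m + 1) := by
    exact_mod_cast h3
  obtain ⟨y, hy, e3, -, e5, hk'⟩ := exists_cbrt m
  have h5 := hk' k hk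
  rw [e5]
  rw [← e3] at h4
  have p := fun i (hi : i ≤ 5) => pow_le_pow_add_one hy hi
  have p1 := p 1 (by simp)
  have p2 := p 2 (by simp)
  have p3 := p 3 (by simp)
  have p4 := p 4 (by simp)
  have p5 := pow_nonneg hy 5
  calc _ ≤ _ := h4
    _ ≤ 8 * (y ^ 3 + 1) * (5 * (y + 1)) ^ 2 + K * (2 * (y ^ 5 + 1)) := by
      gcongr <;> linarith
    _ = 200 * (y ^ 5 + 2 * y ^ 4 + y ^ 3 + y ^ 2 + 2 * y ^ 1 + 1) + K * (2 * (y ^ 5 + 1)) := by ring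
    _ ≤ 200 * (8 * (y ^ 5 + 1)) + K * (2 * (y ^ 5 + 1)) := by
      gcongr; linarith
    _ = _ := by push_cast; ring

theorem peak_diamond_le (n m k : ℕ) (hk : k * tau true k ≤ 40 * (m + 1)) (hm : m ≤ n ^ 2) :
    (schemeDiamond.peak n (m + 1) k : ℝ) ≤ (1600 + 2 * schemeDiamond.slack : ℕ) *
      (min ((n : ℝ) * m) ((m : ℝ) ^ (5 / 3 : ℝ)) + 1) := by
  have h0 := peak_diamond_le_rpow n m k hk
  refine le_mul_min_add_one ?_ h0
  rcases Nat.eq_zero_or_pos m with rfl | hm0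
  -- without edges, the bound `n * m` is no better than `m ^ (5 / 3)`
  · refine h0.trans_eq ?_
    rw [Nat.cast_zero, Real.zero_rpow (by norm_num), mul_zero]
  · have hn : 1 ≤ n := Nat.pos_of_ne_zero (by rintro rfl; simp at hm; omega)
    have h1 := schemeDiamond.peak_le (n := n) (m := m) (k := k) hk
    have h2 := entries_diamond n (m + 1) k
    generalize schemeDiamond.slack = K at h1 ⊢
    have hk3 : k * (k * k) ≤ 40 * (m + 1) := hk
    have e1 : 2 * (m + 1) * min (k * k + 1) n ≤ 4 * (n * m) :=
      (Nat.mul_le_mul_left _ (min_le_right _ _)).trans (by nlinarith)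
    have e2 : 2 * (m + 1) * min (k + 1) n ≤ 4 * (n * m) :=
      (Nat.mul_le_mul_left _ (min_le_right _ _)).trans (by nlinarith)
    have e3 : (k + 1) ^ 3 ≤ 561 * m := by
      have f1 : k ≤ k * k := k.le_mul_self
      have f2 : k * k ≤ k * (k * k) := Nat.mul_le_mul_left k f1
      have f3 : (k + 1) ^ 3 = k * (k * k) + 3 * (k * k) + 3 * k + 1 := by ring
      omega
    have e4 : n * (k + 1) ^ 3 ≤ 561 * (n * m) := (Nat.mul_le_mul_left n e3).trans_eq (by ring)
    have e5 : m ≤ n * m := Nat.le_mul_of_pos_left _ hn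
    have e6 : K * (m + 1) ≤ 2 * K * (n * m) := by
      rw [mul_comm 2, mul_assoc]
      exact Nat.mul_le_mul_left _ (by omega)
    have h3 : schemeDiamond.peak n (m + 1) k ≤ (1600 + 2 * K) * (n * m + 1) := by
      rw [mul_add, add_mul]
      omega
    exact_mod_cast h3

theorem ne_bot_of_adj {P : SimpleGraph (Fin 4)} {b : Fin 4 → Fin 4 → Bool}
    (hb : ∀ i j, P.Adj i j ↔ b i j = true) (h : b 0 1 = true) : P ≠ ⊥ := by
  rintro rfl
  exact (hb 0 1).2 h

end DynCount

theorem mainTheorem1 :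
    DynCount.Maintains DynCount.path3
      (fun _ m => Real.sqrt m)
      (fun _ m => Real.sqrt m)
      (fun n m => min ((m : ℝ) ^ (3 / 2 : ℝ)) ((n : ℝ) ^ 2)) ∧
    DynCount.Maintains DynCount.paw
      (fun _ m => (m : ℝ) ^ (2 / 3 : ℝ))
      (fun _ m => (m : ℝ) ^ (2 / 3 : ℝ))
      (fun n _ => (n : ℝ) ^ 2) ∧
    DynCount.Maintains DynCount.fourCycle
      (fun _ m => (m : ℝ) ^ (2 / 3 : ℝ))
      (fun _ m => (m : ℝ) ^ (2 / 3 : ℝ))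
      (fun n _ => (n : ℝ) ^ 2) ∧
    DynCount.Maintains DynCount.diamond
      (fun _ m => (m : ℝ) ^ (2 / 3 : ℝ))
      (fun _ m => (m : ℝ) ^ (2 / 3 : ℝ))
      (fun n m => min ((n : ℝ) * m) ((m : ℝ) ^ (5 / 3 : ℝ))) := by
  open DynCount in
  refine ⟨?_, ?_, ?_, ?_⟩
  · have h : ∀ m k : ℕ, k * k ≤ 40 * (m + 1) →
        (k : ℝ) ≤ (50 + 2 * schemePath3.slack : ℕ) * (√m + 1) := fun m k hk =>
      (le_sqrt_of_mul_le hk).trans (by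
        have : (7 : ℝ) ≤ (50 + 2 * schemePath3.slack : ℕ) := by norm_cast
        gcongr)
    exact schemePath3.maintains (ne_bot_of_adj path3_adj rfl) (fun _ => h) (fun _ => h) peak_path3_le
      (fun _ _ => by positivity) (fun _ _ => by positivity) (fun _ _ => by positivity)
  · exact schemePaw.maintains_of_sq rfl (ne_bot_of_adj paw_adj rfl)
      (schemePaw.peak_le_sq rfl fun n M k => by
        have : schemePaw.entries n M k =
          n * n + (min (2 * M * min (k * k + 1) n) (n * n) + (n * n + 0)) := rfl
        omega) (fun _ _ => by positivity)
  · exact schemeFourCycle.maintains_of_sq rfl (ne_bot_of_adj fourCycle_adj rfl)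
      (schemeFourCycle.peak_le_sq rfl fun n M k => by
        have : schemeFourCycle.entries n M k =
          n * n + (min (2 * M * min (k * k + 1) n) (n * n) + 0) := rfl
        omega) (fun _ _ => by positivity)
  · exact schemeDiamond.maintains_of_sq rfl (ne_bot_of_adj diamond_adj rfl) peak_diamond_le
      (fun _ _ => by positivity)
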